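/- Let $\Bbbk$ be a field of characteristic $0$. Let $\mathrm{LieR}$ be the symmetric operad on two colours $s$ (commutative algebra) and $l$ (Lie algebra) generated by binary operations $\alpha:s\otimes s\to s$ (symmetric), $\beta:l\otimes l\to l$ (skew-symmetric), $d:s\otimes l\to s$ and $m:s\otimes l\to l$ (no symmetry) with the relations $$\alpha(\alpha(1,2),3)=\alpha(1,\alpha(2,3)),\qquad \beta(\beta(1,2),3)=\beta(\beta(1,3),2)+\beta(1,\beta(2,3)),$$ $$d(\alpha(1,2),3)=\alpha(1,d(2,3))+\alpha(d(1,3),2),\qquad d(1,\beta(2,3))=d(d(1,3),2)-d(d(1,2),3),$$ $$m(\alpha(1,2),3)=m(1,m(2,3)),\qquad d(1,m(2,3))=\alpha(d(1,3),2),\qquad \beta(2,m(1,3))=m(1,\beta(2,3))+m(d(1,2),3).$$ The associated shuffle operad is generated by $\alpha,\beta,d,e,m,n$, where $e(x,y)=d(y,x)$ and $n(x,y)=m(y,x)$. For a shuffle tree monomial $T$ with leaves $1,\dots,r$ and a set $A$ of generators let $v_A(T)\in\mathbb{N}^r$ be the vector whose $i$-th entry is the number of vertices marked by elements of $A$ on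 the path from the root to the leaf $i$. For monomials $T,T'$ of the same arity put $T<_{QM}T'$ if at the first of the levels $A=\{\alpha\},\{d,e\},\{m,n\},\{\beta\}$ at which $v_A(T)\ne v_A(T')$, one has lexicographically $v_A(T)>v_A(T')$ if $A\neq\{\beta\}$, and $v_A(T)<v_A(T')$ if $A=\{\beta\}$. (An admissible ordering is a total ordering of the shuffle tree monomials in which monomials of smaller arity are smaller and which is compatible with shuffle compositions.) (1) There are admissible orderings refining $<_{QM}$, and for each of them the $\Sigma_3$-orbits of the seven relations above, written in shuffle tree monomials, form a Gröbner basis of the ideal of relations of $\mathrm{LieR}$ in the free shuffle operad. All its elements are quadratic; thus $\mathrm{LieR}$ admits a quadratic Gröbner basis. (2) As a $2$-coloured symmetric collection, $\mathrm{LieR}$ is isomorphic to the symmetric composition $N_m\circ(\mathrm{DCom}^1;\mathrm{Lie})$. Here $\mathrm{DCom}$ is generated by $\alpha$ and $d$ with the associativity relation for $\alpha$ and the Leibniz relation (the first and the third relation above), $\mathrm{DCom}^1$ consists of its operations with output colour $s$, $\mathrm{Lie}$ is the operad of Lie algebras in the colour $l$ (generated by $\beta$), and $N_m$ is generated by $m$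 with the relation $m(1,m(2,3))=0$. (3) All spaces of operations of $\mathrm{LieR}$ are finite-dimensional, and the exponential generating series of their dimensions, with output colours $s$ and $l$ respectively ($t_1$ counts inputs of colour $s$, $t_2$ those of colour $l$), are $$\left(e^{\frac{t_1}{1-t_2}}-1,\; -\log(1-t_2)\cdot e^{\frac{t_1}{1-t_2}}\right).$$ -/

import Mathlib

/-! Two-coloured symmetric and shuffle operads generated by binary operations, and the operad of
Lie–Rinehart algebras. -/

open scoped TensorProduct

noncomputable section

namespace ColouredOperad

universe u

/-! ### Coloured symmetric collections -/

/-- A coloured symmetric collection: a functor from finite `I`-coloured sets and colour preserving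
bijections to vector spaces, for every output colour `c`. The value at `(X, χ, c)` is the space of
operations with inputs `X`, input colours `χ` and output colour `c`; for `X = Fin n` the maps along
permutations are the symmetric group action `P(n, χσ, c) → P(n, χ, c)`. -/
structure SymCollection (k : Type u) [Field k] (I : Type) where
  obj : (X : Type) → [Finite X] → (X → I) → I → Type u
  addCommGroup : ∀ (X : Type) [Finite X] (χ : X → I) (c : I), AddCommGroup (obj X χ c)
  module : ∀ (X : Type) [Finite X] (χ : X → I) (c : I), Module k (obj X χ c)
  map : ∀ {X Y : Type} [Finite X] [Finite Y] (e : X ≃ Y) (χ : Y → I) (c : I),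
    obj X (χ ∘ e) c →ₗ[k] obj Y χ c
  map_refl : ∀ (X : Type) [Finite X] (χ : X → I) (c : I) (p : obj X χ c),
    map (Equiv.refl X) χ c p = p
  map_trans : ∀ {X Y Z : Type} [Finite X] [Finite Y] [Finite Z] (e : X ≃ Y) (e' : Y ≃ Z)
    (χ : Z → I) (c : I) (p : obj X (χ ∘ (e.trans e')) c),
    map (e.trans e') χ c p = map e' χ c (map e (χ ∘ e') c p)

attribute [instance] SymCollection.addCommGroup SymCollection.module

namespace SymCollection

variable {k : Type u} [Field k] {I : Type}

/-- Isomorphisms of coloured symmetric collections. -/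
structure Iso (P Q : SymCollection k I) where
  equiv : ∀ (X : Type) [Finite X] (χ : X → I) (c : I), P.obj X χ c ≃ₗ[k] Q.obj X χ c
  natural : ∀ {X Y : Type} [Finite X] [Finite Y] (e : X ≃ Y) (χ : Y → I) (c : I)
    (p : P.obj X (χ ∘ e) c), equiv Y χ c (P.map e χ c p) = Q.map e χ c (equiv X (χ ∘ e) c p)

/-- The collection whose operations with output colour `c` are those of `P c` with output
colour `c`. -/
def ofOutputs (P : I → SymCollection k I) : SymCollection k I where
  obj X _ χ c := (P c).obj X χ c
  addCommGroup X _ χ c := (P c).addCommGroup X χ c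
  module X _ χ c := (P c).module X χ c
  map e χ c := (P c).map e χ c
  map_refl X _ χ c p := (P c).map_refl X χ c p
  map_trans e e' χ c p := (P c).map_trans e e' χ c p

/-! The symmetric composition
`(P ∘ Q)(X, χ, c) = ⨁_(m, ψ) P(m, ψ, c) ⊗_{S_m} [⨁_(f : X ↠ m) ⨂_i Q(f⁻¹(i), χ, ψ(i))]`. -/

/-- The indices `(m, ψ, f)` of the summands of the composition. -/
structure CompIndex (I X : Type) where
  m : ℕ
  ψ : Fin m → I
  f : X → Fin m
  surj : Function.Surjective f

/-- The summand `P(m, ψ, c) ⊗ ⨂_i Q(f⁻¹(i), χ, ψ(i))`. -/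
abbrev CompSummand (P Q : SymCollection k I) {X : Type} [Finite X] (χ : X → I) (c : I)
    (j : CompIndex I X) : Type u :=
  P.obj (Fin j.m) j.ψ c ⊗[k]
    (⨂[k] i : Fin j.m, Q.obj {x : X // j.f x = i} (χ ∘ Subtype.val) (j.ψ i))

abbrev CompSum (P Q : SymCollection k I) {X : Type} [Finite X] (χ : X → I) (c : I) : Type u :=
  DirectSum (CompIndex I X) (CompSummand P Q χ c)

open Classical in
/-- The pure tensor `p ⊗ (q_1 ⊗ ⋯ ⊗ q_m)` in the summand `(m, ψ, f)`. -/
def compPure (P Q : SymCollection k I) {X : Type} [Finite X] (χ : X → I) (c : I)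
    (j : CompIndex I X) (p : P.obj (Fin j.m) j.ψ c)
    (q : ∀ i : Fin j.m, Q.obj {x : X // j.f x = i} (χ ∘ Subtype.val) (j.ψ i)) :
    CompSum P Q χ c :=
  DirectSum.lof k (CompIndex I X) (CompSummand P Q χ c) j (p ⊗ₜ[k] PiTensorProduct.tprod k q)

/-- The bijection `(σ f)⁻¹(σ i) ≃ f⁻¹(i)`. -/
def fiberPerm {X : Type} {m : ℕ} (f : X → Fin m) (σ : Equiv.Perm (Fin m)) (i : Fin m) :
    {x : X // σ (f x) = σ i} ≃ {x : X // f x = i} :=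
  Equiv.subtypeEquivRight fun _ => σ.injective.eq_iff

/-- The bijection `f⁻¹(i) ≃ (f e⁻¹)⁻¹(i)` induced by `e : X ≃ Y`. -/
def fiberMap {X Y : Type} {m : ℕ} (f : X → Fin m) (e : X ≃ Y) (i : Fin m) :
    {x : X // f x = i} ≃ {y : Y // f (e.symm y) = i} :=
  e.subtypeEquiv fun x => by rw [e.symm_apply_apply]

/-- The subspace spanned by the differences of `p ⊗ q` and its image under a permutation `σ`,
which relabels the inputs of `p` and the factors of `q` simultaneously. -/
def compRel (P Q : SymCollection k I) {X : Type} [Finite X] (χ : X → I) (c : I) :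
    Submodule k (CompSum P Q χ c) :=
  Submodule.span k
    {z | ∃ (m : ℕ) (ψ : Fin m → I) (f : X → Fin m) (hf : Function.Surjective f)
      (σ : Equiv.Perm (Fin m)) (p : P.obj (Fin m) (ψ ∘ σ) c)
      (q : ∀ j : Fin m, Q.obj {x : X // σ (f x) = j} (χ ∘ Subtype.val) (ψ j)),
      z = compPure P Q χ c ⟨m, ψ ∘ σ, f, hf⟩ p
            (fun i => Q.map (fiberPerm f σ i) (χ ∘ Subtype.val) (ψ (σ i)) (q (σ i)))
        - compPure P Q χ c ⟨m, ψ, σ ∘ f, σ.surjective.comp hf⟩ (P.map σ ψ c p) q}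

/-- Transport of indices along `e : X ≃ Y`. -/
abbrev CompIndex.map {X Y : Type} (e : X ≃ Y) (j : CompIndex I X) : CompIndex I Y :=
  ⟨j.m, j.ψ, fun y => j.f (e.symm y), j.surj.comp e.symm.surjective⟩

open Classical in
/-- Relabelling of the inputs, on the direct sum. -/
def compSumMap (P Q : SymCollection k I) {X Y : Type} [Finite X] [Finite Y] (e : X ≃ Y)
    (χ : Y → I) (c : I) : CompSum P Q (χ ∘ e) c →ₗ[k] CompSum P Q χ c :=
  DirectSum.toModule k _ _ fun j =>
    (DirectSum.lof k (CompIndex I Y) (CompSummand P Q χ c) (j.map e)).comp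
      (TensorProduct.map LinearMap.id
        (PiTensorProduct.map fun i =>
          Q.map (fiberMap j.f e i) (χ ∘ Subtype.val) (j.ψ i)))

theorem compSumMap_pure (P Q : SymCollection k I) {X Y : Type} [Finite X] [Finite Y] (e : X ≃ Y)
    (χ : Y → I) (c : I) (j : CompIndex I X) (p : P.obj (Fin j.m) j.ψ c)
    (q : ∀ i : Fin j.m, Q.obj {x : X // j.f x = i} ((χ ∘ e) ∘ Subtype.val) (j.ψ i)) :
    compSumMap P Q e χ c (compPure P Q (χ ∘ e) c j p q) =
      compPure P Q χ c (j.map e) p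
        (fun i => Q.map (fiberMap j.f e i) (χ ∘ Subtype.val) (j.ψ i) (q i)) := by
  classical
  unfold compSumMap compPure
  rw [DirectSum.toModule_lof, LinearMap.comp_apply, TensorProduct.map_tmul]
  exact congrArg
    (fun t => DirectSum.lof k (CompIndex I Y) (CompSummand P Q χ c) (j.map e) (p ⊗ₜ[k] t))
    (PiTensorProduct.map_tprod _ q)

theorem compSum_ext (P Q : SymCollection k I) {X : Type} [Finite X] {χ : X → I} {c : I}
    {M : Type u} [AddCommGroup M] [Module k M] {F G : CompSum P Q χ c →ₗ[k] M}
    (h : ∀ j p q, F (compPure P Q χ c j p q) = G (compPure P Q χ c j p q)) : F = G := by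
  classical
  refine DirectSum.linearMap_ext k fun j => ?_
  refine TensorProduct.ext' fun p t => ?_
  have : ((F.comp (DirectSum.lof k (CompIndex I X) (CompSummand P Q χ c) j)).comp
      (TensorProduct.mk k _ _ p)) =
      ((G.comp (DirectSum.lof k (CompIndex I X) (CompSummand P Q χ c) j)).comp
      (TensorProduct.mk k _ _ p)) := by
    refine PiTensorProduct.ext (MultilinearMap.ext fun q => ?_)
    have := h j p q
    unfold compPure at this
    exact this
  exact LinearMap.congr_fun this t

theorem compRel_le (P Q : SymCollection k I) {X Y : Type} [Finite X] [Finite Y] (e : X ≃ Y)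
    (χ : Y → I) (c : I) :
    compRel P Q (χ ∘ e) c ≤ (compRel P Q χ c).comap (compSumMap P Q e χ c) := by
  refine Submodule.span_le.2 ?_
  rintro z ⟨m, ψ, f, hf, σ, p, q, rfl⟩
  refine Submodule.subset_span ⟨m, ψ, fun y => f (e.symm y), hf.comp e.symm.surjective, σ, p,
    fun j => Q.map (fiberMap (σ ∘ f) e j) (χ ∘ Subtype.val) (ψ j) (q j), ?_⟩
  rw [map_sub, compSumMap_pure, compSumMap_pure]
  have key : ∀ i : Fin m,
      Q.map (fiberMap f e i) (χ ∘ Subtype.val) (ψ (σ i))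
        (Q.map (fiberPerm f σ i) ((χ ∘ e) ∘ Subtype.val) (ψ (σ i)) (q (σ i))) =
      Q.map (fiberPerm (fun y => f (e.symm y)) σ i) (χ ∘ Subtype.val) (ψ (σ i))
        (Q.map (fiberMap (σ ∘ f) e (σ i)) (χ ∘ Subtype.val) (ψ (σ i)) (q (σ i))) := by
    intro i
    have h1 := Q.map_trans (fiberPerm f σ i) (fiberMap f e i) (χ ∘ Subtype.val) (ψ (σ i))
      (q (σ i))
    have h2 := Q.map_trans (fiberMap (σ ∘ f) e (σ i)) (fiberPerm (fun y => f (e.symm y)) σ i)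
      (χ ∘ Subtype.val) (ψ (σ i)) (q (σ i))
    exact h1.symm.trans h2
  congr 2
  exact funext key

/-- The symmetric composition of coloured symmetric collections. -/
def comp (P Q : SymCollection k I) : SymCollection k I where
  obj X _ χ c := CompSum P Q χ c ⧸ compRel P Q χ c
  addCommGroup _ _ _ _ := inferInstance
  module _ _ _ _ := inferInstance
  map e χ c := Submodule.mapQ _ _ (compSumMap P Q e χ c) (compRel_le P Q e χ c)
  map_refl X _ χ c p := by
    obtain ⟨p, rfl⟩ := Submodule.Quotient.mk_surjective _ p
    have : compSumMap P Q (Equiv.refl X) χ c = LinearMap.id := by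
      refine compSum_ext P Q fun j p q => ?_
      refine (compSumMap_pure P Q (Equiv.refl X) χ c j p q).trans ?_
      congr 1
      exact funext fun i => Q.map_refl _ _ _ (q i)
    exact congrArg (Submodule.Quotient.mk) (LinearMap.congr_fun this p)
  map_trans {X Y Z} _ _ _ e e' χ c p := by
    obtain ⟨p, rfl⟩ := Submodule.Quotient.mk_surjective _ p
    have : compSumMap P Q (e.trans e') χ c =
        (compSumMap P Q e' χ c).comp (compSumMap P Q e (χ ∘ e') c) := by
      refine compSum_ext P Q fun j p q => ?_
      refine (compSumMap_pure P Q (e.trans e') χ c j p q).trans ?_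
      refine Eq.trans ?_ (congrArg (compSumMap P Q e' χ c)
        (compSumMap_pure P Q e (χ ∘ e') c j p q)).symm
      refine Eq.trans ?_ (compSumMap_pure P Q e' χ c (j.map e) p _).symm
      refine congrArg (compPure P Q χ c ((j.map e).map e') p) ?_
      exact funext fun i => Q.map_trans (fiberMap j.f e i) (fiberMap (j.map e).f e' i)
        (χ ∘ Subtype.val) (j.ψ i) (q i)
    exact congrArg (Submodule.Quotient.mk) (LinearMap.congr_fun this p)

/-- The component with output colour `c` of the generating series: the coefficient of
`∏ t_i ^ m_i` is `dim P(X, χ, c) / ∏ m_i!`, where `X` has `m_i` elements of colour `i`. -/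
def genSeries [Fintype I] (P : SymCollection k I) (c : I) : MvPowerSeries I ℚ :=
  fun m => (Module.finrank k (P.obj (Σ i : I, Fin (m i)) Sigma.fst c) : ℚ) /
    ((∏ i : I, (m i).factorial : ℕ) : ℚ)

end SymCollection

/-! ### Trees and free operads on binary generators -/

/-- Binary generating operations with colours of the first input, the second input and the
output. -/
structure Signature (I : Type) where
  Gen : Type
  in₁ : Gen → I
  in₂ : Gen → I
  out : Gen → I

/-- Planar binary rooted trees with vertices marked by `G` and leaves marked by `X`. -/
inductive OpTree (G X : Type) : Type
  | leaf (x : X) : OpTree G X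
  | node (g : G) (l r : OpTree G X) : OpTree G X

namespace OpTree

variable {G X Y : Type}

def bind (θ : X → OpTree G Y) : OpTree G X → OpTree G Y
  | leaf x => θ x
  | node g l r => node g (l.bind θ) (r.bind θ)

def map (f : X → Y) : OpTree G X → OpTree G Y
  | leaf x => leaf (f x)
  | node g l r => node g (l.map f) (r.map f)

/-- The leaf labels, from left to right. -/
def leaves : OpTree G X → List X
  | leaf x => [x]
  | node _ l r => l.leaves ++ r.leaves

/-- The number of inner vertices. -/
def vertices : OpTree G X → ℕ
  | leaf _ => 0
  | node _ l r => l.vertices + r.vertices + 1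

/-- The word of vertex marks on the path from the root to the leaf `x`. -/
def path [DecidableEq X] (x : X) : OpTree G X → List G
  | leaf _ => []
  | node g l r => g :: (if x ∈ l.leaves then l.path x else r.path x)

/-- The smallest leaf label. -/
def minLeaf [LinearOrder X] : OpTree G X → X
  | leaf x => x
  | node _ l r => min l.minLeaf r.minLeaf

/-- The shuffle condition: at every vertex the smallest labels of the two subtrees increase. -/
def IsShuffle [LinearOrder X] : OpTree G X → Prop
  | leaf _ => True
  | node _ l r => l.minLeaf < r.minLeaf ∧ l.IsShuffle ∧ r.IsShuffle

/-- `u.IsSubtree t`: `u` consists of all that lies above some edge of `t`. -/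
def IsSubtree (u : OpTree G X) : OpTree G X → Prop
  | leaf x => u = leaf x
  | node g l r => u = node g l r ∨ u.IsSubtree l ∨ u.IsSubtree r

theorem map_id (t : OpTree G X) : t.map id = t := by
  induction t with
  | leaf x => rfl
  | node g l r hl hr => simp only [map, hl, hr]

theorem map_comp {Z : Type} (f : X → Y) (g : Y → Z) (t : OpTree G X) :
    t.map (g ∘ f) = (t.map f).map g := by
  induction t with
  | leaf x => rfl
  | node g l r hl hr => simp only [map, hl, hr]

theorem leaves_map (f : X → Y) (t : OpTree G X) : (t.map f).leaves = t.leaves.map f := by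
  induction t with
  | leaf x => rfl
  | node g l r hl hr => simp only [map, leaves, hl, hr, List.map_append]

/-- With inputs coloured by `χ`, the colours match at all edges and the output has colour `c`. -/
def IsColoured {I : Type} (S : Signature I) (χ : X → I) : I → OpTree S.Gen X → Prop
  | c, leaf x => χ x = c
  | c, node g l r => S.out g = c ∧ l.IsColoured S χ (S.in₁ g) ∧ r.IsColoured S χ (S.in₂ g)

theorem IsColoured.map {I : Type} {S : Signature I} (f : X → Y) (χ : Y → I) :
    ∀ (t : OpTree S.Gen X) (c : I), t.IsColoured S (χ ∘ f) c → (t.map f).IsColoured S χ c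
  | leaf _, _, h => h
  | node _ l r, _, h => ⟨h.1, IsColoured.map f χ l _ h.2.1, IsColoured.map f χ r _ h.2.2⟩

open Classical in
/-- Grafting of `t₂` on the leaf `a` of `t₁`; the leaves of `t₁` are relabelled by `φ`, those of
`t₂` by `ψ`. -/
def graft {A B : Type} (a : A) (φ : A → X) (ψ : B → X) (t₁ : OpTree G A) (t₂ : OpTree G B) :
    OpTree G X :=
  t₁.bind fun x => if x = a then t₂.map ψ else leaf (φ x)

end OpTree

/-- Colour matching trees whose leaves are bijectively labelled by `X`. -/
def IsMonomial {I X : Type} (S : Signature I) (χ : X → I) (c : I) (t : OpTree S.Gen X) : Prop :=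
  t.IsColoured S χ c ∧ t.leaves.Nodup ∧ ∀ x, x ∈ t.leaves

/-- Tree monomials: the basis of the component `(X, χ, c)` of the free coloured symmetric operad on
the operations of `S` (without symmetries: permutations of inputs act freely on generators). -/
abbrev Monomial {I X : Type} (S : Signature I) (χ : X → I) (c : I) : Type :=
  {t : OpTree S.Gen X // IsMonomial S χ c t}

theorem IsMonomial.map {I X Y : Type} {S : Signature I} (e : X ≃ Y) {χ : Y → I} {c : I}
    {t : OpTree S.Gen X} (h : IsMonomial S (χ ∘ e) c t) : IsMonomial S χ c (t.map e) := by
  obtain ⟨h1, h2, h3⟩ := h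
  refine ⟨h1.map, ?_, fun y => ?_⟩
  · rw [OpTree.leaves_map]
    exact h2.map e.injective
  · rw [OpTree.leaves_map]
    exact List.mem_map.2 ⟨e.symm y, h3 _, e.apply_symm_apply y⟩

/-- Relabelling of tree monomials. -/
def Monomial.map {I X Y : Type} {S : Signature I} (e : X ≃ Y) (χ : Y → I) (c : I)
    (t : Monomial S (χ ∘ e) c) : Monomial S χ c :=
  ⟨t.1.map e, t.2.map e⟩

/-- `φ` and `ψ` identify `(A ∖ {a}) ⊔ B` with `X`. -/
structure IsGrafting {A B X : Type} (a : A) (φ : A → X) (ψ : B → X) : Prop where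
  inj_left : Set.InjOn φ {a}ᶜ
  inj_right : Function.Injective ψ
  disjoint : ∀ x, x ≠ a → ∀ b, φ x ≠ ψ b
  cover : ∀ y, (∃ x, x ≠ a ∧ φ x = y) ∨ ∃ b, ψ b = y

/-- The colouring `χ` of `(A ∖ {a}) ⊔ B` restricts to `χ₁` and `χ₂`. -/
def IsGlued {I A B X : Type} (a : A) (φ : A → X) (ψ : B → X) (χ₁ : A → I) (χ₂ : B → I)
    (χ : X → I) : Prop :=
  (∀ x, x ≠ a → χ (φ x) = χ₁ x) ∧ ∀ b, χ (ψ b) = χ₂ b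

/-- An element of arity `n` with its input colours and its output colour. -/
structure Element (k : Type u) [Field k] {I : Type} (S : Signature I) where
  arity : ℕ
  inp : Fin arity → I
  out : I
  elt : OpTree S.Gen (Fin arity) →₀ k

section Ideal

variable {k : Type u} [Field k] {I : Type} {S : Signature I}

/-- Membership in the operadic ideal of the free symmetric operad generated by `R`: the smallest
family of subspaces that contains `R` and is closed under relabellings and under partial
compositions with tree monomials on either side. -/
inductive InIdeal (R : Set (Element k S)) :
    ∀ {X : Type} (_ : X → I) (_ : I), (OpTree S.Gen X →₀ k) → Prop
  | rel (r : Element k S) (hr : r ∈ R) : InIdeal R r.inp r.out r.elt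
  | zero {X : Type} (χ : X → I) (c : I) : InIdeal R χ c 0
  | add {X : Type} {χ : X → I} {c : I} {f g : OpTree S.Gen X →₀ k} (hf : InIdeal R χ c f)
      (hg : InIdeal R χ c g) : InIdeal R χ c (f + g)
  | smul {X : Type} {χ : X → I} {c : I} (a : k) {f : OpTree S.Gen X →₀ k}
      (hf : InIdeal R χ c f) : InIdeal R χ c (a • f)
  | relabel {X Y : Type} (e : X ≃ Y) {χ : Y → I} {c : I} {f : OpTree S.Gen X →₀ k}
      (hf : InIdeal R (χ ∘ e) c f) : InIdeal R χ c (f.mapDomain (OpTree.map e))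
  | comp_left {A B X : Type} {a : A} {φ : A → X} {ψ : B → X} (h : IsGrafting a φ ψ)
      {χ₁ : A → I} {χ₂ : B → I} {χ : X → I} (hχ : IsGlued a φ ψ χ₁ χ₂ χ) {c : I}
      {f : OpTree S.Gen A →₀ k} (hf : InIdeal R χ₁ c f)
      {t : OpTree S.Gen B} (ht : IsMonomial S χ₂ (χ₁ a) t) :
      InIdeal R χ c (f.mapDomain fun s => OpTree.graft a φ ψ s t)
  | comp_right {A B X : Type} {a : A} {φ : A → X} {ψ : B → X} (h : IsGrafting a φ ψ)
      {χ₁ : A → I} {χ₂ : B → I} {χ : X → I} (hχ : IsGlued a φ ψ χ₁ χ₂ χ) {c : I}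
      {t : OpTree S.Gen A} (ht : IsMonomial S χ₁ c t)
      {f : OpTree S.Gen B →₀ k} (hf : InIdeal R χ₂ (χ₁ a) f) :
      InIdeal R χ c (f.mapDomain fun s => OpTree.graft a φ ψ t s)

/-- The component `(X, χ, c)` of the operadic ideal generated by `R`. -/
def ideal (R : Set (Element k S)) {X : Type} (χ : X → I) (c : I) :
    Submodule k (OpTree S.Gen X →₀ k) where
  carrier := {f | InIdeal R χ c f}
  zero_mem' := InIdeal.zero χ c
  add_mem' hf hg := InIdeal.add hf hg
  smul_mem' a _ hf := InIdeal.smul a hf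

/-- The relations in the component `(X, χ, c)` of the free operad, with basis the tree monomials. -/
def relations (R : Set (Element k S)) {X : Type} (χ : X → I) (c : I) :
    Submodule k (Monomial S χ c →₀ k) :=
  (ideal R χ c).comap (Finsupp.lmapDomain k k Subtype.val)

theorem relations_map (R : Set (Element k S)) {X Y : Type} (e : X ≃ Y) (χ : Y → I) (c : I) :
    relations R (χ ∘ e) c ≤
      (relations R χ c).comap (Finsupp.lmapDomain k k (Monomial.map e χ c)) := by
  intro f hf
  have h : InIdeal R χ c (Finsupp.mapDomain (OpTree.map e) (Finsupp.mapDomain Subtype.val f)) :=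
    InIdeal.relabel e hf
  change InIdeal R χ c (Finsupp.mapDomain Subtype.val (Finsupp.mapDomain (Monomial.map e χ c) f))
  rw [← Finsupp.mapDomain_comp] at h ⊢
  exact h

/-- The underlying collection of the coloured symmetric operad with generators `S` and
relations `R`: the quotient of the free operad by the operadic ideal generated by `R`. -/
def presented (R : Set (Element k S)) : SymCollection k I where
  obj X _ χ c := (Monomial S χ c →₀ k) ⧸ relations R χ c
  addCommGroup _ _ _ _ := inferInstance
  module _ _ _ _ := inferInstance
  map e χ c :=
    Submodule.mapQ _ _ (Finsupp.lmapDomain k k (Monomial.map e χ c)) (relations_map R e χ c)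
  map_refl X _ χ c p := by
    obtain ⟨p, rfl⟩ := Submodule.Quotient.mk_surjective _ p
    refine congrArg Submodule.Quotient.mk ?_
    have h : Monomial.map (S := S) (Equiv.refl X) χ c = id :=
      funext fun t => Subtype.ext (OpTree.map_id t.1)
    exact (congrArg (fun F => Finsupp.mapDomain F p) h).trans Finsupp.mapDomain_id
  map_trans {X Y Z} _ _ _ e e' χ c p := by
    obtain ⟨p, rfl⟩ := Submodule.Quotient.mk_surjective _ p
    refine congrArg Submodule.Quotient.mk ?_
    have h : Monomial.map (S := S) (e.trans e') χ c =
        Monomial.map e' χ c ∘ Monomial.map e (χ ∘ e') c :=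
      funext fun t => Subtype.ext (OpTree.map_comp e e' t.1)
    exact (congrArg (fun F => Finsupp.mapDomain F p) h).trans Finsupp.mapDomain_comp

end Ideal

/-! ### Free shuffle operads and Gröbner bases -/

section Shuffle

variable {k : Type u} [Field k] {I : Type} {S : Signature I}

/-- Tree monomials of the free shuffle operad. -/
def IsShuffleMonomial {X : Type} [LinearOrder X] (S : Signature I) (χ : X → I) (c : I)
    (t : OpTree S.Gen X) : Prop :=
  IsMonomial S χ c t ∧ t.IsShuffle

/-- The relabellings of a shuffle composition at the `i`-th input: increasing maps that identify
`i` with the smallest label of the grafted tree. -/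
structure IsShuffling {m n N : ℕ} (i : Fin m) (φ : Fin m → Fin N) (ψ : Fin n → Fin N) : Prop where
  grafting : IsGrafting i φ ψ
  left : StrictMono φ
  right : StrictMono ψ
  least : IsLeast (Set.range ψ) (φ i)

/-- Membership in the operadic ideal of the free shuffle operad generated by `R`. -/
inductive InShuffleIdeal (R : Set (Element k S)) :
    ∀ {n : ℕ} (_ : Fin n → I) (_ : I), (OpTree S.Gen (Fin n) →₀ k) → Prop
  | rel (r : Element k S) (hr : r ∈ R) : InShuffleIdeal R r.inp r.out r.elt
  | zero {n : ℕ} (χ : Fin n → I) (c : I) : InShuffleIdeal R χ c 0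
  | add {n : ℕ} {χ : Fin n → I} {c : I} {f g : OpTree S.Gen (Fin n) →₀ k}
      (hf : InShuffleIdeal R χ c f) (hg : InShuffleIdeal R χ c g) : InShuffleIdeal R χ c (f + g)
  | smul {n : ℕ} {χ : Fin n → I} {c : I} (a : k) {f : OpTree S.Gen (Fin n) →₀ k}
      (hf : InShuffleIdeal R χ c f) : InShuffleIdeal R χ c (a • f)
  | comp_left {m n N : ℕ} {i : Fin m} {φ : Fin m → Fin N} {ψ : Fin n → Fin N}
      (h : IsShuffling i φ ψ) {χ₁ : Fin m → I} {χ₂ : Fin n → I} {χ : Fin N → I}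
      (hχ : IsGlued i φ ψ χ₁ χ₂ χ) {c : I}
      {f : OpTree S.Gen (Fin m) →₀ k} (hf : InShuffleIdeal R χ₁ c f)
      {t : OpTree S.Gen (Fin n)} (ht : IsShuffleMonomial S χ₂ (χ₁ i) t) :
      InShuffleIdeal R χ c (f.mapDomain fun s => OpTree.graft i φ ψ s t)
  | comp_right {m n N : ℕ} {i : Fin m} {φ : Fin m → Fin N} {ψ : Fin n → Fin N}
      (h : IsShuffling i φ ψ) {χ₁ : Fin m → I} {χ₂ : Fin n → I} {χ : Fin N → I}
      (hχ : IsGlued i φ ψ χ₁ χ₂ χ) {c : I}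
      {t : OpTree S.Gen (Fin m)} (ht : IsShuffleMonomial S χ₁ c t)
      {f : OpTree S.Gen (Fin n) →₀ k} (hf : InShuffleIdeal R χ₂ (χ₁ i) f) :
      InShuffleIdeal R χ c (f.mapDomain fun s => OpTree.graft i φ ψ t s)

/-- Tree monomials of arity `n` of the free shuffle operad, of all colours. -/
structure ShuffleMonomial (S : Signature I) (n : ℕ) where
  inp : Fin n → I
  out : I
  tree : OpTree S.Gen (Fin n)
  isShuffleMonomial : IsShuffleMonomial S inp out tree

/-- `z` is the shuffle composition `x ∘_{i, ω} y`, where the shuffle `ω` is given by `φ`, `ψ`. -/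
structure IsShuffleComp {m n N : ℕ} (i : Fin m) (φ : Fin m → Fin N) (ψ : Fin n → Fin N)
    (x : ShuffleMonomial S m) (y : ShuffleMonomial S n) (z : ShuffleMonomial S N) : Prop where
  shuffling : IsShuffling i φ ψ
  colour : x.inp i = y.out
  inp : IsGlued i φ ψ x.inp y.inp z.inp
  out : z.out = x.out
  tree : z.tree = OpTree.graft i φ ψ x.tree y.tree

/-- Admissible (total) orderings of the tree monomials. -/
structure IsAdmissible (lt : (Σ n, ShuffleMonomial S n) → (Σ n, ShuffleMonomial S n) → Prop) :
    Prop where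
  total : IsStrictTotalOrder _ lt
  arity : ∀ {m n : ℕ} (x : ShuffleMonomial S m) (y : ShuffleMonomial S n), m < n →
    lt ⟨m, x⟩ ⟨n, y⟩
  comp : ∀ {m n N : ℕ} (i : Fin m) (φ : Fin m → Fin N) (ψ : Fin n → Fin N)
    (x x' : ShuffleMonomial S m) (y y' : ShuffleMonomial S n) (z z' : ShuffleMonomial S N),
    IsShuffleComp i φ ψ x y z → IsShuffleComp i φ ψ x' y' z' →
    (x = x' ∨ lt ⟨m, x⟩ ⟨m, x'⟩) → (y = y' ∨ lt ⟨n, y⟩ ⟨n, y'⟩) →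
    (z = z' ∨ lt ⟨N, z⟩ ⟨N, z'⟩)

/-- `t` is the leading (largest) tree monomial of `f`, an element of the component `(n, χ, c)`. -/
def IsLeadingTerm (lt : (Σ n, ShuffleMonomial S n) → (Σ n, ShuffleMonomial S n) → Prop)
    {n : ℕ} (χ : Fin n → I) (c : I) (f : OpTree S.Gen (Fin n) →₀ k) (t : OpTree S.Gen (Fin n)) :
    Prop :=
  t ∈ f.support ∧ ∃ ht : IsShuffleMonomial S χ c t,
    ∀ s ∈ f.support, s ≠ t → ∃ hs : IsShuffleMonomial S χ c s,
      lt ⟨n, ⟨χ, c, s, hs⟩⟩ ⟨n, ⟨χ, c, t, ht⟩⟩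

/-- Divisibility of tree monomials: `s` is the tree monomial of a subtree `T'` of `t`. Here `u` is
the part of `t` above the output of `T'`, and `θ j` is the part of `t` above the `j`-th leaf of
`T'`, where the leaves are ordered by their smallest descendants. -/
def Divides {m n : ℕ} (χ' : Fin m → I) (s : OpTree S.Gen (Fin m)) (χ : Fin n → I)
    (t : OpTree S.Gen (Fin n)) : Prop :=
  ∃ (u : OpTree S.Gen (Fin n)) (θ : Fin m → OpTree S.Gen (Fin n)),
    u.IsSubtree t ∧ u = s.bind θ ∧ (∀ i j, i < j → (θ i).minLeaf < (θ j).minLeaf) ∧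
      ∀ i, (θ i).IsColoured S χ (χ' i)

/-- `G` is a Gröbner basis of the operadic ideal `M`: it generates `M`, and the leading term of
every nonzero element of `M` is divisible by the leading term of some element of `G`. -/
def IsGroebnerBasis (lt : (Σ n, ShuffleMonomial S n) → (Σ n, ShuffleMonomial S n) → Prop)
    (M : ∀ n : ℕ, (Fin n → I) → I → Submodule k (OpTree S.Gen (Fin n) →₀ k))
    (G : Set (Element k S)) : Prop :=
  (∀ (n : ℕ) (χ : Fin n → I) (c : I) (f : OpTree S.Gen (Fin n) →₀ k),
    f ∈ M n χ c ↔ InShuffleIdeal G χ c f) ∧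
  ∀ (n : ℕ) (χ : Fin n → I) (c : I), ∀ f ∈ M n χ c, f ≠ 0 →
    ∃ g ∈ G, ∃ s t, IsLeadingTerm lt g.inp g.out g.elt s ∧ IsLeadingTerm lt χ c f t ∧
      Divides g.inp s χ t

/-- All tree monomials of the element have exactly two inner vertices. -/
def IsQuadratic (r : Element k S) : Prop :=
  ∀ t ∈ r.elt.support, t.vertices = 2

end Shuffle

/-! ### Relations -/

section Relations

variable (k : Type u) [Field k] {G X : Type}

/-- The basis element of the tree `t`. -/
def mon (t : OpTree G X) : OpTree G X →₀ k := Finsupp.single t 1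

/-- The operation `g(x, y)`. -/
def op (g : G) (x y : OpTree G X) : OpTree G X := OpTree.node g x y

/-- The `i`-th input, counted from `0`. -/
def inp {n : ℕ} (i : Fin n) : OpTree G (Fin n) := OpTree.leaf i

/-- `a(0,1) = a(1,0)` -/
def commRel (a : G) : OpTree G (Fin 2) →₀ k :=
  mon k (op a (inp 0) (inp 1)) - mon k (op a (inp 1) (inp 0))

/-- `b(0,1) = - b(1,0)` -/
def antiRel (b : G) : OpTree G (Fin 2) →₀ k :=
  mon k (op b (inp 0) (inp 1)) + mon k (op b (inp 1) (inp 0))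

/-- `a(a(0,1),2) = a(0,a(1,2))` -/
def assocRel (a : G) : OpTree G (Fin 3) →₀ k :=
  mon k (op a (op a (inp 0) (inp 1)) (inp 2)) - mon k (op a (inp 0) (op a (inp 1) (inp 2)))

/-- `b(b(0,1),2) = b(b(0,2),1) + b(0,b(1,2))` -/
def jacobiRel (b : G) : OpTree G (Fin 3) →₀ k :=
  mon k (op b (op b (inp 0) (inp 1)) (inp 2)) - mon k (op b (op b (inp 0) (inp 2)) (inp 1))
    - mon k (op b (inp 0) (op b (inp 1) (inp 2)))

/-- `d(a(0,1),2) = a(0,d(1,2)) + a(d(0,2),1)` -/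
def leibnizRel (a d : G) : OpTree G (Fin 3) →₀ k :=
  mon k (op d (op a (inp 0) (inp 1)) (inp 2)) - mon k (op a (inp 0) (op d (inp 1) (inp 2)))
    - mon k (op a (op d (inp 0) (inp 2)) (inp 1))

/-- `d(0,b(1,2)) = d(d(0,2),1) - d(d(0,1),2)` -/
def morphismRel (b d : G) : OpTree G (Fin 3) →₀ k :=
  mon k (op d (inp 0) (op b (inp 1) (inp 2))) - mon k (op d (op d (inp 0) (inp 2)) (inp 1))
    + mon k (op d (op d (inp 0) (inp 1)) (inp 2))

/-- `m(a(0,1),2) = m(0,m(1,2))` -/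
def moduleRel (a m : G) : OpTree G (Fin 3) →₀ k :=
  mon k (op m (op a (inp 0) (inp 1)) (inp 2)) - mon k (op m (inp 0) (op m (inp 1) (inp 2)))

/-- `d(0,m(1,2)) = a(d(0,2),1)` -/
def anchorRel (a d m : G) : OpTree G (Fin 3) →₀ k :=
  mon k (op d (inp 0) (op m (inp 1) (inp 2))) - mon k (op a (op d (inp 0) (inp 2)) (inp 1))

/-- `b(1,m(0,2)) = m(0,b(1,2)) + m(d(0,1),2)` -/
def rinehartRel (b d m : G) : OpTree G (Fin 3) →₀ k :=
  mon k (op b (inp 1) (op m (inp 0) (inp 2))) - mon k (op m (inp 0) (op b (inp 1) (inp 2)))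
    - mon k (op m (op d (inp 0) (inp 1)) (inp 2))

end Relations

/-! ### The operads -/

/-- The two colours: straight for the commutative algebra, dotted for the Lie algebra. -/
inductive Col : Type
  | s : Col
  | l : Col
deriving DecidableEq

instance : Fintype Col := ⟨{.s, .l}, fun x => by cases x <;> simp⟩

/-- `α : s ⊗ s → s`, `β : l ⊗ l → l`, `d : s ⊗ l → s`, `m : s ⊗ l → l`. -/
inductive LRGen : Type
  | α : LRGen
  | β : LRGen
  | d : LRGen
  | m : LRGen

def lrSig : Signature Col where
  Gen := LRGen
  in₁ | .α => .s | .β => .l | .d => .s | .m => .s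
  in₂ | .α => .s | .β => .l | .d => .l | .m => .l
  out | .α => .s | .β => .l | .d => .s | .m => .l

section Operads

variable (k : Type u) [Field k]

/-- The symmetries of the generators `α` and `β`. -/
def lrSymmetries : Set (Element k lrSig) :=
  {⟨2, ![.s, .s], .s, commRel k LRGen.α⟩, ⟨2, ![.l, .l], .l, antiRel k LRGen.β⟩}

/-- The quadratic defining relations of Lie–Rinehart algebras. -/
def lrQuadratic : Set (Element k lrSig) :=
  {⟨3, ![.s, .s, .s], .s, assocRel k LRGen.α⟩,
   ⟨3, ![.l, .l, .l], .l, jacobiRel k LRGen.β⟩,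
   ⟨3, ![.s, .s, .l], .s, leibnizRel k LRGen.α LRGen.d⟩,
   ⟨3, ![.s, .l, .l], .s, morphismRel k LRGen.β LRGen.d⟩,
   ⟨3, ![.s, .s, .l], .l, moduleRel k LRGen.α LRGen.m⟩,
   ⟨3, ![.s, .s, .l], .s, anchorRel k LRGen.α LRGen.d LRGen.m⟩,
   ⟨3, ![.s, .l, .l], .l, rinehartRel k LRGen.β LRGen.d LRGen.m⟩}

/-- The operad of Lie–Rinehart algebras. -/
def lieR : SymCollection k Col := presented (lrSymmetries k ∪ lrQuadratic k)

inductive DComGen : Type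
  | α : DComGen
  | d : DComGen

def dComSig : Signature Col where
  Gen := DComGen
  in₁ | .α => .s | .d => .s
  in₂ | .α => .s | .d => .l
  out | .α => .s | .d => .s

/-- The operad of commutative algebras with a space of derivations. -/
def dCom : SymCollection k Col :=
  presented (S := dComSig)
    {⟨2, ![.s, .s], .s, commRel k DComGen.α⟩,
     ⟨3, ![.s, .s, .s], .s, assocRel k DComGen.α⟩,
     ⟨3, ![.s, .s, .l], .s, leibnizRel k DComGen.α DComGen.d⟩}

/-- One generator `β : l ⊗ l → l`. -/
def lieSig : Signature Col where
  Gen := Unit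
  in₁ _ := .l
  in₂ _ := .l
  out _ := .l

/-- The operad of Lie algebras, in the dotted colour. -/
def lie : SymCollection k Col :=
  presented (S := lieSig)
    {⟨2, ![.l, .l], .l, antiRel k ()⟩, ⟨3, ![.l, .l, .l], .l, jacobiRel k ()⟩}

/-- One generator `m : s ⊗ l → l`. -/
def nilSig : Signature Col where
  Gen := Unit
  in₁ _ := .s
  in₂ _ := .l
  out _ := .l

/-- The operad `N_m` generated by `m` with the relation `m(0,m(1,2)) = 0`. -/
def nilM : SymCollection k Col :=
  presented (S := nilSig)
    {⟨3, ![.s, .s, .l], .l, mon k (op () (inp 0) (op () (inp 1) (inp 2)))⟩}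

/-- `(DCom¹; Lie)`: the operations of `DCom` with straight output, and those of `Lie` (with dotted
output). -/
def dComLie : SymCollection k Col :=
  SymCollection.ofOutputs fun
    | .s => dCom k
    | .l => lie k

end Operads

/-! ### The shuffle operad of Lie–Rinehart algebras -/

/-- The generators of the shuffle operad: `e(x,y) = d(y,x)` and `n(x,y) = m(y,x)`. -/
inductive LRShGen : Type
  | α : LRShGen
  | β : LRShGen
  | d : LRShGen
  | e : LRShGen
  | m : LRShGen
  | n : LRShGen
deriving DecidableEq

def lrShSig : Signature Col where
  Gen := LRShGen
  in₁ | .α => .s | .β => .l | .d => .s | .e => .l | .m => .s | .n => .l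
  in₂ | .α => .s | .β => .l | .d => .l | .e => .s | .m => .l | .n => .s
  out | .α => .s | .β => .l | .d => .s | .e => .s | .m => .l | .n => .l

/-- The shuffle generator `g(x,y)`. -/
def LRGen.keep : LRGen → LRShGen
  | .α => .α | .β => .β | .d => .d | .m => .m

/-- The shuffle generator which is, up to the sign `swapSign`, `g(y,x)`. -/
def LRGen.swap : LRGen → LRShGen
  | .α => .α | .β => .β | .d => .e | .m => .n

def LRGen.swapSign : LRGen → ℤ
  | .β => -1
  | _ => 1

/-- The planar representative of `t` which is a shuffle tree. -/
def planar {X : Type} [LinearOrder X] : OpTree LRGen X → OpTree LRShGen X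
  | .leaf x => .leaf x
  | .node g l r =>
    if l.minLeaf < r.minLeaf then .node g.keep (planar l) (planar r)
    else .node g.swap (planar r) (planar l)

/-- The sign with which `t` is equal to its planar representative. -/
def planarSign {X : Type} [LinearOrder X] : OpTree LRGen X → ℤ
  | .leaf _ => 1
  | .node g l r =>
    (if l.minLeaf < r.minLeaf then 1 else g.swapSign) * planarSign l * planarSign r

section

variable (k : Type u) [Field k]

/-- Rewriting of operations by shuffle trees, by means of the symmetries of the generators. -/
def planarize (X : Type) [LinearOrder X] : (OpTree LRGen X →₀ k) →ₗ[k] (OpTree LRShGen X →₀ k) :=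
  Finsupp.linearCombination k fun t => Finsupp.single (planar t) (planarSign t : k)

/-- The ideal of relations of the Lie–Rinehart operad in the free shuffle operad. -/
def lrShuffleIdeal (n : ℕ) (χ : Fin n → Col) (c : Col) :
    Submodule k (OpTree lrShSig.Gen (Fin n) →₀ k) :=
  (ideal (lrSymmetries k ∪ lrQuadratic k) χ c).map (planarize k (Fin n))

/-- The symmetric group orbits of the quadratic defining relations, in the free shuffle operad. -/
def lrShuffleRelations : Set (Element k lrShSig) :=
  {g | ∃ r ∈ lrQuadratic k, ∃ σ : Equiv.Perm (Fin r.arity),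
    g = ⟨r.arity, r.inp ∘ σ.symm, r.out,
      planarize k (Fin r.arity) (r.elt.mapDomain (OpTree.map σ))⟩}

end

/-- The vector of the numbers of letters in the set `L` on the paths to the leaves. -/
def degVector (L : List LRShGen) {n : ℕ} (t : OpTree LRShGen (Fin n)) : Fin n → ℕ :=
  fun i => (t.path i).countP (· ∈ L)

/-- Lexicographic comparison of vectors. -/
def LexLT {n : ℕ} (v w : Fin n → ℕ) : Prop := ∃ i, (∀ j < i, v j = w j) ∧ v i < w i

/-- The (partial) quantum monomial ordering `t < t'` on trees of the same arity: the degree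
vectors in `α`, then in `d, e`, then in `m, n` are compared, and the smaller vector gives the
greater tree; then the degree vectors in `β` are compared, and the greater one gives the greater
tree. -/
def QMLess {n : ℕ} (t t' : OpTree LRShGen (Fin n)) : Prop :=
  LexLT (degVector [.α] t') (degVector [.α] t) ∨
  degVector [.α] t' = degVector [.α] t ∧
    (LexLT (degVector [.d, .e] t') (degVector [.d, .e] t) ∨
    degVector [.d, .e] t' = degVector [.d, .e] t ∧
      (LexLT (degVector [.m, .n] t') (degVector [.m, .n] t) ∨
      degVector [.m, .n] t' = degVector [.m, .n] t ∧
        LexLT (degVector [.β] t) (degVector [.β] t')))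

/-- The ordering of the tree monomials refines the quantum monomial ordering. -/
def RefinesQM (lt : (Σ n, ShuffleMonomial lrShSig n) → (Σ n, ShuffleMonomial lrShSig n) → Prop) :
    Prop :=
  ∀ (n : ℕ) (x y : ShuffleMonomial lrShSig n), QMLess x.tree y.tree → lt ⟨n, x⟩ ⟨n, y⟩

/-! ### The generating series -/

/-- `e^f`, for a power series `f` without constant term. -/
def expSeries (f : MvPowerSeries Col ℚ) : MvPowerSeries Col ℚ := (PowerSeries.exp ℚ).subst f

/-- `log (1 + f)`, for a power series `f` without constant term. -/
def logOneAddSeries (f : MvPowerSeries Col ℚ) : MvPowerSeries Col ℚ := (PowerSeries.log ℚ).subst f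

/-- The variables `t₁` (straight colour) and `t₂` (dotted colour). -/
def t₁ : MvPowerSeries Col ℚ := MvPowerSeries.X Col.s

def t₂ : MvPowerSeries Col ℚ := MvPowerSeries.X Col.l

end ColouredOperad

end

/-!
# Lie–Rinehart algebras: quadratic Gröbner basis, decomposition and generating series

Everything rests on one family of normal forms and one algebra that separates them.

*Normal forms.* In a Lie–Rinehart algebra the relations move `α` and `m` towards the root and `d`
and `β` towards the inputs, until an operation with output `s` is a combination of products of
chains `d(⋯d(d(x, yₙ), yₙ₋₁)⋯, y₁)`, and an operation with output `l` is a combination of Lie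
monomials, possibly multiplied by such a product (`lr_eval_mem`). By the Jacobi identity the Lie
monomials may be taken to be the combs that begin with their smallest input. A normal form is
recorded by its *key*: the multiset of chains and the word of the comb (`Key`).

*A separating algebra.* The polynomials in the variables `(x, w)`, where `w` is a word, together
with their derivations form a Lie–Rinehart algebra. At the variables `(x, ∅)` and the derivations
that add a letter to all words, a normal form takes the value `f`, or `f • D`, where `f` is the
monomial of the chains and `D` applied to the variable of the empty word `(none, ∅)` is the variable
of the word of the comb, plus a combination of variables whose words begin with another letter
(`keyFunctional_keyVal`). Hence the normal forms are linearly independent. Relations and their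
consequences are related to identities in algebras by the free algebra of a presented operad: an
operation that vanishes in all algebras is zero (`presented_eq_zero`). Together this gives the basis
`keyBasis` of `lieR k`, and shows that the model detects the operations (`genericEval_injective`).

*The composition.* Both `N_m` and `(DCom¹; Lie)` act on every Lie–Rinehart algebra; for `N_m` the
nilpotency of `m` is enforced by a second copy of the space. The composition is spanned by elements
which have the values of the normal forms, one for every key (`span_isStd`, `IsStd.unique`). So the
map from the basis `keyBasis` to these elements is bijective, and it is natural because it preserves
values in all algebras (`nonempty_iso_comp`).

*The generating series.* With `p` inputs of colour `s`, a key consists of `p` words, one for each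
chain, and for the output `l` of one more word beginning with its smallest letter. Words on `j`
letters number `j!`, those with smallest first letter `(j - 1)!`; this gives the exponential
generating series `(1 - t)⁻ᵖ` and `-log(1 - t) (1 - t)⁻ᵖ` in the inputs of colour `l`, and the sum
over `p` gives the two series (`genSeries_s`, `genSeries_l`).

*The Gröbner basis.* The leading trees of the quadratic relations are determined by the degree
vectors alone, and substitution of shuffle trees preserves the comparison of degree vectors, since
the first difference occurs at the smallest leaf of a substituted tree (`QMLess.fill_bind`). So
every shuffle tree monomial that is not normal can be rewritten, and modulo the quadratic relations
it equals a combination of smaller normal ones (`single_mem_sup`). A normal shuffle tree can be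
recovered from its chains and its word (`IsGood.eq_of_treeData`), so there are not more normal
shuffle trees than keys. As their values in the model span a space whose dimension is the number of
keys, they are linearly independent (`linearIndependent_normalTree`). This shows both that the
quadratic relations generate the ideal and that no leading term of the ideal is normal.

*An admissible ordering.* After the four degree vectors, the sequences of path words are compared,
where a path word records the vertices from the root to a leaf and the directions taken at them.
Words are compared by length and then lexicographically. In a shuffle composition the entries of
these vectors at the grafted leaves are composed with one entry of the root tree; since the least
grafted leaf takes the place of the input, this is strictly monotone in both arguments for the
lexicographic orderings (`glue_strictMono_left`, `glue_strictMono_right`). The path words determine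
the tree (`OpTree.eq_of_dpath`), so the ordering is total.
-/

noncomputable section

namespace ColouredOperad

universe u v w

/-! ### Trees, substitution and colourings -/

namespace OpTree

variable {G X Y : Type}

theorem leaves_ne_nil (t : OpTree G X) : t.leaves ≠ [] := by
  induction t with
  | leaf x => simp [leaves]
  | node g l r hl hr => simp [leaves, hl]

theorem leaves_bind (θ : X → OpTree G Y) (t : OpTree G X) :
    (t.bind θ).leaves = t.leaves.flatMap fun x => (θ x).leaves := by
  induction t with
  | leaf x => simp [bind, leaves]
  | node g l r hl hr => simp [bind, leaves, hl, hr]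

theorem map_eq_bind (f : X → Y) (t : OpTree G X) : t.map f = t.bind fun x => leaf (f x) := by
  induction t with
  | leaf x => rfl
  | node g l r hl hr => simp only [map, bind, hl, hr]

theorem bind_leaf (t : OpTree G X) : t.bind leaf = t := by
  induction t with
  | leaf x => rfl
  | node g l r hl hr => simp only [bind, hl, hr]

theorem bind_bind {Z : Type} (θ : X → OpTree G Y) (η : Y → OpTree G Z) (t : OpTree G X) :
    (t.bind θ).bind η = t.bind fun x => (θ x).bind η := by
  induction t with
  | leaf x => rfl
  | node g l r hl hr => simp only [bind, hl, hr]

theorem map_bind {Z : Type} (f : X → Y) (η : Y → OpTree G Z) (t : OpTree G X) :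
    (t.map f).bind η = t.bind fun x => η (f x) := by
  rw [map_eq_bind, bind_bind]; rfl

theorem bind_congr {θ η : X → OpTree G Y} (t : OpTree G X) (h : ∀ x ∈ t.leaves, θ x = η x) :
    t.bind θ = t.bind η := by
  induction t with
  | leaf x => exact h x (by simp [leaves])
  | node g l r hl hr =>
    simp only [bind, hl fun x hx => h x (by simp [leaves, hx]),
      hr fun x hx => h x (by simp [leaves, hx])]

theorem IsColoured.unique {I : Type} {S : Signature I} {χ : X → I} {c c' : I}
    {t : OpTree S.Gen X} (h : t.IsColoured S χ c) (h' : t.IsColoured S χ c') : c = c' := by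
  cases t with
  | leaf x => exact h.symm.trans h'
  | node g l r => exact h.1.symm.trans h'.1

theorem IsColoured.bind {I : Type} {S : Signature I} {χ : X → I} {χ' : Y → I}
    {θ : X → OpTree S.Gen Y} : ∀ {t : OpTree S.Gen X} {c : I}, t.IsColoured S χ c →
      (∀ x ∈ t.leaves, (θ x).IsColoured S χ' (χ x)) → (t.bind θ).IsColoured S χ' c
  | leaf x, _, h, hθ => by
    have := hθ x (by simp [leaves])
    rwa [show χ x = _ from h] at this
  | node g l r, _, h, hθ =>
    ⟨h.1, h.2.1.bind fun x hx => hθ x (by simp [leaves, hx]),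
      h.2.2.bind fun x hx => hθ x (by simp [leaves, hx])⟩

/-- A substitution into a coloured tree is ill coloured as soon as one of the substituted trees
is. -/
theorem IsColoured.of_bind {I : Type} {S : Signature I} {χ : X → I} {χ' : Y → I}
    {θ : X → OpTree S.Gen Y} : ∀ {t : OpTree S.Gen X} {c : I}, t.IsColoured S χ c →
      (t.bind θ).IsColoured S χ' c → ∀ x ∈ t.leaves, (θ x).IsColoured S χ' (χ x)
  | leaf x, _, h, hb, y, hy => by
    obtain rfl : y = x := by simpa [leaves] using hy
    rw [show χ y = _ from h]
    exact hb
  | node g l r, _, h, hb, x, hx => by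
    rcases List.mem_append.1 hx with hx | hx
    · exact h.2.1.of_bind hb.2.1 x hx
    · exact h.2.2.of_bind hb.2.2 x hx

theorem IsColoured.congr {I : Type} {S : Signature I} {χ χ' : X → I} :
    ∀ {t : OpTree S.Gen X} {c : I}, t.IsColoured S χ c → (∀ x ∈ t.leaves, χ x = χ' x) →
      t.IsColoured S χ' c
  | leaf x, _, h, hχ => (hχ x (by simp [leaves])).symm.trans h
  | node g l r, _, h, hχ =>
    ⟨h.1, h.2.1.congr fun x hx => hχ x (by simp [leaves, hx]),
      h.2.2.congr fun x hx => hχ x (by simp [leaves, hx])⟩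

theorem leaves_graft {A B : Type} (a : A) (φ : A → X) (ψ : B → X) (t₁ : OpTree G A)
    (t₂ : OpTree G B) [DecidableEq A] : (graft a φ ψ t₁ t₂).leaves =
      t₁.leaves.flatMap fun x => if x = a then t₂.leaves.map ψ else [φ x] := by
  unfold graft
  rw [leaves_bind]
  refine congrArg (fun f => List.flatMap f _) (funext fun x => ?_)
  by_cases h : x = a <;> simp [h, leaves_map, leaves]

end OpTree

open Classical in
theorem isMonomial_iff {I X : Type} {S : Signature I} {χ : X → I} {c : I}
    {t : OpTree S.Gen X} :
    IsMonomial S χ c t ↔ t.IsColoured S χ c ∧ ∀ x, t.leaves.count x = 1 := by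
  refine and_congr_right fun _ => ⟨fun h x => List.count_eq_one_of_mem h.1 (h.2 x), fun h => ?_⟩
  refine ⟨List.nodup_iff_count_le_one.2 fun x => (h x).le, fun x => ?_⟩
  exact List.count_pos_iff.1 (by rw [h x]; exact one_pos)

/-- A grafting of monomials is a monomial. -/
theorem IsMonomial.graft {I A B X : Type} {S : Signature I} {a : A} {φ : A → X} {ψ : B → X}
    (h : IsGrafting a φ ψ) {χ₁ : A → I} {χ₂ : B → I} {χ : X → I} (hχ : IsGlued a φ ψ χ₁ χ₂ χ)
    {c : I} {t₁ : OpTree S.Gen A} (h₁ : IsMonomial S χ₁ c t₁) {t₂ : OpTree S.Gen B}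
    (h₂ : IsMonomial S χ₂ (χ₁ a) t₂) : IsMonomial S χ c (OpTree.graft a φ ψ t₁ t₂) := by
  classical
  refine ⟨h₁.1.bind fun x _ => ?_, ?_, fun y => ?_⟩
  · by_cases hx : x = a
    · subst hx
      simp only [if_true]
      refine OpTree.IsColoured.map ψ χ t₂ _ ?_
      convert h₂.1 using 2
      exact funext fun b => hχ.2 b
    · simp only [hx, if_false]
      exact hχ.1 x hx
  · rw [OpTree.leaves_graft, List.nodup_flatMap]
    refine ⟨fun x _ => ?_, h₁.2.1.imp_of_mem fun {x y} _ _ hxy => ?_⟩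
    · by_cases hx : x = a
      · simpa [hx] using h₂.2.1.map h.inj_right
      · simp [hx]
    · by_cases hx : x = a <;> by_cases hy : y = a
      · exact absurd (hx.trans hy.symm) hxy
      · simp only [Function.onFun, hx, hy, if_true, if_false, List.disjoint_singleton,
          List.mem_map, not_exists, not_and]
        exact fun b _ hb => h.disjoint y hy b hb.symm
      · simp only [Function.onFun, hx, hy, if_true, if_false, List.singleton_disjoint,
          List.mem_map, not_exists, not_and]
        exact fun b _ hb => h.disjoint x hx b hb.symm
      · simp only [Function.onFun, hx, hy, if_false, List.singleton_disjoint, List.mem_singleton]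
        exact fun he => hxy (h.inj_left hx hy he)
  · rw [OpTree.leaves_graft, List.mem_flatMap]
    rcases h.cover y with ⟨x, hx, rfl⟩ | ⟨b, rfl⟩
    · exact ⟨x, h₁.2.2 x, by simp [hx]⟩
    · exact ⟨a, h₁.2.2 a, by simpa using ⟨b, h₂.2.2 b, rfl⟩⟩

/-! ### Evaluation of trees in algebras with bilinear operations -/

section Eval

variable {k : Type u} [Field k] {G X Y : Type} {Z : Type v} [AddCommGroup Z] [Module k Z]

/-- A bilinear operation on `Z` for every generator. -/
abbrev Ops (k : Type u) [Field k] (G : Type) (Z : Type v) [AddCommGroup Z] [Module k Z] :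
    Type v := G → Z →ₗ[k] Z →ₗ[k] Z

/-- The value of a tree at the inputs `z`. -/
def OpTree.eval (μ : Ops k G Z) (z : X → Z) : OpTree G X → Z
  | leaf x => z x
  | node g l r => μ g (l.eval μ z) (r.eval μ z)

/-- The value of a linear combination of trees at the inputs `z`. -/
def evalLin (μ : Ops k G Z) (z : X → Z) : (OpTree G X →₀ k) →ₗ[k] Z :=
  Finsupp.linearCombination k (OpTree.eval μ z)

@[simp] theorem evalLin_single (μ : Ops k G Z) (z : X → Z) (t : OpTree G X) (a : k) :
    evalLin μ z (Finsupp.single t a) = a • t.eval μ z := by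
  simp [evalLin]

@[simp] theorem evalLin_mon (μ : Ops k G Z) (z : X → Z) (t : OpTree G X) :
    evalLin μ z (mon k t) = t.eval μ z := by
  simp [mon]

theorem OpTree.eval_bind (μ : Ops k G Z) (z : Y → Z) (θ : X → OpTree G Y) (t : OpTree G X) :
    (t.bind θ).eval μ z = t.eval μ fun x => (θ x).eval μ z := by
  induction t with
  | leaf x => rfl
  | node g l r hl hr => simp only [bind, eval, hl, hr]

theorem OpTree.eval_map (μ : Ops k G Z) (z : Y → Z) (f : X → Y) (t : OpTree G X) :
    (t.map f).eval μ z = t.eval μ fun x => z (f x) := by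
  rw [map_eq_bind, eval_bind]; rfl

theorem OpTree.eval_congr (μ : Ops k G Z) {z z' : X → Z} (t : OpTree G X)
    (h : ∀ x ∈ t.leaves, z x = z' x) : t.eval μ z = t.eval μ z' := by
  induction t with
  | leaf x => exact h x (by simp [leaves])
  | node g l r hl hr =>
    simp only [eval, hl fun x hx => h x (by simp [leaves, hx]),
      hr fun x hx => h x (by simp [leaves, hx])]

theorem evalLin_mapDomain (μ : Ops k G Z) (z : X → Z) (F : OpTree G Y → OpTree G X)
    (f : OpTree G Y →₀ k) :
    evalLin μ z (f.mapDomain F) = Finsupp.linearCombination k (fun t => (F t).eval μ z) f :=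
  Finsupp.linearCombination_mapDomain k F f

theorem evalLin_map (μ : Ops k G Z) (z : Y → Z) (e : X → Y) (f : OpTree G X →₀ k) :
    evalLin μ z (f.mapDomain (OpTree.map e)) = evalLin μ (fun x => z (e x)) f := by
  rw [evalLin_mapDomain]
  exact congrArg (fun F => Finsupp.linearCombination k F f)
    (funext fun t => OpTree.eval_map μ z e t)

theorem OpTree.eval_update_of_notMem [DecidableEq X] (μ : Ops k G Z) (z : X → Z) (a : X) (v : Z)
    (t : OpTree G X) (h : a ∉ t.leaves) : t.eval μ (Function.update z a v) = t.eval μ z :=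
  t.eval_congr μ fun x hx => Function.update_of_ne (fun e => h (by rwa [← e])) _ _

/-- A tree in which the leaf `a` occurs exactly once is linear in the input `a`. -/
theorem OpTree.exists_eval_update [DecidableEq X] (μ : Ops k G Z) (z : X → Z) (a : X) :
    ∀ t : OpTree G X, t.leaves.Nodup → a ∈ t.leaves →
      ∃ L : Z →ₗ[k] Z, ∀ v, t.eval μ (Function.update z a v) = L v
  | leaf x, _, h => ⟨LinearMap.id, fun v => by
      obtain rfl : a = x := by simpa [leaves] using h
      simp [eval]⟩
  | node g l r, hn, h => by
    obtain ⟨h1, h2, h3⟩ := List.nodup_append'.1 hn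
    by_cases ha : a ∈ l.leaves
    · obtain ⟨L, hL⟩ := OpTree.exists_eval_update μ z a l h1 ha
      refine ⟨((μ g).flip (r.eval μ z)).comp L, fun v => ?_⟩
      simp [eval, hL, eval_update_of_notMem μ z a v r fun h' => h3 ha h']
    · obtain ⟨L, hL⟩ := OpTree.exists_eval_update μ z a r h2
        ((List.mem_append.1 h).resolve_left ha)
      refine ⟨(μ g (l.eval μ z)).comp L, fun v => ?_⟩
      simp [eval, hL, eval_update_of_notMem μ z a v l ha]

open Classical in
/-- The multilinear map of a tree whose leaves are bijectively labelled by `X`. -/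
def evalMultilinear (μ : Ops k G Z) (t : OpTree G X) (h1 : t.leaves.Nodup)
    (h2 : ∀ x, x ∈ t.leaves) : MultilinearMap k (fun _ : X => Z) Z where
  toFun z := t.eval μ z
  map_update_add' {dec} z a x y := by
    obtain rfl : dec = fun a b => Classical.propDecidable _ := Subsingleton.elim _ _
    obtain ⟨L, hL⟩ := OpTree.exists_eval_update μ z a t h1 (h2 a)
    simp only [hL, map_add]
  map_update_smul' {dec} z a b x := by
    obtain rfl : dec = fun a b => Classical.propDecidable _ := Subsingleton.elim _ _
    obtain ⟨L, hL⟩ := OpTree.exists_eval_update μ z a t h1 (h2 a)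
    simp only [hL, map_smul]

theorem OpTree.eval_graft {A B : Type} [DecidableEq A] (μ : Ops k G Z) (z : X → Z) (a : A)
    (φ : A → X) (ψ : B → X) (t₁ : OpTree G A) (t₂ : OpTree G B) :
    (graft a φ ψ t₁ t₂).eval μ z =
      t₁.eval μ (Function.update (fun x => z (φ x)) a (t₂.eval μ fun b => z (ψ b))) := by
  unfold graft
  rw [eval_bind]
  refine congrArg (fun F => t₁.eval μ F) (funext fun x => ?_)
  by_cases h : x = a
  · subst h; simp [eval_map]
  · simp [h, eval]

/-- The value of a left composition is a value of the left factor. -/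
theorem evalLin_graft_left {A B : Type} [DecidableEq A] (μ : Ops k G Z) (z : X → Z) (a : A)
    (φ : A → X) (ψ : B → X) (f : OpTree G A →₀ k) (t : OpTree G B) :
    evalLin μ z (f.mapDomain fun s => OpTree.graft a φ ψ s t) =
      evalLin μ (Function.update (fun x => z (φ x)) a (t.eval μ fun b => z (ψ b))) f := by
  rw [evalLin_mapDomain]
  exact congrArg (fun F => Finsupp.linearCombination k F f)
    (funext fun s => OpTree.eval_graft μ z a φ ψ s t)

/-- The value of a right composition is a linear function of the value of the right factor. -/
theorem exists_evalLin_graft_right {A B : Type} (μ : Ops k G Z) (z : X → Z) (a : A)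
    (φ : A → X) (ψ : B → X) (t : OpTree G A) (h1 : t.leaves.Nodup) (h2 : a ∈ t.leaves) :
    ∃ L : Z →ₗ[k] Z, ∀ f : OpTree G B →₀ k,
      evalLin μ z (f.mapDomain fun s => OpTree.graft a φ ψ t s) =
        L (evalLin μ (fun b => z (ψ b)) f) := by
  classical
  obtain ⟨L, hL⟩ := OpTree.exists_eval_update μ (fun x => z (φ x)) a t h1 h2
  refine ⟨L, fun f => ?_⟩
  rw [evalLin_mapDomain, evalLin, Finsupp.apply_linearCombination]
  refine congrArg (fun F => Finsupp.linearCombination k F f) (funext fun s => ?_)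
  rw [OpTree.eval_graft, hL]; rfl

variable {I : Type} {S : Signature I}

/-- The operations `μ` satisfy the relations `R`, for all values of the inputs. -/
def Sat (R : Set (Element k S)) (μ : Ops k S.Gen Z) : Prop :=
  ∀ r ∈ R, ∀ z : Fin r.arity → Z, evalLin μ z r.elt = 0

/-- The operadic ideal vanishes in every algebra that satisfies the relations. -/
theorem InIdeal.evalLin_eq_zero {R : Set (Element k S)} {μ : Ops k S.Gen Z} (hμ : Sat R μ)
    {X : Type} {χ : X → I} {c : I} {f : OpTree S.Gen X →₀ k} (hf : InIdeal R χ c f) :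
    ∀ z : X → Z, evalLin μ z f = 0 := by
  classical
  induction hf with
  | rel r hr => exact hμ r hr
  | zero => simp
  | add _ _ h1 h2 => intro z; rw [map_add, h1, h2, add_zero]
  | smul a _ h => intro z; rw [map_smul, h, smul_zero]
  | relabel e _ h => intro z; rw [evalLin_map, h]
  | comp_left hg hχ hf ht h => intro z; rw [evalLin_graft_left, h]
  | comp_right hg hχ ht hf h =>
    intro z
    obtain ⟨L, hL⟩ := exists_evalLin_graft_right μ z _ _ _ _ ht.2.1 (ht.2.2 _)
    rw [hL, h, map_zero]

/-- The elements of the ideal of well formed relations are combinations of tree monomials. -/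
theorem InIdeal.isMonomial {R : Set (Element k S)}
    (hR : ∀ r ∈ R, ∀ s ∈ r.elt.support, IsMonomial S r.inp r.out s)
    {X : Type} {χ : X → I} {c : I} {f : OpTree S.Gen X →₀ k} (hf : InIdeal R χ c f) :
    ∀ s ∈ f.support, IsMonomial S χ c s := by
  classical
  induction hf with
  | rel r hr => exact hR r hr
  | zero => simp
  | add _ _ h1 h2 =>
    intro s hs
    exact (Finset.mem_union.1 (Finsupp.support_add hs)).elim (h1 s) (h2 s)
  | smul a _ h => exact fun s hs => h s (Finsupp.support_smul hs)
  | relabel e _ h =>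
    intro s hs
    obtain ⟨t, ht, rfl⟩ := Finset.mem_image.1 (Finsupp.mapDomain_support hs)
    exact (h t ht).map e
  | comp_left hg hχ hf ht h =>
    intro s hs
    obtain ⟨t, ht', rfl⟩ := Finset.mem_image.1 (Finsupp.mapDomain_support hs)
    exact (h t ht').graft hg hχ ht
  | comp_right hg hχ ht hf h =>
    intro s hs
    obtain ⟨t, ht', rfl⟩ := Finset.mem_image.1 (Finsupp.mapDomain_support hs)
    exact ht.graft hg hχ (h t ht')

/-- The multilinear map on an algebra that is given by an operation of a presented operad. -/
def presentedEval {R : Set (Element k S)} {μ : Ops k S.Gen Z} (hμ : Sat R μ) (X : Type) [Finite X]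
    (χ : X → I) (c : I) :
    (presented R).obj X χ c →ₗ[k] MultilinearMap k (fun _ : X => Z) Z :=
  Submodule.liftQ _
    (Finsupp.linearCombination k fun t : Monomial S χ c =>
      evalMultilinear μ t.1 t.2.2.1 t.2.2.2) fun f hf => by
    refine LinearMap.mem_ker.2 (MultilinearMap.ext fun z => ?_)
    have h := InIdeal.evalLin_eq_zero hμ (show InIdeal R χ c _ from hf) z
    rw [Finsupp.lmapDomain_apply, evalLin, Finsupp.linearCombination_mapDomain] at h
    refine Eq.trans ?_ h
    rw [Finsupp.linearCombination_apply, Finsupp.linearCombination_apply, Finsupp.sum, Finsupp.sum,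
      sum_apply]
    rfl

/-- The projection from the free operad to a presented operad. -/
def presentedQ (R : Set (Element k S)) (X : Type) [Finite X] (χ : X → I) (c : I) :
    (Monomial S χ c →₀ k) →ₗ[k] (presented R).obj X χ c := (relations R χ c).mkQ

/-- The class of a tree monomial in a presented operad. -/
def presentedMk (R : Set (Element k S)) {X : Type} [Finite X] {χ : X → I} {c : I}
    (t : Monomial S χ c) : (presented R).obj X χ c :=
  presentedQ R X χ c (Finsupp.single t 1)

theorem presentedEval_mk {R : Set (Element k S)} {μ : Ops k S.Gen Z} (hμ : Sat R μ) {X : Type}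
    [Finite X] {χ : X → I} {c : I} (t : Monomial S χ c) (z : X → Z) :
    presentedEval hμ X χ c (presentedMk R t) z = t.1.eval μ z := by
  have : presentedEval hμ X χ c (presentedMk R t) =
      evalMultilinear μ t.1 t.2.2.1 t.2.2.2 := by
    refine (Submodule.liftQ_apply _ _ _).trans ?_
    rw [Finsupp.linearCombination_single, one_smul]
  rw [this]; rfl

theorem presentedMk_map {R : Set (Element k S)} {X Y : Type} [Finite X] [Finite Y] (e : X ≃ Y)
    (χ : Y → I) (c : I) (t : Monomial S (χ ∘ e) c) :
    (presented R).map e χ c (presentedMk R t) = presentedMk R (Monomial.map e χ c t) :=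
  congrArg (presentedQ R Y χ c) (Finsupp.mapDomain_single (f := Monomial.map e χ c))

theorem presentedQ_apply (R : Set (Element k S)) {X : Type} [Finite X] {χ : X → I} {c : I}
    (f : Monomial S χ c →₀ k) :
    presentedQ R X χ c f = Finsupp.linearCombination k (presentedMk R) f := by
  induction f using Finsupp.induction_linear with
  | zero => simp
  | add f g hf hg => simp only [map_add, hf, hg]
  | single t a =>
    rw [Finsupp.linearCombination_single, presentedMk, ← map_smul, Finsupp.smul_single,
      smul_eq_mul, mul_one]

theorem presentedQ_surjective (R : Set (Element k S)) {X : Type} [Finite X] {χ : X → I} {c : I} :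
    Function.Surjective (presentedQ R X χ c) := Submodule.mkQ_surjective _

theorem presentedQ_eq_zero {R : Set (Element k S)} {X : Type} [Finite X] {χ : X → I} {c : I}
    {f : Monomial S χ c →₀ k} : presentedQ R X χ c f = 0 ↔ f ∈ relations R χ c :=
  Submodule.Quotient.mk_eq_zero _

theorem span_presentedMk (R : Set (Element k S)) (X : Type) [Finite X] (χ : X → I) (c : I) :
    Submodule.span k (Set.range (presentedMk R (X := X) (χ := χ) (c := c))) = ⊤ := by
  refine eq_top_iff.2 fun p _ => ?_
  obtain ⟨f, rfl⟩ := presentedQ_surjective R p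
  rw [presentedQ_apply, ← Finsupp.range_linearCombination]
  exact ⟨f, rfl⟩

theorem presentedEval_presentedQ {R : Set (Element k S)} {μ : Ops k S.Gen Z} (hμ : Sat R μ)
    {X : Type} [Finite X] {χ : X → I} {c : I} (f : Monomial S χ c →₀ k) (z : X → Z) :
    presentedEval hμ X χ c (presentedQ R X χ c f) z =
      Finsupp.linearCombination k (fun t : Monomial S χ c => t.1.eval μ z) f := by
  induction f using Finsupp.induction_linear with
  | zero => simp
  | add f g hf hg => simp only [map_add, add_apply, hf, hg]
  | single t a =>
    rw [presentedQ_apply, Finsupp.linearCombination_single, Finsupp.linearCombination_single,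
      map_smul, smul_apply, presentedEval_mk]

theorem presentedEval_map {R : Set (Element k S)} {μ : Ops k S.Gen Z} (hμ : Sat R μ) {X Y : Type}
    [Finite X] [Finite Y] (e : X ≃ Y) (χ : Y → I) (c : I)
    (p : (presented R).obj X (χ ∘ e) c) (z : Y → Z) :
    presentedEval hμ Y χ c ((presented R).map e χ c p) z =
      presentedEval hμ X (χ ∘ e) c p fun x => z (e x) := by
  have hp : p ∈ Submodule.span k (Set.range (presentedMk R (X := X) (χ := χ ∘ e) (c := c))) := by
    rw [span_presentedMk]; trivial
  induction hp using Submodule.span_induction with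
  | mem p hp =>
    obtain ⟨t, rfl⟩ := hp
    rw [presentedMk_map, presentedEval_mk, presentedEval_mk]
    exact OpTree.eval_map μ z e t.1
  | zero => simp
  | add p q _ _ h1 h2 => simp only [map_add, add_apply, h1, h2]
  | smul a p _ h => simp only [map_smul, smul_apply, h]

end Eval

/-! ### The operadic ideal is detected by algebras -/

theorem sum_update_add {ι T : Type} [Fintype ι] [DecidableEq ι] (F : T → ℕ) (θ : ι → T) (a : ι)
    (t : T) : ∑ b, F (Function.update θ a t b) + F (θ a) = ∑ b, F (θ b) + F t := by
  rw [← Finset.add_sum_erase _ (fun b => F (Function.update θ a t b)) (Finset.mem_univ a),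
    ← Finset.add_sum_erase _ (fun b => F (θ b)) (Finset.mem_univ a)]
  simp only [Function.update_self]
  have : ∑ b ∈ Finset.univ.erase a, F (Function.update θ a t b) =
      ∑ b ∈ Finset.univ.erase a, F (θ b) :=
    Finset.sum_congr rfl fun b hb => by rw [Function.update_of_ne (Finset.ne_of_mem_erase hb)]
  omega

/-- If the leaves of a monomial over `Fin m` are replaced by the trees `θ a`, then each label
occurs as often as in all the `θ a` together. -/
theorem OpTree.count_leaves_bind {G X : Type} [DecidableEq X] {m : ℕ} {t : OpTree G (Fin m)}
    (h1 : t.leaves.Nodup) (h2 : ∀ a, a ∈ t.leaves) (θ : Fin m → OpTree G X) (x : X) :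
    (t.bind θ).leaves.count x = ∑ a, (θ a).leaves.count x := by
  have hp : t.leaves.Perm (List.finRange m) :=
    (List.perm_ext_iff_of_nodup h1 (List.nodup_finRange m)).2 fun a => by simp [h2 a]
  rw [leaves_bind, List.count_flatMap, (hp.map _).sum_eq, Fin.sum_univ_def]
  rfl

section

variable {k : Type u} [Field k] {I : Type} {S : Signature I}

theorem isGrafting_succ {m : ℕ} (a : Fin m) :
    IsGrafting a Fin.succ (![a.succ, 0] : Fin 2 → Fin (m + 1)) where
  inj_left := (Fin.succ_injective m).injOn
  inj_right i j h := by
    fin_cases i <;> fin_cases j <;> simp_all [Fin.succ_ne_zero, (Fin.succ_ne_zero _).symm]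
  disjoint x hx b := by
    fin_cases b
    · simpa using hx
    · simp
  cover y := by
    refine Fin.cases (Or.inr ⟨1, rfl⟩) (fun j => ?_) y
    by_cases h : j = a
    · exact Or.inr ⟨0, by simp [h]⟩
    · exact Or.inl ⟨j, h, rfl⟩

theorem isMonomial_corolla (g : S.Gen) :
    IsMonomial S ![S.in₁ g, S.in₂ g] (S.out g) (.node g (.leaf 0) (.leaf 1)) := by
  refine ⟨⟨rfl, rfl, rfl⟩, by simp [OpTree.leaves], fun x => ?_⟩
  fin_cases x <;> simp [OpTree.leaves]

/-- The ideal is closed under the substitution of trees for all inputs, because trees are iterated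
graftings of corollas. -/
theorem InIdeal.bind {R : Set (Element k S)} {X : Type} [DecidableEq X] {χ : X → I} {c : I}
    {m : ℕ} {χA : Fin m → I} {h : OpTree S.Gen (Fin m) →₀ k} (hh : InIdeal R χA c h)
    (θ : Fin m → OpTree S.Gen X) (hθ : ∀ a, (θ a).IsColoured S χ (χA a))
    (hc : ∀ x, ∑ a, (θ a).leaves.count x = 1) : InIdeal R χ c (h.mapDomain (OpTree.bind θ)) := by
  induction hN : ∑ a, (θ a).vertices generalizing m with
  | zero =>
    have hl : ∀ a, ∃ x, θ a = .leaf x := fun a => by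
      have := (Finset.sum_eq_zero_iff.1 hN) a (Finset.mem_univ a)
      cases ht : θ a with
      | leaf x => exact ⟨x, rfl⟩
      | node g l r => simp [ht, OpTree.vertices] at this
    choose e he using hl
    have hbij : Function.Bijective e := by
      refine ⟨fun a b hab => by_contra fun hne => ?_, fun x => ?_⟩
      · have h1 : ∑ i ∈ {a, b}, (θ i).leaves.count (e a) ≤ ∑ i, (θ i).leaves.count (e a) :=
          Finset.sum_le_sum_of_subset (Finset.subset_univ _)
        rw [hc, Finset.sum_pair hne, he a, he b, ← hab] at h1
        simp [OpTree.leaves] at h1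
      · obtain ⟨a, -, ha⟩ := Finset.exists_ne_zero_of_sum_ne_zero (by rw [hc x]; exact one_ne_zero)
        refine ⟨a, ?_⟩
        rw [he a] at ha
        simpa [OpTree.leaves, List.count_singleton] using ha
    have hχ : χA = χ ∘ Equiv.ofBijective e hbij := funext fun a => by
      have := hθ a
      rw [he a] at this
      exact this.symm
    subst hχ
    have := InIdeal.relabel (Equiv.ofBijective e hbij) hh
    convert this using 2
    exact funext fun t => by rw [OpTree.map_eq_bind]; exact t.bind_congr fun a _ => he a
  | succ N ih =>
    obtain ⟨a, -, ha⟩ : ∃ a ∈ Finset.univ, (θ a).vertices ≠ 0 :=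
      Finset.exists_ne_zero_of_sum_ne_zero (by omega)
    cases ht : θ a with
    | leaf x => exact absurd (by simp [ht, OpTree.vertices]) ha
    | node g l r =>
    have hcol := hθ a
    rw [ht] at hcol
    have hg := isGrafting_succ a
    let χ' : Fin (m + 1) → I := Fin.cons (S.in₂ g) (Function.update χA a (S.in₁ g))
    have hglue : IsGlued a Fin.succ ![a.succ, 0] χA ![S.in₁ g, S.in₂ g] χ' := by
      refine ⟨fun x hx => by simp [χ', hx], fun b => ?_⟩
      fin_cases b
      · simp [χ']
      · rfl
    have h' := InIdeal.comp_left hg hglue hh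
      (t := .node g (.leaf 0) (.leaf 1)) (by rw [← hcol.1]; exact isMonomial_corolla g)
    have key := ih h' (Fin.cons r (Function.update θ a l)) ?_ ?_ ?_
    · rw [← Finsupp.mapDomain_comp] at key
      convert key using 2
      refine funext fun t => ?_
      simp only [Function.comp, OpTree.graft]
      rw [OpTree.bind_bind]
      refine t.bind_congr fun x _ => ?_
      by_cases hx : x = a
      · subst hx; simp [OpTree.map, OpTree.bind, ht, -Fin.cons_update]
      · simp [hx, OpTree.bind]
    · refine Fin.cases hcol.2.2 fun j => ?_
      by_cases hj : j = a
      · subst hj; simpa [χ'] using hcol.2.1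
      · simpa [χ', hj] using hθ j
    · intro x
      have := sum_update_add (fun t : OpTree S.Gen X => t.leaves.count x) θ a l
      rw [hc x, ht] at this
      simp only [OpTree.leaves, List.count_append] at this
      rw [Fin.sum_univ_succ]
      simp only [Fin.cons_zero, Fin.cons_succ]
      omega
    · have := sum_update_add (fun t : OpTree S.Gen X => t.vertices) θ a l
      rw [hN, ht] at this
      simp only [OpTree.vertices] at this
      rw [Fin.sum_univ_succ]
      simp only [Fin.cons_zero, Fin.cons_succ]
      omega

/-- The ideal is closed under the addition of a vertex at the output, with the elements of the
ideal at the second input. -/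
theorem InIdeal.node_right {R : Set (Element k S)} {m : ℕ} {χA : Fin m → I} (g : S.Gen)
    {h : OpTree S.Gen (Fin m) →₀ k} (hh : InIdeal R χA (S.in₂ g) h) :
    InIdeal R (Fin.cons (S.in₁ g) χA) (S.out g)
      (h.mapDomain fun s => .node g (.leaf 0) (s.map Fin.succ)) := by
  have hg : IsGrafting (1 : Fin 2) (fun _ => (0 : Fin (m + 1))) Fin.succ :=
    ⟨fun i hi j hj _ => by
      simp only [Set.mem_compl_iff, Set.mem_singleton_iff] at hi hj; omega,
      Fin.succ_injective m, fun x _ b => (Fin.succ_ne_zero b).symm,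
      fun y => Fin.cases (Or.inl ⟨0, by simp, rfl⟩) (fun j => Or.inr ⟨j, rfl⟩) y⟩
  have := InIdeal.comp_right hg (χ := Fin.cons (S.in₁ g) χA) (χ₂ := χA)
    ⟨fun x hx => by obtain rfl : x = 0 := by omega
                    simp, fun b => by simp⟩ (isMonomial_corolla g) hh
  simpa [OpTree.graft, OpTree.bind] using this

/-- The same with the elements of the ideal at the first input. -/
theorem InIdeal.node_left {R : Set (Element k S)} {m : ℕ} {χA : Fin m → I} (g : S.Gen)
    {h : OpTree S.Gen (Fin m) →₀ k} (hh : InIdeal R χA (S.in₁ g) h) :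
    InIdeal R (Fin.cons (S.in₂ g) χA) (S.out g)
      (h.mapDomain fun s => .node g (s.map Fin.succ) (.leaf 0)) := by
  have hg : IsGrafting (0 : Fin 2) (fun _ => (0 : Fin (m + 1))) Fin.succ :=
    ⟨fun i hi j hj _ => by
      simp only [Set.mem_compl_iff, Set.mem_singleton_iff] at hi hj; omega,
      Fin.succ_injective m, fun x _ b => (Fin.succ_ne_zero b).symm,
      fun y => Fin.cases (Or.inl ⟨1, by simp, rfl⟩) (fun j => Or.inr ⟨j, rfl⟩) y⟩
  have := InIdeal.comp_right hg (χ := Fin.cons (S.in₂ g) χA) (χ₂ := χA)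
    ⟨fun x hx => by obtain rfl : x = 1 := by omega
                    simp, fun b => by simp⟩ (isMonomial_corolla g) hh
  simpa [OpTree.graft, OpTree.bind] using this

/-- Relations that are combinations of tree monomials with at least one vertex. -/
def WellFormed (R : Set (Element k S)) : Prop :=
  ∀ r ∈ R, ∀ s ∈ r.elt.support, IsMonomial S r.inp r.out s ∧ s.vertices ≠ 0

variable (R : Set (Element k S)) {X : Type} (χ : X → I)

/-- The relations of the free algebra over the operad with relations `R`, on generators `X`:
substitutions into elements of the ideal. All trees with mismatching colours are set to zero. -/
def algRel : Submodule k (OpTree S.Gen X →₀ k) :=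
  Submodule.span k ({f | ∃ (m : ℕ) (χA : Fin m → I) (c : I) (h : OpTree S.Gen (Fin m) →₀ k)
      (θ : Fin m → OpTree S.Gen X), InIdeal R χA c h ∧ (∀ a, (θ a).IsColoured S χ (χA a)) ∧
        f = h.mapDomain (OpTree.bind θ)} ∪
    {f | ∃ t : OpTree S.Gen X, (∀ c, ¬ t.IsColoured S χ c) ∧ f = mon k t})

variable {R χ}

theorem mon_mem_algRel {t : OpTree S.Gen X} (h : ∀ c, ¬ t.IsColoured S χ c) :
    mon k t ∈ algRel R χ := Submodule.subset_span (Or.inr ⟨t, h, rfl⟩)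

theorem mapDomain_mem_algRel {T : Type} (h : T →₀ k) (F : T → OpTree S.Gen X)
    (hF : ∀ s ∈ h.support, ∀ c, ¬ (F s).IsColoured S χ c) :
    h.mapDomain F ∈ algRel R χ := by
  refine Submodule.sum_mem _ fun s hs => ?_
  have := Submodule.smul_mem _ (h s) (mon_mem_algRel (R := R) (hF s hs))
  simpa [mon] using this

theorem bind_mem_algRel (hR : WellFormed R) {r : Element k S} (hr : r ∈ R)
    (θ : Fin r.arity → OpTree S.Gen X) : r.elt.mapDomain (OpTree.bind θ) ∈ algRel R χ := by
  by_cases hθ : ∀ a, (θ a).IsColoured S χ (r.inp a)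
  · exact Submodule.subset_span (Or.inl ⟨_, _, _, _, θ, InIdeal.rel r hr, hθ, rfl⟩)
  · obtain ⟨a, ha⟩ := not_forall.1 hθ
    refine mapDomain_mem_algRel _ _ fun s hs c hc => ha ?_
    obtain ⟨hm, hv⟩ := hR r hr s hs
    cases s with
    | leaf x => simp [OpTree.vertices] at hv
    | node g l t =>
      obtain rfl : c = r.out := hc.1.symm.trans hm.1.1
      exact hm.1.of_bind hc a (hm.2.2 a)

theorem node_right_mem_algRel (hR : WellFormed R) (g : S.Gen) (u : OpTree S.Gen X)
    {f : OpTree S.Gen X →₀ k} (hf : f ∈ algRel R χ) :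
    f.mapDomain (fun t => .node g u t) ∈ algRel R χ := by
  have hle : algRel R χ ≤ (algRel R χ).comap (Finsupp.lmapDomain k k fun t => .node g u t) := by
    refine Submodule.span_le.2 ?_
    rintro f (⟨m, χA, c, h, θ, hh, hθ, rfl⟩ | ⟨t, ht, rfl⟩)
    · change (h.mapDomain (OpTree.bind θ)).mapDomain _ ∈ algRel R χ
      rw [← Finsupp.mapDomain_comp]
      by_cases hu : u.IsColoured S χ (S.in₁ g) ∧ c = S.in₂ g
      · obtain ⟨hu, rfl⟩ := hu
        refine Submodule.subset_span (Or.inl ⟨_, _, _, _, Fin.cons u θ, hh.node_right g,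
          fun a => Fin.cases hu hθ a, ?_⟩)
        rw [← Finsupp.mapDomain_comp]
        refine congrArg (fun F => h.mapDomain F) (funext fun s => ?_)
        simp only [Function.comp, OpTree.bind, OpTree.map_bind, Fin.cons_zero, Fin.cons_succ]
      · refine mapDomain_mem_algRel _ _ fun s hs c' hc => hu ⟨hc.2.1, ?_⟩
        have hs' := (InIdeal.isMonomial (fun r hr s hs => (hR r hr s hs).1) hh s hs).1
        exact (hs'.bind fun x _ => hθ x).unique hc.2.2
    · change (mon k t).mapDomain _ ∈ algRel R χ
      rw [mon, Finsupp.mapDomain_single]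
      exact mon_mem_algRel fun c hc => ht _ hc.2.2
  exact hle hf

theorem node_left_mem_algRel (hR : WellFormed R) (g : S.Gen) (u : OpTree S.Gen X)
    {f : OpTree S.Gen X →₀ k} (hf : f ∈ algRel R χ) :
    f.mapDomain (fun t => .node g t u) ∈ algRel R χ := by
  have hle : algRel R χ ≤ (algRel R χ).comap (Finsupp.lmapDomain k k fun t => .node g t u) := by
    refine Submodule.span_le.2 ?_
    rintro f (⟨m, χA, c, h, θ, hh, hθ, rfl⟩ | ⟨t, ht, rfl⟩)
    · change (h.mapDomain (OpTree.bind θ)).mapDomain _ ∈ algRel R χ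
      rw [← Finsupp.mapDomain_comp]
      by_cases hu : u.IsColoured S χ (S.in₂ g) ∧ c = S.in₁ g
      · obtain ⟨hu, rfl⟩ := hu
        refine Submodule.subset_span (Or.inl ⟨_, _, _, _, Fin.cons u θ, hh.node_left g,
          fun a => Fin.cases hu hθ a, ?_⟩)
        rw [← Finsupp.mapDomain_comp]
        refine congrArg (fun F => h.mapDomain F) (funext fun s => ?_)
        simp only [Function.comp, OpTree.bind, OpTree.map_bind, Fin.cons_zero, Fin.cons_succ]
      · refine mapDomain_mem_algRel _ _ fun s hs c' hc => hu ⟨hc.2.2, ?_⟩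
        have hs' := (InIdeal.isMonomial (fun r hr s hs => (hR r hr s hs).1) hh s hs).1
        exact (hs'.bind fun x _ => hθ x).unique hc.2.1
    · change (mon k t).mapDomain _ ∈ algRel R χ
      rw [mon, Finsupp.mapDomain_single]
      exact mon_mem_algRel fun c hc => ht _ hc.2.1
  exact hle hf

/-- The bilinear extension of the formation of trees with given root mark and branches. -/
def nodeLin (k : Type u) [Field k] {G X : Type} (g : G) :
    (OpTree G X →₀ k) →ₗ[k] (OpTree G X →₀ k) →ₗ[k] (OpTree G X →₀ k) :=
  Finsupp.linearCombination k fun l => Finsupp.lmapDomain k k fun r => .node g l r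

theorem nodeLin_mon {G : Type} (g : G) (l r : OpTree G X) :
    nodeLin k g (mon k l) (mon k r) = mon k (.node g l r) := by
  simp [nodeLin, mon]

theorem nodeLin_mon_left {G : Type} (g : G) (l : OpTree G X) (f : OpTree G X →₀ k) :
    nodeLin k g (mon k l) f = f.mapDomain fun r => .node g l r := by
  simp [nodeLin, mon]

theorem nodeLin_mon_right {G : Type} (g : G) (r : OpTree G X) (f : OpTree G X →₀ k) :
    nodeLin k g f (mon k r) = f.mapDomain fun l => .node g l r := by
  induction f using Finsupp.induction_linear with
  | zero => simp
  | add f f' h h' => rw [map_add, LinearMap.add_apply, h, h', Finsupp.mapDomain_add]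
  | single t a => simp [nodeLin, mon]

/-- The free algebra on `X` over the operad with relations `R`. -/
abbrev FreeAlg (R : Set (Element k S)) (χ : X → I) : Type u := (OpTree S.Gen X →₀ k) ⧸ algRel R χ

theorem nodeLin_mem_left (hR : WellFormed R) (g : S.Gen) {f : OpTree S.Gen X →₀ k}
    (hf : f ∈ algRel R χ) (f' : OpTree S.Gen X →₀ k) : nodeLin k g f f' ∈ algRel R χ := by
  induction f' using Finsupp.induction_linear with
  | zero => simp
  | add f f' h h' => rw [map_add]; exact add_mem h h'
  | single t a =>
    rw [← mul_one a, ← smul_eq_mul, ← Finsupp.smul_single, map_smul]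
    refine Submodule.smul_mem _ _ ?_
    have := nodeLin_mon_right g t f
    rw [mon] at this
    rw [this]
    exact node_left_mem_algRel hR g t hf

theorem nodeLin_mem_right (hR : WellFormed R) (g : S.Gen) (f : OpTree S.Gen X →₀ k)
    {f' : OpTree S.Gen X →₀ k} (hf : f' ∈ algRel R χ) : nodeLin k g f f' ∈ algRel R χ := by
  induction f using Finsupp.induction_linear with
  | zero => simp
  | add f f' h h' => rw [map_add, LinearMap.add_apply]; exact add_mem h h'
  | single t a =>
    rw [← mul_one a, ← smul_eq_mul, ← Finsupp.smul_single, map_smul]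
    refine Submodule.smul_mem _ _ ?_
    have := nodeLin_mon_left g t f'
    rw [mon] at this
    rw [this]
    exact node_right_mem_algRel hR g t hf

/-- The operations of the free algebra. -/
def freeOps (hR : WellFormed R) (χ : X → I) : Ops k S.Gen (FreeAlg R χ) := fun g =>
  (Submodule.liftQ _
    (Submodule.liftQ (algRel R χ) ((nodeLin k g).compr₂ (algRel R χ).mkQ) fun f hf =>
      LinearMap.mem_ker.2 <| LinearMap.ext fun f' =>
        (Submodule.Quotient.mk_eq_zero _).2 (nodeLin_mem_left hR g hf f')).flip
    fun f' hf' => LinearMap.mem_ker.2 <| LinearMap.ext fun q => by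
      obtain ⟨f, rfl⟩ := Submodule.mkQ_surjective _ q
      exact (Submodule.Quotient.mk_eq_zero _).2 (nodeLin_mem_right hR g f hf')).flip

theorem freeOps_mk (hR : WellFormed R) (g : S.Gen) (f f' : OpTree S.Gen X →₀ k) :
    freeOps hR χ g ((algRel R χ).mkQ f) ((algRel R χ).mkQ f') =
      (algRel R χ).mkQ (nodeLin k g f f') := rfl

theorem eval_freeOps (hR : WellFormed R) {Y : Type} (θ : Y → OpTree S.Gen X) (t : OpTree S.Gen Y) :
    t.eval (freeOps hR χ) (fun y => (algRel R χ).mkQ (mon k (θ y))) =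
      (algRel R χ).mkQ (mon k (t.bind θ)) := by
  induction t with
  | leaf x => rfl
  | node g l r hl hr => rw [OpTree.eval, hl, hr, freeOps_mk, nodeLin_mon]; rfl

theorem evalLin_freeOps (hR : WellFormed R) {Y : Type} (θ : Y → OpTree S.Gen X)
    (f : OpTree S.Gen Y →₀ k) :
    evalLin (freeOps hR χ) (fun y => (algRel R χ).mkQ (mon k (θ y))) f =
      (algRel R χ).mkQ (f.mapDomain (OpTree.bind θ)) := by
  induction f using Finsupp.induction_linear with
  | zero => simp
  | add f f' h h' => rw [map_add, h, h', Finsupp.mapDomain_add, map_add]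
  | single t a =>
    rw [evalLin_single, eval_freeOps, ← map_smul, Finsupp.mapDomain_single, mon,
      Finsupp.smul_single, smul_eq_mul, mul_one]

/-- The free algebra satisfies the relations: by multilinearity they need only be checked on
trees. -/
theorem sat_freeOps (hR : WellFormed R) (χ : X → I) : Sat R (freeOps hR χ) := by
  classical
  intro r hr z
  let M : MultilinearMap k (fun _ : Fin r.arity => FreeAlg R χ) (FreeAlg R χ) :=
    ∑ s ∈ r.elt.support.attach, r.elt s.1 • evalMultilinear (freeOps hR χ) s.1
      (hR r hr s.1 s.2).1.2.1 (hR r hr s.1 s.2).1.2.2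
  have hM : ∀ z, M z = evalLin (freeOps hR χ) z r.elt := fun z => by
    simp only [M, sum_apply, smul_apply]
    rw [evalLin, Finsupp.linearCombination_apply, Finsupp.sum]
    exact Finset.sum_attach r.elt.support fun s => r.elt s • s.eval (freeOps hR χ) z
  have h0 : M.compLinearMap (fun _ => (algRel R χ).mkQ) = 0 := by
    refine Module.Basis.ext_multilinear (fun _ => Finsupp.basisSingleOne) fun θ => ?_
    rw [MultilinearMap.compLinearMap_apply, hM]
    simp only [Finsupp.coe_basisSingleOne]
    have := evalLin_freeOps (χ := χ) hR θ r.elt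
    refine this.trans ?_
    exact (Submodule.Quotient.mk_eq_zero _).2 (bind_mem_algRel hR hr θ)
  choose f hf using fun i => Submodule.mkQ_surjective (algRel R χ) (z i)
  have := congrArg (fun F => F f) h0
  simp only [MultilinearMap.compLinearMap_apply, hM, hf] at this
  exact this

/-- The monomials in a relation of the free algebra are an element of the ideal. In a substitution
instance, either all trees or no trees are monomials. -/
theorem filter_mem_ideal (hR : WellFormed R) [Finite X] (c : I) {f : OpTree S.Gen X →₀ k}
    (hf : f ∈ algRel R χ) [DecidablePred (IsMonomial S χ c)] :
    InIdeal R χ c (f.filter (IsMonomial S χ c)) := by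
  classical
  induction hf using Submodule.span_induction with
  | zero => rw [Finsupp.filter_zero]; exact InIdeal.zero _ _
  | add f f' _ _ h h' => rw [Finsupp.filter_add]; exact InIdeal.add h h'
  | smul a f _ h => rw [Finsupp.filter_smul]; exact InIdeal.smul a h
  | mem f hf =>
    obtain (⟨m, χA, c', h, θ, hh, hθ, rfl⟩ | ⟨t, ht, rfl⟩) := hf
    · have hmon := InIdeal.isMonomial (fun r hr s hs => (hR r hr s hs).1) hh
      by_cases hc : c' = c ∧ ∀ x, ∑ a, (θ a).leaves.count x = 1
      · obtain ⟨rfl, hc⟩ := hc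
        rw [(Finsupp.filter_eq_self_iff _ _).2]
        · exact hh.bind θ hθ hc
        · intro t ht
          obtain ⟨s, hs, rfl⟩ := Finset.mem_image.1
            (Finsupp.mapDomain_support (Finsupp.mem_support_iff.2 ht))
          refine isMonomial_iff.2 ⟨(hmon s hs).1.bind fun x _ => hθ x, fun x => ?_⟩
          convert hc x using 1
          convert OpTree.count_leaves_bind (hmon s hs).2.1 (hmon s hs).2.2 θ x
      · rw [(Finsupp.filter_eq_zero_iff _ _).2]
        · exact InIdeal.zero _ _
        · intro t ht
          by_contra ht0
          obtain ⟨s, hs, rfl⟩ := Finset.mem_image.1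
            (Finsupp.mapDomain_support (Finsupp.mem_support_iff.2 ht0))
          refine hc ⟨((hmon s hs).1.bind fun x _ => hθ x).unique ht.1, fun x => ?_⟩
          rw [← OpTree.count_leaves_bind (hmon s hs).2.1 (hmon s hs).2.2 θ x]
          convert (isMonomial_iff.1 ht).2 x
    · rw [mon, Finsupp.filter_single_of_neg _ fun h => ht _ h.1]
      exact InIdeal.zero _ _

/-- An element of a presented operad is zero if it vanishes in the free algebra on its inputs. -/
theorem mem_ideal_of_evalLin_eq_zero (hR : WellFormed R) [Finite X] {c : I}
    {f : OpTree S.Gen X →₀ k} (hf : ∀ s ∈ f.support, IsMonomial S χ c s)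
    (h : evalLin (freeOps hR χ) (fun x => (algRel R χ).mkQ (mon k (.leaf x))) f = 0) :
    InIdeal R χ c f := by
  classical
  rw [evalLin_freeOps] at h
  have h' := filter_mem_ideal hR c ((Submodule.Quotient.mk_eq_zero _).1 h)
  have : (OpTree.bind OpTree.leaf : OpTree S.Gen X → OpTree S.Gen X) = id :=
    funext fun t => t.bind_leaf
  rwa [this, Finsupp.mapDomain_id, (Finsupp.filter_eq_self_iff _ _).2
    fun s hs => hf s (Finsupp.mem_support_iff.2 hs)] at h'

/-- An element of a presented operad that vanishes in all algebras is zero. -/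
theorem presented_eq_zero (hR : WellFormed R) {X : Type} [Finite X] {χ : X → I} {c : I}
    {p : (presented R).obj X χ c}
    (h : presentedEval (sat_freeOps hR χ) X χ c p
      (fun x => (algRel R χ).mkQ (mon k (.leaf x))) = 0) : p = 0 := by
  classical
  obtain ⟨f, rfl⟩ := presentedQ_surjective R p
  refine presentedQ_eq_zero.2 ?_
  refine mem_ideal_of_evalLin_eq_zero hR (fun s hs => ?_) ?_
  · obtain ⟨t, -, rfl⟩ := Finset.mem_image.1 (Finsupp.mapDomain_support hs)
    exact t.2
  · rw [presentedEval_presentedQ] at h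
    exact (Finsupp.linearCombination_mapDomain k _ f).trans h

end

/-! ### Algebras over the operads -/

section

variable {k : Type u} [Field k] {Z : Type v} [AddCommGroup Z] [Module k Z]

/-- `α` is a commutative associative product on which `d` acts by derivations. -/
structure IsDComAlg (α d : Z →ₗ[k] Z →ₗ[k] Z) : Prop where
  comm : ∀ a b, α a b = α b a
  assoc : ∀ a b c, α (α a b) c = α a (α b c)
  leibniz : ∀ a b y, d (α a b) y = α a (d b y) + α (d a y) b

/-- `β` is a Lie bracket. -/
structure IsLieAlg (β : Z →ₗ[k] Z →ₗ[k] Z) : Prop where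
  anti : ∀ x y, β x y = -β y x
  jacobi : ∀ x y z, β (β x y) z = β (β x z) y + β x (β y z)

/-- The operations of a Lie–Rinehart algebra. -/
structure IsLRAlg (μ : Ops k LRGen Z) : Prop where
  dCom : IsDComAlg (μ .α) (μ .d)
  lie : IsLieAlg (μ .β)
  morphism : ∀ a x y, μ .d a (μ .β x y) = μ .d (μ .d a y) x - μ .d (μ .d a x) y
  module : ∀ a b x, μ .m (μ .α a b) x = μ .m a (μ .m b x)
  anchor : ∀ a b x, μ .d a (μ .m b x) = μ .α (μ .d a x) b
  rinehart : ∀ a x y, μ .β x (μ .m a y) = μ .m a (μ .β x y) + μ .m (μ .d a x) y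

/-- All relations of the Lie–Rinehart operad. -/
abbrev lrRel (k : Type u) [Field k] : Set (Element k lrSig) := lrSymmetries k ∪ lrQuadratic k

/-- The relations of the operad `DCom`. -/
abbrev dComRel (k : Type u) [Field k] : Set (Element k dComSig) :=
  {⟨2, ![.s, .s], .s, commRel k DComGen.α⟩,
     ⟨3, ![.s, .s, .s], .s, assocRel k DComGen.α⟩,
     ⟨3, ![.s, .s, .l], .s, leibnizRel k DComGen.α DComGen.d⟩}

/-- The relations of the operad `Lie`. -/
abbrev lieRel (k : Type u) [Field k] : Set (Element k lieSig) :=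
  {⟨2, ![.l, .l], .l, antiRel k ()⟩, ⟨3, ![.l, .l, .l], .l, jacobiRel k ()⟩}

/-- The relation of the operad `N_m`. -/
abbrev nilRel (k : Type u) [Field k] : Set (Element k nilSig) :=
  {⟨3, ![.s, .s, .l], .l, mon k (op () (inp 0) (op () (inp 1) (inp 2)))⟩}

section Values

variable {G : Type} (μ : Ops k G Z)

theorem evalLin_commRel (a : G) (z : Fin 2 → Z) :
    evalLin μ z (commRel k a) = μ a (z 0) (z 1) - μ a (z 1) (z 0) := by
  simp only [commRel, map_sub, evalLin_mon, op, inp, OpTree.eval]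

theorem evalLin_antiRel (b : G) (z : Fin 2 → Z) :
    evalLin μ z (antiRel k b) = μ b (z 0) (z 1) + μ b (z 1) (z 0) := by
  simp only [antiRel, map_add, evalLin_mon, op, inp, OpTree.eval]

theorem evalLin_assocRel (a : G) (z : Fin 3 → Z) :
    evalLin μ z (assocRel k a) = μ a (μ a (z 0) (z 1)) (z 2) - μ a (z 0) (μ a (z 1) (z 2)) := by
  simp only [assocRel, map_sub, evalLin_mon, op, inp, OpTree.eval]

theorem evalLin_jacobiRel (b : G) (z : Fin 3 → Z) :
    evalLin μ z (jacobiRel k b) = μ b (μ b (z 0) (z 1)) (z 2) - μ b (μ b (z 0) (z 2)) (z 1) -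
      μ b (z 0) (μ b (z 1) (z 2)) := by
  simp only [jacobiRel, map_sub, evalLin_mon, op, inp, OpTree.eval]

theorem evalLin_leibnizRel (a d : G) (z : Fin 3 → Z) :
    evalLin μ z (leibnizRel k a d) = μ d (μ a (z 0) (z 1)) (z 2) - μ a (z 0) (μ d (z 1) (z 2)) -
      μ a (μ d (z 0) (z 2)) (z 1) := by
  simp only [leibnizRel, map_sub, evalLin_mon, op, inp, OpTree.eval]

theorem evalLin_morphismRel (b d : G) (z : Fin 3 → Z) :
    evalLin μ z (morphismRel k b d) = μ d (z 0) (μ b (z 1) (z 2)) - μ d (μ d (z 0) (z 2)) (z 1) +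
      μ d (μ d (z 0) (z 1)) (z 2) := by
  simp only [morphismRel, map_sub, map_add, evalLin_mon, op, inp, OpTree.eval]

theorem evalLin_moduleRel (a m : G) (z : Fin 3 → Z) :
    evalLin μ z (moduleRel k a m) = μ m (μ a (z 0) (z 1)) (z 2) - μ m (z 0) (μ m (z 1) (z 2)) := by
  simp only [moduleRel, map_sub, evalLin_mon, op, inp, OpTree.eval]

theorem evalLin_anchorRel (a d m : G) (z : Fin 3 → Z) :
    evalLin μ z (anchorRel k a d m) =
      μ d (z 0) (μ m (z 1) (z 2)) - μ a (μ d (z 0) (z 2)) (z 1) := by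
  simp only [anchorRel, map_sub, evalLin_mon, op, inp, OpTree.eval]

theorem evalLin_rinehartRel (b d m : G) (z : Fin 3 → Z) :
    evalLin μ z (rinehartRel k b d m) = μ b (z 1) (μ m (z 0) (z 2)) -
      μ m (z 0) (μ b (z 1) (z 2)) - μ m (μ d (z 0) (z 1)) (z 2) := by
  simp only [rinehartRel, map_sub, evalLin_mon, op, inp, OpTree.eval]

end Values

theorem sat_dComRel {μ : Ops k DComGen Z} :
    Sat (S := dComSig) (dComRel k) μ ↔ IsDComAlg (μ .α) (μ .d) := by
  constructor
  · intro h
    refine ⟨fun a b => sub_eq_zero.1 ?_, fun a b c => sub_eq_zero.1 ?_,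
      fun a b c => sub_eq_iff_eq_add'.1 (sub_eq_zero.1 ?_)⟩
    · exact (evalLin_commRel μ _ ![a, b]).symm.trans (h _ (Or.inl rfl) _)
    · exact (evalLin_assocRel μ _ ![a, b, c]).symm.trans (h _ (Or.inr (Or.inl rfl)) _)
    · exact (evalLin_leibnizRel μ _ _ ![a, b, c]).symm.trans (h _ (Or.inr (Or.inr rfl)) _)
  · rintro ⟨h1, h2, h3⟩ r (rfl | rfl | rfl) z
    · exact (evalLin_commRel μ _ z).trans (sub_eq_zero.2 (h1 _ _))
    · exact (evalLin_assocRel μ _ z).trans (sub_eq_zero.2 (h2 _ _ _))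
    · exact (evalLin_leibnizRel μ _ _ z).trans
        (sub_eq_zero.2 (sub_eq_iff_eq_add'.2 (h3 _ _ _)))

theorem sat_lieRel {μ : Ops k Unit Z} : Sat (S := lieSig) (lieRel k) μ ↔ IsLieAlg (μ ()) := by
  constructor
  · intro h
    refine ⟨fun a b => eq_neg_of_add_eq_zero_left ?_,
      fun a b c => sub_eq_iff_eq_add'.1 (sub_eq_zero.1 ?_)⟩
    · exact (evalLin_antiRel μ _ ![a, b]).symm.trans (h _ (Or.inl rfl) _)
    · exact (evalLin_jacobiRel μ _ ![a, b, c]).symm.trans (h _ (Or.inr rfl) _)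
  · rintro ⟨h1, h2⟩ r (rfl | rfl) z
    · exact (evalLin_antiRel μ _ z).trans (add_eq_zero_iff_eq_neg.2 (h1 _ _))
    · exact (evalLin_jacobiRel μ _ z).trans (sub_eq_zero.2 (sub_eq_iff_eq_add'.2 (h2 _ _ _)))

/-- The algebras over `lieR k` are the Lie–Rinehart algebras: each relation, evaluated at elements,
is one of the axioms. -/
theorem sat_lrRel {μ : Ops k LRGen Z} : Sat (S := lrSig) (lrRel k) μ ↔ IsLRAlg μ := by
  constructor
  · intro h
    have h1 := h _ (Or.inl (Or.inl rfl))
    have h2 := h _ (Or.inl (Or.inr rfl))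
    have h3 := h _ (Or.inr (Or.inl rfl))
    have h4 := h _ (Or.inr (Or.inr (Or.inl rfl)))
    have h5 := h _ (Or.inr (Or.inr (Or.inr (Or.inl rfl))))
    have h6 := h _ (Or.inr (Or.inr (Or.inr (Or.inr (Or.inl rfl)))))
    have h7 := h _ (Or.inr (Or.inr (Or.inr (Or.inr (Or.inr (Or.inl rfl))))))
    have h8 := h _ (Or.inr (Or.inr (Or.inr (Or.inr (Or.inr (Or.inr (Or.inl rfl)))))))
    have h9 := h _ (Or.inr (Or.inr (Or.inr (Or.inr (Or.inr (Or.inr (Or.inr rfl)))))))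
    refine ⟨⟨fun a b => sub_eq_zero.1 ?_, fun a b c => sub_eq_zero.1 ?_,
      fun a b c => sub_eq_iff_eq_add'.1 (sub_eq_zero.1 ?_)⟩,
      ⟨fun a b => eq_neg_of_add_eq_zero_left ?_,
      fun a b c => sub_eq_iff_eq_add'.1 (sub_eq_zero.1 ?_)⟩,
      fun a b c => ?_, fun a b c => sub_eq_zero.1 ?_,
      fun a b c => sub_eq_zero.1 ?_, fun a b c => sub_eq_iff_eq_add'.1 (sub_eq_zero.1 ?_)⟩
    · exact (evalLin_commRel μ _ ![a, b]).symm.trans (h1 _)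
    · exact (evalLin_assocRel μ _ ![a, b, c]).symm.trans (h3 _)
    · exact (evalLin_leibnizRel μ _ _ ![a, b, c]).symm.trans (h5 _)
    · exact (evalLin_antiRel μ _ ![a, b]).symm.trans (h2 _)
    · exact (evalLin_jacobiRel μ _ ![a, b, c]).symm.trans (h4 _)
    · have := (evalLin_morphismRel μ _ _ ![a, b, c]).symm.trans (h6 _)
      rw [sub_add] at this
      exact sub_eq_zero.1 this
    · exact (evalLin_moduleRel μ _ _ ![a, b, c]).symm.trans (h7 _)
    · exact (evalLin_anchorRel μ _ _ _ ![a, b, c]).symm.trans (h8 _)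
    · exact (evalLin_rinehartRel μ _ _ _ ![a, b, c]).symm.trans (h9 _)
  · rintro ⟨⟨h1, h2, h3⟩, ⟨h4, h5⟩, h6, h7, h8, h9⟩ r
      ((rfl | rfl) | (rfl | rfl | rfl | rfl | rfl | rfl | rfl)) z
    · exact (evalLin_commRel μ _ z).trans (sub_eq_zero.2 (h1 _ _))
    · exact (evalLin_antiRel μ _ z).trans (add_eq_zero_iff_eq_neg.2 (h4 _ _))
    · exact (evalLin_assocRel μ _ z).trans (sub_eq_zero.2 (h2 _ _ _))
    · exact (evalLin_jacobiRel μ _ z).trans (sub_eq_zero.2 (sub_eq_iff_eq_add'.2 (h5 _ _ _)))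
    · exact (evalLin_leibnizRel μ _ _ z).trans
        (sub_eq_zero.2 (sub_eq_iff_eq_add'.2 (h3 _ _ _)))
    · refine (evalLin_morphismRel μ _ _ z).trans ?_
      rw [sub_add]
      exact sub_eq_zero.2 (h6 _ _ _)
    · exact (evalLin_moduleRel μ _ _ z).trans (sub_eq_zero.2 (h7 _ _ _))
    · exact (evalLin_anchorRel μ _ _ _ z).trans (sub_eq_zero.2 (h8 _ _ _))
    · exact (evalLin_rinehartRel μ _ _ _ z).trans
        (sub_eq_zero.2 (sub_eq_iff_eq_add'.2 (h9 _ _ _)))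

theorem sat_nilRel {μ : Ops k Unit Z} (h : ∀ a b c, μ () a (μ () b c) = 0) :
    Sat (S := nilSig) (nilRel k) μ := by
  rintro r rfl z
  exact (evalLin_mon μ z _).trans (h _ _ _)

section WellFormed

variable {G X : Type} {P : OpTree G X → Prop}

theorem forall_support_mon {t : OpTree G X} (h : P t) : ∀ s ∈ (mon k t).support, P s := by
  intro s hs
  rw [mon] at hs
  obtain rfl := Finset.mem_singleton.1 (Finsupp.support_single_subset hs)
  exact h

theorem forall_support_sub {f g : OpTree G X →₀ k} (hf : ∀ s ∈ f.support, P s)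
    (hg : ∀ s ∈ g.support, P s) : ∀ s ∈ (f - g).support, P s := by
  classical
  exact fun s hs => (Finset.mem_union.1 (Finsupp.support_sub hs)).elim (hf s) (hg s)

theorem forall_support_add {f g : OpTree G X →₀ k} (hf : ∀ s ∈ f.support, P s)
    (hg : ∀ s ∈ g.support, P s) : ∀ s ∈ (f + g).support, P s := by
  classical
  exact fun s hs => (Finset.mem_union.1 (Finsupp.support_add hs)).elim (hf s) (hg s)

end WellFormed

theorem wellFormed_dComRel : WellFormed (S := dComSig) (dComRel k) := by
  rintro r (rfl | rfl | rfl)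
  · refine forall_support_sub (forall_support_mon ?_) (forall_support_mon ?_) <;>
    exact ⟨⟨⟨rfl, rfl, rfl⟩, by simp [op, inp, OpTree.leaves], fun x => by
      fin_cases x <;> simp [op, inp, OpTree.leaves]⟩, by simp [op, OpTree.vertices]⟩
  · refine forall_support_sub (forall_support_mon ?_) (forall_support_mon ?_) <;>
    exact ⟨⟨by simp [op, inp, OpTree.IsColoured, dComSig], by simp [op, inp, OpTree.leaves],
      fun x => by fin_cases x <;> simp [op, inp, OpTree.leaves]⟩, by simp [op, OpTree.vertices]⟩
  · refine forall_support_sub (forall_support_sub (forall_support_mon ?_) (forall_support_mon ?_))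
      (forall_support_mon ?_) <;>
    exact ⟨⟨by simp [op, inp, OpTree.IsColoured, dComSig], by simp [op, inp, OpTree.leaves],
      fun x => by fin_cases x <;> simp [op, inp, OpTree.leaves]⟩, by simp [op, OpTree.vertices]⟩

theorem wellFormed_lieRel : WellFormed (S := lieSig) (lieRel k) := by
  rintro r (rfl | rfl)
  · refine forall_support_add (forall_support_mon ?_) (forall_support_mon ?_) <;>
    exact ⟨⟨by simp [op, inp, OpTree.IsColoured, lieSig], by simp [op, inp, OpTree.leaves],
      fun x => by fin_cases x <;> simp [op, inp, OpTree.leaves]⟩, by simp [op, OpTree.vertices]⟩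
  · refine forall_support_sub (forall_support_sub (forall_support_mon ?_) (forall_support_mon ?_))
      (forall_support_mon ?_) <;>
    exact ⟨⟨by simp [op, inp, OpTree.IsColoured, lieSig], by simp [op, inp, OpTree.leaves],
      fun x => by fin_cases x <;> simp [op, inp, OpTree.leaves]⟩, by simp [op, OpTree.vertices]⟩

theorem wellFormed_nilRel : WellFormed (S := nilSig) (nilRel k) := by
  rintro r rfl
  refine forall_support_mon ?_
  exact ⟨⟨by simp [op, inp, OpTree.IsColoured, nilSig], by simp [op, inp, OpTree.leaves],
      fun x => by fin_cases x <;> simp [op, inp, OpTree.leaves]⟩, by simp [op, OpTree.vertices]⟩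

/-- The quadratic relations are combinations of monomials with two vertices. -/
theorem lrQuadratic_support {r : Element k lrSig} (hr : r ∈ lrQuadratic k) :
    ∀ s ∈ r.elt.support, IsMonomial lrSig r.inp r.out s ∧ s.vertices = 2 := by
  have key : ∀ (inps : Fin 3 → Col) (out : Col) (t : OpTree LRGen (Fin 3)),
      t.IsColoured lrSig inps out → t.leaves.Nodup → (∀ x, x ∈ t.leaves) → t.vertices = 2 →
      ∀ s ∈ (mon k t).support, IsMonomial lrSig inps out s ∧ s.vertices = 2 :=
    fun inps out t h1 h2 h3 h4 => forall_support_mon ⟨⟨h1, h2, h3⟩, h4⟩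
  obtain (rfl | rfl | rfl | rfl | rfl | rfl | rfl) := hr <;>
  simp only [jacobiRel, assocRel, leibnizRel, morphismRel, moduleRel, anchorRel, rinehartRel]
  · refine forall_support_sub (key _ _ _ ?_ ?_ ?_ ?_) (key _ _ _ ?_ ?_ ?_ ?_) <;>
    simp [op, inp, OpTree.IsColoured, lrSig, OpTree.leaves, OpTree.vertices, Fin.forall_fin_succ]
  · refine forall_support_sub (forall_support_sub (key _ _ _ ?_ ?_ ?_ ?_) (key _ _ _ ?_ ?_ ?_ ?_))
      (key _ _ _ ?_ ?_ ?_ ?_) <;>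
    simp [op, inp, OpTree.IsColoured, lrSig, OpTree.leaves, OpTree.vertices, Fin.forall_fin_succ]
  · refine forall_support_sub (forall_support_sub (key _ _ _ ?_ ?_ ?_ ?_) (key _ _ _ ?_ ?_ ?_ ?_))
      (key _ _ _ ?_ ?_ ?_ ?_) <;>
    simp [op, inp, OpTree.IsColoured, lrSig, OpTree.leaves, OpTree.vertices, Fin.forall_fin_succ]
  · refine forall_support_add (forall_support_sub (key _ _ _ ?_ ?_ ?_ ?_) (key _ _ _ ?_ ?_ ?_ ?_))
      (key _ _ _ ?_ ?_ ?_ ?_) <;>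
    simp [op, inp, OpTree.IsColoured, lrSig, OpTree.leaves, OpTree.vertices, Fin.forall_fin_succ]
  · refine forall_support_sub (key _ _ _ ?_ ?_ ?_ ?_) (key _ _ _ ?_ ?_ ?_ ?_) <;>
    simp [op, inp, OpTree.IsColoured, lrSig, OpTree.leaves, OpTree.vertices, Fin.forall_fin_succ]
  · refine forall_support_sub (key _ _ _ ?_ ?_ ?_ ?_) (key _ _ _ ?_ ?_ ?_ ?_) <;>
    simp [op, inp, OpTree.IsColoured, lrSig, OpTree.leaves, OpTree.vertices, Fin.forall_fin_succ]
  · refine forall_support_sub (forall_support_sub (key _ _ _ ?_ ?_ ?_ ?_) (key _ _ _ ?_ ?_ ?_ ?_))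
      (key _ _ _ ?_ ?_ ?_ ?_) <;>
    simp [op, inp, OpTree.IsColoured, lrSig, OpTree.leaves, OpTree.vertices, Fin.forall_fin_succ]

theorem wellFormed_lrRel : WellFormed (S := lrSig) (lrRel k) := by
  rintro r ((rfl | rfl) | hr)
  · refine forall_support_sub (forall_support_mon ?_) (forall_support_mon ?_) <;>
    exact ⟨⟨by simp [op, inp, OpTree.IsColoured, lrSig], by simp [op, inp, OpTree.leaves],
      fun x => by fin_cases x <;> simp [op, inp, OpTree.leaves]⟩, by simp [op, OpTree.vertices]⟩
  · refine forall_support_add (forall_support_mon ?_) (forall_support_mon ?_) <;>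
    exact ⟨⟨by simp [op, inp, OpTree.IsColoured, lrSig], by simp [op, inp, OpTree.leaves],
      fun x => by fin_cases x <;> simp [op, inp, OpTree.leaves]⟩, by simp [op, OpTree.vertices]⟩
  · intro s hs
    obtain ⟨h1, h2⟩ := lrQuadratic_support hr s hs
    exact ⟨h1, by omega⟩

/-! ### Normal forms in algebras -/

/-- The set of values of a bilinear map on two spans. -/
theorem bilin_mem_of_span {f : Z →ₗ[k] Z →ₗ[k] Z} {s t : Set Z} {p : Submodule k Z}
    (h : ∀ a ∈ s, ∀ b ∈ t, f a b ∈ p) {a b : Z} (ha : a ∈ Submodule.span k s)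
    (hb : b ∈ Submodule.span k t) : f a b ∈ p := by
  have h' : Submodule.map₂ f (Submodule.span k s) (Submodule.span k t) ≤ p := by
    rw [Submodule.map₂_span_span, Submodule.span_le]
    rintro _ ⟨a, ha, b, hb, rfl⟩
    exact h a ha b hb
  exact h' (Submodule.apply_mem_map₂ f ha hb)

theorem linear_mem_of_span {M : Type w} [AddCommGroup M] [Module k M] {f : M →ₗ[k] Z} {s : Set M}
    {p : Submodule k Z}
    (h : ∀ a ∈ s, f a ∈ p) {a : M} (ha : a ∈ Submodule.span k s) : f a ∈ p :=
  (Submodule.span_le (p := p.comap f)).2 h ha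

/-- The product of a nonempty list (and `0` for the empty one). -/
def prodVal (α : Z →ₗ[k] Z →ₗ[k] Z) : List Z → Z
  | [] => 0
  | [a] => a
  | a :: b :: l => α a (prodVal α (b :: l))

variable {α d β : Z →ₗ[k] Z →ₗ[k] Z}

theorem prodVal_cons (a : Z) {l : List Z} (hl : l ≠ []) :
    prodVal α (a :: l) = α a (prodVal α l) := by
  cases l with
  | nil => exact absurd rfl hl
  | cons b l => rfl

theorem IsDComAlg.prodVal_append (h : IsDComAlg α d) {l l' : List Z} (hl : l ≠ [])
    (hl' : l' ≠ []) : prodVal α (l ++ l') = α (prodVal α l) (prodVal α l') := by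
  induction l with
  | nil => exact absurd rfl hl
  | cons a l ih =>
    rcases eq_or_ne l [] with rfl | hne
    · exact prodVal_cons a hl'
    · rw [List.cons_append, prodVal_cons a (by simp [hne]), ih hne, prodVal_cons a hne, h.assoc]

theorem IsDComAlg.prodVal_perm (h : IsDComAlg α d) {l l' : List Z} (hp : l.Perm l') :
    prodVal α l = prodVal α l' := by
  induction hp with
  | nil => rfl
  | cons a hp ih =>
    rename_i l₁ l₂
    rcases eq_or_ne l₁ [] with rfl | hne
    · rw [hp.nil_eq]
    · have hne' : l₂ ≠ [] := fun e => hne (by rw [e] at hp; exact hp.eq_nil)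
      rw [prodVal_cons a hne, prodVal_cons a hne', ih]
  | swap a b l =>
    rcases eq_or_ne l [] with rfl | hne
    · exact h.comm b a
    · rw [prodVal_cons _ (by simp), prodVal_cons _ hne, prodVal_cons _ (by simp),
        prodVal_cons _ hne, ← h.assoc, h.comm b a, h.assoc]
  | trans _ _ h1 h2 => exact h1.trans h2

variable {X : Type} (z : X → Z) (χ : X → Col)

/-- `d(⋯d(d(x, y_n), y_{n-1})⋯, y_1)` for the list `y_1, …, y_n`. -/
def chainVal (d : Z →ₗ[k] Z →ₗ[k] Z) (x : X) : List X → Z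
  | [] => z x
  | y :: w => d (chainVal d x w) (z y)

/-- The product of the chains `(x, w)`. -/
def chainsVal (α d : Z →ₗ[k] Z →ₗ[k] Z) (ps : List (X × List X)) : Z :=
  prodVal α (ps.map fun p => chainVal z d p.1 p.2)

/-- The labels that occur in a collection of chains. -/
def pairLabels (S : Multiset (X × List X)) : Multiset X :=
  S.map Prod.fst + S.bind fun p => (p.2 : Multiset X)

/-- The chains are correctly coloured. -/
def PairsColoured (S : Multiset (X × List X)) : Prop :=
  ∀ p ∈ S, χ p.1 = .s ∧ ∀ y ∈ p.2, χ y = .l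

/-- The values of products of chains that use the labels `L`. -/
def chainsSet (α d : Z →ₗ[k] Z →ₗ[k] Z) (L : Multiset X) : Set Z :=
  {a | ∃ ps : List (X × List X), ps ≠ [] ∧ pairLabels ↑ps = L ∧ PairsColoured χ ↑ps ∧
    a = chainsVal z α d ps}

variable {z χ}

theorem pairLabels_add (S T : Multiset (X × List X)) :
    pairLabels (S + T) = pairLabels S + pairLabels T := by
  simp only [pairLabels, Multiset.map_add, Multiset.add_bind]
  abel

theorem pairLabels_nil : pairLabels (([] : List (X × List X)) : Multiset (X × List X)) = 0 := by
  simp [pairLabels]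

theorem pairLabels_cons (p : X × List X) (ps : List (X × List X)) :
    pairLabels ((p :: ps : List (X × List X)) : Multiset (X × List X)) =
      {p.1} + (p.2 : Multiset X) + pairLabels ↑ps := by
  rw [← Multiset.cons_coe, ← Multiset.singleton_add, pairLabels_add]
  simp [pairLabels]

theorem chains_mul_mem (h : IsDComAlg α d) {L L' : Multiset X} {a b : Z}
    (ha : a ∈ Submodule.span k (chainsSet z χ α d L))
    (hb : b ∈ Submodule.span k (chainsSet z χ α d L')) :
    α a b ∈ Submodule.span k (chainsSet z χ α d (L + L')) := by
  refine bilin_mem_of_span ?_ ha hb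
  rintro _ ⟨ps, h1, rfl, h2, rfl⟩ _ ⟨qs, h3, rfl, h4, rfl⟩
  refine Submodule.subset_span ⟨ps ++ qs, by simp [h1], ?_, ?_, ?_⟩
  · rw [← Multiset.coe_add, pairLabels_add]
  · intro p hp
    rw [← Multiset.coe_add, Multiset.mem_add] at hp
    exact hp.elim (h2 p) (h4 p)
  · simp only [chainsVal, List.map_append]
    exact (h.prodVal_append (by simpa using h1) (by simpa using h3)).symm

/-- A derivation of a product of chains is a sum of products of chains, by the Leibniz rule. -/
theorem chains_leaf_mem (h : IsDComAlg α d) {L : Multiset X} {y : X} (hy : χ y = .l) {a : Z}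
    (ha : a ∈ Submodule.span k (chainsSet z χ α d L)) :
    d a (z y) ∈ Submodule.span k (chainsSet z χ α d (L + {y})) := by
  refine linear_mem_of_span (f := d.flip (z y)) ?_ ha
  rintro _ ⟨ps, h1, rfl, h2, rfl⟩
  clear ha
  induction ps with
  | nil => exact absurd rfl h1
  | cons p ps ih =>
    have hp : PairsColoured χ (([(p.1, y :: p.2)] : List (X × List X)) : Multiset (X × List X)) := by
      intro q hq
      obtain rfl : q = (p.1, y :: p.2) := by simpa using hq
      have := h2 p (by simp)
      exact ⟨this.1, fun x hx => (List.mem_cons.1 hx).elim (fun e => e ▸ hy) (this.2 x)⟩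
    have hp' : PairsColoured χ (([p] : List (X × List X)) : Multiset (X × List X)) := by
      intro q hq
      obtain rfl : q = p := by simpa using hq
      exact h2 q (by simp)
    rcases eq_or_ne ps [] with rfl | hne
    · refine Submodule.subset_span ⟨[(p.1, y :: p.2)], by simp, ?_, hp, rfl⟩
      simp [pairLabels, add_comm, ← Multiset.singleton_add, add_left_comm, add_assoc,
        ← Multiset.cons_coe]
    · have e : (d.flip (z y)) (chainsVal z α d (p :: ps)) =
          α (chainsVal z α d [p]) (d.flip (z y) (chainsVal z α d ps)) +
          α (chainsVal z α d [(p.1, y :: p.2)]) (chainsVal z α d ps) := by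
        simp only [chainsVal, List.map_cons, List.map_nil, LinearMap.flip_apply]
        rw [prodVal_cons _ (by simpa using hne), h.leibniz]
        rfl
      have hps : PairsColoured χ (ps : Multiset (X × List X)) := fun q hq => h2 q (by
        simp at hq ⊢; exact Or.inr hq)
      rw [e]
      refine add_mem ?_ ?_
      · have := chains_mul_mem h
          (Submodule.subset_span (s := chainsSet z χ α d _) ⟨[p], by simp, rfl, hp', rfl⟩)
          (ih hne hps)
        convert this using 3
        rw [← add_assoc, ← pairLabels_add]
        rfl
      · have := chains_mul_mem h
          (Submodule.subset_span (s := chainsSet z χ α d _)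
            ⟨[(p.1, y :: p.2)], by simp, rfl, hp, rfl⟩)
          (Submodule.subset_span (s := chainsSet z χ α d _) ⟨ps, hne, rfl, hps, rfl⟩)
        convert this using 3
        rw [pairLabels_cons, pairLabels_cons, pairLabels_nil, ← Multiset.cons_coe,
          ← Multiset.singleton_add]
        abel

/-- The iterated bracket `β(⋯β(β(a, y_1), y_2)⋯, y_n)`. -/
def combVal (z : X → Z) (β : Z →ₗ[k] Z →ₗ[k] Z) (a : Z) (v : List X) : Z :=
  v.foldl (fun b y => β b (z y)) a

/-- The values of iterated brackets that begin with `a` and go on with the labels `L`. -/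
def combSet (z : X → Z) (β : Z →ₗ[k] Z →ₗ[k] Z) (a : Z) (L : Multiset X) : Set Z :=
  {b | ∃ v : List X, (v : Multiset X) = L ∧ b = combVal z β a v}

/-- The bracket of an iterated bracket with any Lie monomial is a sum of iterated brackets. -/
theorem comb_bracket_mem (h : IsLieAlg β) (a : Z) (t : OpTree Unit X) :
    ∀ {L : Multiset X} {b : Z}, b ∈ Submodule.span k (combSet z β a L) →
      β b (t.eval (fun _ => β) z) ∈ Submodule.span k (combSet z β a (L + ↑t.leaves)) := by
  induction t with
  | leaf y =>
    intro L b hb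
    refine linear_mem_of_span (f := β.flip (z y)) ?_ hb
    rintro _ ⟨v, rfl, rfl⟩
    refine Submodule.subset_span ⟨v ++ [y], by simp [OpTree.leaves, ← Multiset.coe_add], ?_⟩
    simp [combVal]
  | node g l r hl hr =>
    intro L b hb
    have e : β b (β (l.eval (fun _ => β) z) (r.eval (fun _ => β) z)) =
        β (β b (l.eval (fun _ => β) z)) (r.eval (fun _ => β) z) -
        β (β b (r.eval (fun _ => β) z)) (l.eval (fun _ => β) z) := by
      rw [h.jacobi]; abel
    rw [OpTree.eval, e]
    have e1 : L + ↑(OpTree.node g l r).leaves = L + ↑l.leaves + ↑r.leaves := by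
      rw [OpTree.leaves, ← Multiset.coe_add, add_assoc]
    refine sub_mem ?_ ?_
    · rw [e1]; exact hr (hl hb)
    · rw [e1, add_right_comm]; exact hl (hr hb)

/-- A Lie monomial is a combination of iterated brackets that begin with any chosen one of its
leaves. -/
theorem lie_mem_span_comb (h : IsLieAlg β) {x : X} {L : Multiset X} (t : OpTree Unit X)
    (hL : (t.leaves : Multiset X) = x ::ₘ L) :
    t.eval (fun _ => β) z ∈ Submodule.span k (combSet z β (z x) L) := by
  classical
  induction t generalizing L with
  | leaf y =>
    rw [OpTree.leaves, Multiset.coe_singleton] at hL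
    obtain ⟨rfl, rfl⟩ : y = x ∧ L = 0 := by
      have : x ∈ ({y} : Multiset X) := by rw [hL]; simp
      obtain rfl := Multiset.mem_singleton.1 this
      exact ⟨rfl, by simpa [← Multiset.singleton_add] using hL.symm⟩
    exact Submodule.subset_span ⟨[], rfl, rfl⟩
  | node g l r hl hr =>
    have hL' : (l.leaves : Multiset X) + ↑r.leaves = x ::ₘ L := by
      rw [Multiset.coe_add]; exact hL
    have hx : x ∈ (l.leaves : Multiset X) + ↑r.leaves := by rw [hL']; simp
    rw [OpTree.eval]
    rcases Multiset.mem_add.1 hx with hx | hx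
    · obtain ⟨M, hM⟩ := Multiset.exists_cons_of_mem hx
      rw [hM, Multiset.cons_add, Multiset.cons_inj_right] at hL'
      rw [← hL']
      exact comb_bracket_mem h _ _ (hl hM)
    · obtain ⟨M, hM⟩ := Multiset.exists_cons_of_mem hx
      rw [hM, Multiset.add_cons, Multiset.cons_inj_right] at hL'
      rw [← hL', h.anti, add_comm]
      exact neg_mem (comb_bracket_mem h _ _ (hr hM))

end

section

variable {k : Type u} [Field k] {Z : Type v} [AddCommGroup Z] [Module k Z]
  {α d : Z →ₗ[k] Z →ₗ[k] Z} {X : Type} {z : X → Z} {χ : X → Col}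

/-- In `DCom`, every monomial is a sum of products of chains. -/
theorem dCom_eval_mem {μ : Ops k DComGen Z} (h : IsDComAlg (μ .α) (μ .d)) :
    ∀ {t : OpTree DComGen X}, t.IsColoured dComSig χ .s →
      t.eval μ z ∈ Submodule.span k (chainsSet z χ (μ .α) (μ .d) ↑t.leaves)
  | .leaf x, hc => Submodule.subset_span ⟨[(x, [])], by simp, by
      rw [pairLabels_cons, pairLabels_nil]; simp [OpTree.leaves], fun p hp => by
        obtain rfl : p = (x, []) := by simpa using hp
        exact ⟨hc, by simp⟩, rfl⟩
  | .node .α l r, hc => by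
    rw [OpTree.leaves, ← Multiset.coe_add]
    exact chains_mul_mem h (dCom_eval_mem h hc.2.1) (dCom_eval_mem h hc.2.2)
  | .node .d l (.leaf y), hc => by
    rw [OpTree.leaves, ← Multiset.coe_add]
    exact chains_leaf_mem h hc.2.2 (dCom_eval_mem h hc.2.1)
  | .node .d l (.node g r r'), hc => by cases g <;> cases hc.2.2.1

/-- Values of Lie monomials with labels `L`. -/
def lieSet (z : X → Z) (χ : X → Col) (β : Z →ₗ[k] Z →ₗ[k] Z) (L : Multiset X) : Set Z :=
  {a | ∃ t : OpTree Unit X, t.IsColoured lieSig χ .l ∧ (t.leaves : Multiset X) = L ∧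
    a = t.eval (fun _ => β) z}

/-- Values of Lie monomials, possibly multiplied by a product of chains, with labels `L`. -/
def lrSet (z : X → Z) (χ : X → Col) (μ : Ops k LRGen Z) (L : Multiset X) : Set Z :=
  lieSet z χ (μ .β) L ∪ {a | ∃ L₁ L₂, L₁ + L₂ = L ∧ ∃ b ∈ chainsSet z χ (μ .α) (μ .d) L₁,
    ∃ x ∈ lieSet z χ (μ .β) L₂, a = μ .m b x}

variable {μ : Ops k LRGen Z}

theorem lie_bracket_mem {β : Z →ₗ[k] Z →ₗ[k] Z} {L L' : Multiset X} {a b : Z}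
    (ha : a ∈ lieSet z χ β L) (hb : b ∈ lieSet z χ β L') : β a b ∈ lieSet z χ β (L + L') := by
  obtain ⟨t, h1, rfl, rfl⟩ := ha
  obtain ⟨t', h2, rfl, rfl⟩ := hb
  exact ⟨.node () t t', ⟨rfl, h1, h2⟩, by rw [OpTree.leaves, ← Multiset.coe_add], rfl⟩

/-- A Lie monomial acts on sums of products of chains: brackets act by commutators. -/
theorem chains_lie_mem (h : IsLRAlg μ) (t : OpTree Unit X) :
    ∀ {L : Multiset X} {a : Z}, t.IsColoured lieSig χ .l →
      a ∈ Submodule.span k (chainsSet z χ (μ .α) (μ .d) L) →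
      μ .d a (t.eval (fun _ => μ .β) z) ∈
        Submodule.span k (chainsSet z χ (μ .α) (μ .d) (L + ↑t.leaves)) := by
  induction t with
  | leaf y => exact fun hc ha => chains_leaf_mem h.dCom hc ha
  | node g l r hl hr =>
    intro L a hc ha
    rw [OpTree.eval, h.morphism, OpTree.leaves, ← Multiset.coe_add, ← add_assoc]
    refine sub_mem ?_ (hr hc.2.2 (hl hc.2.1 ha))
    rw [add_right_comm]
    exact hl hc.2.1 (hr hc.2.2 ha)

theorem chains_lieSet_mem (h : IsLRAlg μ) {L L' : Multiset X} {a x : Z}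
    (ha : a ∈ Submodule.span k (chainsSet z χ (μ .α) (μ .d) L)) (hx : x ∈ lieSet z χ (μ .β) L') :
    μ .d a x ∈ Submodule.span k (chainsSet z χ (μ .α) (μ .d) (L + L')) := by
  obtain ⟨t, h1, rfl, rfl⟩ := hx
  exact chains_lie_mem h t h1 ha

theorem smul_lie_mem {L L' : Multiset X} {a x : Z}
    (ha : a ∈ Submodule.span k (chainsSet z χ (μ .α) (μ .d) L)) (hx : x ∈ lieSet z χ (μ .β) L') :
    μ .m a x ∈ Submodule.span k (lrSet z χ μ (L + L')) := by
  refine linear_mem_of_span (f := (μ .m).flip x) (fun b hb => ?_) ha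
  exact Submodule.subset_span (Or.inr ⟨L, L', rfl, b, hb, x, hx, rfl⟩)

theorem chains_lr_mem (h : IsLRAlg μ) {L L' : Multiset X} {a x : Z}
    (ha : a ∈ Submodule.span k (chainsSet z χ (μ .α) (μ .d) L))
    (hx : x ∈ Submodule.span k (lrSet z χ μ L')) :
    μ .d a x ∈ Submodule.span k (chainsSet z χ (μ .α) (μ .d) (L + L')) := by
  refine linear_mem_of_span (f := μ .d a) ?_ hx
  rintro _ (hx | ⟨L₁, L₂, rfl, b, hb, x, hx, rfl⟩)
  · exact chains_lieSet_mem h ha hx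
  · rw [h.anchor, add_comm L₁, ← add_assoc]
    exact chains_mul_mem h.dCom (chains_lieSet_mem h ha hx) (Submodule.subset_span hb)

theorem smul_lr_mem (h : IsLRAlg μ) {L L' : Multiset X} {a x : Z}
    (ha : a ∈ Submodule.span k (chainsSet z χ (μ .α) (μ .d) L))
    (hx : x ∈ Submodule.span k (lrSet z χ μ L')) :
    μ .m a x ∈ Submodule.span k (lrSet z χ μ (L + L')) := by
  refine linear_mem_of_span (f := μ .m a) ?_ hx
  rintro _ (hx | ⟨L₁, L₂, rfl, b, hb, x, hx, rfl⟩)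
  · exact smul_lie_mem ha hx
  · rw [← h.module, ← add_assoc]
    exact smul_lie_mem (chains_mul_mem h.dCom ha (Submodule.subset_span hb)) hx

theorem lr_bracket_mem (h : IsLRAlg μ) {L L' : Multiset X} {x y : Z}
    (hx : x ∈ Submodule.span k (lrSet z χ μ L)) (hy : y ∈ Submodule.span k (lrSet z χ μ L')) :
    μ .β x y ∈ Submodule.span k (lrSet z χ μ (L + L')) := by
  -- a bracket with a Lie monomial on the left
  have key : ∀ {L L' : Multiset X} {x y : Z}, x ∈ lieSet z χ (μ .β) L → y ∈ lrSet z χ μ L' →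
      μ .β x y ∈ Submodule.span k (lrSet z χ μ (L + L')) := by
    rintro L L' x _ hx (hy | ⟨L₁, L₂, rfl, b, hb, y, hy, rfl⟩)
    · exact Submodule.subset_span (Or.inl (lie_bracket_mem hx hy))
    · rw [h.rinehart]
      refine add_mem ?_ ?_
      · rw [add_left_comm]
        exact smul_lie_mem (Submodule.subset_span hb) (lie_bracket_mem hx hy)
      · rw [← add_assoc, add_comm L]
        exact smul_lie_mem (chains_lieSet_mem h (Submodule.subset_span hb) hx) hy
  have key' : ∀ {L L' : Multiset X} {x y : Z}, x ∈ lrSet z χ μ L → y ∈ lieSet z χ (μ .β) L' →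
      μ .β x y ∈ Submodule.span k (lrSet z χ μ (L + L')) := by
    intro L L' x y hx hy
    rw [h.lie.anti, add_comm]
    exact neg_mem (key hy hx)
  refine bilin_mem_of_span ?_ hx hy
  rintro x hx _ (hy | ⟨L₁, L₂, rfl, b, hb, y, hy, rfl⟩)
  · exact key' hx hy
  · rw [h.rinehart]
    refine add_mem ?_ ?_
    · rw [add_left_comm]
      exact smul_lr_mem h (Submodule.subset_span hb) (key' hx hy)
    · rw [← add_assoc, add_comm L]
      exact smul_lie_mem (chains_lr_mem h (Submodule.subset_span hb) (Submodule.subset_span hx)) hy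

/-- Every monomial of the Lie–Rinehart operad is a sum of normal forms. -/
theorem lr_eval_mem (h : IsLRAlg μ) : ∀ t : OpTree LRGen X,
    (t.IsColoured lrSig χ .s →
      t.eval μ z ∈ Submodule.span k (chainsSet z χ (μ .α) (μ .d) ↑t.leaves)) ∧
    (t.IsColoured lrSig χ .l → t.eval μ z ∈ Submodule.span k (lrSet z χ μ ↑t.leaves))
  | .leaf x => by
    refine ⟨fun hc => Submodule.subset_span ⟨[(x, [])], by simp, by
      rw [pairLabels_cons, pairLabels_nil]; simp [OpTree.leaves], fun p hp => by
        obtain rfl : p = (x, []) := by simpa using hp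
        exact ⟨hc, by simp⟩, rfl⟩, fun hc => ?_⟩
    exact Submodule.subset_span (Or.inl ⟨.leaf x, hc, rfl, rfl⟩)
  | .node g l r => by
    rw [OpTree.leaves, ← Multiset.coe_add]
    have hl := lr_eval_mem h l
    have hr := lr_eval_mem h r
    cases g with
    | α => exact ⟨fun hc => chains_mul_mem h.dCom (hl.1 hc.2.1) (hr.1 hc.2.2), fun hc => by
        cases hc.1⟩
    | β => exact ⟨fun hc => (by cases hc.1), fun hc => lr_bracket_mem h (hl.2 hc.2.1) (hr.2 hc.2.2)⟩
    | d => exact ⟨fun hc => chains_lr_mem h (hl.1 hc.2.1) (hr.2 hc.2.2), fun hc => by cases hc.1⟩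
    | m => exact ⟨fun hc => (by cases hc.1), fun hc => smul_lr_mem h (hl.1 hc.2.1) (hr.2 hc.2.2)⟩

end

/-! ### Normal forms as monomials -/

section

variable {G X : Type}

/-- The tree `d(⋯d(d(x, y_n), y_{n-1})⋯, y_1)` for the list `y_1, …, y_n`. -/
def chainTree (d : G) (x : X) : List X → OpTree G X
  | [] => .leaf x
  | y :: w => .node d (chainTree d x w) (.leaf y)

/-- The product of a nonempty list of trees (an arbitrary leaf for the empty list). -/
def prodTree [Nonempty X] (a : G) : List (OpTree G X) → OpTree G X
  | [] => .leaf (Classical.arbitrary X)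
  | [t] => t
  | t :: t' :: ts => .node a t (prodTree a (t' :: ts))

/-- The product of the chains `(x, w)`. -/
def chainsTree [Nonempty X] (a d : G) (ps : List (X × List X)) : OpTree G X :=
  prodTree a (ps.map fun p => chainTree d p.1 p.2)

/-- The iterated bracket of the leaves in a nonempty list. -/
def combTree [Nonempty X] (b : G) : List X → OpTree G X
  | [] => .leaf (Classical.arbitrary X)
  | x :: v => v.foldl (fun t y => .node b t (.leaf y)) (.leaf x)

theorem prodTree_cons [Nonempty X] (a : G) (t : OpTree G X) {ts : List (OpTree G X)}
    (h : ts ≠ []) : prodTree a (t :: ts) = .node a t (prodTree a ts) := by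
  cases ts with
  | nil => exact absurd rfl h
  | cons t' ts => rfl

theorem chainTree_leaves (d : G) (x : X) (w : List X) :
    ((chainTree d x w).leaves : Multiset X) = {x} + (w : Multiset X) := by
  induction w with
  | nil => simp [chainTree, OpTree.leaves]
  | cons y w ih =>
    rw [chainTree, OpTree.leaves, ← Multiset.coe_add, ih, ← Multiset.cons_coe,
      ← Multiset.singleton_add, OpTree.leaves, Multiset.coe_singleton]
    abel

theorem chainsTree_leaves [Nonempty X] (a d : G) {ps : List (X × List X)} (h : ps ≠ []) :
    ((chainsTree a d ps).leaves : Multiset X) = pairLabels ↑ps := by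
  induction ps with
  | nil => exact absurd rfl h
  | cons p ps ih =>
    rw [pairLabels_cons]
    rcases eq_or_ne ps [] with rfl | hne
    · rw [pairLabels_nil, add_zero, ← chainTree_leaves d]; rfl
    · rw [chainsTree, List.map_cons, prodTree_cons _ _ (by simpa using hne), OpTree.leaves,
        ← Multiset.coe_add, chainTree_leaves]
      exact congrArg _ (ih hne)

theorem foldl_leaves (b : G) (v : List X) (t : OpTree G X) :
    (v.foldl (fun t y => OpTree.node b t (.leaf y)) t).leaves = t.leaves ++ v := by
  induction v generalizing t with
  | nil => simp
  | cons y v ih => simp [ih, OpTree.leaves]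

theorem combTree_leaves [Nonempty X] (b : G) {v : List X} (h : v ≠ []) :
    (combTree b v).leaves = v := by
  cases v with
  | nil => exact absurd rfl h
  | cons x v => exact foldl_leaves b v _

variable {S : Signature Col} {χ : X → Col}

theorem chainTree_isColoured {d : S.Gen} (h1 : S.in₁ d = .s) (h2 : S.in₂ d = .l)
    (h3 : S.out d = .s) {x : X} (hx : χ x = .s) {w : List X} (hw : ∀ y ∈ w, χ y = .l) :
    (chainTree d x w).IsColoured S χ .s := by
  induction w with
  | nil => exact hx
  | cons y w ih =>
    refine ⟨h3, ?_, ?_⟩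
    · rw [h1]; exact ih fun y hy => hw y (by simp [hy])
    · rw [h2]; exact hw y (by simp)

theorem chainsTree_isColoured [Nonempty X] {a d : S.Gen} (h1 : S.in₁ d = .s) (h2 : S.in₂ d = .l)
    (h3 : S.out d = .s) (h4 : S.in₁ a = .s) (h5 : S.in₂ a = .s) (h6 : S.out a = .s)
    {ps : List (X × List X)} (h : ps ≠ []) (hps : PairsColoured χ ↑ps) :
    (chainsTree a d ps).IsColoured S χ .s := by
  induction ps with
  | nil => exact absurd rfl h
  | cons p ps ih =>
    have hp := chainTree_isColoured h1 h2 h3 (hps p (by simp)).1 (hps p (by simp)).2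
    rcases eq_or_ne ps [] with rfl | hne
    · exact hp
    · rw [chainsTree, List.map_cons, prodTree_cons _ _ (by simpa using hne)]
      refine ⟨h6, by rwa [h4], ?_⟩
      rw [h5]
      exact ih hne fun q hq => hps q (by simp at hq ⊢; exact Or.inr hq)

theorem combTree_isColoured [Nonempty X] {b : S.Gen} (h1 : S.in₁ b = .l) (h2 : S.in₂ b = .l)
    (h3 : S.out b = .l) {v : List X} (h : v ≠ []) (hv : ∀ y ∈ v, χ y = .l) :
    (combTree b v).IsColoured S χ .l := by
  have key : ∀ (v : List X) (t : OpTree S.Gen X), t.IsColoured S χ .l → (∀ y ∈ v, χ y = .l) →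
      (v.foldl (fun t y => OpTree.node b t (.leaf y)) t).IsColoured S χ .l := by
    intro v
    induction v with
    | nil => exact fun t ht _ => ht
    | cons y v ih =>
      refine fun t ht hv => ih _ ⟨h3, by rwa [h1], ?_⟩ fun y hy => hv y (by simp [hy])
      rw [h2]
      exact hv y (by simp)
  cases v with
  | nil => exact absurd rfl h
  | cons x v => exact key v _ (hv x (by simp)) fun y hy => hv y (by simp [hy])

variable {k : Type u} [Field k] {Z : Type v} [AddCommGroup Z] [Module k Z] {z : X → Z}

theorem chainTree_eval (μ : Ops k G Z) (d : G) (x : X) (w : List X) :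
    (chainTree d x w).eval μ z = chainVal z (μ d) x w := by
  induction w with
  | nil => rfl
  | cons y w ih => rw [chainTree, OpTree.eval, ih]; rfl

theorem chainsTree_eval [Nonempty X] (μ : Ops k G Z) (a d : G) {ps : List (X × List X)}
    (h : ps ≠ []) : (chainsTree a d ps).eval μ z = chainsVal z (μ a) (μ d) ps := by
  induction ps with
  | nil => exact absurd rfl h
  | cons p ps ih =>
    rcases eq_or_ne ps [] with rfl | hne
    · exact chainTree_eval μ d p.1 p.2
    · rw [chainsTree, chainsVal, List.map_cons, prodTree_cons _ _ (by simpa using hne),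
        List.map_cons, prodVal_cons _ (by simpa using hne), OpTree.eval, chainTree_eval]
      exact congrArg _ (ih hne)

theorem combTree_eval [Nonempty X] (μ : Ops k G Z) (b : G) (x : X) (v : List X) :
    (combTree b (x :: v)).eval μ z = combVal z (μ b) (z x) v := by
  have key : ∀ (v : List X) (t : OpTree G X),
      (v.foldl (fun t y => OpTree.node b t (.leaf y)) t).eval μ z =
        combVal z (μ b) (t.eval μ z) v := by
    intro v
    induction v with
    | nil => exact fun _ => rfl
    | cons y v ih => exact fun t => ih _
  exact key v _

end

/-! ### Keys of normal forms -/

open Classical in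
/-- The value of the normal form with the given key. -/
def keyVal {k : Type u} [Field k] {Z : Type v} [AddCommGroup Z] [Module k Z] {X : Type}
    (z : X → Z) (μ : Ops k LRGen Z) (q : Multiset (X × List X) × List X) : Z :=
  match q.2 with
  | [] => chainsVal z (μ .α) (μ .d) q.1.toList
  | x :: v => if q.1 = 0 then combVal z (μ .β) (z x) v
    else μ .m (chainsVal z (μ .α) (μ .d) q.1.toList) (combVal z (μ .β) (z x) v)

section

variable {X : Type}

/-- The first letter of the nonempty word `v` is the smallest one. -/
def MinHead [LinearOrder X] (v : List X) : Prop := ∃ x v', v = x :: v' ∧ ∀ y ∈ v', x ≤ y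

/-- The data that determine a normal form: the chains `(x, w)` in the product, and the word of the
iterated bracket. All labels occur exactly once, straight ones at the beginning of chains, and
dotted ones everywhere else. The output is straight if there is no bracket; otherwise the
bracket begins with its smallest label. -/
structure IsKey [LinearOrder X] [Fintype X] (χ : X → Col) (c : Col)
    (q : Multiset (X × List X) × List X) : Prop where
  labels : pairLabels q.1 + (q.2 : Multiset X) = Finset.univ.val
  coloured : PairsColoured χ q.1
  coloured' : ∀ y ∈ q.2, χ y = .l
  out : match c with
    | .s => q.1 ≠ 0 ∧ q.2 = []
    | .l => MinHead q.2

/-- The type of keys. -/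
abbrev Key [LinearOrder X] [Fintype X] (χ : X → Col) (c : Col) : Type :=
  {q : Multiset (X × List X) × List X // IsKey χ c q}

variable [LinearOrder X] [Fintype X] {χ : X → Col}

omit [Fintype X] in
theorem MinHead.ne_nil {v : List X} (h : MinHead v) : v ≠ [] := by
  obtain ⟨x, v', rfl, -⟩ := h
  simp

omit [LinearOrder X] in
theorem isMonomial_of_leaves {I : Type} {S : Signature I} {χ : X → I} {c : I}
    {t : OpTree S.Gen X} (hc : t.IsColoured S χ c)
    (h : (t.leaves : Multiset X) = Finset.univ.val) : IsMonomial S χ c t := by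
  refine ⟨hc, ?_, fun x => ?_⟩
  · rw [← Multiset.coe_nodup, h]; exact Finset.univ.nodup
  · rw [← Multiset.mem_coe, h]; exact Finset.mem_univ x

omit [LinearOrder X] in
theorem IsMonomial.leaves_eq {I : Type} {S : Signature I} {χ : X → I} {c : I}
    {t : OpTree S.Gen X} (h : IsMonomial S χ c t) :
    (t.leaves : Multiset X) = Finset.univ.val :=
  (Multiset.Nodup.ext (Multiset.coe_nodup.2 h.2.1) Finset.univ.nodup).2 fun x => by
    simpa using h.2.2 x

theorem IsKey.nonempty {c : Col} {q : Multiset (X × List X) × List X} (h : IsKey χ c q) :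
    Nonempty X := by
  have h' := h.out
  cases c with
  | s =>
    obtain ⟨p, -⟩ := Multiset.exists_mem_of_ne_zero h'.1
    exact ⟨p.1⟩
  | l => obtain ⟨x, -⟩ := h'; exact ⟨x⟩

/-- The normal form with the given key. -/
def keyTree [Nonempty X] (q : Multiset (X × List X) × List X) : OpTree LRGen X :=
  if q.2 = [] then chainsTree .α .d q.1.toList
  else if q.1 = 0 then combTree .β q.2
  else .node .m (chainsTree .α .d q.1.toList) (combTree .β q.2)

/-- The normal form of a key is multilinear, since every input occurs once among the labels of the
key. -/
theorem IsKey.isMonomial {c : Col} {q : Multiset (X × List X) × List X} (h : IsKey χ c q)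
    [Nonempty X] : IsMonomial lrSig χ c (keyTree q) := by
  suffices h' : (keyTree q).IsColoured lrSig χ c ∧ ((keyTree q).leaves : Multiset X) =
      Finset.univ.val from isMonomial_of_leaves h'.1 h'.2
  have h1 := h.labels
  have hps : PairsColoured χ (q.1.toList : Multiset (X × List X)) := by
    rw [Multiset.coe_toList]; exact h.coloured
  have h2 := h.out
  have hv := h.coloured'
  obtain ⟨S, v⟩ := q
  dsimp only at *
  cases c with
  | s =>
    obtain ⟨h3, rfl⟩ := h2
    have hne : S.toList ≠ [] := by simpa using h3
    rw [keyTree, if_pos rfl]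
    refine ⟨chainsTree_isColoured rfl rfl rfl rfl rfl rfl hne hps, ?_⟩
    rw [chainsTree_leaves _ _ hne, Multiset.coe_toList]
    simpa using h1
  | l =>
    have hcol := combTree_isColoured (S := lrSig) (b := LRGen.β) rfl rfl rfl h2.ne_nil hv
    rw [keyTree, if_neg h2.ne_nil]
    split_ifs with h3
    · subst h3
      refine ⟨hcol, ?_⟩
      rw [combTree_leaves _ h2.ne_nil]
      simpa [pairLabels] using h1
    · have hne : S.toList ≠ [] := by simpa using h3
      refine ⟨⟨rfl, chainsTree_isColoured rfl rfl rfl rfl rfl rfl hne hps, hcol⟩, ?_⟩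
      rw [OpTree.leaves, ← Multiset.coe_add, chainsTree_leaves _ _ hne, Multiset.coe_toList,
        combTree_leaves _ h2.ne_nil]
      exact h1

/-- The monomial with the given key. -/
def keyMonomial {c : Col} (q : Key χ c) : Monomial lrSig χ c :=
  haveI := q.2.nonempty
  ⟨keyTree q.1, q.2.isMonomial⟩

variable {k : Type u} [Field k] {Z : Type v} [AddCommGroup Z] [Module k Z] {z : X → Z}

theorem keyMonomial_eval {c : Col} (q : Key χ c) (μ : Ops k LRGen Z) :
    (keyMonomial q).1.eval μ z = keyVal z μ q.1 := by
  have := q.2.nonempty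
  have h2 := q.2.out
  obtain ⟨⟨S, v⟩, hq⟩ := q
  change (keyTree (S, v)).eval μ z = _
  dsimp only at *
  cases v with
  | nil =>
    have hne : S.toList ≠ [] := by
      cases c with
      | s => simpa using h2.1
      | l => exact absurd rfl h2.ne_nil
    rw [keyTree, if_pos rfl]
    exact chainsTree_eval μ _ _ hne
  | cons x v =>
    rw [keyTree, if_neg (by simp), keyVal]
    dsimp only
    split_ifs with h
    · exact combTree_eval μ _ x v
    · rw [OpTree.eval, combTree_eval, chainsTree_eval]
      simpa using h

omit [LinearOrder X] [Fintype X] in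
theorem chainsVal_toList {α d : Z →ₗ[k] Z →ₗ[k] Z} (h : IsDComAlg α d)
    (ps : List (X × List X)) :
    chainsVal z α d (ps : Multiset (X × List X)).toList = chainsVal z α d ps :=
  h.prodVal_perm ((Multiset.coe_eq_coe.1 (Multiset.coe_toList _)).map _)

omit [Fintype X] in
theorem exists_minHead {L : Multiset X} (h : L ≠ 0) : ∃ x M, L = x ::ₘ M ∧ ∀ y ∈ M, x ≤ y := by
  classical
  obtain ⟨x, hx, hmin⟩ := L.toFinset.exists_min_image id (by
    obtain ⟨x, hx⟩ := Multiset.exists_mem_of_ne_zero h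
    exact ⟨x, by simpa using hx⟩)
  obtain ⟨M, rfl⟩ := Multiset.exists_cons_of_mem (by simpa using hx : x ∈ L)
  exact ⟨x, M, rfl, fun y hy => hmin y (by simp [hy])⟩

/-- The values of monomials in a Lie–Rinehart algebra are combinations of those of normal forms. -/
theorem eval_mem_span_keyVal {μ : Ops k LRGen Z} (h : IsLRAlg μ) {c : Col} (t : Monomial lrSig χ c) :
    t.1.eval μ z ∈ Submodule.span k (Set.range fun q : Key χ c => keyVal z μ q.1) := by
  have hL := t.2.leaves_eq
  have hlie : ∀ {L : Multiset X} {a : Z}, a ∈ lieSet z χ (μ .β) L →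
      ∃ x M, L = x ::ₘ M ∧ (∀ y ∈ M, x ≤ y) ∧ (∀ y ∈ L, χ y = .l) ∧
        a ∈ Submodule.span k (combSet z (μ .β) (z x) M) := by
    rintro L a ⟨t, ht, rfl, rfl⟩
    obtain ⟨x, M, hM, hx⟩ := exists_minHead (L := (t.leaves : Multiset X))
      (by simpa using t.leaves_ne_nil)
    refine ⟨x, M, hM, hx, fun y hy => ?_, lie_mem_span_comb h.lie t hM⟩
    have key : ∀ (t : OpTree Unit X), t.IsColoured lieSig χ .l → ∀ y ∈ t.leaves, χ y = .l := by
      intro t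
      induction t with
      | leaf x => intro ht y hy; obtain rfl : y = x := by simpa [OpTree.leaves] using hy
                  exact ht
      | node g l r hl hr =>
        exact fun ht y hy => (List.mem_append.1 hy).elim (hl ht.2.1 y) (hr ht.2.2 y)
    exact key t ht y hy
  cases c with
  | s =>
    refine Submodule.span_mono ?_ ((lr_eval_mem h t.1).1 t.2.1)
    rintro _ ⟨ps, hne, hlab, hcol, rfl⟩
    refine ⟨⟨(↑ps, []), by simpa using hlab.trans hL, hcol, by simp, by simpa using hne, rfl⟩, ?_⟩
    exact chainsVal_toList h.dCom ps
  | l =>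
    refine Submodule.span_le.2 ?_ ((lr_eval_mem h t.1).2 t.2.1)
    rintro a (ha | ⟨L₁, L₂, hL', b, ⟨ps, hne, rfl, hcol, rfl⟩, a, ha, rfl⟩)
    · obtain ⟨x, M, hM, hx, hl, ha⟩ := hlie ha
      refine Submodule.span_mono ?_ ha
      rintro _ ⟨v, rfl, rfl⟩
      have hM' := hM
      replace hM := hL.symm.trans hM
      refine ⟨⟨(0, x :: v), by rw [hM]; simp [pairLabels], by simp [PairsColoured], fun y hy =>
        hl y (by rw [hM']; simpa using hy), x, v, rfl, by simpa using hx⟩, ?_⟩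
      simp [keyVal]
    · obtain ⟨x, M, rfl, hx, hl, ha⟩ := hlie ha
      refine linear_mem_of_span ?_ ha
      rintro _ ⟨v, rfl, rfl⟩
      replace hL' := hL'.trans hL
      refine Submodule.subset_span ⟨⟨(↑ps, x :: v), by rw [← hL']; simp, hcol, fun y hy =>
        hl y (by simpa using hy), x, v, rfl, by simpa using hx⟩, ?_⟩
      simp only [keyVal]
      rw [if_neg (by simpa using hne), chainsVal_toList h.dCom]

/-- Membership in a span of classes in a presented operad can be checked in algebras. -/
theorem presentedMk_mem_span {I : Type} {S : Signature I} {R : Set (Element k S)}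
    (hR : WellFormed R) {X : Type} [Finite X] {χ : X → I} {c : I} {J : Type}
    (b : J → Monomial S χ c) (t : Monomial S χ c)
    (h : ∀ (Z : Type u) [AddCommGroup Z] [Module k Z] (μ : Ops k S.Gen Z), Sat R μ → ∀ z : X → Z,
      t.1.eval μ z ∈ Submodule.span k (Set.range fun j => (b j).1.eval μ z)) :
    presentedMk R t ∈ Submodule.span k (Set.range fun j => presentedMk R (b j)) := by
  let E : (presented R).obj X χ c →ₗ[k] FreeAlg R χ :=
    { toFun := fun p => presentedEval (sat_freeOps hR χ) X χ c p
        (fun x => (algRel R χ).mkQ (mon k (.leaf x)))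
      map_add' := fun p q => by rw [map_add, add_apply]
      map_smul' := fun a p => by rw [map_smul, smul_apply]; rfl }
  have hE : Function.Injective E :=
    (injective_iff_map_eq_zero E).2 fun p hp => presented_eq_zero hR hp
  have h' := h (FreeAlg R χ) (freeOps hR χ) (sat_freeOps hR χ)
    (fun x => (algRel R χ).mkQ (mon k (.leaf x)))
  have hEt : ∀ t : Monomial S χ c, E (presentedMk R t) =
      t.1.eval (freeOps hR χ) (fun x => (algRel R χ).mkQ (mon k (.leaf x))) :=
    fun t => presentedEval_mk _ t _
  simp only [← hEt] at h'
  rw [show (fun j => E (presentedMk R (b j))) = E ∘ fun j => presentedMk R (b j) from rfl,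
    Set.range_comp, ← Submodule.map_span] at h'
  obtain ⟨p, hp, hp'⟩ := h'
  rwa [← hE hp']

/-- The operad of Lie–Rinehart algebras is spanned by the normal forms. -/
theorem span_keyMonomial (k : Type u) [Field k] (χ : X → Col) (c : Col) :
    Submodule.span k (Set.range fun q : Key χ c => presentedMk (lrRel k) (keyMonomial q)) = ⊤ := by
  rw [eq_top_iff, ← span_presentedMk, Submodule.span_le]
  rintro _ ⟨t, rfl⟩
  refine presentedMk_mem_span wellFormed_lrRel _ t fun Z _ _ μ hμ z => ?_
  refine (congrArg (fun F => t.1.eval μ z ∈ Submodule.span k (Set.range F))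
    (funext fun q : Key χ c => keyMonomial_eval q μ)).mpr ?_
  exact eval_mem_span_keyVal (sat_lrRel.1 hμ) t

end

/-! ### Derivations of a commutative algebra -/

section

variable (k : Type u) [Field k] (A : Type v) [CommRing A] [Algebra k A]

/-- The four operations on a commutative algebra together with its derivations. -/
def derivationOps : Ops k LRGen (A × Derivation k A A)
  | .α => LinearMap.mk₂ k (fun p q => (p.1 * q.1, 0))
      (fun _ _ _ => Prod.ext (add_mul _ _ _) (add_zero _).symm)
      (fun _ _ _ => Prod.ext (smul_mul_assoc _ _ _) (smul_zero _).symm)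
      (fun _ _ _ => Prod.ext (mul_add _ _ _) (add_zero _).symm)
      (fun _ _ _ => Prod.ext (mul_smul_comm _ _ _) (smul_zero _).symm)
  | .β => LinearMap.mk₂ k (fun p q => (0, ⁅p.2, q.2⁆))
      (fun _ _ _ => Prod.ext (add_zero _).symm (add_lie _ _ _))
      (fun _ _ _ => Prod.ext (smul_zero _).symm (smul_lie _ _ _))
      (fun _ _ _ => Prod.ext (add_zero _).symm (lie_add _ _ _))
      (fun _ _ _ => Prod.ext (smul_zero _).symm (lie_smul _ _ _))
  | .d => LinearMap.mk₂ k (fun p q => (q.2 p.1, 0))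
      (fun _ _ _ => Prod.ext (map_add _ _ _) (add_zero _).symm)
      (fun _ _ _ => Prod.ext (Derivation.map_smul _ _ _) (smul_zero _).symm)
      (fun _ _ _ => Prod.ext (Derivation.add_apply _) (add_zero _).symm)
      (fun _ _ _ => Prod.ext rfl (smul_zero _).symm)
  | .m => LinearMap.mk₂ k (fun p q => (0, p.1 • q.2))
      (fun _ _ _ => Prod.ext (add_zero _).symm (add_smul _ _ _))
      (fun _ _ _ => Prod.ext (smul_zero _).symm (smul_assoc _ _ _))
      (fun _ _ _ => Prod.ext (add_zero _).symm (smul_add _ _ _))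
      (fun _ _ _ => Prod.ext (smul_zero _).symm (smul_comm _ _ _))

variable {k A}

theorem derivationOps_α (p q : A × Derivation k A A) :
    derivationOps k A .α p q = (p.1 * q.1, 0) := rfl
theorem derivationOps_β (p q : A × Derivation k A A) :
    derivationOps k A .β p q = (0, ⁅p.2, q.2⁆) := rfl
theorem derivationOps_d (p q : A × Derivation k A A) :
    derivationOps k A .d p q = (q.2 p.1, 0) := rfl
theorem derivationOps_m (p q : A × Derivation k A A) :
    derivationOps k A .m p q = (0, p.1 • q.2) := rfl

/-- A commutative algebra and its derivations form a Lie–Rinehart algebra. -/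
theorem isLRAlg_derivationOps : IsLRAlg (derivationOps k A) where
  dCom :=
    { comm := fun a b => by simp only [derivationOps_α, mul_comm]
      assoc := fun a b c => by simp only [derivationOps_α, mul_assoc]
      leibniz := fun a b y => by
        simp only [derivationOps_α, derivationOps_d, Derivation.leibniz, smul_eq_mul,
          Prod.mk_add_mk, add_zero]
        rw [mul_comm b.1] }
  lie :=
    { anti := fun x y => Prod.ext neg_zero.symm (lie_skew _ _).symm
      jacobi := fun x y z => by
        refine Prod.ext (add_zero _).symm (Derivation.ext fun p => ?_)
        simp only [derivationOps_β, Prod.mk_add_mk, Derivation.commutator_apply,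
          Derivation.add_apply, map_sub]
        abel }
  morphism a x y := by
    simp only [derivationOps_β, derivationOps_d, Derivation.commutator_apply, Prod.mk_sub_mk,
      sub_zero]
  module a b x := by simp only [derivationOps_α, derivationOps_m, mul_smul]
  anchor a b x := by
    simp only [derivationOps_α, derivationOps_d, derivationOps_m, Derivation.smul_apply,
      smul_eq_mul, mul_comm]
  rinehart a x y := by
    refine Prod.ext (add_zero _).symm (Derivation.ext fun p => ?_)
    simp only [derivationOps_β, derivationOps_d, derivationOps_m, Prod.mk_add_mk,
      Derivation.commutator_apply, Derivation.smul_apply, Derivation.add_apply,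
      Derivation.leibniz, smul_eq_mul, mul_sub]
    ring

end

/-! ### Polynomial vector fields -/

section

variable (k : Type u) [Field k] (X : Type)

/-- Polynomials in variables `(x, w)`, where `x` is a label or the extra element `none`, and `w` is
a word in the labels. -/
abbrev ModelPoly : Type u := MvPolynomial (Option X × List X) k

/-- The algebra of polynomials together with its derivations. -/
abbrev Model : Type u := ModelPoly k X × Derivation k (ModelPoly k X) (ModelPoly k X)

/-- The operations of the Lie–Rinehart algebra of polynomials and their derivations. -/
def modelOps : Ops k LRGen (Model k X) := derivationOps k (ModelPoly k X)

variable {k X}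

theorem modelOps_α (p q : Model k X) : modelOps k X .α p q = (p.1 * q.1, 0) := rfl
theorem modelOps_β (p q : Model k X) : modelOps k X .β p q = (0, ⁅p.2, q.2⁆) := rfl
theorem modelOps_d (p q : Model k X) : modelOps k X .d p q = (q.2 p.1, 0) := rfl
theorem modelOps_m (p q : Model k X) : modelOps k X .m p q = (0, p.1 • q.2) := rfl

theorem isLRAlg_modelOps : IsLRAlg (modelOps k X) := isLRAlg_derivationOps

/-- The derivation that adds the letter `y` at the beginning of words. -/
def wordDer (y : X) : Derivation k (ModelPoly k X) (ModelPoly k X) :=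
  MvPolynomial.mkDerivation k fun p => MvPolynomial.X (p.1, y :: p.2)

theorem wordDer_X (y : X) (p : Option X × List X) :
    wordDer (k := k) y (MvPolynomial.X p) = MvPolynomial.X (p.1, y :: p.2) :=
  MvPolynomial.mkDerivation_X _ _ _

/-- The generic elements: variables for straight labels, and derivations for dotted labels. -/
def generic (k : Type u) [Field k] (χ : X → Col) (x : X) : Model k X :=
  match χ x with
  | .s => (MvPolynomial.X (some x, []), 0)
  | .l => (0, wordDer x)

theorem generic_s {χ : X → Col} {x : X} (h : χ x = .s) :
    generic k χ x = (MvPolynomial.X (some x, []), 0) := by simp [generic, h]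

theorem generic_l {χ : X → Col} {x : X} (h : χ x = .l) :
    generic k χ x = (0, wordDer x) := by simp [generic, h]

open Classical in
/-- The exponent of the monomial given by a product of chains. -/
def chainsExp (S : Multiset (X × List X)) : Option X × List X →₀ ℕ :=
  Multiset.toFinsupp (S.map fun p => ((some p.1, p.2) : Option X × List X))

theorem chainVal_generic {χ : X → Col} {x : X} (hx : χ x = .s) {w : List X}
    (hw : ∀ y ∈ w, χ y = .l) :
    chainVal (generic k χ) (modelOps k X .d) x w = (MvPolynomial.X (some x, w), 0) := by
  induction w with
  | nil => exact generic_s hx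
  | cons y w ih =>
    rw [chainVal, ih fun y hy => hw y (by simp [hy]), generic_l (hw y (by simp)), modelOps_d,
      wordDer_X]

theorem chainsVal_generic {χ : X → Col} {ps : List (X × List X)} (hne : ps ≠ [])
    (h : PairsColoured χ ↑ps) :
    chainsVal (generic k χ) (modelOps k X .α) (modelOps k X .d) ps =
      (MvPolynomial.monomial (chainsExp ↑ps) 1, 0) := by
  classical
  induction ps with
  | nil => exact absurd rfl hne
  | cons p ps ih =>
    have hp := chainVal_generic (k := k) (h p (by simp)).1 (h p (by simp)).2
    have e : chainsExp (X := X) ↑[p] = Finsupp.single (some p.1, p.2) 1 := by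
      simp [chainsExp, Multiset.toFinsupp_singleton]
    rcases eq_or_ne ps [] with rfl | hne'
    · rw [e]; exact hp
    · have hps : PairsColoured χ (ps : Multiset (X × List X)) := fun q hq => h q (by
        simp at hq ⊢; exact Or.inr hq)
      have e' : chainsExp (X := X) ↑(p :: ps) = chainsExp ↑[p] + chainsExp ↑ps := by
        simp only [chainsExp, ← map_add, ← Multiset.map_add]
        rfl
      rw [chainsVal, List.map_cons, prodVal_cons _ (by simpa using hne'), hp]
      have := ih hne' hps
      rw [chainsVal] at this
      rw [this, modelOps_α, e', e, MvPolynomial.X, MvPolynomial.monomial_mul, one_mul]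

/-- The variables that begin with a letter of `v`. -/
def wordSet (k : Type u) [Field k] (v : List X) : Set (ModelPoly k X) :=
  {p | ∃ b ∈ v, ∃ u : List X, p = MvPolynomial.X (none, b :: u)}

/-- Among the words in an iterated bracket, only one begins with the first letter of the
bracket. -/
theorem combVal_generic {χ : X → Col} {x : X} (hx : χ x = .l) {v : List X}
    (hv : ∀ y ∈ v, χ y = .l) :
    ∃ D : Derivation k (ModelPoly k X) (ModelPoly k X),
      combVal (generic k χ) (modelOps k X .β) (generic k χ x) v = (0, D) ∧
      ∀ u, D (MvPolynomial.X (none, u)) - MvPolynomial.X (none, x :: v ++ u) ∈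
        Submodule.span k (wordSet k v) := by
  induction v using List.reverseRecOn with
  | nil => exact ⟨wordDer x, generic_l hx, fun u => by rw [wordDer_X]; simp⟩
  | append_singleton v y ih =>
    obtain ⟨D, hD, h⟩ := ih fun y hy => hv y (by simp [hy])
    refine ⟨⁅D, wordDer y⁆, ?_, fun u => ?_⟩
    · have : combVal (generic k χ) (modelOps k X .β) (generic k χ x) (v ++ [y]) =
          modelOps k X .β (combVal (generic k χ) (modelOps k X .β) (generic k χ x) v)
            (generic k χ y) := by simp [combVal]
      rw [this, hD, generic_l (hv y (by simp)), modelOps_β]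
    · rw [Derivation.commutator_apply, wordDer_X, sub_right_comm]
      have hmono : wordSet k v ⊆ wordSet k (v ++ [y]) := by
        rintro _ ⟨b, hb, u, rfl⟩
        exact ⟨b, by simp [hb], u, rfl⟩
      refine sub_mem ?_ ?_
      · have := Submodule.span_mono hmono (h (y :: u))
        simpa using this
      · have hu : D (MvPolynomial.X (none, u)) ∈ Submodule.span k
            (Set.range fun w : List X => (MvPolynomial.X (none, w) : ModelPoly k X)) := by
          rw [← sub_add_cancel (D (MvPolynomial.X (none, u)))
            (MvPolynomial.X (none, x :: v ++ u))]
          refine add_mem (Submodule.span_mono ?_ (h u)) (Submodule.subset_span ⟨_, rfl⟩)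
          rintro _ ⟨b, -, u, rfl⟩
          exact ⟨_, rfl⟩
        refine linear_mem_of_span (f := (wordDer y : Derivation k (ModelPoly k X)
          (ModelPoly k X)).toLinearMap) ?_ hu
        rintro _ ⟨w, rfl⟩
        exact Submodule.subset_span ⟨y, by simp, w, wordDer_X y (none, w)⟩

theorem chainsExp_injective : Function.Injective (chainsExp (X := X)) := by
  classical
  intro S T h
  refine Multiset.map_injective (f := fun p : X × List X => ((some p.1, p.2) : Option X × List X))
    (fun p q h => ?_) (Multiset.toFinsupp.injective h)
  simpa [Prod.ext_iff] using h

theorem chainsExp_add_single {S T : Multiset (X × List X)} {u v : List X}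
    (h : chainsExp S + Finsupp.single (none, u) 1 = chainsExp T + Finsupp.single (none, v) 1) :
    S = T ∧ u = v := by
  classical
  have huv : u = v := by
    have h1 := DFunLike.congr_fun h (none, u)
    have h2 : ∀ S : Multiset (X × List X), chainsExp S (none, u) = 0 := fun S => by
      simp [chainsExp, Multiset.toFinsupp_apply]
    simp only [Finsupp.add_apply, h2, Finsupp.single_eq_same, zero_add] at h1
    by_contra hne
    rw [Finsupp.single_eq_of_ne (by simpa using hne)] at h1
    exact one_ne_zero h1
  subst huv
  exact ⟨chainsExp_injective (add_right_cancel h), rfl⟩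

end

section

variable {k : Type u} [Field k] {X : Type} [LinearOrder X] [Fintype X] {χ : X → Col}

open Classical in
/-- The coefficient of the leading monomial of the normal form with key `q`. -/
def keyFunctional (k : Type u) [Field k] (c : Col) (q : Multiset (X × List X) × List X) :
    Model k X →ₗ[k] k :=
  match c with
  | .s => (MvPolynomial.lcoeff k (chainsExp q.1)).comp (LinearMap.fst k _ _)
  | .l =>
    { toFun := fun p => MvPolynomial.coeff (chainsExp q.1 + Finsupp.single (none, q.2) 1)
        (p.2 (MvPolynomial.X (none, [])))
      map_add' := fun p p' => by simp
      map_smul' := fun a p => by simp }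

/-- The functionals are dual to the values of the normal forms. In the output colour `l`, the value
is a vector field `f • D`, where `D` is a comb of Lie brackets; up to words with another first
letter, `D` sends the variable of the empty word to the variable of the word of the comb. -/
theorem keyFunctional_keyVal {c : Col} (q q' : Key χ c) :
    keyFunctional k c q'.1 (keyVal (generic k χ) (modelOps k X) q.1) =
      if q = q' then 1 else 0 := by
  classical
  obtain ⟨⟨S, v⟩, h1, h2, h3, h4⟩ := q
  obtain ⟨⟨S', v'⟩, h1', h2', h3', h4'⟩ := q'
  simp only [Subtype.mk.injEq, Prod.mk.injEq] at *
  have hS : S ≠ 0 → chainsVal (generic k χ) (modelOps k X .α) (modelOps k X .d) S.toList =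
      (MvPolynomial.monomial (chainsExp S) 1, 0) := fun hS => by
    rw [chainsVal_generic (by simpa using hS) (by rwa [Multiset.coe_toList]), Multiset.coe_toList]
  cases c with
  | s =>
    obtain ⟨hne, rfl⟩ := h4
    obtain ⟨hne', rfl⟩ := h4'
    simp only [keyVal, keyFunctional, hS hne, LinearMap.comp_apply, LinearMap.fst_apply,
      MvPolynomial.lcoeff_apply, MvPolynomial.coeff_monomial, chainsExp_injective.eq_iff, and_true]
  | l =>
    obtain ⟨x, v, rfl, hx⟩ := h4
    obtain ⟨x', v', rfl, hx'⟩ := h4'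
    obtain ⟨D, hD, hD'⟩ := combVal_generic (k := k) (h3 x (by simp))
      fun y hy => h3 y (List.mem_cons_of_mem x hy)
    have hval : (keyVal (generic k χ) (modelOps k X) (S, x :: v)).2 (MvPolynomial.X (none, [])) =
        MvPolynomial.monomial (chainsExp S) 1 * D (MvPolynomial.X (none, [])) := by
      simp only [keyVal]
      split_ifs with h0
      · subst h0
        simp [hD, chainsExp]
      · rw [hD, hS h0, modelOps_m]
        simp
    have hlin : MvPolynomial.coeff (chainsExp S' + Finsupp.single (none, x' :: v') 1)
        (MvPolynomial.monomial (chainsExp S) 1 *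
          (D (MvPolynomial.X (none, [])) - MvPolynomial.X (none, x :: v ++ []))) = 0 := by
      let F : ModelPoly k X →ₗ[k] k := (MvPolynomial.lcoeff k
        (chainsExp S' + Finsupp.single (none, x' :: v') 1)).comp
          (LinearMap.mulLeft k (MvPolynomial.monomial (chainsExp S) 1))
      have hF : Submodule.span k (wordSet k v) ≤ LinearMap.ker F := by
        rw [Submodule.span_le]
        rintro _ ⟨b, hb, u, rfl⟩
        simp only [F, SetLike.mem_coe, LinearMap.mem_ker, LinearMap.comp_apply,
          LinearMap.mulLeft_apply, MvPolynomial.lcoeff_apply, MvPolynomial.X,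
          MvPolynomial.monomial_mul, one_mul, MvPolynomial.coeff_monomial]
        refine if_neg fun he => ?_
        obtain ⟨hSS, hbu⟩ := chainsExp_add_single he
        subst hSS
        obtain ⟨rfl, rfl⟩ := List.cons_eq_cons.1 hbu
        -- the words of both keys have the same letters, hence the same first letter
        have hvv : ((x :: v : List X) : Multiset X) = ((b :: u : List X) : Multiset X) :=
          add_left_cancel (h1.trans h1'.symm)
        have hnd : (x :: v).Nodup := by
          rw [← Multiset.coe_nodup]
          exact (Multiset.nodup_add.1 (h1 ▸ Finset.univ.nodup)).2.1
        have hxb : x ≤ b := hx b hb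
        have hbx : b ≤ x := by
          have : x ∈ ((b :: u : List X) : Multiset X) := by rw [← hvv]; simp
          rcases List.mem_cons.1 (Multiset.mem_coe.1 this) with rfl | hxu
          · exact le_rfl
          · exact hx' x hxu
        obtain rfl := le_antisymm hxb hbx
        exact (List.nodup_cons.1 hnd).1 hb
      exact hF (hD' [])
    have hcoeff : MvPolynomial.coeff (chainsExp S' + Finsupp.single (none, x' :: v') 1)
        (MvPolynomial.monomial (chainsExp S) 1 * D (MvPolynomial.X (none, []))) =
        if S = S' ∧ x :: v = x' :: v' then (1 : k) else 0 := by
      rw [mul_sub, MvPolynomial.coeff_sub, sub_eq_zero] at hlin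
      rw [hlin, MvPolynomial.X, MvPolynomial.monomial_mul, one_mul, MvPolynomial.coeff_monomial,
        List.append_nil]
      refine if_congr ⟨fun h => chainsExp_add_single h, fun h => by rw [h.1, h.2]⟩ rfl rfl
    change MvPolynomial.coeff _ ((keyVal (generic k χ) (modelOps k X) (S, x :: v)).2
      (MvPolynomial.X (none, []))) = _
    rw [hval, hcoeff]

/-- The values of the normal forms at the generic elements are linearly independent. -/
theorem linearIndependent_keyVal (k : Type u) [Field k] (χ : X → Col) (c : Col) :
    LinearIndependent k fun q : Key χ c => keyVal (generic k χ) (modelOps k X) q.1 := by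
  refine LinearIndependent.of_pairwise_dual_eq_zero_one _ (fun q => keyFunctional k c q.1) ?_ ?_
  · intro q q' hne
    rw [keyFunctional_keyVal, if_neg hne.symm]
  · intro q
    rw [keyFunctional_keyVal, if_pos rfl]

/-- The value at the generic elements, as a linear map. -/
def genericEval (k : Type u) [Field k] {X : Type} [Finite X] (χ : X → Col) (c : Col) :
    (lieR k).obj X χ c →ₗ[k] Model k X where
  toFun p := presentedEval (sat_lrRel.2 isLRAlg_modelOps) X χ c p (generic k χ)
  map_add' p q := congrArg (fun F : MultilinearMap k (fun _ : X => Model k X) (Model k X) =>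
    F (generic k χ)) (map_add (presentedEval (sat_lrRel.2 isLRAlg_modelOps) X χ c) p q)
  map_smul' a p := congrArg (fun F : MultilinearMap k (fun _ : X => Model k X) (Model k X) =>
    F (generic k χ)) (map_smul (presentedEval (sat_lrRel.2 isLRAlg_modelOps) X χ c) a p)

theorem genericEval_mk {X : Type} [Finite X] {χ : X → Col} {c : Col} (t : Monomial lrSig χ c) :
    genericEval k χ c (presentedMk (lrRel k) t) = t.1.eval (modelOps k X) (generic k χ) :=
  presentedEval_mk _ t _

/-- The normal forms are a basis of the operad of Lie–Rinehart algebras. -/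
def keyBasis (k : Type u) [Field k] (χ : X → Col) (c : Col) :
    Module.Basis (Key χ c) k ((lieR k).obj X χ c) :=
  Module.Basis.mk (v := fun q : Key χ c => presentedMk (lrRel k) (keyMonomial q))
    (by
      refine LinearIndependent.of_comp (genericEval k χ c) ?_
      convert linearIndependent_keyVal k χ c using 1
      exact funext fun q => (genericEval_mk _).trans (keyMonomial_eval q _))
    (span_keyMonomial k χ c).ge

theorem keyBasis_apply {c : Col} (q : Key χ c) :
    keyBasis k χ c q = presentedMk (lrRel k) (keyMonomial q) :=
  Module.Basis.mk_apply _ _ _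

omit [LinearOrder X] [Fintype X] in
/-- The generic elements detect the operations of Lie–Rinehart algebras. -/
theorem genericEval_injective [Finite X] (χ : X → Col) (c : Col) :
    Function.Injective (genericEval k χ c) := by
  classical
  obtain ⟨n, ⟨e⟩⟩ := Finite.exists_equiv_fin X
  let _ : LinearOrder X := LinearOrder.lift' e e.injective
  let _ : Fintype X := Fintype.ofFinite X
  refine (injective_iff_map_eq_zero _).2 fun p hp => ?_
  have hli : LinearIndependent k (genericEval k χ c ∘ keyBasis k χ c) := by
    convert linearIndependent_keyVal k χ c using 1
    exact funext fun q => (congrArg _ (keyBasis_apply q)).trans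
      ((genericEval_mk _).trans (keyMonomial_eval q _))
  have h := LinearMap.congr_fun ((keyBasis k χ c).constr_self k (genericEval k χ c)) p
  rw [Module.Basis.constr_apply, hp] at h
  exact (keyBasis k χ c).repr.map_eq_zero_iff.1 (linearIndependent_iff.1 hli _ h)

end

/-! ### Values of the operations of the composition -/

section

open SymCollection

variable {k : Type u} [Field k] {Z : Type u} [AddCommGroup Z] [Module k Z] {μ : Ops k LRGen Z}

/-- In a Lie–Rinehart algebra, the commutative algebra with the action of the Lie algebra. -/
def dComOps (μ : Ops k LRGen Z) : Ops k DComGen Z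
  | .α => μ .α
  | .d => μ .d

/-- In a Lie–Rinehart algebra, the Lie algebra. -/
def lieOps (μ : Ops k LRGen Z) : Ops k Unit Z := fun _ => μ .β

/-- The multiplication `m`, made nilpotent by a second copy of the space for its values. -/
def nilOps (μ : Ops k LRGen Z) : Ops k Unit (Z × Z) := fun _ =>
  (((μ .m).compl₁₂ (LinearMap.fst k Z Z) (LinearMap.fst k Z Z))).compr₂ (LinearMap.inr k Z Z)

theorem nilOps_apply (μ : Ops k LRGen Z) (a b : Z × Z) :
    nilOps μ () a b = (0, μ .m a.1 b.1) := rfl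

theorem sat_dComOps (h : IsLRAlg μ) : Sat (S := dComSig) (dComRel k) (dComOps μ) :=
  sat_dComRel.2 h.dCom

theorem sat_lieOps (h : IsLRAlg μ) : Sat (S := lieSig) (lieRel k) (lieOps μ) := sat_lieRel.2 h.lie

theorem sat_nilOps (μ : Ops k LRGen Z) : Sat (S := nilSig) (nilRel k) (nilOps μ) :=
  sat_nilRel fun a b c => by simp [nilOps_apply]

/-- The multilinear operations given by `(DCom¹; Lie)`. -/
def pieceEval (h : IsLRAlg μ) (X : Type) [Finite X] (χ : X → Col) :
    ∀ c : Col, (dComLie k).obj X χ c →ₗ[k] MultilinearMap k (fun _ : X => Z) Z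
  | .s => presentedEval (sat_dComOps h) X χ .s
  | .l => presentedEval (sat_lieOps h) X χ .l

theorem pieceEval_map (h : IsLRAlg μ) {X Y : Type} [Finite X] [Finite Y] (e : X ≃ Y) (χ : Y → Col) :
    ∀ (c : Col) (p : (dComLie k).obj X (χ ∘ e) c) (z : Y → Z),
    pieceEval h Y χ c ((dComLie k).map e χ c p) z =
      pieceEval h X (χ ∘ e) c p fun x => z (e x)
  | .s, p, z => presentedEval_map (sat_dComOps h) e χ .s p z
  | .l, p, z => presentedEval_map (sat_lieOps h) e χ .l p z

/-- The multilinear operations given by `N_m`. -/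
def nilEval (μ : Ops k LRGen Z) (m : ℕ) (ψ : Fin m → Col) (c : Col) :
    (nilM k).obj (Fin m) ψ c →ₗ[k] MultilinearMap k (fun _ : Fin m => Z) Z :=
  (LinearMap.compMultilinearMapₗ k (LinearMap.fst k Z Z + LinearMap.snd k Z Z)).comp
    ((MultilinearMap.compLinearMapₗ fun _ : Fin m => LinearMap.inl k Z Z).comp
      (presentedEval (sat_nilOps μ) (Fin m) ψ c))

theorem nilEval_apply (μ : Ops k LRGen Z) {m : ℕ} {ψ : Fin m → Col} {c : Col}
    (p : (nilM k).obj (Fin m) ψ c) (z : Fin m → Z) :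
    nilEval μ m ψ c p z =
      (presentedEval (sat_nilOps μ) (Fin m) ψ c p fun i => (z i, 0)).1 +
      (presentedEval (sat_nilOps μ) (Fin m) ψ c p fun i => (z i, 0)).2 := rfl

theorem nilEval_map (μ : Ops k LRGen Z) {m : ℕ} (σ : Equiv.Perm (Fin m)) (ψ : Fin m → Col) (c : Col)
    (p : (nilM k).obj (Fin m) (ψ ∘ σ) c) (z : Fin m → Z) :
    nilEval μ m ψ c ((nilM k).map σ ψ c p) z = nilEval μ m (ψ ∘ σ) c p fun i => z (σ i) := by
  rw [nilEval_apply, nilEval_apply]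
  have := presentedEval_map (sat_nilOps μ) σ ψ c p fun i => (z i, 0)
  exact congrArg₂ (· + ·) (congrArg Prod.fst this) (congrArg Prod.snd this)

variable {X : Type} [Finite X]

/-- The value at `z` of an element of a summand of the composition. -/
def summandEval (h : IsLRAlg μ) (z : X → Z) (χ : X → Col) (c : Col) (j : CompIndex Col X) :
    CompSummand (nilM k) (dComLie k) χ c j →ₗ[k] Z :=
  TensorProduct.lift
    ((PiTensorProduct.lift (R := k)).toLinearMap.comp
      ((MultilinearMap.compLinearMapₗ fun i : Fin j.m =>
        { toFun := fun q => pieceEval h {x : X // j.f x = i} (χ ∘ Subtype.val) (j.ψ i) q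
            fun x => z x
          map_add' := fun q q' => by rw [map_add, add_apply]
          map_smul' := fun a q => by rw [map_smul, smul_apply]; rfl }).comp
        (nilEval μ j.m j.ψ c)))

open Classical in
/-- The value at `z` of an operation of the composition. -/
def sumEval (h : IsLRAlg μ) (z : X → Z) (χ : X → Col) (c : Col) :
    CompSum (nilM k) (dComLie k) χ c →ₗ[k] Z :=
  DirectSum.toModule k _ _ (summandEval h z χ c)

theorem sumEval_pure (h : IsLRAlg μ) (z : X → Z) (χ : X → Col) (c : Col) (j : CompIndex Col X)
    (p : (nilM k).obj (Fin j.m) j.ψ c)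
    (q : ∀ i : Fin j.m, (dComLie k).obj {x : X // j.f x = i} (χ ∘ Subtype.val) (j.ψ i)) :
    sumEval h z χ c (compPure (nilM k) (dComLie k) χ c j p q) =
      nilEval μ j.m j.ψ c p fun i => pieceEval h _ _ _ (q i) fun x => z x := by
  classical
  unfold sumEval compPure
  rw [DirectSum.toModule_lof]
  refine (TensorProduct.lift.tmul _ _).trans ?_
  exact PiTensorProduct.lift.tprod _

theorem compRel_le_ker (h : IsLRAlg μ) (z : X → Z) (χ : X → Col) (c : Col) :
    compRel (nilM k) (dComLie k) χ c ≤ LinearMap.ker (sumEval h z χ c) := by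
  refine Submodule.span_le.2 ?_
  rintro _ ⟨m, ψ, f, hf, σ, p, q, rfl⟩
  refine LinearMap.mem_ker.2 ?_
  rw [map_sub, sub_eq_zero, sumEval_pure, sumEval_pure]
  refine Eq.trans ?_ (nilEval_map μ σ ψ c p _).symm
  refine congrArg _ (funext fun i => ?_)
  exact pieceEval_map h (fiberPerm f σ i) (χ ∘ Subtype.val) (ψ (σ i)) (q (σ i)) _

/-- The value at `z` of an operation of the composition. -/
def compEval (h : IsLRAlg μ) (z : X → Z) (χ : X → Col) (c : Col) :
    (comp (nilM k) (dComLie k)).obj X χ c →ₗ[k] Z :=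
  Submodule.liftQ _ (sumEval h z χ c) (compRel_le_ker h z χ c)

/-- The class of a pure tensor in the composition. -/
def compMk (χ : X → Col) (c : Col) (j : CompIndex Col X)
    (p : (nilM k).obj (Fin j.m) j.ψ c)
    (q : ∀ i : Fin j.m, (dComLie k).obj {x : X // j.f x = i} (χ ∘ Subtype.val) (j.ψ i)) :
    (comp (nilM k) (dComLie k)).obj X χ c :=
  (compRel (nilM k) (dComLie k) χ c).mkQ (compPure (nilM k) (dComLie k) χ c j p q)

theorem compEval_compMk (h : IsLRAlg μ) (z : X → Z) (χ : X → Col) (c : Col) (j : CompIndex Col X)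
    (p : (nilM k).obj (Fin j.m) j.ψ c)
    (q : ∀ i : Fin j.m, (dComLie k).obj {x : X // j.f x = i} (χ ∘ Subtype.val) (j.ψ i)) :
    compEval h z χ c (compMk χ c j p q) =
      nilEval μ j.m j.ψ c p fun i => pieceEval h _ _ _ (q i) fun x => z x :=
  (Submodule.liftQ_apply _ _ _).trans (sumEval_pure h z χ c j p q)

theorem comp_ext {χ : X → Col} {c : Col} {M : Type u} [AddCommGroup M] [Module k M]
    {F G : (comp (nilM k) (dComLie k)).obj X χ c →ₗ[k] M}
    (h : ∀ j p q, F (compMk χ c j p q) = G (compMk χ c j p q)) : F = G := by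
  have := compSum_ext (nilM k) (dComLie k)
    (F := F.comp (compRel (nilM k) (dComLie k) χ c).mkQ)
    (G := G.comp (compRel (nilM k) (dComLie k) χ c).mkQ) h
  refine LinearMap.ext fun p => ?_
  obtain ⟨p, rfl⟩ := Submodule.mkQ_surjective _ p
  exact LinearMap.congr_fun this p

theorem compEval_map (h : IsLRAlg μ) {X Y : Type} [Finite X] [Finite Y] (e : X ≃ Y) (z : Y → Z)
    (χ : Y → Col) (c : Col) (p : (comp (nilM k) (dComLie k)).obj X (χ ∘ e) c) :
    compEval h z χ c ((comp (nilM k) (dComLie k)).map e χ c p) =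
      compEval h (fun x => z (e x)) (χ ∘ e) c p := by
  have : (compEval h z χ c).comp ((comp (nilM k) (dComLie k)).map e χ c) =
      compEval h (fun x => z (e x)) (χ ∘ e) c := by
    refine comp_ext fun j p q => ?_
    have hmap : (comp (nilM k) (dComLie k)).map e χ c (compMk (χ ∘ e) c j p q) =
        compMk χ c (j.map e) p
          (fun i => (dComLie k).map (fiberMap j.f e i) (χ ∘ Subtype.val) (j.ψ i) (q i)) :=
      congrArg (compRel (nilM k) (dComLie k) χ c).mkQ
        (compSumMap_pure (nilM k) (dComLie k) e χ c j p q)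
    rw [LinearMap.comp_apply, hmap, compEval_compMk, compEval_compMk]
    refine congrArg _ (funext fun i => ?_)
    exact pieceEval_map h (fiberMap j.f e i) (χ ∘ Subtype.val) (j.ψ i) (q i) _
  exact LinearMap.congr_fun this p

theorem compMk_perm (χ : X → Col) (c : Col) {m : ℕ} (ψ : Fin m → Col) (f : X → Fin m)
    (hf : Function.Surjective f) (σ : Equiv.Perm (Fin m)) (p : (nilM k).obj (Fin m) (ψ ∘ σ) c)
    (q : ∀ j : Fin m, (dComLie k).obj {x : X // σ (f x) = j} (χ ∘ Subtype.val) (ψ j)) :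
    compMk χ c (⟨m, ψ, σ ∘ f, σ.surjective.comp hf⟩ : CompIndex Col X)
      ((nilM k).map σ ψ c p) q =
    compMk χ c (⟨m, ψ ∘ σ, f, hf⟩ : CompIndex Col X) p
      (fun i => (dComLie k).map (fiberPerm f σ i) (χ ∘ Subtype.val) (ψ (σ i)) (q (σ i))) :=
  ((Submodule.Quotient.eq (compRel (nilM k) (dComLie k) χ c)).2
    (Submodule.subset_span ⟨m, ψ, f, hf, σ, p, q, rfl⟩)).symm

end

/-! ### Normal forms of the two factors -/

section

/-- Transport of keys along maps of labels. -/
def keyMap {X Y : Type} (g : X → Y) (q : Multiset (X × List X) × List X) :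
    Multiset (Y × List Y) × List Y :=
  (q.1.map (Prod.map g (List.map g)), q.2.map g)

variable {X Y : Type}

theorem pairLabels_map (g : X → Y) (S : Multiset (X × List X)) :
    pairLabels (S.map (Prod.map g (List.map g))) = (pairLabels S).map g := by
  simp only [pairLabels, Multiset.map_add, Multiset.map_map, Multiset.map_bind, Multiset.bind_map]
  rfl

theorem pairsColoured_map (g : X → Y) (χ : Y → Col) (S : Multiset (X × List X)) :
    PairsColoured χ (S.map (Prod.map g (List.map g))) ↔ PairsColoured (χ ∘ g) S := by
  simp only [PairsColoured, Multiset.forall_mem_map_iff, Prod.map_fst, Prod.map_snd,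
    List.forall_mem_map, Function.comp_apply]

theorem keyMap_injective {g : X → Y} (hg : Function.Injective g) :
    Function.Injective (keyMap g) := by
  rintro ⟨S, v⟩ ⟨S', v'⟩ h
  obtain ⟨h1, h2⟩ := Prod.mk.inj h
  exact Prod.ext (Multiset.map_injective (hg.prodMap (List.map_injective_iff.2 hg)) h1)
    (List.map_injective_iff.2 hg h2)

theorem exists_keyMap_val {P : X → Prop} {q : Multiset (X × List X) × List X}
    (h : ∀ x ∈ pairLabels q.1 + (q.2 : Multiset X), P x) :
    ∃ q' : Multiset ({x // P x} × List {x // P x}) × List {x // P x},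
      keyMap Subtype.val q' = q := by
  obtain ⟨S, v⟩ := q
  have hlist : ∀ w : List X, (∀ y ∈ w, P y) → ∃ w' : List {x // P x}, w'.map Subtype.val = w :=
    fun w hw => by lift w to List {x // P x} using hw; exact ⟨w, rfl⟩
  have hS : ∀ S : Multiset (X × List X), (∀ x ∈ pairLabels S, P x) →
      ∃ S' : Multiset ({x // P x} × List {x // P x}),
        S'.map (Prod.map Subtype.val (List.map Subtype.val)) = S := by
    intro S
    induction S using Multiset.induction with
    | empty => exact fun _ => ⟨0, rfl⟩
    | cons p S ih =>
      intro h
      rw [← Multiset.singleton_add, pairLabels_add] at h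
      obtain ⟨S', rfl⟩ := ih fun x hx => h x (Multiset.mem_add.2 (Or.inr hx))
      obtain ⟨x, w⟩ := p
      have hx : P x := h x (Multiset.mem_add.2 (Or.inl (by simp [pairLabels])))
      obtain ⟨w', rfl⟩ := hlist w fun y hy =>
        h y (Multiset.mem_add.2 (Or.inl (by simp [pairLabels]; exact Or.inr (by simpa using hy))))
      exact ⟨(⟨x, hx⟩, w') ::ₘ S', by simp⟩
  obtain ⟨S', hS'⟩ := hS S fun x hx => h x (Multiset.mem_add.2 (Or.inl hx))
  obtain ⟨v', hv'⟩ := hlist v fun x hx => h x (Multiset.mem_add.2 (Or.inr hx))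
  exact ⟨(S', v'), Prod.ext hS' hv'⟩

variable {k : Type u} [Field k]

theorem chainVal_map {Z : Type v} [AddCommGroup Z] [Module k Z] (g : X → Y) (z : Y → Z)
    (d : Z →ₗ[k] Z →ₗ[k] Z) (x : X) (w : List X) :
    chainVal z d (g x) (w.map g) = chainVal (fun x => z (g x)) d x w := by
  induction w with
  | nil => rfl
  | cons y w ih => rw [List.map_cons, chainVal, ih]; rfl

theorem keyVal_keyMap {Z : Type v} [AddCommGroup Z] [Module k Z] {μ : Ops k LRGen Z}
    (h : IsLRAlg μ) (g : X → Y) (z : Y → Z) (q : Multiset (X × List X) × List X) :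
    keyVal z μ (keyMap g q) = keyVal (fun x => z (g x)) μ q := by
  classical
  obtain ⟨S, v⟩ := q
  induction S using Quotient.inductionOn with
  | h ps =>
    have h1 : chainsVal z (μ .α) (μ .d)
        (((ps : Multiset (X × List X)).map (Prod.map g (List.map g))).toList) =
        chainsVal (fun x => z (g x)) (μ .α) (μ .d) (ps : Multiset (X × List X)).toList := by
      rw [Multiset.map_coe, chainsVal_toList h.dCom, chainsVal_toList h.dCom, chainsVal, chainsVal,
        List.map_map]
      congr 1
      refine List.map_congr_left fun p _ => ?_
      exact chainVal_map g z _ p.1 p.2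
    have h2 : ∀ a v, combVal z (μ .β) a (v.map g) = combVal (fun x => z (g x)) (μ .β) a v :=
      fun a v => by simp [combVal, List.foldl_map]
    cases v with
    | nil => exact h1
    | cons x v =>
      change (if _ then _ else _) = (if _ then _ else _)
      refine if_congr ?_ (h2 _ _) (congrArg₂ (fun a b => μ .m a b) h1 (h2 _ _))
      exact Multiset.map_eq_zero (s := (ps : Multiset (X × List X))) (f := Prod.map g (List.map g))

variable [LinearOrder X] [Fintype X]

/-- Keys of normal forms without multiplications of brackets by functions. -/
abbrev PieceKey (χ : X → Col) (c : Col) : Type :=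
  {q : Multiset (X × List X) × List X // IsKey χ c q ∧ (c = .l → q.1 = 0)}

omit [Fintype X] in
theorem minHead_cons {x : X} {v : List X} : MinHead (x :: v) ↔ ∀ y ∈ v, x ≤ y :=
  ⟨fun ⟨_, _, h, h'⟩ => by obtain ⟨rfl, rfl⟩ := List.cons_eq_cons.1 h; exact h',
    fun h => ⟨x, v, rfl, h⟩⟩

omit [Fintype X] in
theorem minHead_map_val {P : X → Prop} {v : List {x // P x}} :
    MinHead (v.map Subtype.val) ↔ MinHead v := by
  cases v with
  | nil => simp [MinHead]
  | cons x v => rw [List.map_cons, minHead_cons, minHead_cons, List.forall_mem_map]; rfl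

/-- Keys on a subset, in terms of the whole set. -/
theorem isKey_val_iff {P : X → Prop} [DecidablePred P] {χ : X → Col} {c : Col}
    {q : Multiset ({x // P x} × List {x // P x}) × List {x // P x}} :
    IsKey (χ ∘ Subtype.val) c q ↔
      (pairLabels (keyMap Subtype.val q).1 + ((keyMap Subtype.val q).2 : Multiset X) =
        (Finset.univ.filter P).val ∧ PairsColoured χ (keyMap Subtype.val q).1 ∧
        (∀ y ∈ (keyMap Subtype.val q).2, χ y = .l) ∧
        match c with
        | .s => (keyMap Subtype.val q).1 ≠ 0 ∧ (keyMap Subtype.val q).2 = []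
        | .l => MinHead (keyMap Subtype.val q).2) := by
  obtain ⟨S, v⟩ := q
  have h1 : pairLabels (keyMap Subtype.val (S, v)).1 +
      ((keyMap Subtype.val (S, v)).2 : Multiset X) =
      (pairLabels S + (v : Multiset {x // P x})).map Subtype.val := by
    rw [Multiset.map_add, keyMap, pairLabels_map]; rfl
  have h2 : (Finset.univ.filter P).val =
      (Finset.univ : Finset {x // P x}).val.map Subtype.val := by
    refine (Multiset.Nodup.ext (Finset.nodup _)
      ((Finset.nodup _).map Subtype.val_injective)).2 fun x => ?_
    simp
  rw [h1, h2, (Multiset.map_injective Subtype.val_injective).eq_iff, keyMap, pairsColoured_map]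
  constructor
  · rintro ⟨a, b, c', d⟩
    refine ⟨a, b, by simpa using c', ?_⟩
    cases c with
    | s => exact ⟨fun h => d.1 (Multiset.map_eq_zero.1 h), List.map_eq_nil_iff.2 d.2⟩
    | l => exact minHead_map_val.2 d
  · rintro ⟨a, b, c', d⟩
    refine ⟨a, b, by simpa using c', ?_⟩
    cases c with
    | s => exact ⟨fun h => d.1 (Multiset.map_eq_zero.2 h), List.map_eq_nil_iff.1 d.2⟩
    | l => exact minHead_map_val.1 d

variable {k : Type u} [Field k]

variable {χ : X → Col}

theorem PieceKey.isMonomial_s (q : PieceKey χ .s) [Nonempty X] :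
    IsMonomial dComSig χ .s (chainsTree .α .d q.1.1.toList) := by
  obtain ⟨⟨S, v⟩, h, -⟩ := q
  obtain ⟨hne, rfl⟩ := h.out
  refine isMonomial_of_leaves (chainsTree_isColoured rfl rfl rfl rfl rfl rfl (by simpa using hne)
    (by rw [Multiset.coe_toList]; exact h.coloured)) ?_
  refine (chainsTree_leaves (X := X) DComGen.α DComGen.d (ps := S.toList)
    (by simpa using hne)).trans ?_
  rw [Multiset.coe_toList]
  simpa using h.labels

theorem PieceKey.isMonomial_l (q : PieceKey χ .l) [Nonempty X] :
    IsMonomial lieSig χ .l (combTree () q.1.2) := by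
  obtain ⟨⟨S, v⟩, h, h'⟩ := q
  obtain rfl : S = 0 := h' rfl
  refine isMonomial_of_leaves (combTree_isColoured rfl rfl rfl h.out.ne_nil h.coloured') ?_
  refine (congrArg _ (combTree_leaves (X := X) () h.out.ne_nil)).trans ?_
  simpa [pairLabels] using h.labels

/-- The normal forms of `(DCom¹; Lie)`. -/
def pieceMk (k : Type u) [Field k] :
    ∀ {c : Col} (_ : PieceKey χ c), (dComLie k).obj X χ c
  | .s, q => haveI := q.2.1.nonempty
    presentedMk (dComRel k) ⟨_, q.isMonomial_s⟩
  | .l, q => haveI := q.2.1.nonempty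
    presentedMk (lieRel k) ⟨_, q.isMonomial_l⟩

theorem pieceEval_pieceMk {Z : Type u} [AddCommGroup Z] [Module k Z] {μ : Ops k LRGen Z}
    (h : IsLRAlg μ) (z : X → Z) {c : Col} (q : PieceKey χ c) :
    pieceEval h X χ c (pieceMk k q) z = keyVal z μ q.1 := by
  have := q.2.1.nonempty
  obtain ⟨⟨S, v⟩, hq, hq'⟩ := q
  cases c with
  | s =>
    obtain ⟨hne, rfl⟩ := hq.out
    refine (presentedEval_mk (sat_dComOps h) _ _).trans ?_
    exact chainsTree_eval (dComOps μ) _ _ (by simpa using hne)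
  | l =>
    obtain rfl : S = 0 := hq' rfl
    obtain ⟨x, v, rfl, -⟩ := hq.out
    refine (presentedEval_mk (sat_lieOps h) _ _).trans ?_
    refine (combTree_eval (lieOps μ) _ _ _).trans ?_
    simp [keyVal, lieOps]

/-- The operations of `DCom¹` are spanned by products of chains (Leibniz rule), and those of `Lie` by
the combs that begin with the smallest input (Jacobi identity). -/
theorem span_pieceMk (k : Type u) [Field k] (χ : X → Col) (c : Col) :
    Submodule.span k (Set.range fun q : PieceKey χ c => pieceMk k q) = ⊤ := by
  cases c with
  | s =>
    refine eq_top_iff.2 ((span_presentedMk (dComRel k) X χ .s).ge.trans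
      (Submodule.span_le.2 ?_))
    rintro _ ⟨t, rfl⟩
    refine presentedMk_mem_span wellFormed_dComRel
      (fun q : PieceKey χ .s => haveI := q.2.1.nonempty; ⟨_, q.isMonomial_s⟩) t
      fun Z _ _ μ hμ z => ?_
    have h := sat_dComRel.1 hμ
    refine Submodule.span_mono ?_ (dCom_eval_mem h t.2.1)
    rintro _ ⟨ps, hne, hlab, hcol, rfl⟩
    have : Nonempty X := ⟨(ps.head hne).1⟩
    refine ⟨⟨(↑ps, []), ⟨by simpa using hlab.trans t.2.leaves_eq, hcol, by simp,
      by simpa using hne, rfl⟩, by simp⟩, ?_⟩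
    refine (@chainsTree_eval _ _ _ _ _ _ _ _ _ μ _ _ _ (by simpa using hne)).trans ?_
    exact chainsVal_toList h ps
  | l =>
    refine eq_top_iff.2 ((span_presentedMk (lieRel k) X χ .l).ge.trans
      (Submodule.span_le.2 ?_))
    rintro _ ⟨t, rfl⟩
    refine presentedMk_mem_span wellFormed_lieRel
      (fun q : PieceKey χ .l => haveI := q.2.1.nonempty; ⟨_, q.isMonomial_l⟩) t
      fun Z _ _ μ hμ z => ?_
    have h := sat_lieRel.1 hμ
    have hL := t.2.leaves_eq
    obtain ⟨x, M, hM, hx⟩ := exists_minHead (L := (t.1.leaves : Multiset X))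
      (by simpa using t.1.leaves_ne_nil)
    refine Submodule.span_mono ?_ (lie_mem_span_comb h t.1 hM)
    have key : ∀ (t : OpTree Unit X), t.IsColoured lieSig χ .l → ∀ y ∈ t.leaves, χ y = .l := by
      intro t
      induction t with
      | leaf x => intro ht y hy; obtain rfl : y = x := by simpa [OpTree.leaves] using hy
                  exact ht
      | node g l r hl hr =>
        exact fun ht y hy => (List.mem_append.1 hy).elim (hl ht.2.1 y) (hr ht.2.2 y)
    have hcol : ∀ y : X, χ y = .l := fun y => key t.1 t.2.1 y (t.2.2.2 y)
    rintro _ ⟨v, rfl, rfl⟩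
    have : Nonempty X := ⟨x⟩
    refine ⟨⟨(0, x :: v), ⟨by simpa [pairLabels] using (hL.symm.trans hM).symm,
      by simp [PairsColoured], fun y _ => hcol y, x, v, rfl, by simpa using hx⟩, by simp⟩, ?_⟩
    exact @combTree_eval _ _ _ _ _ _ _ _ _ μ () x v

end

/-! ### The isomorphism with the composition -/

/-- The values of a multilinear map are combinations of those on spanning sets. -/
theorem multilinear_mem_span {k : Type u} [Field k] {ι : Type} [Fintype ι] {M : ι → Type v}
    {N : Type w} [∀ i, AddCommGroup (M i)] [∀ i, Module k (M i)] [AddCommGroup N] [Module k N]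
    (F : MultilinearMap k M N) (s : ∀ i, Set (M i)) (hs : ∀ i, Submodule.span k (s i) = ⊤)
    (q : ∀ i, M i) : F q ∈ Submodule.span k {a | ∃ r : ∀ i, M i, (∀ i, r i ∈ s i) ∧ a = F r} := by
  classical
  have key : ∀ (T : Finset ι) (q : ∀ i, M i), (∀ i ∉ T, q i ∈ s i) →
      F q ∈ Submodule.span k {a | ∃ r : ∀ i, M i, (∀ i, r i ∈ s i) ∧ a = F r} := by
    intro T
    induction T using Finset.induction_on with
    | empty => exact fun q hq => Submodule.subset_span ⟨q, fun i => hq i (by simp), rfl⟩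
    | insert i T hi ih =>
      intro q hq
      have hqi : q i ∈ Submodule.span k (s i) := by rw [hs]; trivial
      have := linear_mem_of_span
        (p := Submodule.span k {a | ∃ r : ∀ i, M i, (∀ i, r i ∈ s i) ∧ a = F r}) (f := F.toLinearMap q i)
        (fun a ha => ?_) hqi
      · simpa using this
      · refine ih _ fun j hj => ?_
        rcases eq_or_ne j i with rfl | hne
        · simpa using ha
        · rw [Function.update_of_ne hne]
          exact hq j (by simp [hne, hj])
  exact key Finset.univ q (by simp)

section

open SymCollection

variable {k : Type u} [Field k] {X : Type} [Finite X] {χ : X → Col} {c : Col}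

/-- Pure tensors depend multilinearly on the second factor. -/
def compMkMultilinear (χ : X → Col) (c : Col) (j : CompIndex Col X)
    (p : (nilM k).obj (Fin j.m) j.ψ c) :
    MultilinearMap k
      (fun i : Fin j.m => (dComLie k).obj {x : X // j.f x = i} (χ ∘ Subtype.val) (j.ψ i))
      ((comp (nilM k) (dComLie k)).obj X χ c) :=
  haveI := Classical.decEq (CompIndex Col X)
  LinearMap.compMultilinearMap
    (((compRel (nilM k) (dComLie k) χ c).mkQ.comp
      (DirectSum.lof k (CompIndex Col X) (CompSummand (nilM k) (dComLie k) χ c) j)).comp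
      (TensorProduct.mk k _ _ p)) (PiTensorProduct.tprod k)

theorem compMkMultilinear_apply (j : CompIndex Col X) (p : (nilM k).obj (Fin j.m) j.ψ c)
    (q : ∀ i : Fin j.m, (dComLie k).obj {x : X // j.f x = i} (χ ∘ Subtype.val) (j.ψ i)) :
    compMkMultilinear χ c j p q = compMk χ c j p q := by
  unfold compMkMultilinear compMk compPure
  rfl

/-- Pure tensors depend linearly on the first factor. -/
def compMkLinear (χ : X → Col) (c : Col) (j : CompIndex Col X)
    (q : ∀ i : Fin j.m, (dComLie k).obj {x : X // j.f x = i} (χ ∘ Subtype.val) (j.ψ i)) :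
    (nilM k).obj (Fin j.m) j.ψ c →ₗ[k] (comp (nilM k) (dComLie k)).obj X χ c :=
  haveI := Classical.decEq (CompIndex Col X)
  ((compRel (nilM k) (dComLie k) χ c).mkQ.comp
      (DirectSum.lof k (CompIndex Col X) (CompSummand (nilM k) (dComLie k) χ c) j)).comp
      ((TensorProduct.mk k _ _).flip (PiTensorProduct.tprod k q))

theorem compMkLinear_apply (j : CompIndex Col X) (p : (nilM k).obj (Fin j.m) j.ψ c)
    (q : ∀ i : Fin j.m, (dComLie k).obj {x : X // j.f x = i} (χ ∘ Subtype.val) (j.ψ i)) :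
    compMkLinear χ c j q p = compMk χ c j p q := by
  unfold compMkLinear compMk compPure
  rfl

theorem nilEval_leaf {Z : Type u} [AddCommGroup Z] [Module k Z] (μ : Ops k LRGen Z) {m : ℕ}
    {ψ : Fin m → Col} {i : Fin m} (h : IsMonomial nilSig ψ c (.leaf i)) (z : Fin m → Z) :
    nilEval μ m ψ c (presentedMk (nilRel k) ⟨.leaf i, h⟩) z = z i := by
  have h1 := presentedEval_mk (sat_nilOps μ) ⟨.leaf i, h⟩ fun i => (z i, 0)
  have h2 : (OpTree.leaf i : OpTree Unit (Fin m)).eval (nilOps μ) (fun i => (z i, 0)) = (z i, 0) :=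
    rfl
  exact (congrArg (fun a : Z × Z => a.1 + a.2) (h1.trans h2)).trans (add_zero _)

theorem nilEval_node {Z : Type u} [AddCommGroup Z] [Module k Z] (μ : Ops k LRGen Z) {m : ℕ}
    {ψ : Fin m → Col} {i j : Fin m} (h : IsMonomial nilSig ψ c (.node () (.leaf i) (.leaf j)))
    (z : Fin m → Z) :
    nilEval μ m ψ c (presentedMk (nilRel k) ⟨.node () (.leaf i) (.leaf j), h⟩) z =
      μ .m (z i) (z j) := by
  have h1 := presentedEval_mk (sat_nilOps μ) ⟨.node () (.leaf i) (.leaf j), h⟩ fun i => (z i, 0)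
  have h2 : (OpTree.node () (.leaf i) (.leaf j) : OpTree Unit (Fin m)).eval (nilOps μ)
      (fun i => (z i, 0)) = (0, μ .m (z i) (z j)) := rfl
  exact (congrArg (fun a : Z × Z => a.1 + a.2) (h1.trans h2)).trans (zero_add _)

/-- In `N_m`, all monomials with more than one vertex vanish. -/
theorem nil_monomial (k : Type u) [Field k] (t : Monomial nilSig χ c) :
    presentedMk (nilRel k) t = 0 ∨ (∃ i, t.1 = .leaf i) ∨
      ∃ i j, t.1 = .node () (.leaf i) (.leaf j) := by
  obtain ⟨t, ht⟩ := t
  cases t with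
  | leaf i => exact Or.inr (Or.inl ⟨i, rfl⟩)
  | node g l r =>
    cases l with
    | node g' l' r' => cases ht.1.2.1.1
    | leaf i =>
      cases r with
      | leaf j => exact Or.inr (Or.inr ⟨i, j, rfl⟩)
      | node g' l' r' =>
        refine Or.inl (presented_eq_zero wellFormed_nilRel ?_)
        refine (presentedEval_mk _ _ _).trans ?_
        have h := sat_freeOps (wellFormed_nilRel (k := k)) χ _ rfl
        exact (evalLin_mon _ ![_, _, _] _).symm.trans (h ![_, _, _])

end

section

open SymCollection

variable {k : Type u} [Field k] {X : Type} [LinearOrder X] [Fintype X] {χ : X → Col} {c : Col}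

theorem isMonomial_nilLeaf (c : Col) :
    IsMonomial nilSig (fun _ : Fin 1 => c) c (.leaf (0 : Fin 1)) :=
  ⟨rfl, by simp [OpTree.leaves], fun x => by simp [OpTree.leaves, Subsingleton.elim x 0]⟩

theorem isMonomial_nilNode :
    IsMonomial nilSig ![Col.s, Col.l] .l (.node () (.leaf (0 : Fin 2)) (.leaf 1)) :=
  ⟨⟨rfl, rfl, rfl⟩, by simp [OpTree.leaves], fun x => by fin_cases x <;> simp [OpTree.leaves]⟩

/-- The normal forms of the composition without the operation `m`. -/
def stdOne (k : Type u) [Field k] (f : X → Fin 1) (hf : Function.Surjective f)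
    (q : ∀ i : Fin 1, PieceKey (X := {x // f x = i}) (χ ∘ Subtype.val) c) :
    (comp (nilM k) (dComLie k)).obj X χ c :=
  compMk χ c (⟨1, fun _ => c, f, hf⟩ : CompIndex Col X)
    (presentedMk (nilRel k) ⟨_, isMonomial_nilLeaf c⟩) fun i => pieceMk k (q i)

/-- The normal forms of the composition with the operation `m`. -/
def stdTwo (k : Type u) [Field k] (f : X → Fin 2) (hf : Function.Surjective f)
    (q : ∀ i : Fin 2, PieceKey (X := {x // f x = i}) (χ ∘ Subtype.val) (![Col.s, Col.l] i)) :
    (comp (nilM k) (dComLie k)).obj X χ .l :=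
  compMk χ .l (⟨2, ![.s, .l], f, hf⟩ : CompIndex Col X)
    (presentedMk (nilRel k) ⟨_, isMonomial_nilNode⟩) fun i => pieceMk k (q i)

/-- `IsStd b q`: `b` is a normal form of the composition, with key `q`. -/
def IsStd (k : Type u) [Field k] (χ : X → Col) :
    ∀ c : Col, (comp (nilM k) (dComLie k)).obj X χ c → Multiset (X × List X) × List X → Prop
  | .s, b, q => ∃ f hf r, b = stdOne k f hf r ∧ q = keyMap Subtype.val (r 0).1
  | .l, b, q => (∃ f hf r, b = stdOne k f hf r ∧ q = keyMap Subtype.val (r 0).1) ∨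
    ∃ f hf r, b = stdTwo k f hf r ∧
      q = ((keyMap Subtype.val (r 0).1).1, (keyMap Subtype.val (r 1).1).2)

theorem IsStd.one (f : X → Fin 1) (hf : Function.Surjective f)
    (r : ∀ i : Fin 1, PieceKey (X := {x // f x = i}) (χ ∘ Subtype.val) c) :
    IsStd k χ c (stdOne k f hf r) (keyMap Subtype.val (r 0).1) := by
  cases c with
  | s => exact ⟨f, hf, r, rfl, rfl⟩
  | l => exact Or.inl ⟨f, hf, r, rfl, rfl⟩

theorem stdOne_eval {Z : Type u} [AddCommGroup Z] [Module k Z] {μ : Ops k LRGen Z}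
    (h : IsLRAlg μ) (z : X → Z) (f : X → Fin 1) (hf : Function.Surjective f)
    (r : ∀ i : Fin 1, PieceKey (X := {x // f x = i}) (χ ∘ Subtype.val) c) :
    compEval h z χ c (stdOne k f hf r) = keyVal z μ (keyMap Subtype.val (r 0).1) := by
  refine (compEval_compMk h z χ c _ _ _).trans ?_
  refine (nilEval_leaf μ _ _).trans ?_
  rw [keyVal_keyMap h]
  exact pieceEval_pieceMk h _ (r 0)

theorem stdTwo_eval {Z : Type u} [AddCommGroup Z] [Module k Z] {μ : Ops k LRGen Z}
    (h : IsLRAlg μ) (z : X → Z) (f : X → Fin 2) (hf : Function.Surjective f)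
    (r : ∀ i : Fin 2, PieceKey (X := {x // f x = i}) (χ ∘ Subtype.val) (![Col.s, Col.l] i)) :
    compEval h z χ .l (stdTwo k f hf r) =
      keyVal z μ ((keyMap Subtype.val (r 0).1).1, (keyMap Subtype.val (r 1).1).2) := by
  refine (compEval_compMk h z χ .l _ _ _).trans ?_
  refine (nilEval_node μ _ _).trans ?_
  have h0 := (pieceEval_pieceMk h (fun x : {x // f x = 0} => z x) (r 0)).trans
    (keyVal_keyMap h Subtype.val z (r 0).1).symm
  have h1 := (pieceEval_pieceMk h (fun x : {x // f x = 1} => z x) (r 1)).trans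
    (keyVal_keyMap h Subtype.val z (r 1).1).symm
  refine (congrArg₂ (fun a b => μ .m a b) h0 h1).trans ?_
  obtain ⟨⟨S, v⟩, hr0, -⟩ := r 0
  obtain ⟨⟨S', v'⟩, hr1, hr1'⟩ := r 1
  obtain ⟨hne, rfl⟩ := hr0.out
  obtain rfl : S' = 0 := hr1' rfl
  obtain ⟨x, v', rfl, -⟩ := hr1.out
  simp only [keyMap, keyVal, List.map_cons, List.map_nil, Multiset.map_zero]
  rw [if_pos trivial, if_neg (by simpa using hne)]

theorem IsStd.eval {Z : Type u} [AddCommGroup Z] [Module k Z] {μ : Ops k LRGen Z}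
    (h : IsLRAlg μ) (z : X → Z) {b : (comp (nilM k) (dComLie k)).obj X χ c}
    {q : Multiset (X × List X) × List X} (hb : IsStd k χ c b q) :
    compEval h z χ c b = keyVal z μ q := by
  cases c with
  | s =>
    obtain ⟨f, hf, r, rfl, rfl⟩ := hb
    exact stdOne_eval h z f hf r
  | l =>
    rcases hb with ⟨f, hf, r, rfl, rfl⟩ | ⟨f, hf, r, rfl, rfl⟩
    · exact stdOne_eval h z f hf r
    · exact stdTwo_eval h z f hf r

theorem stdOne_isKey (f : X → Fin 1)
    (r : ∀ i : Fin 1, PieceKey (X := {x // f x = i}) (χ ∘ Subtype.val) c) :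
    IsKey χ c (keyMap Subtype.val (r 0).1) := by
  obtain ⟨h1, h2, h3, h4⟩ := isKey_val_iff.1 (r 0).2.1
  refine ⟨h1.trans ?_, h2, h3, h4⟩
  rw [Finset.filter_true_of_mem fun x _ => Subsingleton.elim _ _]

theorem stdTwo_isKey (f : X → Fin 2)
    (r : ∀ i : Fin 2, PieceKey (X := {x // f x = i}) (χ ∘ Subtype.val) (![Col.s, Col.l] i)) :
    IsKey χ .l ((keyMap Subtype.val (r 0).1).1, (keyMap Subtype.val (r 1).1).2) := by
  obtain ⟨h1, h2, h3, h4⟩ := isKey_val_iff.1 (r 0).2.1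
  obtain ⟨h1', h2', h3', h4'⟩ := isKey_val_iff.1 (r 1).2.1
  have h5 : (keyMap Subtype.val (r 0).1).2 = [] := h4.2
  have h6 : (keyMap Subtype.val (r 1).1).1 = 0 := by
    rw [keyMap, (r 1).2.2 rfl]; rfl
  rw [h5] at h1
  rw [h6] at h1'
  refine ⟨?_, h2, h3', h4'⟩
  have h1 : pairLabels (keyMap Subtype.val (r 0).1).1 =
      (Finset.univ.filter fun x => f x = 0).val := by simpa using h1
  have h1' : ((keyMap Subtype.val (r 1).1).2 : Multiset X) =
      (Finset.univ.filter fun x => f x = 1).val := by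
    simpa [pairLabels] using h1'
  dsimp only
  rw [h1, h1', Finset.filter_val, Finset.filter_val]
  refine Eq.trans ?_ (Multiset.filter_add_not (fun x => f x = 0) Finset.univ.val)
  congr 1
  refine Multiset.filter_congr fun x _ => ?_
  omega

theorem IsStd.isKey {b : (comp (nilM k) (dComLie k)).obj X χ c}
    {q : Multiset (X × List X) × List X} (hb : IsStd k χ c b q) : IsKey χ c q := by
  cases c with
  | s =>
    obtain ⟨f, hf, r, -, rfl⟩ := hb
    exact stdOne_isKey f r
  | l =>
    rcases hb with ⟨f, hf, r, -, rfl⟩ | ⟨f, hf, r, -, rfl⟩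
    · exact stdOne_isKey f r
    · exact stdTwo_isKey f r

/-- A key occurs in only one way in the composition: the word of the key consists of the inputs of
the second factor of `m`. -/
theorem IsStd.unique {b b' : (comp (nilM k) (dComLie k)).obj X χ c}
    {q : Multiset (X × List X) × List X} (hb : IsStd k χ c b q) (hb' : IsStd k χ c b' q) :
    b = b' := by
  have one : ∀ (f f' : X → Fin 1) hf hf'
      (r : ∀ i : Fin 1, PieceKey (X := {x // f x = i}) (χ ∘ Subtype.val) c)
      (r' : ∀ i : Fin 1, PieceKey (X := {x // f' x = i}) (χ ∘ Subtype.val) c),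
      keyMap Subtype.val (r 0).1 = keyMap Subtype.val (r' 0).1 →
      stdOne k f hf r = stdOne k f' hf' r' := by
    intro f f' hf hf' r r' h
    obtain rfl : f = f' := Subsingleton.elim _ _
    have : r = r' := funext fun i => by
      obtain rfl : i = 0 := Subsingleton.elim _ _
      exact Subtype.ext (keyMap_injective Subtype.val_injective h)
    rw [this]
  cases c with
  | s =>
    obtain ⟨f, hf, r, rfl, rfl⟩ := hb
    obtain ⟨f', hf', r', rfl, h⟩ := hb'
    exact one f f' hf hf' r r' h
  | l =>
    -- whether the operation `m` occurs is determined by the first component of the key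
    have h1 : ∀ (f : X → Fin 1)
        (r : ∀ i : Fin 1, PieceKey (X := {x // f x = i}) (χ ∘ Subtype.val) Col.l),
        (keyMap Subtype.val (r 0).1).1 = 0 := fun f r => by
      rw [keyMap, (r 0).2.2 rfl]; rfl
    have h2 : ∀ (f : X → Fin 2)
        (r : ∀ i : Fin 2, PieceKey (X := {x // f x = i}) (χ ∘ Subtype.val) (![Col.s, Col.l] i)),
        (keyMap Subtype.val (r 0).1).1 ≠ 0 := fun f r => (isKey_val_iff.1 (r 0).2.1).2.2.2.1
    rcases hb with ⟨f, hf, r, rfl, rfl⟩ | ⟨f, hf, r, rfl, rfl⟩ <;>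
      rcases hb' with ⟨f', hf', r', rfl, h⟩ | ⟨f', hf', r', rfl, h⟩
    · exact one f f' hf hf' r r' h
    · exact absurd ((congrArg Prod.fst h).symm.trans (h1 f r)) (h2 f' r')
    · exact absurd ((congrArg Prod.fst h).trans (h1 f' r')) (h2 f r)
    · obtain ⟨h3, h4⟩ := Prod.mk.inj h
      have mem : ∀ (f : X → Fin 2)
          (r : ∀ i : Fin 2, PieceKey (X := {x // f x = i}) (χ ∘ Subtype.val)
            (![Col.s, Col.l] i)) (x : X), x ∈ (keyMap Subtype.val (r 1).1).2 ↔ f x = 1 := by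
        intro f r x
        have h5 := (isKey_val_iff.1 (r 1).2.1).1
        have h6 : (keyMap Subtype.val (r 1).1).1 = 0 := by
          rw [keyMap, (r 1).2.2 rfl]; rfl
        rw [h6] at h5
        have h5 : ((keyMap Subtype.val (r 1).1).2 : Multiset X) =
            (Finset.univ.filter fun x => f x = 1).val := by
          simpa [pairLabels] using h5
        rw [← Multiset.mem_coe, h5]
        simp
      obtain rfl : f = f' := funext fun x => by
        have h5 := mem f r x
        rw [h4, mem f' r' x] at h5
        omega
      have : r = r' := funext fun i => by
        fin_cases i
        · refine Subtype.ext (keyMap_injective Subtype.val_injective (Prod.ext h3 ?_))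
          exact ((isKey_val_iff.1 (r 0).2.1).2.2.2.2).trans
            ((isKey_val_iff.1 (r' 0).2.1).2.2.2.2).symm
        · refine Subtype.ext (keyMap_injective Subtype.val_injective (Prod.ext ?_ h4))
          have e : ∀ r : PieceKey (X := {x // f x = 1}) (χ ∘ Subtype.val) Col.l,
              (keyMap Subtype.val r.1).1 = 0 := fun r => by
            rw [keyMap, r.2.2 rfl]; rfl
          exact (e (r 1)).trans (e (r' 1)).symm
      rw [this]

/-- Every key occurs in the composition. Without an application of `m` this is an element of a
single piece; otherwise the inputs are divided into those of the chains and those of the word. -/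
theorem exists_isStd (k : Type u) [Field k] {q : Multiset (X × List X) × List X}
    (hq : IsKey χ c q) : ∃ b, IsStd k χ c b q := by
  by_cases h : c = .l → q.1 = 0
  · have := hq.nonempty
    obtain ⟨q', rfl⟩ := exists_keyMap_val (P := fun x => (fun _ : X => (0 : Fin 1)) x = 0) (q := q)
      fun _ _ => rfl
    have hq' : IsKey (X := {x : X // (fun _ : X => (0 : Fin 1)) x = 0}) (χ ∘ Subtype.val) c q' := by
      refine isKey_val_iff.2 ⟨hq.labels.trans ?_, hq.coloured, hq.coloured', hq.out⟩
      rw [Finset.filter_true_of_mem fun x _ => rfl]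
    have hs : Function.Surjective fun _ : X => (0 : Fin 1) :=
      fun i => ⟨Classical.arbitrary X, Subsingleton.elim _ _⟩
    exact ⟨_, IsStd.one (k := k) (fun _ => 0) hs
      (Fin.cases (motive := fun i => PieceKey (X := {x : X // (0 : Fin 1) = i}) (χ ∘ Subtype.val) c)
        ⟨q', hq', fun hc => Multiset.map_eq_zero.1 (h hc)⟩ fun i => i.elim0)⟩
  · obtain ⟨rfl, hne⟩ := Classical.not_imp.1 h
    obtain ⟨S, v⟩ := q
    dsimp only at hne
    have hlab := hq.labels
    dsimp only at hlab
    have hnd : (pairLabels S + (v : Multiset X)).Nodup := hlab ▸ Finset.univ.nodup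
    have hdisj : ∀ x ∈ pairLabels S, x ∉ v := fun x hx hv =>
      Multiset.disjoint_left.1 (Multiset.nodup_add.1 hnd).2.2 hx hv
    have hcover : ∀ x, x ∉ v → x ∈ pairLabels S := fun x hx => by
      have : x ∈ pairLabels S + (v : Multiset X) := hlab ▸ Finset.mem_univ x
      exact (Multiset.mem_add.1 this).resolve_right hx
    let f : X → Fin 2 := fun x => if x ∈ v then 1 else 0
    have hf0 : ∀ x, f x = 0 ↔ x ∉ v := fun x => by by_cases hx : x ∈ v <;> simp [f, hx]
    have hf1 : ∀ x, f x = 1 ↔ x ∈ v := fun x => by by_cases hx : x ∈ v <;> simp [f, hx]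
    have hs : Function.Surjective f := by
      intro i
      fin_cases i
      · obtain ⟨p, hp⟩ := Multiset.exists_mem_of_ne_zero hne
        have : p.1 ∈ pairLabels S := by
          rw [pairLabels]
          exact Multiset.mem_add.2 (Or.inl (Multiset.mem_map_of_mem _ hp))
        exact ⟨p.1, (hf0 _).2 (hdisj _ this)⟩
      · obtain ⟨x, v', hv, -⟩ := hq.out
        exact ⟨x, (hf1 _).2 (by rw [show v = x :: v' from hv]; simp)⟩
    obtain ⟨q0, h0⟩ := exists_keyMap_val (P := fun x => f x = 0) (q := (S, []))
      fun x hx => (hf0 x).2 (hdisj x (by simpa using hx))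
    obtain ⟨q1, h1⟩ := exists_keyMap_val (P := fun x => f x = 1) (q := (0, v))
      fun x hx => (hf1 x).2 (by simpa [pairLabels] using hx)
    have hq0 : IsKey (X := {x : X // f x = 0}) (χ ∘ Subtype.val) .s q0 := by
      rw [isKey_val_iff, h0]
      refine ⟨?_, hq.coloured, by simp, hne, rfl⟩
      refine (Multiset.Nodup.ext ?_ (Finset.nodup _)).2 fun x => ?_
      · simpa using (Multiset.nodup_add.1 hnd).1
      · simp only [Multiset.coe_nil, add_zero, Finset.mem_val, Finset.mem_filter, Finset.mem_univ,
          true_and, hf0]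
        exact ⟨hdisj x, hcover x⟩
    have hq1 : IsKey (X := {x : X // f x = 1}) (χ ∘ Subtype.val) .l q1 := by
      rw [isKey_val_iff, h1]
      refine ⟨?_, by simp [PairsColoured], hq.coloured', hq.out⟩
      refine (Multiset.Nodup.ext ?_ (Finset.nodup _)).2 fun x => ?_
      · simpa [pairLabels] using (Multiset.nodup_add.1 hnd).2.1
      · simp [pairLabels, hf1]
    refine ⟨_, Or.inr ⟨f, hs, Fin.cases (motive := fun i => PieceKey (X := {x : X // f x = i})
      (χ ∘ Subtype.val) (![Col.s, Col.l] i)) ⟨q0, hq0, fun hc => by cases hc⟩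
      (Fin.cases (motive := fun i : Fin 1 => PieceKey (X := {x : X // f x = i.succ})
        (χ ∘ Subtype.val) (![Col.s, Col.l] i.succ)) ⟨q1, hq1, fun _ =>
          Multiset.map_eq_zero.1 (congrArg Prod.fst h1)⟩ fun i => i.elim0), rfl, ?_⟩⟩
    exact Prod.ext (congrArg Prod.fst h0).symm (congrArg Prod.snd h1).symm

theorem compMk_mem_of_pieceMk {V : Submodule k ((comp (nilM k) (dComLie k)).obj X χ c)} {m : ℕ}
    {ψ : Fin m → Col} {f : X → Fin m} {hf : Function.Surjective f} {p : (nilM k).obj (Fin m) ψ c}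
    (h : ∀ r : ∀ i : Fin m, PieceKey (X := {x : X // f x = i}) (χ ∘ Subtype.val) (ψ i),
      compMk χ c (⟨m, ψ, f, hf⟩ : CompIndex Col X) p (fun i => pieceMk k (r i)) ∈ V)
    (q : ∀ i : Fin m, (dComLie k).obj {x : X // f x = i} (χ ∘ Subtype.val) (ψ i)) :
    compMk χ c (⟨m, ψ, f, hf⟩ : CompIndex Col X) p q ∈ V := by
  rw [← compMkMultilinear_apply]
  refine (Submodule.span_le (p := V)).2 ?_ (multilinear_mem_span _
    (fun i => Set.range fun r : PieceKey (X := {x : X // f x = i}) (χ ∘ Subtype.val) (ψ i) =>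
      pieceMk k r) (fun i => span_pieceMk k _ _) q)
  rintro _ ⟨r, hr, rfl⟩
  choose r' hr' using hr
  obtain rfl : (fun i => pieceMk k (r' i)) = r := funext hr'
  exact h r'

/-- The normal forms span the composition. -/
theorem compMk_mem_span_isStd {m : ℕ} (ψ : Fin m → Col) (f : X → Fin m)
    (hf : Function.Surjective f) (p : (nilM k).obj (Fin m) ψ c)
    (q : ∀ i : Fin m, (dComLie k).obj {x : X // f x = i} (χ ∘ Subtype.val) (ψ i)) :
    compMk χ c (⟨m, ψ, f, hf⟩ : CompIndex Col X) p q ∈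
      Submodule.span k {b | ∃ q, IsStd k χ c b q} := by
  have hp : p ∈ Submodule.span k (Set.range (presentedMk (nilRel k) (χ := ψ) (c := c))) := by
    rw [span_presentedMk]; trivial
  have hlin := compMkLinear_apply (k := k) (χ := χ) (c := c) (⟨m, ψ, f, hf⟩ : CompIndex Col X)
  suffices h : ∀ t : Monomial nilSig ψ c,
      compMk χ c (⟨m, ψ, f, hf⟩ : CompIndex Col X) (presentedMk (nilRel k) t) q ∈
        Submodule.span k {b | ∃ q, IsStd k χ c b q} by
    rw [← hlin]
    refine linear_mem_of_span (f := compMkLinear χ c (⟨m, ψ, f, hf⟩ : CompIndex Col X) q)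
      (fun a ha => ?_) hp
    obtain ⟨t, rfl⟩ := ha
    exact (congrArg (· ∈ Submodule.span k {b | ∃ q, IsStd k χ c b q}) (hlin _ q)).mpr (h t)
  intro t
  rcases nil_monomial k t with ht | ⟨i, hi⟩ | ⟨i, j, hij⟩
  · have := (hlin _ q).symm.trans ((congrArg (compMkLinear χ c
      (⟨m, ψ, f, hf⟩ : CompIndex Col X) q) ht).trans (map_zero _))
    exact (congrArg (· ∈ Submodule.span k {b | ∃ q, IsStd k χ c b q}) this).mpr (zero_mem _)
  · obtain ⟨t, ht⟩ := t
    dsimp only at hi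
    subst hi
    have huniq : ∀ x, x = i := fun x => by simpa [OpTree.leaves] using ht.2.2 x
    obtain rfl : m = 1 := by
      have : Subsingleton (Fin m) := ⟨fun x y => (huniq x).trans (huniq y).symm⟩
      have h1 : m ≤ 1 := by
        by_contra hm
        have := (huniq ⟨0, by omega⟩).trans (huniq ⟨1, by omega⟩).symm
        simp at this
      have := i.pos
      omega
    obtain rfl : i = 0 := Subsingleton.elim _ _
    obtain rfl : ψ = fun _ => c := funext fun x => by rw [huniq x]; exact ht.1
    exact compMk_mem_of_pieceMk (V := Submodule.span k {b | ∃ q, IsStd k χ c b q})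
      (fun r => Submodule.subset_span (Exists.intro _ (IsStd.one f hf r))) q
  · have two : ∀ (ψ : Fin 2 → Col) (f : X → Fin 2) (hf : Function.Surjective f)
        (h : IsMonomial nilSig ψ c (.node () (.leaf (0 : Fin 2)) (.leaf 1)))
        (q : ∀ i : Fin 2, (dComLie k).obj {x : X // f x = i} (χ ∘ Subtype.val) (ψ i)),
        compMk χ c (⟨2, ψ, f, hf⟩ : CompIndex Col X) (presentedMk (nilRel k) ⟨_, h⟩) q ∈
          Submodule.span k {b | ∃ q, IsStd k χ c b q} := by
      intro ψ f hf h q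
      obtain rfl : .l = c := h.1.1
      obtain rfl : ψ = ![.s, .l] := funext fun x => by
        fin_cases x
        · exact h.1.2.1
        · exact h.1.2.2
      exact compMk_mem_of_pieceMk (V := Submodule.span k {b | ∃ q, IsStd k χ .l b q})
        (fun r => Submodule.subset_span (Exists.intro _ (Or.inr ⟨f, hf, r, rfl, rfl⟩))) q
    obtain ⟨t, ht⟩ := t
    dsimp only at hij
    subst hij
    have hne : i ≠ j := by simpa [OpTree.leaves] using ht.2.1
    have huniq : ∀ x, x = i ∨ x = j := fun x => by simpa [OpTree.leaves] using ht.2.2 x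
    obtain rfl : m = 2 := by
      have h1 : Finset.univ = ({i, j} : Finset (Fin m)) := by
        ext x; simpa using huniq x
      have := congrArg Finset.card h1
      rwa [Finset.card_pair hne, Finset.card_univ, Fintype.card_fin] at this
    rcases (show i = 0 ∧ j = 1 ∨ i = 1 ∧ j = 0 by omega) with ⟨rfl, rfl⟩ | ⟨rfl, rfl⟩
    · exact two ψ f hf ht q
    · -- the exchange of the two inputs of the operation of `N_m`
      let σ : Equiv.Perm (Fin 2) := Equiv.swap 0 1
      obtain ⟨f', rfl⟩ : ∃ f' : X → Fin 2, f = σ ∘ f' := ⟨σ ∘ f, funext fun x => by simp [σ]⟩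
      have hf' : Function.Surjective f' := (Equiv.comp_surjective f' σ).1 hf
      have h' : IsMonomial nilSig (ψ ∘ σ) c (.node () (.leaf (0 : Fin 2)) (.leaf 1)) :=
        ⟨⟨ht.1.1, ht.1.2.1, ht.1.2.2⟩, by simp [OpTree.leaves], fun x => by
          fin_cases x <;> simp [OpTree.leaves]⟩
      have hmap := presentedMk_map (R := nilRel k) σ ψ c ⟨_, h'⟩
      have := compMk_perm χ c ψ f' hf' σ (presentedMk (nilRel k) ⟨_, h'⟩) q
      refine (congrArg (fun p => compMk χ c (⟨2, ψ, σ ∘ f', hf⟩ : CompIndex Col X) p q ∈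
        Submodule.span k {b | ∃ q, IsStd k χ c b q}) hmap).mp ?_
      refine (congrArg (· ∈ Submodule.span k {b | ∃ q, IsStd k χ c b q}) this).mpr ?_
      exact two _ _ _ _ _

theorem span_isStd (k : Type u) [Field k] (χ : X → Col) (c : Col) :
    Submodule.span k {b | ∃ q, IsStd k χ c b q} = ⊤ := by
  have : (Submodule.span k {b | ∃ q, IsStd k χ c b q}).mkQ = 0 :=
    comp_ext fun j p q => (Submodule.Quotient.mk_eq_zero _).2
      (compMk_mem_span_isStd j.ψ j.f j.surj p q)
  rw [← Submodule.ker_mkQ (Submodule.span k _), this, LinearMap.ker_zero]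

/-- The comparison of bases. The map sends the normal form of a key to the standard element with that
key; both have the same values in all Lie–Rinehart algebras, and the values at the generic
elements of polynomial vector fields detect the operations of `lieR k`. -/
theorem exists_compEquiv (k : Type u) [Field k] {X : Type} [Finite X] (χ : X → Col) (c : Col) :
    ∃ T : (lieR k).obj X χ c ≃ₗ[k] (comp (nilM k) (dComLie k)).obj X χ c,
      ∀ (Z : Type u) [AddCommGroup Z] [Module k Z] (μ : Ops k LRGen Z) (h : IsLRAlg μ) (z : X → Z)
        (p : (lieR k).obj X χ c),
        compEval h z χ c (T p) = presentedEval (sat_lrRel.2 h) X χ c p z := by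
  classical
  obtain ⟨n, ⟨e⟩⟩ := Finite.exists_equiv_fin X
  let _ : LinearOrder X := LinearOrder.lift' e e.injective
  let _ : Fintype X := Fintype.ofFinite X
  choose B hB using fun q : Key χ c => exists_isStd k q.2
  let T := (keyBasis k χ c).constr k B
  have hT : ∀ (Z : Type u) [AddCommGroup Z] [Module k Z] (μ : Ops k LRGen Z) (h : IsLRAlg μ)
      (z : X → Z) (p : (lieR k).obj X χ c),
      compEval h z χ c (T p) = presentedEval (sat_lrRel.2 h) X χ c p z := by
    intro Z _ _ μ h z p
    let E : (lieR k).obj X χ c →ₗ[k] Z :=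
      { toFun := fun p => presentedEval (sat_lrRel.2 h) X χ c p z
        map_add' := fun p q => congrArg (fun F : MultilinearMap k (fun _ : X => Z) Z => F z)
          (map_add (presentedEval (sat_lrRel.2 h) X χ c) p q)
        map_smul' := fun a p => congrArg (fun F : MultilinearMap k (fun _ : X => Z) Z => F z)
          (map_smul (presentedEval (sat_lrRel.2 h) X χ c) a p) }
    have : (compEval h z χ c).comp T = E := by
      refine (keyBasis k χ c).ext fun q => ?_
      rw [LinearMap.comp_apply, Module.Basis.constr_basis, (hB q).eval h z, keyBasis_apply]
      exact ((presentedEval_mk (sat_lrRel.2 h) _ _).trans (keyMonomial_eval q μ)).symm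
    exact LinearMap.congr_fun this p
  refine ⟨LinearEquiv.ofBijective T ⟨?_, ?_⟩, hT⟩
  · refine (injective_iff_map_eq_zero _).2 fun p hp => genericEval_injective χ c ?_
    rw [map_zero]
    refine (hT _ _ isLRAlg_modelOps (generic k χ) p).symm.trans ?_
    rw [hp, map_zero]
  · rw [← LinearMap.range_eq_top, eq_top_iff, ← span_isStd, Submodule.span_le]
    rintro b ⟨q, hb⟩
    refine ⟨keyBasis k χ c ⟨q, hb.isKey⟩, ?_⟩
    rw [Module.Basis.constr_basis]
    exact (hB _).unique hb

/-- The operad of Lie–Rinehart algebras is the composition of `N_m` and `(DCom¹; Lie)`: both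
collections act on Lie–Rinehart algebras, in the same way. -/
theorem nonempty_iso_comp (k : Type u) [Field k] :
    Nonempty (Iso (lieR k) (comp (nilM k) (dComLie k))) := by
  choose T hT using fun (X : Type) [Finite X] (χ : X → Col) (c : Col) => exists_compEquiv k χ c
  refine ⟨⟨fun X _ χ c => T X χ c, fun {X Y} _ _ e χ c p => ?_⟩⟩
  -- the values at the generic elements detect the operations of the composition
  have hinj : Function.Injective (compEval (isLRAlg_modelOps (k := k)) (generic k χ) χ c) := by
    refine (injective_iff_map_eq_zero _).2 fun b hb => ?_
    obtain ⟨p, rfl⟩ := (T Y χ c).surjective b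
    rw [hT] at hb
    rw [(genericEval_injective χ c) (hb.trans (map_zero _).symm : genericEval k χ c p = _), map_zero]
  refine hinj ?_
  rw [compEval_map, hT, hT]
  exact presentedEval_map (sat_lrRel.2 isLRAlg_modelOps) e χ c p _

end

/-! ### Enumeration of words -/

section

variable {X : Type}

/-- Words with letters `L` that satisfy `C`. -/
abbrev Words (C : List X → Prop) (L : Multiset X) : Type :=
  {v : List X // (v : Multiset X) = L ∧ C v}

/-- Sequences of `p` words, with letters `L` in total. -/
abbrev WordSeq (X : Type) (p : ℕ) (L : Multiset X) : Type :=
  {w : Fin p → List X // ∑ i, (w i : Multiset X) = L}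

/-- A word that satisfies `C`, and a sequence of `p` words, with letters `L` in total. -/
abbrev WordWithSeq (C : List X → Prop) (p : ℕ) (L : Multiset X) : Type :=
  {vw : List X × (Fin p → List X) //
    (vw.1 : Multiset X) + ∑ i, (vw.2 i : Multiset X) = L ∧ C vw.1}

theorem finite_words (C : List X → Prop) (L : Multiset X) : Finite (Words C L) := by
  classical
  induction L using Quotient.inductionOn with
  | h l =>
    refine (Set.Finite.subset (List.finite_toSet l.permutations) fun v hv => ?_ :
      Set.Finite {v : List X | (v : Multiset X) = (l : Multiset X) ∧ C v}).to_subtype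
    exact List.mem_permutations.2 (Multiset.coe_eq_coe.1 hv.1)

theorem card_words [DecidableEq X] (J : Finset X) :
    Nat.card (Words (fun _ => True) J.val) = J.card.factorial := by
  have hJ : (J.toList : Multiset X) = J.val := Finset.coe_toList J
  have e : Words (fun _ => True) J.val ≃ {v // v ∈ J.toList.permutations.toFinset} :=
    Equiv.subtypeEquivRight fun v => by
      rw [List.mem_toFinset, List.mem_permutations, ← Multiset.coe_eq_coe, hJ, and_true]
  rw [Nat.card_congr e, Nat.card_eq_fintype_card, Fintype.card_coe, List.toFinset_card_of_nodup
    (List.nodup_permutations _ J.nodup_toList), List.length_permutations, Finset.length_toList]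

theorem card_words_minHead [LinearOrder X] {J : Finset X} (hJ : J.Nonempty) :
    Nat.card (Words MinHead J.val) = (J.card - 1).factorial := by
  rw [← Finset.card_erase_of_mem (J.min'_mem hJ), ← card_words]
  refine (Nat.card_eq_of_bijective (fun v : Words (fun _ => True) (J.erase (J.min' hJ)).val =>
    (⟨J.min' hJ :: v.1, ?_, J.min' hJ, v.1, rfl, ?_⟩ : Words MinHead J.val)) ⟨?_, ?_⟩).symm
  · rw [← Multiset.cons_coe, v.2.1, Finset.erase_val]
    exact Multiset.cons_erase (J.min'_mem hJ)
  · intro y hy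
    refine J.min'_le y ?_
    have : y ∈ (J.erase (J.min' hJ)).val := by rw [← v.2.1]; exact hy
    exact Finset.mem_of_mem_erase this
  · intro v v' h
    exact Subtype.ext (List.cons_injective (congrArg Subtype.val h))
  · rintro ⟨_, h1, x, v, rfl, h2⟩
    have hx : x = J.min' hJ := by
      refine le_antisymm ?_ ?_
      · have : J.min' hJ ∈ ((x :: v : List X) : Multiset X) := by rw [h1]; exact J.min'_mem hJ
        rcases List.mem_cons.1 (Multiset.mem_coe.1 this) with h | h
        · exact h.ge
        · exact h2 _ h
      · refine J.min'_le x ?_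
        rw [← Finset.mem_val, ← h1]
        simp
    subst hx
    refine ⟨⟨v, ?_, trivial⟩, rfl⟩
    rw [Finset.erase_val, ← h1, ← Multiset.cons_coe, Multiset.erase_cons_head]

/-- The letters of the first word are an arbitrary subset. -/
theorem card_wordWithSeq_eq_sum [DecidableEq X] (C : List X → Prop) (p : ℕ)
    (h : ∀ L : Finset X, Finite (WordSeq X p L.val)) (L : Finset X) :
    Finite (WordWithSeq C p L.val) ∧ Nat.card (WordWithSeq C p L.val) =
      ∑ J ∈ L.powerset, Nat.card (Words C J.val) * Nat.card (WordSeq X p (L \ J).val) := by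
  have hw := finite_words (X := X) C
  let F : (Σ J : L.powerset, Words C J.1.val × WordSeq X p (L \ J.1).val) →
      WordWithSeq C p L.val := fun a =>
    ⟨(a.2.1.1, a.2.2.1), by
      dsimp only
      rw [a.2.1.2.1, a.2.2.2, Finset.sdiff_val]
      exact add_tsub_cancel_of_le (Finset.val_le_iff.2 (Finset.mem_powerset.1 a.1.2)),
      a.2.1.2.2⟩
  have hF : Function.Bijective F := by
    constructor
    · rintro ⟨⟨J, hJ⟩, ⟨v, hv⟩, ⟨w, hw⟩⟩ ⟨⟨J', hJ'⟩, ⟨v', hv'⟩, ⟨w', hw'⟩⟩ h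
      have h' := congrArg Subtype.val h
      obtain ⟨rfl, rfl⟩ := Prod.mk.inj h'
      obtain rfl : J = J' := Finset.val_injective (hv.1.symm.trans hv'.1)
      rfl
    · rintro ⟨⟨v, w⟩, h1, h2⟩
      dsimp only at h1 h2
      have hle : (v : Multiset X) ≤ L.val := by rw [← h1]; exact Multiset.le_add_right _ _
      let J : Finset X := ⟨v, Multiset.nodup_of_le hle L.nodup⟩
      refine ⟨⟨⟨J, Finset.mem_powerset.2 (Finset.val_le_iff.1 hle)⟩, ⟨v, rfl, h2⟩, ⟨w, ?_⟩⟩, rfl⟩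
      refine Eq.trans ?_ (congrArg (· - (v : Multiset X)) h1)
      exact (add_tsub_cancel_left _ _).symm
  refine ⟨Finite.of_surjective F hF.2, ?_⟩
  rw [← Nat.card_eq_of_bijective F hF, Nat.card_sigma, ← Finset.sum_coe_sort L.powerset]
  exact Finset.sum_congr rfl fun J _ => Nat.card_prod _ _

/-- The convolution of exponential generating functions. -/
theorem sum_powerset_factorial (f g : PowerSeries ℚ) (L : Finset X) [DecidableEq X] :
    ∑ J ∈ L.powerset, (J.card.factorial * PowerSeries.coeff J.card f) *
      ((L \ J).card.factorial * PowerSeries.coeff (L \ J).card g) =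
    L.card.factorial * PowerSeries.coeff L.card (f * g) := by
  have h : ∀ J ∈ L.powerset, (J.card.factorial * PowerSeries.coeff J.card f) *
      ((L \ J).card.factorial * PowerSeries.coeff (L \ J).card g) =
      (fun j : ℕ => (j.factorial * PowerSeries.coeff j f) *
        ((L.card - j).factorial * PowerSeries.coeff (L.card - j) g)) J.card := fun J hJ => by
    rw [Finset.card_sdiff_of_subset (Finset.mem_powerset.1 hJ)]
  rw [Finset.sum_congr rfl h, Finset.sum_powerset_apply_card (fun j : ℕ =>
    ((j.factorial : ℚ) * PowerSeries.coeff j f) *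
        ((L.card - j).factorial * PowerSeries.coeff (L.card - j) g)), PowerSeries.coeff_mul,
    Finset.Nat.sum_antidiagonal_eq_sum_range_succ_mk, Finset.mul_sum]
  refine Finset.sum_congr rfl fun j hj => ?_
  have := Nat.choose_mul_factorial_mul_factorial (Nat.lt_succ_iff.1 (Finset.mem_range.1 hj))
  rw [← this, nsmul_eq_mul]
  push_cast
  ring

theorem card_wordWithSeq [DecidableEq X] (C : List X → Prop) (p : ℕ) (f g : PowerSeries ℚ)
    (hC : ∀ J : Finset X, (Nat.card (Words C J.val) : ℚ) =
      J.card.factorial * PowerSeries.coeff J.card f)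
    (h : ∀ L : Finset X, Finite (WordSeq X p L.val))
    (hg : ∀ J : Finset X, (Nat.card (WordSeq X p J.val) : ℚ) =
      J.card.factorial * PowerSeries.coeff J.card g) (L : Finset X) :
    (Nat.card (WordWithSeq C p L.val) : ℚ) =
      L.card.factorial * PowerSeries.coeff L.card (f * g) := by
  rw [(card_wordWithSeq_eq_sum C p h L).2, ← sum_powerset_factorial]
  push_cast
  exact Finset.sum_congr rfl fun J _ => by rw [hC, hg]

/-- The geometric series. -/
abbrev geom : PowerSeries ℚ := PowerSeries.mk 1

/-- Sequences of `p` words in which every letter of `L` occurs once in total are counted by the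
exponential generating series `(1 - t)⁻ᵖ`. -/
theorem card_wordSeq [DecidableEq X] (p : ℕ) :
    (∀ L : Finset X, Finite (WordSeq X p L.val)) ∧
    ∀ L : Finset X, (Nat.card (WordSeq X p L.val) : ℚ) =
      L.card.factorial * PowerSeries.coeff L.card (geom ^ p) := by
  induction p with
  | zero =>
    refine ⟨fun L => inferInstance, fun L => ?_⟩
    rw [pow_zero, PowerSeries.coeff_one]
    rcases L.eq_empty_or_nonempty with rfl | hne
    · have : Unique (WordSeq X 0 (∅ : Finset X).val) :=
        ⟨⟨⟨fun i => i.elim0, by simp⟩⟩, fun w => Subtype.ext (Subsingleton.elim _ _)⟩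
      rw [Nat.card_unique]
      simp
    · have : IsEmpty (WordSeq X 0 L.val) := ⟨fun w => by
        have := w.2
        simp only [Finset.univ_eq_empty, Finset.sum_empty] at this
        exact hne.ne_empty (Finset.val_eq_zero.1 this.symm)⟩
      rw [Nat.card_of_isEmpty, if_neg (by simpa using hne.ne_empty)]
      simp
  | succ p ih =>
    have e : ∀ L : Multiset X, WordWithSeq (fun _ => True) p L ≃ WordSeq X (p + 1) L := fun L =>
      (Fin.consEquiv fun _ : Fin (p + 1) => List X).subtypeEquiv fun vw => by
        simp [Fin.consEquiv, Fin.sum_univ_succ]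
    refine ⟨fun L => ?_, fun L => ?_⟩
    · have := (card_wordWithSeq_eq_sum (X := X) (fun _ => True) p ih.1 L).1
      exact Finite.of_equiv _ (e L.val)
    · rw [← Nat.card_congr (e L.val), pow_succ']
      refine card_wordWithSeq _ p geom _ (fun J => ?_) ih.1 ih.2 L
      rw [card_words]
      simp

end

/-! ### The number of normal forms -/

section

variable {X : Type} [LinearOrder X] [Fintype X] {χ : X → Col}

omit [LinearOrder X] in
/-- The chains with the given beginnings and continuations. -/
def seqPairs {p : ℕ} (x : Fin p ≃ {x : X // χ x = .s}) (w : Fin p → List X) :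
    Multiset (X × List X) :=
  Finset.univ.val.map fun i => ((x i : X), w i)

omit [LinearOrder X] in
theorem pairLabels_seqPairs {p : ℕ} (x : Fin p ≃ {x : X // χ x = .s}) (w : Fin p → List X) :
    pairLabels (seqPairs x w) =
      (Finset.univ.filter fun x => χ x = .s).val + ∑ i, (w i : Multiset X) := by
  classical
  rw [pairLabels, seqPairs, Multiset.map_map, Multiset.bind_map]
  congr 1
  refine (Multiset.Nodup.ext ?_ (Finset.nodup _)).2 fun y => ?_
  · exact Finset.univ.nodup.map (Subtype.val_injective.comp x.injective)
  · simp only [Multiset.mem_map, Finset.mem_val, Finset.mem_univ, true_and, Function.comp_apply,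
      Finset.mem_filter]
    exact ⟨fun ⟨i, hi⟩ => hi ▸ (x i).2, fun hy => ⟨x.symm ⟨y, hy⟩, by simp⟩⟩

omit [LinearOrder X] [Fintype X] in
theorem seqPairs_injective {p : ℕ} (x : Fin p ≃ {x : X // χ x = .s}) :
    Function.Injective (seqPairs x) := by
  intro w w' h
  funext i
  have : ((x i : X), w i) ∈ seqPairs x w' := by
    rw [← h]; exact Multiset.mem_map_of_mem _ (Finset.mem_univ i)
  obtain ⟨j, -, hj⟩ := Multiset.mem_map.1 this
  obtain ⟨h1, h2⟩ := Prod.mk.inj hj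
  rw [← h2, x.injective (Subtype.ext h1)]

omit [LinearOrder X] in
/-- The collections of chains that occur in keys. -/
theorem isKey_labels_iff {p : ℕ} (x : Fin p ≃ {x : X // χ x = .s}) {S : Multiset (X × List X)}
    {v : List X} :
    (pairLabels S + (v : Multiset X) = Finset.univ.val ∧ PairsColoured χ S ∧
      ∀ y ∈ v, χ y = .l) ↔
    ∃ w, S = seqPairs x w ∧ (v : Multiset X) + ∑ i, (w i : Multiset X) =
      (Finset.univ.filter fun x => χ x = .l).val := by
  classical
  have huniv : (Finset.univ : Finset X).val = (Finset.univ.filter fun x => χ x = .s).val +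
      (Finset.univ.filter fun x => χ x = .l).val := by
    rw [Finset.filter_val, Finset.filter_val]
    refine (Multiset.filter_add_not (fun x => χ x = .s) Finset.univ.val).symm.trans ?_
    congr 1
    refine Multiset.filter_congr fun x _ => ?_
    cases χ x <;> simp
  constructor
  · rintro ⟨h1, h2, h3⟩
    have hnd : (pairLabels S + (v : Multiset X)).Nodup := h1 ▸ Finset.univ.nodup
    have hnd' : (S.map Prod.fst).Nodup :=
      (Multiset.nodup_add.1 (Multiset.nodup_add.1 hnd).1).1
    have hmem : ∀ y, χ y = .s → ∃ u, (y, u) ∈ S := by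
      intro y hy
      have : y ∈ pairLabels S + (v : Multiset X) := h1 ▸ Finset.mem_univ y
      rcases Multiset.mem_add.1 this with h | h
      · rcases Multiset.mem_add.1 h with h | h
        · obtain ⟨q, hq, rfl⟩ := Multiset.mem_map.1 h
          exact ⟨q.2, hq⟩
        · obtain ⟨q, hq, hq'⟩ := Multiset.mem_bind.1 h
          exact absurd (hy.symm.trans ((h2 q hq).2 y hq')) (by simp)
      · exact absurd (hy.symm.trans (h3 y h)) (by simp)
    choose w hw using fun i => hmem (x i) (x i).2
    have hS : S = seqPairs x w := by
      refine (Multiset.Nodup.ext (Multiset.Nodup.of_map _ hnd') (Finset.univ.nodup.map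
        fun i j h => x.injective (Subtype.ext (congrArg Prod.fst h)))).2 fun q => ?_
      constructor
      · intro hq
        refine Multiset.mem_map.2 ⟨x.symm ⟨q.1, (h2 q hq).1⟩, Finset.mem_univ (x.symm _), ?_⟩
        refine Multiset.inj_on_of_nodup_map hnd' _ (hw _) q hq ?_
        simp
      · intro hq
        obtain ⟨i, -, rfl⟩ := Multiset.mem_map.1 hq
        exact hw i
    refine ⟨w, hS, ?_⟩
    rw [hS, pairLabels_seqPairs, huniv, add_assoc] at h1
    rw [add_comm]
    exact add_left_cancel h1
  · rintro ⟨w, rfl, h⟩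
    have hl : ∀ y ∈ (v : Multiset X) + ∑ i, (w i : Multiset X), χ y = .l := fun y hy => by
      rw [h] at hy
      exact (Finset.mem_filter.1 hy).2
    refine ⟨?_, fun q hq => ?_, fun y hy => hl y (Multiset.mem_add.2 (Or.inl hy))⟩
    · rw [pairLabels_seqPairs, huniv, add_assoc, add_comm (∑ i, _), h]
    · obtain ⟨i, -, rfl⟩ := Multiset.mem_map.1 hq
      refine ⟨(x i).2, fun y hy => hl y (Multiset.mem_add.2 (Or.inr ?_))⟩
      exact Multiset.mem_sum.2 ⟨i, Finset.mem_univ i, hy⟩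

/-- The normal forms with output colour `s` and `p` inputs of colour `s`: one chain begins with each
of these inputs, and the inputs of colour `l` are distributed over the chains as words. -/
theorem card_key_s (p : ℕ) (x : Fin p ≃ {x : X // χ x = .s}) :
    Finite (Key χ .s) ∧ (Nat.card (Key χ .s) : ℚ) = if p = 0 then 0 else
      ((Finset.univ.filter fun x => χ x = .l).card.factorial : ℚ) *
        PowerSeries.coeff (Finset.univ.filter fun x => χ x = .l).card (geom ^ p) := by
  rcases Nat.eq_zero_or_pos p with rfl | hp
  · have : IsEmpty (Key χ .s) := ⟨fun ⟨⟨S, v⟩, h⟩ => by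
      obtain ⟨w, hw, -⟩ := (isKey_labels_iff x).1 ⟨h.labels, h.coloured, h.coloured'⟩
      exact h.out.1 (hw.trans (by simp [seqPairs]))⟩
    exact ⟨inferInstance, by simp⟩
  · let F : WordSeq X p (Finset.univ.filter fun x => χ x = .l).val → Key χ .s := fun w =>
      ⟨(seqPairs x w.1, []), by
        obtain ⟨h1, h2, h3⟩ := (isKey_labels_iff (v := []) x).2 ⟨w.1, rfl, by simpa using w.2⟩
        refine ⟨h1, h2, h3, ?_, rfl⟩
        have : (⟨0, hp⟩ : Fin p) ∈ (Finset.univ : Finset (Fin p)) := Finset.mem_univ _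
        intro h
        rw [seqPairs, Multiset.map_eq_zero, Finset.val_eq_zero] at h
        simp [h] at this⟩
    have hF : Function.Bijective F := by
      constructor
      · intro w w' h
        exact Subtype.ext (seqPairs_injective x (congrArg Prod.fst (congrArg Subtype.val h)))
      · rintro ⟨⟨S, v⟩, h⟩
        obtain ⟨w, hw, hw'⟩ := (isKey_labels_iff x).1 ⟨h.labels, h.coloured, h.coloured'⟩
        obtain ⟨-, hv⟩ := h.out
        dsimp only at hv hw
        subst hv hw
        exact ⟨⟨w, by simpa using hw'⟩, rfl⟩
    have := (card_wordSeq (X := X) p).1 (Finset.univ.filter fun x => χ x = .l)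
    exact ⟨Finite.of_surjective F hF.2, by
      rw [← Nat.card_eq_of_bijective F hF, (card_wordSeq p).2, if_neg hp.ne']⟩

/-- The series `-log(1 - t)`. -/
abbrev negLog : PowerSeries ℚ := PowerSeries.mk fun n => 1 / (n : ℚ)

/-- The normal forms with output colour `l`: in addition to the chains there is a word that begins
with its smallest letter, so that the words of length `j` on given letters number `(j - 1)!`. -/
theorem card_key_l (p : ℕ) (x : Fin p ≃ {x : X // χ x = .s}) :
    Finite (Key χ .l) ∧ (Nat.card (Key χ .l) : ℚ) =
      ((Finset.univ.filter fun x => χ x = .l).card.factorial : ℚ) *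
        PowerSeries.coeff (Finset.univ.filter fun x => χ x = .l).card (negLog * geom ^ p) := by
  let F : WordWithSeq MinHead p (Finset.univ.filter fun x => χ x = .l).val → Key χ .l := fun w =>
    ⟨(seqPairs x w.1.2, w.1.1), by
      obtain ⟨h1, h2, h3⟩ := (isKey_labels_iff (v := w.1.1) x).2 ⟨w.1.2, rfl, w.2.1⟩
      exact ⟨h1, h2, h3, w.2.2⟩⟩
  have hF : Function.Bijective F := by
    constructor
    · intro w w' h
      have h' := congrArg Subtype.val h
      exact Subtype.ext (Prod.ext (congrArg Prod.snd h')
        (seqPairs_injective x (congrArg Prod.fst h')))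
    · rintro ⟨⟨S, v⟩, h⟩
      obtain ⟨w, hw, hw'⟩ := (isKey_labels_iff x).1 ⟨h.labels, h.coloured, h.coloured'⟩
      dsimp only at hw
      subst hw
      exact ⟨⟨(v, w), hw', h.out⟩, rfl⟩
  have := (card_wordWithSeq_eq_sum (X := X) MinHead p (card_wordSeq p).1
    (Finset.univ.filter fun x => χ x = .l)).1
  refine ⟨Finite.of_surjective F hF.2, ?_⟩
  rw [← Nat.card_eq_of_bijective F hF]
  refine card_wordWithSeq MinHead p negLog (geom ^ p) (fun J => ?_) (card_wordSeq p).1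
    (card_wordSeq p).2 _
  rcases J.eq_empty_or_nonempty with rfl | hJ
  · have : IsEmpty (Words (X := X) MinHead (∅ : Finset X).val) := ⟨fun v => by
      obtain ⟨-, x, v', h, -⟩ := v.2
      have := v.2.1
      rw [h] at this
      simp at this⟩
    rw [Nat.card_of_isEmpty]
    simp
  · rw [card_words_minHead hJ, PowerSeries.coeff_mk, ← Nat.mul_factorial_pred hJ.card_pos.ne']
    have : (J.card : ℚ) ≠ 0 := by exact_mod_cast hJ.card_pos.ne'
    push_cast
    field_simp

theorem finite_key (χ : X → Col) (c : Col) : Finite (Key χ c) := by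
  let x := (Fintype.equivFin {x : X // χ x = .s}).symm
  cases c with
  | s => exact (card_key_s _ x).1
  | l => exact (card_key_l _ x).1

end

theorem finite_lieR (k : Type u) [Field k] (X : Type) [Finite X] (χ : X → Col) (c : Col) :
    Module.Finite k ((lieR k).obj X χ c) := by
  classical
  obtain ⟨n, ⟨e⟩⟩ := Finite.exists_equiv_fin X
  let _ : LinearOrder X := LinearOrder.lift' e e.injective
  let _ : Fintype X := Fintype.ofFinite X
  have := finite_key χ c
  exact Module.Finite.of_basis (keyBasis k χ c)

/-! ### The generating series -/

theorem hasSubst_t₂ : PowerSeries.HasSubst t₂ :=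
  PowerSeries.HasSubst.of_constantCoeff_zero (MvPowerSeries.constantCoeff_X _)

theorem coeff_subst_t₂ (f : PowerSeries ℚ) (m : Col →₀ ℕ) :
    MvPowerSeries.coeff m (f.subst t₂ : MvPowerSeries Col ℚ) =
      if m .s = 0 then PowerSeries.coeff (m .l) f else 0 := by
  classical
  have key : ∀ d : ℕ, (m = Finsupp.single Col.l d) ↔ m .s = 0 ∧ m .l = d := fun d => by
    rw [Finsupp.ext_iff]
    constructor
    · intro h
      exact ⟨by rw [h]; simp, by rw [h]; simp⟩
    · rintro ⟨h1, h2⟩ i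
      cases i <;> simp [h1, h2]
  rw [PowerSeries.coeff_subst hasSubst_t₂]
  simp only [t₂, MvPowerSeries.coeff_X_pow, key, smul_eq_mul]
  rw [finsum_eq_single _ (m .l) fun d hd => by rw [if_neg fun h => hd h.2.symm, mul_zero]]
  simp

theorem coeff_t₁_pow_mul_subst (f : PowerSeries ℚ) (d : ℕ) (m : Col →₀ ℕ) :
    MvPowerSeries.coeff m (t₁ ^ d * (f.subst t₂ : MvPowerSeries Col ℚ)) =
      if m .s = d then PowerSeries.coeff (m .l) f else 0 := by
  classical
  rw [t₁, MvPowerSeries.X_pow_eq, MvPowerSeries.coeff_monomial_mul, coeff_subst_t₂, one_mul]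
  by_cases h : Finsupp.single Col.s d ≤ m
  · have h' : d ≤ m .s := by simpa using h .s
    rw [if_pos h]
    simp only [Finsupp.tsub_apply, Finsupp.single_eq_same]
    rw [Finsupp.single_eq_of_ne (by simp), Nat.sub_zero]
    exact if_congr (by omega) rfl rfl
  · rw [if_neg h, if_neg]
    rintro rfl
    exact h (by simp)

theorem inv_one_sub_t₂ : (1 - t₂)⁻¹ = (geom.subst t₂ : MvPowerSeries Col ℚ) := by
  have hc : MvPowerSeries.constantCoeff (1 - t₂) ≠ 0 := by
    simp [t₂]
  refine ((MvPowerSeries.eq_inv_iff_mul_eq_one hc).2 ?_).symm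
  have h := congrArg (PowerSeries.substAlgHom (R := ℚ) hasSubst_t₂)
    (PowerSeries.mk_one_mul_one_sub_eq_one ℚ)
  rw [map_mul, map_sub, map_one, PowerSeries.coe_substAlgHom,
    PowerSeries.subst_X hasSubst_t₂] at h
  exact h

theorem coeff_expSeries (m : Col →₀ ℕ) :
    MvPowerSeries.coeff m (expSeries (t₁ * (1 - t₂)⁻¹)) =
      1 / ((m .s).factorial : ℚ) * PowerSeries.coeff (m .l) (geom ^ (m .s)) := by
  have hs : PowerSeries.HasSubst (t₁ * (1 - t₂)⁻¹) :=
    PowerSeries.HasSubst.of_constantCoeff_zero (by simp [t₁])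
  have hpow : ∀ d : ℕ, MvPowerSeries.coeff m ((t₁ * (1 - t₂)⁻¹) ^ d) =
      if m .s = d then PowerSeries.coeff (m .l) (geom ^ d) else 0 := fun d => by
    rw [mul_pow, inv_one_sub_t₂, ← coeff_t₁_pow_mul_subst]
    have := map_pow (PowerSeries.substAlgHom (R := ℚ) hasSubst_t₂) geom d
    rw [PowerSeries.coe_substAlgHom] at this
    rw [this]
  rw [expSeries, PowerSeries.coeff_subst hs]
  simp only [hpow]
  rw [finsum_eq_single _ (m .s) fun d hd => by rw [if_neg fun h => hd h.symm, smul_zero]]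
  simp [PowerSeries.coeff_exp]

theorem coeff_subst_mul_expSeries (f : PowerSeries ℚ) (m : Col →₀ ℕ) :
    MvPowerSeries.coeff m ((f.subst t₂ : MvPowerSeries Col ℚ) * expSeries (t₁ * (1 - t₂)⁻¹)) =
      1 / ((m .s).factorial : ℚ) * PowerSeries.coeff (m .l) (f * geom ^ (m .s)) := by
  classical
  -- only one power of the first variable contributes
  have h : MvPowerSeries.coeff m
      ((f.subst t₂ : MvPowerSeries Col ℚ) * expSeries (t₁ * (1 - t₂)⁻¹)) =
      MvPowerSeries.coeff m ((f.subst t₂ : MvPowerSeries Col ℚ) *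
        ((1 / ((m .s).factorial : ℚ)) •
          (t₁ ^ (m .s) * ((geom ^ (m .s)).subst t₂ : MvPowerSeries Col ℚ)))) := by
    rw [MvPowerSeries.coeff_mul, MvPowerSeries.coeff_mul]
    refine Finset.sum_congr rfl fun a ha => ?_
    rw [coeff_subst_t₂]
    split_ifs with h0
    · have h1 : a.2 .s = m .s := by
        rw [← Finset.HasAntidiagonal.mem_antidiagonal.1 ha, Finsupp.add_apply, h0, zero_add]
      rw [coeff_expSeries, map_smul, coeff_t₁_pow_mul_subst, if_pos h1, h1, smul_eq_mul]
    · rw [zero_mul, zero_mul]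
  rw [h, mul_smul_comm, map_smul, smul_eq_mul, mul_left_comm]
  have := map_mul (PowerSeries.substAlgHom (R := ℚ) hasSubst_t₂) f (geom ^ (m .s))
  rw [PowerSeries.coe_substAlgHom] at this
  rw [← this, coeff_t₁_pow_mul_subst, if_pos rfl]

theorem neg_logOneAddSeries : -logOneAddSeries (-t₂) = (negLog.subst t₂ : MvPowerSeries Col ℚ) := by
  classical
  have hs : PowerSeries.HasSubst (-t₂) :=
    PowerSeries.HasSubst.of_constantCoeff_zero (by simp [t₂])
  ext m
  rw [map_neg, logOneAddSeries, PowerSeries.coeff_subst hs, PowerSeries.coeff_subst hasSubst_t₂,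
    ← finsum_neg_distrib]
  refine finsum_congr fun d => ?_
  rw [neg_pow, PowerSeries.coeff_log, PowerSeries.coeff_mk]
  rcases eq_or_ne d 0 with rfl | hd
  · simp
  · have h1 : ((-1 : MvPowerSeries Col ℚ) ^ d * t₂ ^ d) = ((-1 : ℚ) ^ d) • t₂ ^ d := by
      rw [MvPowerSeries.smul_eq_C_mul, map_pow, map_neg, map_one]
    rw [if_neg hd, h1, map_smul]
    simp only [Algebra.algebraMap_self, RingHom.id_apply, smul_eq_mul]
    have h2 : (-1 : ℚ) ^ d * (-1) ^ d = 1 := by rw [← mul_pow]; simp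
    rw [pow_succ]
    linear_combination (1 / (d : ℚ) * MvPowerSeries.coeff m (t₂ ^ d)) * h2

/-- The labels of a given colour. -/
def sigmaFstEquiv (m : Col →₀ ℕ) (c : Col) :
    Fin (m c) ≃ {x : Σ i : Col, Fin (m i) // x.1 = c} where
  toFun j := ⟨⟨c, j⟩, rfl⟩
  invFun x := x.2 ▸ x.1.2
  left_inv _ := rfl
  right_inv := by rintro ⟨⟨c, j⟩, rfl⟩; rfl

theorem coeff_genSeries (k : Type u) [Field k] (c : Col) (m : Col →₀ ℕ) :
    ∃ (_ : LinearOrder (Σ i : Col, Fin (m i))),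
    MvPowerSeries.coeff m ((lieR k).genSeries c) =
      (Nat.card (Key (Sigma.fst : (Σ i : Col, Fin (m i)) → Col) c) : ℚ) /
        ((m .s).factorial * (m .l).factorial) := by
  obtain ⟨n, ⟨e⟩⟩ := Finite.exists_equiv_fin (Σ i : Col, Fin (m i))
  let _ : LinearOrder (Σ i : Col, Fin (m i)) := LinearOrder.lift' e e.injective
  refine ⟨inferInstance, ?_⟩
  change (Module.finrank k ((lieR k).obj (Σ i : Col, Fin (m i)) Sigma.fst c) : ℚ) /
    ((∏ i : Col, (m i).factorial : ℕ) : ℚ) = _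
  rw [Module.finrank_eq_nat_card_basis (keyBasis k Sigma.fst c)]
  have : ∏ i : Col, (m i).factorial = (m .s).factorial * (m .l).factorial :=
    Finset.prod_pair (by simp)
  rw [this]
  push_cast
  rfl

theorem card_filter_fst (m : Col →₀ ℕ) (c : Col) :
    (Finset.univ.filter fun x : Σ i : Col, Fin (m i) => x.1 = c).card = m c := by
  rw [← Fintype.card_subtype, ← Fintype.card_congr (sigmaFstEquiv m c), Fintype.card_fin]

theorem genSeries_s (k : Type u) [Field k] :
    (lieR k).genSeries Col.s = expSeries (t₁ * (1 - t₂)⁻¹) - 1 := by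
  classical
  ext m
  obtain ⟨_, h⟩ := coeff_genSeries k .s m
  rw [h, (card_key_s _ (sigmaFstEquiv m .s)).2, card_filter_fst, map_sub, coeff_expSeries,
    MvPowerSeries.coeff_one]
  have h0 : m = 0 ↔ m .s = 0 ∧ m .l = 0 := by
    rw [Finsupp.ext_iff]
    exact ⟨fun h => ⟨h _, h _⟩, fun h i => by cases i <;> simp [h.1, h.2]⟩
  have hs : ((m .s).factorial : ℚ) ≠ 0 := by exact_mod_cast (m .s).factorial_ne_zero
  have hl : ((m .l).factorial : ℚ) ≠ 0 := by exact_mod_cast (m .l).factorial_ne_zero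
  by_cases h1 : m .s = 0
  · simp [h0, h1, PowerSeries.coeff_one]
  · rw [if_neg h1, if_neg (by simp [h0, h1])]
    field_simp
    ring

theorem genSeries_l (k : Type u) [Field k] :
    (lieR k).genSeries Col.l = -logOneAddSeries (-t₂) * expSeries (t₁ * (1 - t₂)⁻¹) := by
  ext m
  obtain ⟨_, h⟩ := coeff_genSeries k .l m
  rw [h, (card_key_l _ (sigmaFstEquiv m .s)).2, card_filter_fst, neg_logOneAddSeries,
    coeff_subst_mul_expSeries]
  have hs : ((m .s).factorial : ℚ) ≠ 0 := by exact_mod_cast (m .s).factorial_ne_zero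
  have hl : ((m .l).factorial : ℚ) ≠ 0 := by exact_mod_cast (m .l).factorial_ne_zero
  field_simp

/-! ### Shuffle trees -/

namespace OpTree

section MinLeaf

variable {G X Y : Type} [LinearOrder X] [LinearOrder Y]

theorem minLeaf_mem (t : OpTree G X) : t.minLeaf ∈ t.leaves := by
  induction t with
  | leaf x => simp [leaves, minLeaf]
  | node g l r hl hr =>
    rcases min_choice l.minLeaf r.minLeaf with h | h <;> simp [leaves, minLeaf, h, hl, hr]

theorem minLeaf_le {t : OpTree G X} {x : X} (h : x ∈ t.leaves) : t.minLeaf ≤ x := by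
  induction t with
  | leaf y => exact (List.mem_singleton.1 h).ge
  | node g l r hl hr =>
    rcases List.mem_append.1 h with h | h
    · exact (min_le_left _ _).trans (hl h)
    · exact (min_le_right _ _).trans (hr h)

theorem minLeaf_eq {G' : Type} {t : OpTree G X} {t' : OpTree G' X}
    (h : ∀ x, x ∈ t.leaves ↔ x ∈ t'.leaves) : t.minLeaf = t'.minLeaf :=
  le_antisymm (minLeaf_le ((h _).2 t'.minLeaf_mem)) (minLeaf_le ((h _).1 t.minLeaf_mem))

theorem minLeaf_bind {θ : X → OpTree G Y} (hθ : Monotone fun x => (θ x).minLeaf)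
    (t : OpTree G X) : (t.bind θ).minLeaf = (θ t.minLeaf).minLeaf := by
  induction t with
  | leaf x => rfl
  | node g l r hl hr => simp only [bind, minLeaf, hl, hr, hθ.map_min]

theorem IsShuffle.bind {θ : X → OpTree G Y} (hθ : StrictMono fun x => (θ x).minLeaf)
    {t : OpTree G X} (ht : t.IsShuffle) (h : ∀ x ∈ t.leaves, (θ x).IsShuffle) :
    (t.bind θ).IsShuffle := by
  induction t with
  | leaf x => exact h x (List.mem_singleton_self x)
  | node g l r hl hr =>
    refine ⟨?_, hl ht.2.1 fun x hx => h x (List.mem_append_left _ hx),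
      hr ht.2.2 fun x hx => h x (List.mem_append_right _ hx)⟩
    rw [minLeaf_bind hθ.monotone, minLeaf_bind hθ.monotone]
    exact hθ ht.1

theorem minLeaf_map {f : X → Y} (hf : Monotone f) (t : OpTree G X) :
    (t.map f).minLeaf = f t.minLeaf := by
  rw [map_eq_bind, minLeaf_bind (θ := fun x => leaf (f x)) hf]; rfl

theorem IsShuffle.map {f : X → Y} (hf : StrictMono f) {t : OpTree G X} (ht : t.IsShuffle) :
    (t.map f).IsShuffle := by
  rw [map_eq_bind]
  exact ht.bind (θ := fun x => leaf (f x)) hf fun _ _ => trivial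

/-- The leftmost leaf of a shuffle tree is the smallest one. -/
theorem IsShuffle.head_leaves {t : OpTree G X} (ht : t.IsShuffle) :
    ∃ w, t.leaves = t.minLeaf :: w := by
  induction t with
  | leaf x => exact ⟨[], rfl⟩
  | node g l r hl hr =>
    obtain ⟨w, hw⟩ := hl ht.2.1
    exact ⟨w ++ r.leaves, by simp [leaves, hw, minLeaf, ht.1.le]⟩

omit [LinearOrder X] in
theorem leaves_length (t : OpTree G X) : t.leaves.length = t.vertices + 1 := by
  induction t with
  | leaf x => rfl
  | node g l r hl hr => simp only [leaves, vertices, List.length_append, hl, hr]; omega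

end MinLeaf

end OpTree

theorem IsShuffling.minLeaf_graft_arg {G : Type} {m n N : ℕ} {i : Fin m} {φ : Fin m → Fin N}
    {ψ : Fin n → Fin N} (h : IsShuffling i φ ψ) {t : OpTree G (Fin n)} (ht : ∀ x, x ∈ t.leaves)
    (x : Fin m) :
    (if x = i then t.map ψ else OpTree.leaf (φ x)).minLeaf = φ x := by
  split_ifs with hx
  · subst hx
    rw [OpTree.minLeaf_map h.right.monotone]
    refine h.least.unique ⟨⟨_, rfl⟩, ?_⟩ |>.symm
    rintro _ ⟨y, rfl⟩
    exact h.right.monotone (OpTree.minLeaf_le (ht y))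
  · rfl

/-- A shuffle composition of shuffle tree monomials is a shuffle tree monomial. -/
theorem IsShuffleMonomial.graft {I : Type} {S : Signature I} {m n N : ℕ} {i : Fin m}
    {φ : Fin m → Fin N} {ψ : Fin n → Fin N} (h : IsShuffling i φ ψ) {χ₁ : Fin m → I}
    {χ₂ : Fin n → I} {χ : Fin N → I} (hχ : IsGlued i φ ψ χ₁ χ₂ χ) {c : I}
    {t₁ : OpTree S.Gen (Fin m)} (h₁ : IsShuffleMonomial S χ₁ c t₁) {t₂ : OpTree S.Gen (Fin n)}
    (h₂ : IsShuffleMonomial S χ₂ (χ₁ i) t₂) :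
    IsShuffleMonomial S χ c (OpTree.graft i φ ψ t₁ t₂) := by
  refine ⟨h₁.1.graft h.grafting hχ h₂.1, ?_⟩
  unfold OpTree.graft
  have e := fun x => h.minLeaf_graft_arg h₂.1.2.2 x
  have key : ∀ θ : Fin m → OpTree S.Gen (Fin N), (∀ x, (θ x).minLeaf = φ x) →
      (∀ x, (θ x).IsShuffle) → (t₁.bind θ).IsShuffle := by
    intro θ h1 h2
    refine h₁.2.bind ?_ fun x _ => h2 x
    intro x y hxy
    simpa only [h1] using h.left hxy
  refine key _ (fun x => ?_) fun x => ?_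
  · convert e x
  · by_cases hx : x = i
    · simp only [hx, if_true]; exact h₂.2.map h.right
    · simp only [hx, if_false]; trivial

section

variable {k : Type u} [Field k] {I : Type} {S : Signature I} {Z : Type v} [AddCommGroup Z]
  [Module k Z]

theorem InShuffleIdeal.isShuffleMonomial {R : Set (Element k S)}
    (hR : ∀ r ∈ R, ∀ s ∈ r.elt.support, IsShuffleMonomial S r.inp r.out s)
    {n : ℕ} {χ : Fin n → I} {c : I} {f : OpTree S.Gen (Fin n) →₀ k}
    (hf : InShuffleIdeal R χ c f) : ∀ s ∈ f.support, IsShuffleMonomial S χ c s := by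
  classical
  induction hf with
  | rel r hr => exact hR r hr
  | zero => simp
  | add _ _ h1 h2 =>
    intro s hs
    exact (Finset.mem_union.1 (Finsupp.support_add hs)).elim (h1 s) (h2 s)
  | smul a _ h => exact fun s hs => h s (Finsupp.support_smul hs)
  | comp_left hg hχ hf ht h =>
    intro s hs
    obtain ⟨t, ht', rfl⟩ := Finset.mem_image.1 (Finsupp.mapDomain_support hs)
    exact (h t ht').graft hg hχ ht
  | comp_right hg hχ ht hf h =>
    intro s hs
    obtain ⟨t, ht', rfl⟩ := Finset.mem_image.1 (Finsupp.mapDomain_support hs)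
    exact ht.graft hg hχ (h t ht')

/-- The ideal of a free shuffle operad vanishes in every algebra that satisfies the relations. -/
theorem InShuffleIdeal.evalLin_eq_zero {R : Set (Element k S)} {μ : Ops k S.Gen Z} (hμ : Sat R μ)
    {n : ℕ} {χ : Fin n → I} {c : I} {f : OpTree S.Gen (Fin n) →₀ k}
    (hf : InShuffleIdeal R χ c f) : ∀ z : Fin n → Z, evalLin μ z f = 0 := by
  classical
  induction hf with
  | rel r hr => exact hμ r hr
  | zero => simp
  | add _ _ h1 h2 => intro z; rw [map_add, h1, h2, add_zero]
  | smul a _ h => intro z; rw [map_smul, h, smul_zero]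
  | comp_left hg hχ hf ht h => intro z; rw [evalLin_graft_left, h]
  | comp_right hg hχ ht hf h =>
    intro z
    obtain ⟨L, hL⟩ := exists_evalLin_graft_right μ z _ _ _ _ ht.1.2.1 (ht.1.2.2 _)
    rw [hL, h, map_zero]

end

/-! ### Planar representatives -/

section Planar

variable {X : Type} [LinearOrder X]

theorem leaves_planar (t : OpTree LRGen X) : (planar t).leaves.Perm t.leaves := by
  induction t with
  | leaf x => exact List.Perm.refl _
  | node g l r hl hr =>
    unfold planar
    split_ifs
    · exact hl.append hr
    · exact (hr.append hl).trans List.perm_append_comm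

theorem minLeaf_planar (t : OpTree LRGen X) : (planar t).minLeaf = t.minLeaf :=
  OpTree.minLeaf_eq fun _ => (leaves_planar t).mem_iff

theorem vertices_planar (t : OpTree LRGen X) : (planar t).vertices = t.vertices := by
  have := (leaves_planar t).length_eq
  rw [OpTree.leaves_length, OpTree.leaves_length] at this
  omega

theorem isShuffle_planar {t : OpTree LRGen X} (h : t.leaves.Nodup) : (planar t).IsShuffle := by
  induction t with
  | leaf x => trivial
  | node g l r hl hr =>
    obtain ⟨h1, h2, h3⟩ := List.nodup_append'.1 h
    unfold planar
    split_ifs with hlr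
    · exact ⟨by rwa [minLeaf_planar, minLeaf_planar], hl h1, hr h2⟩
    · refine ⟨?_, hr h2, hl h1⟩
      rw [minLeaf_planar, minLeaf_planar]
      exact lt_of_le_of_ne (not_lt.1 hlr) fun e =>
        h3 (l.minLeaf_mem) (by rw [← e]; exact r.minLeaf_mem)

theorem isColoured_planar {χ : X → Col} {t : OpTree LRGen X} : ∀ {c : Col},
    t.IsColoured lrSig χ c → (planar t).IsColoured lrShSig χ c := by
  induction t with
  | leaf x => exact fun h => h
  | node g l r hl hr =>
    intro c h
    unfold planar
    split_ifs with hlr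
    · cases g <;> exact ⟨h.1, hl h.2.1, hr h.2.2⟩
    · cases g <;> exact ⟨h.1, hr h.2.2, hl h.2.1⟩

theorem isShuffleMonomial_planar {χ : X → Col} {c : Col} {t : OpTree LRGen X}
    (h : IsMonomial lrSig χ c t) : IsShuffleMonomial lrShSig χ c (planar t) :=
  ⟨⟨isColoured_planar h.1, (leaves_planar t).nodup_iff.2 h.2.1,
    fun x => (leaves_planar t).mem_iff.2 (h.2.2 x)⟩, isShuffle_planar h.2.1⟩

/-- The tree without the generators `e`, `n` that is equal to a shuffle tree. -/
def unplanar : OpTree LRShGen X → OpTree LRGen X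
  | .leaf x => .leaf x
  | .node .α l r => .node .α (unplanar l) (unplanar r)
  | .node .β l r => .node .β (unplanar l) (unplanar r)
  | .node .d l r => .node .d (unplanar l) (unplanar r)
  | .node .m l r => .node .m (unplanar l) (unplanar r)
  | .node .e l r => .node .d (unplanar r) (unplanar l)
  | .node .n l r => .node .m (unplanar r) (unplanar l)

omit [LinearOrder X] in
theorem leaves_unplanar (t : OpTree LRShGen X) : (unplanar t).leaves.Perm t.leaves := by
  induction t with
  | leaf x => exact List.Perm.refl _
  | node g l r hl hr =>
    cases g
    case e => exact (hr.append hl).trans List.perm_append_comm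
    case n => exact (hr.append hl).trans List.perm_append_comm
    all_goals exact hl.append hr

theorem minLeaf_unplanar (t : OpTree LRShGen X) : (unplanar t).minLeaf = t.minLeaf :=
  OpTree.minLeaf_eq fun _ => (leaves_unplanar t).mem_iff

omit [LinearOrder X] in
theorem isColoured_unplanar {χ : X → Col} {t : OpTree LRShGen X} : ∀ {c : Col},
    t.IsColoured lrShSig χ c → (unplanar t).IsColoured lrSig χ c := by
  induction t with
  | leaf x => exact fun h => h
  | node g l r hl hr =>
    intro c h
    cases g
    case e => exact ⟨h.1, hr h.2.2, hl h.2.1⟩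
    case n => exact ⟨h.1, hr h.2.2, hl h.2.1⟩
    all_goals exact ⟨h.1, hl h.2.1, hr h.2.2⟩

omit [LinearOrder X] in
theorem isMonomial_unplanar {χ : X → Col} {c : Col} {t : OpTree LRShGen X}
    (h : IsMonomial lrShSig χ c t) : IsMonomial lrSig χ c (unplanar t) :=
  ⟨isColoured_unplanar h.1, (leaves_unplanar t).nodup_iff.2 h.2.1,
    fun x => (leaves_unplanar t).mem_iff.2 (h.2.2 x)⟩

theorem planar_unplanar {t : OpTree LRShGen X} (h : t.IsShuffle) :
    planar (unplanar t) = t ∧ planarSign (unplanar t) = 1 := by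
  induction t with
  | leaf x => exact ⟨rfl, rfl⟩
  | node g l r hl hr =>
    obtain ⟨h1, h2⟩ := hl h.2.1
    obtain ⟨h3, h4⟩ := hr h.2.2
    have h5 := h.1
    cases g <;>
    simp [unplanar, planar, planarSign, minLeaf_unplanar, h1, h2, h3, h4, h5, h5.le, not_lt,
      LRGen.keep, LRGen.swap, LRGen.swapSign]

variable {k : Type u} [Field k] {Z : Type v} [AddCommGroup Z] [Module k Z]

/-- The operations of the shuffle generators: `e` and `n` are the opposites of `d` and `m`. -/
def shOps (μ : Ops k LRGen Z) : Ops k LRShGen Z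
  | .α => μ .α
  | .β => μ .β
  | .d => μ .d
  | .e => (μ .d).flip
  | .m => μ .m
  | .n => (μ .m).flip

theorem eval_planar {μ : Ops k LRGen Z} (hμ : IsLRAlg μ) (z : X → Z) (t : OpTree LRGen X) :
    (planarSign t : k) • (planar t).eval (shOps μ) z = t.eval μ z := by
  induction t with
  | leaf x => simp [planarSign, planar, OpTree.eval]
  | node g l r hl hr =>
    rw [planar, planarSign, OpTree.eval, ← hl, ← hr]
    split_ifs with h
    · cases g <;> simp [OpTree.eval, LRGen.keep, shOps, smul_smul, mul_comm]
    · cases g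
      · simp [OpTree.eval, LRGen.swap, LRGen.swapSign, shOps, smul_smul, mul_comm,
          hμ.dCom.comm ((planar r).eval (shOps μ) z)]
      · simp [OpTree.eval, LRGen.swap, LRGen.swapSign, shOps, smul_smul, mul_comm,
          hμ.lie.anti ((planar r).eval (shOps μ) z)]
      · simp [OpTree.eval, LRGen.swap, LRGen.swapSign, shOps, smul_smul, mul_comm]
      · simp [OpTree.eval, LRGen.swap, LRGen.swapSign, shOps, smul_smul, mul_comm]

theorem evalLin_planarize {μ : Ops k LRGen Z} (hμ : IsLRAlg μ) (z : X → Z)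
    (f : OpTree LRGen X →₀ k) :
    evalLin (shOps μ) z (planarize k X f) = evalLin μ z f := by
  induction f using Finsupp.induction_linear with
  | zero => simp
  | add f g hf hg => rw [map_add, map_add, map_add, hf, hg]
  | single t a =>
    rw [planarize, Finsupp.linearCombination_single, map_smul, evalLin_single, evalLin_single,
      eval_planar hμ]

theorem support_planarize {P : OpTree LRGen X → Prop} {Q : OpTree LRShGen X → Prop}
    (h : ∀ t, P t → Q (planar t)) {f : OpTree LRGen X →₀ k} (hf : ∀ s ∈ f.support, P s) :
    ∀ s ∈ (planarize k X f).support, Q s := by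
  classical
  intro s hs
  rw [planarize, Finsupp.linearCombination_apply, Finsupp.sum] at hs
  obtain ⟨t, ht, hst⟩ := Finset.mem_biUnion.1 (Finsupp.support_finsetSum hs)
  obtain rfl : s = planar t := by
    have := Finsupp.support_smul hst
    exact Finset.mem_singleton.1 (Finsupp.support_single_subset this)
  exact h t (hf t ht)

/-- The relations of the Lie–Rinehart operad are the combinations of shuffle tree monomials that
vanish at the generic elements. -/
theorem mem_lrShuffleIdeal {n : ℕ} {χ : Fin n → Col} {c : Col}
    {f : OpTree LRShGen (Fin n) →₀ k} :
    f ∈ lrShuffleIdeal k n χ c ↔ (∀ s ∈ f.support, IsShuffleMonomial lrShSig χ c s) ∧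
      evalLin (shOps (modelOps k (Fin n))) (generic k χ) f = 0 := by
  classical
  constructor
  · rintro ⟨g, hg, rfl⟩
    refine ⟨support_planarize (fun t ht => isShuffleMonomial_planar ht)
      (InIdeal.isMonomial (fun r hr s hs => (wellFormed_lrRel r hr s hs).1) hg), ?_⟩
    refine (evalLin_planarize isLRAlg_modelOps _ g).trans ?_
    exact InIdeal.evalLin_eq_zero (sat_lrRel.2 isLRAlg_modelOps) hg _
  · rintro ⟨hf, h0⟩
    have hp : planarize k (Fin n) (f.mapDomain unplanar) = f := by
      rw [planarize, Finsupp.linearCombination_mapDomain, Finsupp.linearCombination_apply]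
      conv_rhs => rw [← Finsupp.sum_single f]
      refine Finsupp.sum_congr fun s hs => ?_
      simp [planar_unplanar (hf s hs).2]
    refine ⟨f.mapDomain unplanar, ?_, hp⟩
    have hm : ∀ s ∈ (f.mapDomain unplanar).support, IsMonomial lrSig χ c s := by
      intro s hs
      obtain ⟨t, ht, rfl⟩ := Finset.mem_image.1 (Finsupp.mapDomain_support hs)
      exact isMonomial_unplanar (hf t ht).1
    obtain ⟨h', hh'⟩ : ∃ h' : Monomial lrSig χ c →₀ k,
        h'.mapDomain Subtype.val = f.mapDomain unplanar :=
      (Finsupp.mem_range_mapDomain_iff _ Subtype.val_injective _).2 fun s hs => by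
        by_contra hne
        exact hs ⟨⟨s, hm s (Finsupp.mem_support_iff.2 hne)⟩, rfl⟩
    have e : genericEval k χ c (presentedQ (lrRel k) (Fin n) χ c h') = 0 := by
      refine (presentedEval_presentedQ (sat_lrRel.2 isLRAlg_modelOps) h' (generic k χ)).trans ?_
      refine (Finsupp.linearCombination_mapDomain k Subtype.val h').symm.trans ?_
      refine (congrArg (evalLin (modelOps k (Fin n)) (generic k χ)) hh').trans ?_
      exact (evalLin_planarize isLRAlg_modelOps _ _).symm.trans ((congrArg _ hp).trans h0)
    have e' := presentedQ_eq_zero.1 (genericEval_injective χ c (e.trans (map_zero _).symm))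
    have : InIdeal (lrRel k) χ c (h'.mapDomain Subtype.val) := e'
    rwa [hh'] at this

end Planar

/-! ### Substitution in the ideals of shuffle operads -/

namespace OpTree

variable {G X Y : Type}

theorem isColoured_map {I : Type} {S : Signature I} {χ : Y → I} {f : X → Y} :
    ∀ {t : OpTree S.Gen X} {c : I},
    (t.map f).IsColoured S χ c ↔ t.IsColoured S (χ ∘ f) c
  | leaf _, _ => Iff.rfl
  | node _ _ _, _ => and_congr Iff.rfl (and_congr isColoured_map isColoured_map)

theorem isShuffle_map [LinearOrder X] [LinearOrder Y] {f : X → Y} (hf : StrictMono f)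
    {t : OpTree G X} : (t.map f).IsShuffle ↔ t.IsShuffle := by
  induction t with
  | leaf x => exact Iff.rfl
  | node g l r hl hr =>
    simp only [map, IsShuffle, hl, hr, minLeaf_map hf.monotone, hf.lt_iff_lt]

theorem exists_map_eq {f : X → Y} {t : OpTree G Y} (h : ∀ y ∈ t.leaves, ∃ x, f x = y) :
    ∃ t' : OpTree G X, t'.map f = t := by
  induction t with
  | leaf y =>
    obtain ⟨x, hx⟩ := h y (List.mem_singleton_self y)
    exact ⟨leaf x, congrArg leaf hx⟩
  | node g l r hl hr =>
    obtain ⟨l', hl'⟩ := hl fun y hy => h y (List.mem_append_left _ hy)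
    obtain ⟨r', hr'⟩ := hr fun y hy => h y (List.mem_append_right _ hy)
    exact ⟨node g l' r', by rw [map, hl', hr']⟩

open Classical in
/-- Substitution of `s` for the leaf `a`. -/
def subst (a : X) (s : OpTree G X) : X → OpTree G X := fun x => if x = a then s else leaf x

theorem subst_self (a : X) (s : OpTree G X) : subst a s a = s := if_pos rfl

theorem subst_of_ne {a x : X} (s : OpTree G X) (h : x ≠ a) : subst a s x = leaf x := if_neg h

theorem bind_subst_of_notMem {a : X} (s : OpTree G X) {t : OpTree G X} (h : a ∉ t.leaves) :
    t.bind (subst a s) = t := by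
  conv_rhs => rw [← bind_leaf t]
  exact bind_congr t fun x hx => subst_of_ne s fun e => h (e ▸ hx)

end OpTree

open OpTree

section

variable {k : Type u} [Field k] {I : Type} {S : Signature I} {X : Type} [LinearOrder X]
  {R : Set (Element k S)}

omit [Field k] in
theorem exists_strictMono_fin (A : Finset X) :
    ∃ (n : ℕ) (κ : Fin n → X), StrictMono κ ∧ ∀ x, x ∈ A ↔ ∃ i, κ i = x := by
  refine ⟨_, A.orderEmbOfFin rfl, (A.orderEmbOfFin rfl).strictMono, fun x => ?_⟩
  rw [← Finset.mem_coe, ← Finset.range_orderEmbOfFin A rfl]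
  rfl

/-- Two subsets of an ordered set that have only the smallest element of the second one in common
give rise to a shuffle composition. -/
theorem exists_isShuffling {A B : Finset X} {a : X} (hA : a ∈ A) (hB : a ∈ B)
    (hmin : ∀ y ∈ B, a ≤ y) (hAB : ∀ x ∈ A, x ∈ B → x = a) {m n : ℕ} {ι : Fin m → X}
    {κ : Fin n → X} (hι : StrictMono ι) (hκ : StrictMono κ) (rι : ∀ x, x ∈ A ↔ ∃ i, ι i = x)
    (rκ : ∀ x, x ∈ B ↔ ∃ i, κ i = x) :
    ∃ (N : ℕ) (ω : Fin N → X) (i : Fin m) (φ : Fin m → Fin N) (ψ : Fin n → Fin N),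
      StrictMono ω ∧ (∀ x, x ∈ A ∪ B ↔ ∃ j, ω j = x) ∧ ι i = a ∧ (∀ x, ω (φ x) = ι x) ∧
      (∀ y, ω (ψ y) = κ y) ∧ IsShuffling i φ ψ := by
  obtain ⟨N, ω, hω, rω⟩ := exists_strictMono_fin (A ∪ B)
  obtain ⟨i, hi⟩ := (rι a).1 hA
  obtain ⟨j, hj⟩ := (rκ a).1 hB
  choose φ hφ using fun x => (rω (ι x)).1 (Finset.mem_union_left _ ((rι _).2 ⟨x, rfl⟩))
  choose ψ hψ using fun y => (rω (κ y)).1 (Finset.mem_union_right _ ((rκ _).2 ⟨y, rfl⟩))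
  have hφm : StrictMono φ := fun x y h => hω.lt_iff_lt.1 (by rw [hφ, hφ]; exact hι h)
  have hψm : StrictMono ψ := fun x y h => hω.lt_iff_lt.1 (by rw [hψ, hψ]; exact hκ h)
  refine ⟨_, ω, i, φ, ψ, hω, rω, hi, hφ, hψ, ⟨⟨hφm.injective.injOn, hψm.injective, ?_, ?_⟩,
    hφm, hψm, ⟨⟨j, ?_⟩, ?_⟩⟩⟩
  · intro x hx b hb
    refine hx (hι.injective ?_)
    have e : ι x = κ b := by rw [← hφ, ← hψ, hb]
    rw [hi]
    exact hAB _ ((rι _).2 ⟨x, rfl⟩) ((rκ _).2 ⟨b, e.symm⟩)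
  · intro y
    by_cases hy : ω y ∈ B
    · obtain ⟨b, hb⟩ := (rκ _).1 hy
      exact Or.inr ⟨b, hω.injective ((hψ b).trans hb)⟩
    · obtain ⟨x, hx⟩ := (rι _).1
        ((Finset.mem_union.1 ((rω (ω y)).2 ⟨y, rfl⟩)).resolve_right hy)
      refine Or.inl ⟨x, ?_, hω.injective ((hφ x).trans hx)⟩
      rintro rfl
      exact hy (by rw [← hx, hi]; exact hB)
  · exact hω.injective (by rw [hφ, hψ, hi, hj])
  · rintro _ ⟨b, rfl⟩
    refine hω.le_iff_le.1 ?_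
    rw [hφ, hψ, hi]
    exact hmin _ ((rκ _).2 ⟨b, rfl⟩)

/-- The ideal of a free shuffle operad, for operations whose inputs are labelled by a finite
subset `A` of an ordered set: the inputs are numbered in increasing order. -/
def InShuffleIdealOn (R : Set (Element k S)) (A : Finset X) (χ : X → I) (c : I)
    (h : OpTree S.Gen X →₀ k) : Prop :=
  ∃ (m : ℕ) (ι : Fin m → X), StrictMono ι ∧ (∀ x, x ∈ A ↔ ∃ i, ι i = x) ∧
    ∃ h' : OpTree S.Gen (Fin m) →₀ k, InShuffleIdeal R (χ ∘ ι) c h' ∧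
      h = h'.mapDomain (OpTree.map ι)

theorem InShuffleIdealOn.inShuffleIdeal {n : ℕ} {χ : Fin n → I} {c : I}
    {h : OpTree S.Gen (Fin n) →₀ k} (hh : InShuffleIdealOn R Finset.univ χ c h) :
    InShuffleIdeal R χ c h := by
  obtain ⟨m, ι, hι, rι, h', hh', rfl⟩ := hh
  have hs : Function.Surjective ι := fun x => (rι x).1 (Finset.mem_univ x)
  obtain rfl : m = n := by
    simpa using Fintype.card_of_bijective ⟨hι.injective, hs⟩
  obtain rfl : ι = id := funext fun x => DFunLike.congr_fun (Subsingleton.elim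
    (hι.orderIsoOfSurjective ι hs) (OrderIso.refl (Fin m))) x
  have : (OpTree.map id : OpTree S.Gen (Fin m) → _) = id := funext fun t => OpTree.map_id t
  rw [this, Finsupp.mapDomain_id]
  exact hh'

/-- Numbering of the leaves of a shuffle tree. -/
theorem exists_isShuffleMonomial_map {B : Finset X} {t : OpTree S.Gen X}
    (hB : ∀ x, x ∈ B ↔ x ∈ t.leaves) (hn : t.leaves.Nodup) (hs : t.IsShuffle) {χ : X → I} {c : I}
    (hc : t.IsColoured S χ c) :
    ∃ (n : ℕ) (κ : Fin n → X) (t' : OpTree S.Gen (Fin n)), StrictMono κ ∧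
      (∀ x, x ∈ B ↔ ∃ i, κ i = x) ∧ t'.map κ = t ∧ IsShuffleMonomial S (χ ∘ κ) c t' := by
  obtain ⟨n, κ, hκ, rκ⟩ := exists_strictMono_fin B
  obtain ⟨t', rfl⟩ := OpTree.exists_map_eq (f := κ) fun y hy => (rκ y).1 ((hB y).2 hy)
  refine ⟨_, κ, t', hκ, rκ, rfl, ⟨isColoured_map.1 hc, ?_, fun x => ?_⟩, (isShuffle_map hκ).1 hs⟩
  · rw [leaves_map] at hn
    exact hn.of_map
  · have := (hB (κ x)).1 ((rκ _).2 ⟨x, rfl⟩)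
    rw [leaves_map] at this
    exact (List.mem_map_of_injective hκ.injective).1 this

/-- Substitution of a shuffle tree for an input. -/
theorem InShuffleIdealOn.comp_left {A B : Finset X} {a : X} (hA : a ∈ A)
    (hAB : ∀ x ∈ A, x ∈ B → x = a) {χ₁ χ : X → I} (hχ : ∀ x ∈ A, x ≠ a → χ x = χ₁ x) {c : I}
    {h : OpTree S.Gen X →₀ k} (hh : InShuffleIdealOn R A χ₁ c h) {t : OpTree S.Gen X}
    (hB : ∀ x, x ∈ B ↔ x ∈ t.leaves) (hn : t.leaves.Nodup) (hs : t.IsShuffle)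
    (hc : t.IsColoured S χ (χ₁ a)) (ha : t.minLeaf = a) :
    InShuffleIdealOn R (A ∪ B) χ c (h.mapDomain (OpTree.bind (subst a t))) := by
  obtain ⟨m, ι, hι, rι, h', hh', rfl⟩ := hh
  obtain ⟨n, κ, t', hκ, rκ, rfl, ht'⟩ := exists_isShuffleMonomial_map hB hn hs hc
  obtain ⟨N, ω, i, φ, ψ, hω, rω, hi, hφ, hψ, hsh⟩ := exists_isShuffling hA
    ((hB a).2 (ha ▸ minLeaf_mem _)) (fun y hy => ha ▸ minLeaf_le ((hB y).1 hy)) hAB hι hκ rι rκ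
  subst hi
  refine ⟨N, ω, hω, rω, _, InShuffleIdeal.comp_left hsh (χ := χ ∘ ω) ⟨fun x hx => ?_, fun b => ?_⟩
    hh' ht', ?_⟩
  · simp only [Function.comp, hφ]
    exact hχ _ ((rι _).2 ⟨x, rfl⟩) fun e => hx (hι.injective e)
  · simp only [Function.comp, hψ]
  · rw [← Finsupp.mapDomain_comp, ← Finsupp.mapDomain_comp]
    refine congrArg (fun F => Finsupp.mapDomain F h') (funext fun s => ?_)
    simp only [Function.comp, graft]
    rw [map_bind, map_eq_bind ω, bind_bind]
    refine bind_congr s fun x _ => ?_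
    by_cases hx : x = i
    · subst hx
      rw [subst_self, if_pos rfl, ← map_eq_bind, ← OpTree.map_comp]
      exact congrArg (fun F => OpTree.map F t') (funext hψ).symm
    · rw [subst_of_ne _ fun e => hx (hι.injective e), if_neg hx]
      exact congrArg leaf (hφ x).symm

/-- Substitution into an input of a shuffle tree. -/
theorem InShuffleIdealOn.comp_right {A B : Finset X} {a : X} (ha : a ∈ B)
    (hmin : ∀ y ∈ B, a ≤ y) (hAB : ∀ x ∈ A, x ∈ B → x = a) {χ₁ χ : X → I}
    (hχ : ∀ x ∈ A, x ≠ a → χ x = χ₁ x) {c : I} {t : OpTree S.Gen X} (haA : a ∈ A)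
    (hA : ∀ x, x ∈ A ↔ x ∈ t.leaves) (hn : t.leaves.Nodup) (hs : t.IsShuffle)
    (hc : t.IsColoured S χ₁ c) {h : OpTree S.Gen X →₀ k} (hh : InShuffleIdealOn R B χ (χ₁ a) h) :
    InShuffleIdealOn R (A ∪ B) χ c (h.mapDomain fun s => t.bind (subst a s)) := by
  obtain ⟨n, κ, hκ, rκ, h', hh', rfl⟩ := hh
  obtain ⟨m, ι, t', hι, rι, rfl, ht'⟩ := exists_isShuffleMonomial_map hA hn hs hc
  obtain ⟨N, ω, i, φ, ψ, hω, rω, hi, hφ, hψ, hsh⟩ := exists_isShuffling haA ha hmin hAB hι hκ rι rκ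
  subst hi
  refine ⟨N, ω, hω, rω, _, InShuffleIdeal.comp_right hsh (χ := χ ∘ ω) ⟨fun x hx => ?_, fun b => ?_⟩
    ht' hh', ?_⟩
  · simp only [Function.comp, hφ]
    exact hχ _ ((rι _).2 ⟨x, rfl⟩) fun e => hx (hι.injective e)
  · simp only [Function.comp, hψ]
  · rw [← Finsupp.mapDomain_comp, ← Finsupp.mapDomain_comp]
    refine congrArg (fun F => Finsupp.mapDomain F h') (funext fun s => ?_)
    simp only [Function.comp, graft]
    rw [map_bind, map_eq_bind ω, bind_bind]
    refine bind_congr t' fun x _ => ?_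
    by_cases hx : x = i
    · subst hx
      rw [subst_self, if_pos rfl, ← map_eq_bind, ← OpTree.map_comp]
      exact congrArg (fun F => OpTree.map F s) (funext hψ).symm
    · rw [subst_of_ne _ fun e => hx (hι.injective e), if_neg hx]
      exact congrArg leaf (hφ x).symm

/-- Simultaneous substitution of shuffle trees for all inputs, in the order of their smallest
leaves. -/
theorem InShuffleIdeal.bind {m : ℕ} {χ' : Fin m → I} {c : I} {g : OpTree S.Gen (Fin m) →₀ k}
    (hg : InShuffleIdeal R χ' c g) {θ : Fin m → OpTree S.Gen X}
    (hθ : StrictMono fun i => (θ i).minLeaf) (hn : ∀ i, (θ i).leaves.Nodup)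
    (hd : ∀ i j, i ≠ j → List.Disjoint (θ i).leaves (θ j).leaves) (hs : ∀ i, (θ i).IsShuffle)
    {χ : X → I} (hχ : ∀ i, (θ i).IsColoured S χ (χ' i)) :
    InShuffleIdealOn R (Finset.univ.biUnion fun i => (θ i).leaves.toFinset) χ c
      (g.mapDomain (OpTree.bind θ)) := by
  classical
  -- the trees are substituted one by one
  have key : ∀ (T : Finset (Fin m)) (θ' : Fin m → OpTree S.Gen X),
      (∀ i, θ' i = if i ∈ T then θ i else leaf (θ i).minLeaf) → ∀ χ : X → I,
      (∀ i, (θ' i).IsColoured S χ (χ' i)) →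
      InShuffleIdealOn R (Finset.univ.biUnion fun i => (θ' i).leaves.toFinset) χ c
        (g.mapDomain (OpTree.bind θ')) := by
    intro T
    induction T using Finset.induction_on with
    | empty =>
      intro θ' h χ hχ
      obtain rfl : θ' = fun i => leaf (θ i).minLeaf := funext fun i => by simpa using h i
      refine ⟨m, fun i => (θ i).minLeaf, hθ, fun x => ?_, g, ?_, ?_⟩
      · simp [leaves, eq_comm]
      · convert hg using 1
        exact funext hχ
      · exact congrArg (fun F => Finsupp.mapDomain F g)
          (funext fun t => (map_eq_bind (fun i => (θ i).minLeaf) t).symm)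
    | insert j T hj ih =>
      intro θ' h χ hχ
      have hj' : θ' j = θ j := by simp [h]
      have hsub : ∀ i, ∀ x ∈ (θ' i).leaves, x ∈ (θ i).leaves := by
        intro i x hx
        rw [h] at hx
        split_ifs at hx
        · exact hx
        · rw [List.mem_singleton.1 hx]; exact minLeaf_mem _
      have hne : ∀ i, i ≠ j → (θ j).minLeaf ∉ (θ' i).leaves := fun i hi hm =>
        hd i j hi (hsub i _ hm) (minLeaf_mem _)
      have hT := ih (fun i => if i = j then leaf (θ j).minLeaf else θ' i) (fun i => by
        by_cases hi : i = j
        · subst hi; simp [hj]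
        · simp [hi, h]) (Function.update χ (θ j).minLeaf (χ' j)) (fun i => by
        by_cases hi : i = j
        · subst hi; simp [OpTree.IsColoured]
        · simp only [hi, if_false]
          refine (hχ i).congr fun x hx => ?_
          rw [Function.update_of_ne]
          rintro rfl
          exact hne i hi hx)
      have hstep := InShuffleIdealOn.comp_left (χ := χ) (a := (θ j).minLeaf)
        (B := (θ j).leaves.toFinset) (t := θ j) ?_ ?_ ?_ hT ?_ (hn j) (hs j) ?_ rfl
      · convert hstep using 1
        · ext x
          simp only [Finset.mem_biUnion, Finset.mem_univ, true_and, List.mem_toFinset,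
            Finset.mem_union]
          constructor
          · rintro ⟨i, hi⟩
            by_cases hij : i = j
            · subst hij; exact Or.inr (by rwa [hj'] at hi)
            · exact Or.inl ⟨i, by simpa [hij] using hi⟩
          · rintro (⟨i, hi⟩ | hx)
            · by_cases hij : i = j
              · subst hij
                refine ⟨i, ?_⟩
                rw [if_pos rfl] at hi
                rw [hj', List.mem_singleton.1 hi]
                exact minLeaf_mem _
              · exact ⟨i, by simpa [hij] using hi⟩
            · exact ⟨j, by rwa [hj']⟩
        · rw [← Finsupp.mapDomain_comp]
          refine congrArg (fun F => Finsupp.mapDomain F g) (funext fun t => ?_)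
          simp only [Function.comp]
          rw [bind_bind]
          refine bind_congr t fun i _ => ?_
          by_cases hij : i = j
          · subst hij; simp only [if_true, OpTree.bind, subst_self, hj']
          · simp only [hij, if_false]
            exact (bind_subst_of_notMem _ (hne i hij)).symm
      · simp only [Finset.mem_biUnion, Finset.mem_univ, true_and, List.mem_toFinset]
        exact ⟨j, by simp [leaves]⟩
      · simp only [Finset.mem_biUnion, Finset.mem_univ, true_and, List.mem_toFinset]
        rintro x ⟨i, hi⟩ hx
        by_cases hij : i = j
        · simpa [hij, leaves] using hi
        · simp only [hij, if_false] at hi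
          exact absurd hx (hd i j hij (hsub i x hi))
      · exact fun x _ hx => (Function.update_of_ne hx _ _).symm
      · exact fun x => List.mem_toFinset
      · rw [Function.update_self, ← hj']; exact hχ j
  exact key Finset.univ θ (by simp) χ hχ

end

/-- Trees with a hole. -/
inductive Ctx (G X : Type) : Type
  | hole : Ctx G X
  | left (g : G) (C : Ctx G X) (r : OpTree G X) : Ctx G X
  | right (g : G) (l : OpTree G X) (C : Ctx G X) : Ctx G X

namespace Ctx

variable {G X : Type}

/-- Insertion of a tree in the hole. -/
def fill (u : OpTree G X) : Ctx G X → OpTree G X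
  | hole => u
  | left g C r => node g (C.fill u) r
  | right g l C => node g l (C.fill u)

theorem isSubtree_refl (u : OpTree G X) : u.IsSubtree u := by
  cases u
  · rfl
  · exact Or.inl rfl

theorem isSubtree_fill (u : OpTree G X) (C : Ctx G X) : u.IsSubtree (C.fill u) := by
  induction C with
  | hole => exact isSubtree_refl u
  | left g C r ih => exact Or.inr (Or.inl ih)
  | right g l C ih => exact Or.inr (Or.inr ih)

theorem leaves_fill_perm {u u' : OpTree G X} (h : u'.leaves.Perm u.leaves) (C : Ctx G X) :
    (C.fill u').leaves.Perm (C.fill u).leaves := by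
  induction C with
  | hole => exact h
  | left g C r ih => exact ih.append_right _
  | right g l C ih => exact ih.append_left _

theorem leaves_subset_fill (u : OpTree G X) (C : Ctx G X) :
    ∀ x ∈ u.leaves, x ∈ (C.fill u).leaves := by
  induction C with
  | hole => exact fun x hx => hx
  | left g C r ih => exact fun x hx => List.mem_append_left _ (ih x hx)
  | right g l C ih => exact fun x hx => List.mem_append_right _ (ih x hx)

theorem nodup_of_fill {u : OpTree G X} {C : Ctx G X} (h : (C.fill u).leaves.Nodup) :
    u.leaves.Nodup := by
  induction C with
  | hole => exact h
  | left g C r ih => exact ih (List.nodup_append.1 h).1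
  | right g l C ih => exact ih (List.nodup_append.1 h).2.1

theorem isShuffle_of_fill [LinearOrder X] {u : OpTree G X} {C : Ctx G X}
    (h : (C.fill u).IsShuffle) : u.IsShuffle := by
  induction C with
  | hole => exact h
  | left g C r ih => exact ih h.2.1
  | right g l C ih => exact ih h.2.2

theorem exists_isColoured_fill {I : Type} {S : Signature I} {χ : X → I} {u : OpTree S.Gen X}
    {C : Ctx S.Gen X} : ∀ {c : I}, (C.fill u).IsColoured S χ c →
    ∃ c', u.IsColoured S χ c' ∧ ∀ u' : OpTree S.Gen X, u'.IsColoured S χ c' →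
      (C.fill u').IsColoured S χ c := by
  induction C with
  | hole => exact fun {c} h => ⟨c, h, fun _ h => h⟩
  | left g C r ih =>
    intro c h
    obtain ⟨c', h1, h2⟩ := ih h.2.1
    exact ⟨c', h1, fun u' hu' => ⟨h.1, h2 u' hu', h.2.2⟩⟩
  | right g l C ih =>
    intro c h
    obtain ⟨c', h1, h2⟩ := ih h.2.2
    exact ⟨c', h1, fun u' hu' => ⟨h.1, h.2.1, h2 u' hu'⟩⟩

end Ctx

section

variable {k : Type u} [Field k] {I : Type} {S : Signature I} {X : Type} [LinearOrder X]
  {R : Set (Element k S)}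

/-- The ideal is closed under contexts. -/
theorem InShuffleIdealOn.fill {χ : X → I} {u : OpTree S.Gen X} {h : OpTree S.Gen X →₀ k} {c' : I}
    (hh : InShuffleIdealOn R u.leaves.toFinset χ c' h) (hu : u.IsColoured S χ c')
    (C : Ctx S.Gen X) : ∀ {c : I}, (C.fill u).IsColoured S χ c → (C.fill u).leaves.Nodup →
      (C.fill u).IsShuffle → InShuffleIdealOn R (C.fill u).leaves.toFinset χ c
        (h.mapDomain fun s => C.fill s) := by
  induction C with
  | hole =>
    intro c hc _ _
    obtain rfl := hu.unique hc
    exact (congrArg (InShuffleIdealOn R _ χ c') Finsupp.mapDomain_id).mpr hh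
  | left g C r ih =>
    intro c hc hn hs
    obtain ⟨hn1, hn2, hn3⟩ := List.nodup_append'.1 hn
    have hC := ih hc.2.1 hn1 hs.2.1
    have hm := minLeaf_mem (C.fill u)
    have har : (C.fill u).minLeaf ∉ r.leaves := fun h => hn3 hm h
    have := InShuffleIdealOn.comp_right (A := insert (C.fill u).minLeaf r.leaves.toFinset)
      (t := node g (leaf (C.fill u).minLeaf) r) (c := c)
      (χ₁ := Function.update χ (C.fill u).minLeaf (S.in₁ g)) (List.mem_toFinset.2 hm)
      (fun y hy => minLeaf_le (List.mem_toFinset.1 hy)) ?_ ?_ ?_ ?_ ?_ ?_ ?_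
      (by rw [Function.update_self]; exact hC)
    · convert this using 1
      · ext x
        simp only [Ctx.fill, leaves, List.toFinset_append, Finset.mem_union, List.mem_toFinset,
          Finset.mem_insert]
        constructor
        · tauto
        · rintro ((rfl | h) | h) <;> tauto
      · rw [← Finsupp.mapDomain_comp]
        refine congrArg (fun F => Finsupp.mapDomain F h) (funext fun s => ?_)
        simp only [Function.comp, OpTree.bind, subst_self, Ctx.fill]
        rw [bind_subst_of_notMem _ har]
    · simp only [Finset.mem_insert, List.mem_toFinset]
      rintro x (rfl | hx) hx'
      · rfl
      · exact absurd hx (hn3 hx')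
    · exact fun x _ hx => (Function.update_of_ne hx _ _).symm
    · exact Finset.mem_insert_self _ _
    · exact fun x => by simp [leaves]
    · simpa [leaves] using ⟨har, hn2⟩
    · exact ⟨hs.1, trivial, hs.2.2⟩
    · refine ⟨hc.1, Function.update_self .., hc.2.2.congr fun x hx => ?_⟩
      rw [Function.update_of_ne]
      rintro rfl
      exact har hx
  | right g l C ih =>
    intro c hc hn hs
    obtain ⟨hn1, hn2, hn3⟩ := List.nodup_append'.1 hn
    have hC := ih hc.2.2 hn2 hs.2.2
    have hm := minLeaf_mem (C.fill u)
    have hal : (C.fill u).minLeaf ∉ l.leaves := fun h => hn3 h hm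
    have := InShuffleIdealOn.comp_right (A := insert (C.fill u).minLeaf l.leaves.toFinset)
      (t := node g l (leaf (C.fill u).minLeaf)) (c := c)
      (χ₁ := Function.update χ (C.fill u).minLeaf (S.in₂ g)) (List.mem_toFinset.2 hm)
      (fun y hy => minLeaf_le (List.mem_toFinset.1 hy)) ?_ ?_ ?_ ?_ ?_ ?_ ?_
      (by rw [Function.update_self]; exact hC)
    · convert this using 1
      · ext x
        simp only [Ctx.fill, leaves, List.toFinset_append, Finset.mem_union, List.mem_toFinset,
          Finset.mem_insert]
        constructor
        · tauto
        · rintro ((rfl | h) | h) <;> tauto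
      · rw [← Finsupp.mapDomain_comp]
        refine congrArg (fun F => Finsupp.mapDomain F h) (funext fun s => ?_)
        simp only [Function.comp, OpTree.bind, subst_self, Ctx.fill]
        rw [bind_subst_of_notMem _ hal]
    · simp only [Finset.mem_insert, List.mem_toFinset]
      rintro x (rfl | hx) hx'
      · rfl
      · exact absurd hx' (hn3 hx)
    · exact fun x _ hx => (Function.update_of_ne hx _ _).symm
    · exact Finset.mem_insert_self _ _
    · exact fun x => by simp [leaves, or_comm]
    · rw [leaves, List.nodup_append']
      exact ⟨hn1, List.nodup_singleton _, by simpa [leaves] using hal⟩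
    · exact ⟨hs.1, hs.2.1, trivial⟩
    · refine ⟨hc.1, hc.2.1.congr fun x hx => ?_, Function.update_self ..⟩
      rw [Function.update_of_ne]
      rintro rfl
      exact hal hx

end

open OpTree

/-! ### Substitution and the quantum monomial ordering -/

section Path

variable {G X Y : Type} [DecidableEq X] [DecidableEq Y]

theorem OpTree.path_bind {θ : X → OpTree G Y}
    (hd : ∀ i j, i ≠ j → List.Disjoint (θ i).leaves (θ j).leaves) {i : X} {y : Y}
    (hy : y ∈ (θ i).leaves) : ∀ {s : OpTree G X}, i ∈ s.leaves →
      (s.bind θ).path y = s.path i ++ (θ i).path y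
  | leaf x, h => by
    obtain rfl := List.mem_singleton.1 h
    rfl
  | node g l r, h => by
    have e : y ∈ (l.bind θ).leaves ↔ i ∈ l.leaves := by
      rw [leaves_bind, List.mem_flatMap]
      refine ⟨fun ⟨j, hj, hyj⟩ => ?_, fun hi => ⟨i, hi, hy⟩⟩
      by_contra hi
      exact hd i j (fun e => hi (e ▸ hj)) hy hyj
    simp only [OpTree.bind, path, e, List.cons_append]
    split_ifs with hi
    · rw [OpTree.path_bind hd hy hi]
    · rw [OpTree.path_bind hd hy ((List.mem_append.1 h).resolve_left hi)]

theorem Ctx.path_fill_of_mem {x : X} {u : OpTree G X} (hx : x ∈ u.leaves) {C : Ctx G X}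
    (hn : (C.fill u).leaves.Nodup) : ∃ p, ∀ u' : OpTree G X, u'.leaves.Perm u.leaves →
      (C.fill u').path x = p ++ u'.path x := by
  induction C with
  | hole => exact ⟨[], fun _ _ => rfl⟩
  | left g C r ih =>
    obtain ⟨p, hp⟩ := ih (List.nodup_append'.1 hn).1
    refine ⟨g :: p, fun u' hu' => ?_⟩
    have := (leaves_fill_perm hu' C).mem_iff.2 (leaves_subset_fill u C x hx)
    simp only [fill, path, this, if_true, hp u' hu', List.cons_append]
  | right g l C ih =>
    obtain ⟨p, hp⟩ := ih (List.nodup_append'.1 hn).2.1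
    refine ⟨g :: p, fun u' hu' => ?_⟩
    have : x ∉ l.leaves := fun h =>
      (List.nodup_append'.1 hn).2.2 h (leaves_subset_fill u C x hx)
    simp only [fill, path, this, if_false, hp u' hu', List.cons_append]

theorem Ctx.path_fill_of_notMem {x : X} {u u' : OpTree G X} (hx : x ∉ u.leaves)
    (hu' : u'.leaves.Perm u.leaves) {C : Ctx G X} (h : x ∈ (C.fill u).leaves) :
    (C.fill u').path x = (C.fill u).path x := by
  induction C with
  | hole => exact absurd h hx
  | left g C r ih =>
    simp only [fill, path, (leaves_fill_perm hu' C).mem_iff]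
    split_ifs with hC
    · rw [ih hC]
    · rfl
  | right g l C ih =>
    simp only [fill, path]
    split_ifs with hl
    · rfl
    · rw [ih ((List.mem_append.1 h).resolve_left hl)]

omit [DecidableEq X] [DecidableEq Y] in
theorem OpTree.IsShuffle.of_bind [LinearOrder Y] {θ : X → OpTree G Y} {t : OpTree G X}
    (h : (t.bind θ).IsShuffle) : ∀ x ∈ t.leaves, (θ x).IsShuffle := by
  induction t with
  | leaf x => exact fun y hy => List.mem_singleton.1 hy ▸ h
  | node g l r hl hr =>
    exact fun x hx => (List.mem_append.1 hx).elim (hl h.2.1 x) (hr h.2.2 x)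

omit [DecidableEq X] [DecidableEq Y] in
theorem OpTree.disjoint_of_nodup_bind {θ : X → OpTree G Y} {t : OpTree G X}
    (h : (t.bind θ).leaves.Nodup) {i j : X} (hi : i ∈ t.leaves)
    (hj : j ∈ t.leaves) (hij : i ≠ j) : List.Disjoint (θ i).leaves (θ j).leaves := by
  rw [leaves_bind, List.nodup_flatMap] at h
  have : Std.Symm (Function.onFun List.Disjoint fun x => (θ x).leaves) :=
    ⟨fun _ _ h => List.Disjoint.symm h⟩
  exact h.2.forall hi hj hij

omit [DecidableEq X] [DecidableEq Y] in
theorem OpTree.nodup_of_nodup_bind {θ : X → OpTree G Y} {t : OpTree G X}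
    (h : (t.bind θ).leaves.Nodup) {i : X} (hi : i ∈ t.leaves) : (θ i).leaves.Nodup := by
  rw [leaves_bind, List.nodup_flatMap] at h
  exact h.1 i hi

end Path

section QM

theorem lexLT_iff {n : ℕ} {v w : Fin n → ℕ} : LexLT v w ↔ toLex v < toLex w := Iff.rfl

open OrderDual in
/-- The degree vectors of a tree, as an element of an ordered set, such that the quantum monomial
ordering is the ordering of these elements. -/
def qmKey {n : ℕ} (t : OpTree LRShGen (Fin n)) :
    (Lex (Fin n → ℕ))ᵒᵈ ×ₗ (Lex (Fin n → ℕ))ᵒᵈ ×ₗ (Lex (Fin n → ℕ))ᵒᵈ ×ₗ Lex (Fin n → ℕ) :=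
  toLex (toDual (toLex (degVector [.α] t)), toLex (toDual (toLex (degVector [.d, .e] t)),
    toLex (toDual (toLex (degVector [.m, .n] t)), toLex (degVector [.β] t))))

theorem qmLess_iff {n : ℕ} {t t' : OpTree LRShGen (Fin n)} :
    QMLess t t' ↔ qmKey t < qmKey t' := by
  simp only [QMLess, qmKey, Prod.Lex.toLex_lt_toLex, OrderDual.toDual_lt_toDual, lexLT_iff,
    EmbeddingLike.apply_eq_iff_eq, @eq_comm _ (degVector _ t')]

theorem QMLess.irrefl {n : ℕ} {t : OpTree LRShGen (Fin n)} : ¬QMLess t t :=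
  fun h => lt_irrefl _ (qmLess_iff.1 h)

theorem QMLess.trans {n : ℕ} {t t' t'' : OpTree LRShGen (Fin n)} (h : QMLess t t')
    (h' : QMLess t' t'') : QMLess t t'' :=
  qmLess_iff.2 ((qmLess_iff.1 h).trans (qmLess_iff.1 h'))

variable {m n : ℕ} {θ : Fin m → OpTree LRShGen (Fin n)} {s s' : OpTree LRShGen (Fin m)}
  {C : Ctx LRShGen (Fin n)}

theorem mapDomain_eq_single_add {k α β : Type*} [Semiring k] (F : α → β) (f : α →₀ k) (a : α) :
    f.mapDomain F = Finsupp.single (F a) (f a) + (f.erase a).mapDomain F := by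
  rw [← Finsupp.mapDomain_single, ← Finsupp.mapDomain_add, Finsupp.single_add_erase]

theorem mem_support_mapDomain_erase {k α β : Type*} [Semiring k] {F : α → β} {f : α →₀ k} {a : α}
    {y : β} (h : y ∈ ((f.erase a).mapDomain F).support) : ∃ x ∈ f.support, x ≠ a ∧ F x = y := by
  classical
  obtain ⟨x, hx, rfl⟩ := Finset.mem_image.1 (Finsupp.mapDomain_support h)
  rw [Finsupp.support_erase, Finset.mem_erase] at hx
  exact ⟨x, hx.2, hx.1, rfl⟩

/-- The ideal of a free shuffle operad is closed under substitution in a shuffle tree. -/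
theorem InShuffleIdeal.fill_bind {k : Type u} [Field k] {I : Type} {S : Signature I}
    {R : Set (Element k S)} {χ' : Fin m → I} {c' : I} {g : OpTree S.Gen (Fin m) →₀ k}
    (hg : InShuffleIdeal R χ' c' g) {s : OpTree S.Gen (Fin m)}
    (hs : IsShuffleMonomial S χ' c' s) {θ : Fin m → OpTree S.Gen (Fin n)}
    (hθ : StrictMono fun i => (θ i).minLeaf) {χ : Fin n → I}
    (hc : ∀ i, (θ i).IsColoured S χ (χ' i)) {C : Ctx S.Gen (Fin n)} {c : I}
    (ht : IsShuffleMonomial S χ c (C.fill (s.bind θ))) :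
    InShuffleIdeal R χ c (g.mapDomain fun s => C.fill (s.bind θ)) := by
  have hu := Ctx.nodup_of_fill ht.1.2.1
  have hB := hg.bind hθ (fun i => nodup_of_nodup_bind hu (hs.1.2.2 i))
    (fun i j hij => disjoint_of_nodup_bind hu (hs.1.2.2 i) (hs.1.2.2 j) hij)
    (fun i => IsShuffle.of_bind (Ctx.isShuffle_of_fill ht.2) i (hs.1.2.2 i)) hc
  have hset : (Finset.univ.biUnion fun i => (θ i).leaves.toFinset) =
      (s.bind θ).leaves.toFinset := by
    ext x
    simp [leaves_bind, hs.1.2.2]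
  rw [hset] at hB
  have hI := InShuffleIdealOn.fill hB (hs.1.1.bind fun x _ => hc x) C ht.1.1 ht.1.2.1 ht.2
  refine InShuffleIdealOn.inShuffleIdeal ?_
  rw [← Finsupp.mapDomain_comp] at hI
  have huniv : (C.fill (s.bind θ)).leaves.toFinset = Finset.univ := by
    ext x
    simp [ht.1.2.2 x]
  rw [huniv] at hI
  exact hI

/-- The degree vector after a substitution, at the leaves of a substituted tree. -/
theorem exists_degVector_fill_bind (L : List LRShGen) (hs' : ∀ i, i ∈ s.leaves)
    (hn : (C.fill (s.bind θ)).leaves.Nodup) {i : Fin m} {x : Fin n} (hx : x ∈ (θ i).leaves) :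
    ∃ b, ∀ s' : OpTree LRShGen (Fin m), s'.leaves.Perm s.leaves →
      degVector L (C.fill (s'.bind θ)) x = b + degVector L s' i := by
  have hxs : x ∈ (s.bind θ).leaves := by
    rw [leaves_bind]; exact List.mem_flatMap.2 ⟨i, hs' i, hx⟩
  obtain ⟨p, hp⟩ := Ctx.path_fill_of_mem hxs hn
  refine ⟨p.countP (· ∈ L) + ((θ i).path x).countP (· ∈ L), fun s' h => ?_⟩
  simp only [degVector]
  rw [hp _ (by rw [leaves_bind, leaves_bind]; exact h.flatMap_right _),
    OpTree.path_bind (fun i j hij => disjoint_of_nodup_bind (Ctx.nodup_of_fill hn) (hs' i)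
      (hs' j) hij) hx (h.mem_iff.2 (hs' i)), List.countP_append, List.countP_append]
  omega

theorem degVector_fill_bind_eq (L : List LRShGen) (hp : s'.leaves.Perm s.leaves) {x : Fin n}
    (hx : x ∉ (s.bind θ).leaves) (hx' : x ∈ (C.fill (s.bind θ)).leaves) :
    degVector L (C.fill (s'.bind θ)) x = degVector L (C.fill (s.bind θ)) x := by
  simp only [degVector]
  rw [Ctx.path_fill_of_notMem hx (by rw [leaves_bind, leaves_bind]; exact hp.flatMap_right _) hx']

/-- Substitution is compatible with the quantum monomial ordering: the first difference of the
degree vectors occurs at the smallest leaf of a substituted tree. -/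
theorem QMLess.fill_bind (hθ : StrictMono fun i => (θ i).minLeaf)
    (hs' : ∀ i, i ∈ s.leaves) (hp : s'.leaves.Perm s.leaves)
    (hn : (C.fill (s.bind θ)).leaves.Nodup) (hn' : ∀ x, x ∈ (C.fill (s.bind θ)).leaves)
    (h : QMLess s' s) : QMLess (C.fill (s'.bind θ)) (C.fill (s.bind θ)) := by
  have heq : ∀ (L : List LRShGen) (x : Fin n), (∀ i, x ∈ (θ i).leaves →
      degVector L s' i = degVector L s i) →
      degVector L (C.fill (s'.bind θ)) x = degVector L (C.fill (s.bind θ)) x := by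
    intro L x hx
    by_cases hxs : x ∈ (s.bind θ).leaves
    · have hxs' := hxs
      rw [leaves_bind] at hxs'
      obtain ⟨i, _, hi⟩ := List.mem_flatMap.1 hxs'
      obtain ⟨b, hb⟩ := exists_degVector_fill_bind L hs' hn hi
      rw [hb s' hp, hb s (List.Perm.refl _), hx i hi]
    · exact degVector_fill_bind_eq L hp hxs (hn' x)
  have hlt : ∀ (L : List LRShGen) (v w : OpTree LRShGen (Fin m)), v.leaves.Perm s.leaves →
      w.leaves.Perm s.leaves → LexLT (degVector L v) (degVector L w) →
      (∀ x, (∀ i, x ∈ (θ i).leaves → degVector L v i = degVector L w i) →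
        degVector L (C.fill (v.bind θ)) x = degVector L (C.fill (w.bind θ)) x) →
      LexLT (degVector L (C.fill (v.bind θ))) (degVector L (C.fill (w.bind θ))) := by
    rintro L v w hv hw ⟨i, h1, h2⟩ he
    refine ⟨(θ i).minLeaf, fun x hx => he x fun j hj => h1 j ?_, ?_⟩
    · exact hθ.lt_iff_lt.1 ((minLeaf_le hj).trans_lt hx)
    · obtain ⟨b, hb⟩ := exists_degVector_fill_bind L hs' hn (minLeaf_mem (θ i))
      rw [hb v hv, hb w hw]
      omega
  have h1 := fun L => hlt L s' s hp (List.Perm.refl _)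
  have h2 := fun L => hlt L s s' (List.Perm.refl _) hp
  have e1 := fun L => heq L
  have e2 : ∀ (L : List LRShGen) (x : Fin n), (∀ i, x ∈ (θ i).leaves →
      degVector L s i = degVector L s' i) →
      degVector L (C.fill (s.bind θ)) x = degVector L (C.fill (s'.bind θ)) x :=
    fun L x hx => (heq L x fun i hi => (hx i hi).symm).symm
  have e3 : ∀ L, degVector L s = degVector L s' →
      degVector L (C.fill (s.bind θ)) = degVector L (C.fill (s'.bind θ)) :=
    fun L h => funext fun x => e2 L x fun i _ => congrFun h i
  rcases h with h | ⟨h, h' | ⟨h', h'' | ⟨h'', h4⟩⟩⟩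
  · exact Or.inl (h2 _ h (e2 _))
  · exact Or.inr ⟨e3 _ h, Or.inl (h2 _ h' (e2 _))⟩
  · exact Or.inr ⟨e3 _ h, Or.inr ⟨e3 _ h', Or.inl (h2 _ h'' (e2 _))⟩⟩
  · exact Or.inr ⟨e3 _ h, Or.inr ⟨e3 _ h', Or.inr ⟨e3 _ h'', h1 _ h4 (e1 _)⟩⟩⟩

end QM

/-! ### Reducible tree monomials -/

section Reducible

variable {n : ℕ}

/-- All trees in `f` other than `s` are smaller than `s`, which occurs in `f`. -/
def IsQMLeading {k : Type u} [Field k] (f : OpTree LRShGen (Fin n) →₀ k)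
    (s : OpTree LRShGen (Fin n)) : Prop :=
  s ∈ f.support ∧ ∀ s' ∈ f.support, s' ≠ s → QMLess s' s

/-- The tree `t` is divisible by the leading tree of one of the quadratic relations. -/
def Reducible (k : Type u) [Field k] (χ : Fin n → Col) (t : OpTree LRShGen (Fin n)) : Prop :=
  ∃ g ∈ lrShuffleRelations k, ∃ s : OpTree LRShGen (Fin g.arity),
    IsQMLeading (n := g.arity) g.elt s ∧
    ∃ (C : Ctx LRShGen (Fin n)) (θ : Fin g.arity → OpTree LRShGen (Fin n)),
      C.fill (s.bind θ) = t ∧ (StrictMono fun i => (θ i).minLeaf) ∧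
      ∀ i, (θ i).IsColoured lrShSig χ (g.inp i)

variable {k : Type u} [Field k]

theorem lrShuffleRelations_isShuffleMonomial {g : Element k lrShSig}
    (hg : g ∈ lrShuffleRelations k) :
    ∀ s ∈ g.elt.support, IsShuffleMonomial lrShSig g.inp g.out s := by
  classical
  obtain ⟨r, hr, σ, rfl⟩ := hg
  refine support_planarize (k := k) (P := IsMonomial lrSig (r.inp ∘ σ.symm) r.out)
    (fun t ht => isShuffleMonomial_planar ht) fun s hs => ?_
  obtain ⟨t, ht, rfl⟩ := Finset.mem_image.1 (Finsupp.mapDomain_support hs)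
  refine IsMonomial.map σ ?_
  have e : (r.inp ∘ σ.symm) ∘ σ = r.inp := funext fun x => congrArg r.inp (σ.symm_apply_apply x)
  rw [e]
  exact (lrQuadratic_support hr t ht).1

theorem lrShuffleRelations_isQuadratic {g : Element k lrShSig}
    (hg : g ∈ lrShuffleRelations k) : IsQuadratic g := by
  classical
  obtain ⟨r, hr, σ, rfl⟩ := hg
  refine support_planarize (k := k) (P := fun t => t.vertices = 2)
    (fun t ht => (vertices_planar t).trans ht) fun s hs => ?_
  obtain ⟨t, ht, rfl⟩ := Finset.mem_image.1 (Finsupp.mapDomain_support hs)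
  have h := (lrQuadratic_support hr t ht).2
  have e1 := leaves_length t
  have e2 := leaves_length (t.map σ)
  rw [leaves_map, List.length_map, e1] at e2
  exact (Nat.succ_injective e2).symm.trans h

/-- A reducible tree can be rewritten as a combination of smaller trees. -/
theorem Reducible.exists_rewrite {χ : Fin n → Col} {c : Col} {t : OpTree LRShGen (Fin n)}
    (ht : IsShuffleMonomial lrShSig χ c t) (h : Reducible k χ t) :
    ∃ (a : k) (r : OpTree LRShGen (Fin n) →₀ k), a ≠ 0 ∧
      InShuffleIdeal (S := lrShSig) (lrShuffleRelations k) χ c (Finsupp.single t a + r) ∧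
      ∀ s ∈ r.support, QMLess s t := by
  classical
  obtain ⟨g, hg, s, ⟨hs, hlead⟩, C, θ, rfl, hθ, hc⟩ := h
  have hm := lrShuffleRelations_isShuffleMonomial hg
  have hsm := hm s hs
  have hn := ht.1.2.1
  have hI' := InShuffleIdeal.fill_bind (InShuffleIdeal.rel g hg) hsm hθ hc ht
  refine ⟨g.elt s, (g.elt.erase s).mapDomain fun s => C.fill (s.bind θ),
    Finsupp.mem_support_iff.1 hs, ?_, ?_⟩
  · exact (congrArg (InShuffleIdeal (S := lrShSig) (lrShuffleRelations k) χ c)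
      (mapDomain_eq_single_add _ _ _)).mp hI'
  · intro s' hs'
    obtain ⟨v, hv, hvs, rfl⟩ := mem_support_mapDomain_erase hs'
    have hvm := hm v hv
    refine QMLess.fill_bind hθ hsm.1.2.2 ?_ hn ht.1.2.2 (hlead v hv hvs)
    exact (List.perm_ext_iff_of_nodup hvm.1.2.1 hsm.1.2.1).2 fun x => by
      simp [hvm.1.2.2 x, hsm.1.2.2 x]

end Reducible

open OpTree

/-! ### Leading trees of the quadratic relations -/

section Leading

/-- Makes the comparison of concrete degree vectors available to `decide`. -/
instance {n : ℕ} (v w : Fin n → ℕ) : Decidable (LexLT v w) :=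
  inferInstanceAs (Decidable (∃ i, (∀ j < i, v j = w j) ∧ v i < w i))

/-- Makes the comparison of concrete trees available to `decide`. -/
instance {n : ℕ} (t t' : OpTree LRShGen (Fin n)) : Decidable (QMLess t t') :=
  inferInstanceAs (Decidable (_ ∨ _))

theorem qmLess_leibniz : ∀ a b c : Fin 3, a ≠ b → a ≠ c → b ≠ c →
    QMLess (planar (op .α (inp a) (op .d (inp b) (inp c))))
      (planar (op .d (op .α (inp a) (inp b)) (inp c))) ∧
    QMLess (planar (op .α (op .d (inp a) (inp c)) (inp b)))
      (planar (op .d (op .α (inp a) (inp b)) (inp c))) := by decide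

theorem qmLess_morphism : ∀ a b c : Fin 3, a ≠ b → a ≠ c → b ≠ c →
    QMLess (planar (op .d (op .d (inp a) (inp c)) (inp b)))
      (planar (op .d (inp a) (op .β (inp b) (inp c)))) ∧
    QMLess (planar (op .d (op .d (inp a) (inp b)) (inp c)))
      (planar (op .d (inp a) (op .β (inp b) (inp c)))) := by decide

theorem qmLess_module : ∀ a b c : Fin 3, a ≠ b → a ≠ c → b ≠ c →
    QMLess (planar (op .m (op .α (inp a) (inp b)) (inp c)))
      (planar (op .m (inp a) (op .m (inp b) (inp c)))) := by decide

theorem qmLess_anchor : ∀ a b c : Fin 3, a ≠ b → a ≠ c → b ≠ c →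
    QMLess (planar (op .α (op .d (inp a) (inp c)) (inp b)))
      (planar (op .d (inp a) (op .m (inp b) (inp c)))) := by decide

theorem qmLess_rinehart : ∀ a b c : Fin 3, a ≠ b → a ≠ c → b ≠ c →
    QMLess (planar (op .m (inp a) (op .β (inp b) (inp c))))
      (planar (op .β (inp b) (op .m (inp a) (inp c)))) ∧
    QMLess (planar (op .m (op .d (inp a) (inp b)) (inp c)))
      (planar (op .β (inp b) (op .m (inp a) (inp c)))) := by decide

theorem qmLess_assoc : ∀ a b c : Fin 3, a ≠ b → a < c → b < c →
    QMLess (planar (op .α (op .α (inp a) (inp b)) (inp c)))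
      (planar (op .α (inp a) (op .α (inp b) (inp c)))) := by decide

theorem qmLess_jacobi : ∀ a b c : Fin 3, a < b → b < c →
    QMLess (planar (op .β (op .β (inp a) (inp c)) (inp b)))
      (planar (op .β (op .β (inp a) (inp b)) (inp c))) ∧
    QMLess (planar (op .β (inp a) (op .β (inp b) (inp c))))
      (planar (op .β (op .β (inp a) (inp b)) (inp c))) := by decide

end Leading

section Substitution

variable {X Y : Type} [LinearOrder X]

/-- The shuffle tree of the operation obtained from `T` by substitution of the trees `τ`, provided
that their smallest leaves are distinct. -/
def substPlanar (τ : Y → OpTree LRShGen X) : OpTree LRGen Y → OpTree LRShGen X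
  | .leaf y => τ y
  | .node g l r =>
    if (substPlanar τ l).minLeaf < (substPlanar τ r).minLeaf then
      .node g.keep (substPlanar τ l) (substPlanar τ r)
    else .node g.swap (substPlanar τ r) (substPlanar τ l)

theorem planar_bind {Y' : Type} [LinearOrder Y'] {θ : Y' → OpTree LRShGen X}
    (hθ : StrictMono fun i => (θ i).minLeaf) (σ : Y → Y') (T : OpTree LRGen Y) :
    (planar (T.map σ)).bind θ = substPlanar (fun y => θ (σ y)) T := by
  induction T with
  | leaf y => rfl
  | node g l r hl hr =>
    have e : ∀ T : OpTree LRGen Y, (planar (T.map σ)).bind θ = substPlanar (fun y => θ (σ y)) T →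
        (substPlanar (fun y => θ (σ y)) T).minLeaf = (θ (T.map σ).minLeaf).minLeaf :=
      fun T h => by rw [← h, minLeaf_bind hθ.monotone, minLeaf_planar]
    rw [OpTree.map, planar, substPlanar, e l hl, e r hr, ← hl, ← hr]
    have hlt : (θ (l.map σ).minLeaf).minLeaf < (θ (r.map σ).minLeaf).minLeaf ↔
        (l.map σ).minLeaf < (r.map σ).minLeaf := hθ.lt_iff_lt
    simp only [hlt]
    split_ifs <;> rfl

theorem leaves_substPlanar (τ : Y → OpTree LRShGen X) (T : OpTree LRGen Y) :
    (substPlanar τ T).leaves.Perm (T.leaves.flatMap fun y => (τ y).leaves) := by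
  induction T with
  | leaf y => simp [substPlanar, leaves]
  | node g l r hl hr =>
    rw [substPlanar, leaves, List.flatMap_append]
    split_ifs
    · exact hl.append hr
    · exact (hr.append hl).trans List.perm_append_comm

theorem isColoured_of_substPlanar {τ : Y → OpTree LRShGen X} {χ : X → Col} {χ' : Y → Col} :
    ∀ {T : OpTree LRGen Y} {c : Col}, T.IsColoured lrSig χ' c →
      (substPlanar τ T).IsColoured lrShSig χ c → ∀ y ∈ T.leaves,
        (τ y).IsColoured lrShSig χ (χ' y)
  | .leaf y, c, h, h' => fun y' hy' => by
    obtain rfl := List.mem_singleton.1 hy'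
    obtain rfl : χ' y' = c := h
    exact h'
  | .node g l r, c, h, h' => fun y hy => by
    have key : (substPlanar τ l).IsColoured lrShSig χ (lrSig.in₁ g) ∧
        (substPlanar τ r).IsColoured lrShSig χ (lrSig.in₂ g) := by
      rw [substPlanar] at h'
      split_ifs at h' <;> cases g
      all_goals first | exact ⟨h'.2.1, h'.2.2⟩ | exact ⟨h'.2.2, h'.2.1⟩
    rcases List.mem_append.1 hy with hy | hy
    · exact isColoured_of_substPlanar h.2.1 key.1 y hy
    · exact isColoured_of_substPlanar h.2.2 key.2 y hy

theorem planarSign_ne_zero {k : Type u} [Field k] (T : OpTree LRGen X) :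
    (planarSign T : k) ≠ 0 := by
  induction T with
  | leaf x => simp [planarSign]
  | node g l r hl hr =>
    rw [planarSign]
    push_cast
    refine mul_ne_zero (mul_ne_zero ?_ hl) hr
    split_ifs
    · simp
    · cases g <;> simp [LRGen.swapSign]

end Substitution

section

variable {k : Type u} [Field k] {n : ℕ} {χ : Fin n → Col} {c : Col}

theorem forall_support_neg {α : Type*} {P : α → Prop} {f : α →₀ k} (hf : ∀ s ∈ f.support, P s) :
    ∀ s ∈ (-f).support, P s := by
  rwa [Finsupp.support_neg]

/-- Trees which are obtained by substitution in the leading tree `node g T₁ T₂` of a relation are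
reducible. -/
theorem reducible_substPlanar {r : Element k lrSig} (hr : r ∈ lrQuadratic k) {g : LRGen}
    {T₁ T₂ : OpTree LRGen (Fin r.arity)} {a : k} {f : OpTree LRGen (Fin r.arity) →₀ k}
    (he : r.elt = Finsupp.single (.node g T₁ T₂) a + f) (ha : a ≠ 0)
    (hT : IsMonomial lrSig r.inp r.out (.node g T₁ T₂))
    {τ : Fin r.arity → OpTree LRShGen (Fin n)}
    (hlead : ∀ σ : Equiv.Perm (Fin r.arity),
      (∀ i j, (τ i).minLeaf < (τ j).minLeaf ↔ σ i < σ j) → ∀ T ∈ f.support,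
        QMLess (planar (T.map σ)) (planar (OpTree.map σ (.node g T₁ T₂))))
    {C : Ctx LRShGen (Fin n)}
    (ht : IsShuffleMonomial lrShSig χ c (C.fill (substPlanar τ (.node g T₁ T₂)))) :
    Reducible k χ (C.fill (substPlanar τ (.node g T₁ T₂))) := by
  classical
  have hn : (substPlanar τ (.node g T₁ T₂)).leaves.Nodup := Ctx.nodup_of_fill ht.1.2.1
  rw [(leaves_substPlanar τ _).nodup_iff, List.nodup_flatMap] at hn
  have hsymm : Std.Symm (Function.onFun List.Disjoint fun x => (τ x).leaves) :=
    ⟨fun _ _ h => List.Disjoint.symm h⟩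
  have hinj : Function.Injective fun i => (τ i).minLeaf := by
    intro i j hij
    by_contra hne
    have hij : (τ i).minLeaf = (τ j).minLeaf := hij
    refine hn.2.forall (hT.2.2 i) (hT.2.2 j) hne (minLeaf_mem (τ i)) ?_
    rw [hij]
    exact minLeaf_mem _
  -- the substituted trees are numbered in the order of their smallest leaves
  have hmono : StrictMono fun i => (τ (Tuple.sort (fun i => (τ i).minLeaf) i)).minLeaf :=
    (Tuple.monotone_sort fun i => (τ i).minLeaf).strictMono_of_injective
      (hinj.comp (Equiv.injective _))
  generalize hσ : (Tuple.sort fun i => (τ i).minLeaf).symm = σ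
  have hσ' : Tuple.sort (fun i => (τ i).minLeaf) = σ.symm := by rw [← hσ, Equiv.symm_symm]
  rw [hσ'] at hmono
  have hp := planar_bind hmono σ (.node g T₁ T₂)
  simp only [Equiv.symm_apply_apply] at hp
  have hl := hlead σ fun i j => by
    have := hmono.lt_iff_lt (a := σ i) (b := σ j)
    simpa only [Equiv.symm_apply_apply] using this
  obtain ⟨c', hc', -⟩ := Ctx.exists_isColoured_fill (S := lrShSig) ht.1.1
  have hout : r.out = c' := by
    refine hT.1.1.symm.trans ?_
    rw [substPlanar] at hc'
    split_ifs at hc' <;> cases g <;> exact hc'.1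
  subst hout
  have hcol := isColoured_of_substPlanar hT.1 hc'
  have helt : planarize k (Fin r.arity) (r.elt.mapDomain (OpTree.map σ)) =
      Finsupp.single (planar (OpTree.map σ (.node g T₁ T₂)))
        (a * (planarSign (OpTree.map σ (.node g T₁ T₂)) : k)) +
      planarize k (Fin r.arity) (f.mapDomain (OpTree.map σ)) := by
    have : r.elt.mapDomain (OpTree.map σ) = Finsupp.single (OpTree.map σ (.node g T₁ T₂)) a +
        f.mapDomain (OpTree.map σ) := by
      refine (congrArg (Finsupp.mapDomain (OpTree.map σ)) he).trans ?_
      exact Finsupp.mapDomain_add.trans (congrArg (· + _) Finsupp.mapDomain_single)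
    refine (congrArg (planarize k (Fin r.arity)) this).trans ?_
    rw [map_add]
    congr 1
    rw [planarize, Finsupp.linearCombination_single, Finsupp.smul_single, smul_eq_mul]
  have hrest : ∀ s ∈ (planarize k (Fin r.arity) (f.mapDomain (OpTree.map σ))).support,
      QMLess s (planar (OpTree.map σ (.node g T₁ T₂))) := by
    refine support_planarize
      (P := fun T => QMLess (planar T) (planar (OpTree.map σ (.node g T₁ T₂)))) (fun _ h => h) ?_
    intro s hs
    obtain ⟨T, hT, rfl⟩ := Finset.mem_image.1 (Finsupp.mapDomain_support hs)
    exact hl T hT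
  refine ⟨_, ⟨r, hr, σ, rfl⟩, planar (OpTree.map σ (.node g T₁ T₂)), ?_, C,
    fun i => τ (σ.symm i), congrArg (fun u => C.fill u) hp, hmono,
    fun i => hcol _ (hT.2.2 _)⟩
  refine (congrArg (fun F => IsQMLeading F (planar (OpTree.map σ (.node g T₁ T₂)))) helt).mpr ⟨?_, ?_⟩
  · rw [Finsupp.mem_support_iff, Finsupp.add_apply, Finsupp.single_eq_same,
      Finsupp.notMem_support_iff.1 fun h => QMLess.irrefl (hrest _ h), add_zero]
    exact mul_ne_zero ha (planarSign_ne_zero _)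
  · intro s hs hne
    refine hrest s ?_
    rcases Finset.mem_union.1 (Finsupp.support_add hs) with h | h
    · exact absurd (Finset.mem_singleton.1 (Finsupp.support_single_subset h)) hne
    · exact h

end

open OpTree

section

variable {k : Type u} [Field k] {n : ℕ} {χ : Fin n → Col} {c : Col}
  {τ : Fin 3 → OpTree LRShGen (Fin n)} {C : Ctx LRShGen (Fin n)}

theorem perm_ne (σ : Equiv.Perm (Fin 3)) : σ 0 ≠ σ 1 ∧ σ 0 ≠ σ 2 ∧ σ 1 ≠ σ 2 := by
  simp

theorem reducible_leibniz (ht : IsShuffleMonomial lrShSig χ c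
    (C.fill (substPlanar τ (op .d (op .α (inp 0) (inp 1)) (inp 2))))) :
    Reducible k χ (C.fill (substPlanar τ (op .d (op .α (inp 0) (inp 1)) (inp 2)))) := by
  refine reducible_substPlanar (k := k) (r := ⟨3, ![.s, .s, .l], .s, leibnizRel k .α .d⟩)
    (by simp [lrQuadratic]) (a := 1)
    (f := -mon k (op .α (inp 0) (op .d (inp 1) (inp 2)))
      - mon k (op .α (op .d (inp 0) (inp 2)) (inp 1)))
    (by simp only [leibnizRel, mon, op]; abel) one_ne_zero ?_ (fun σ _ => ?_) ht
  · exact ⟨by simp [inp, op, OpTree.IsColoured, lrSig], by simp [inp, op, leaves],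
      fun x => by change Fin 3 at x; fin_cases x <;> simp [inp, op, leaves]⟩
  · obtain ⟨h1, h2⟩ := qmLess_leibniz _ _ _ (perm_ne σ).1 (perm_ne σ).2.1 (perm_ne σ).2.2
    exact forall_support_sub (forall_support_neg (forall_support_mon h1)) (forall_support_mon h2)

theorem reducible_morphism (ht : IsShuffleMonomial lrShSig χ c
    (C.fill (substPlanar τ (op .d (inp 0) (op .β (inp 1) (inp 2)))))) :
    Reducible k χ (C.fill (substPlanar τ (op .d (inp 0) (op .β (inp 1) (inp 2))))) := by
  refine reducible_substPlanar (k := k) (r := ⟨3, ![.s, .l, .l], .s, morphismRel k .β .d⟩)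
    (by simp [lrQuadratic]) (a := 1)
    (f := -mon k (op .d (op .d (inp 0) (inp 2)) (inp 1))
      + mon k (op .d (op .d (inp 0) (inp 1)) (inp 2)))
    (by simp only [morphismRel, mon, op]; abel) one_ne_zero ?_ (fun σ _ => ?_) ht
  · exact ⟨by simp [inp, op, OpTree.IsColoured, lrSig], by simp [inp, op, leaves],
      fun x => by change Fin 3 at x; fin_cases x <;> simp [inp, op, leaves]⟩
  · obtain ⟨h1, h2⟩ := qmLess_morphism _ _ _ (perm_ne σ).1 (perm_ne σ).2.1 (perm_ne σ).2.2
    exact forall_support_add (forall_support_neg (forall_support_mon h1)) (forall_support_mon h2)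

theorem reducible_module (ht : IsShuffleMonomial lrShSig χ c
    (C.fill (substPlanar τ (op .m (inp 0) (op .m (inp 1) (inp 2)))))) :
    Reducible k χ (C.fill (substPlanar τ (op .m (inp 0) (op .m (inp 1) (inp 2))))) := by
  refine reducible_substPlanar (k := k) (r := ⟨3, ![.s, .s, .l], .l, moduleRel k .α .m⟩)
    (by simp [lrQuadratic]) (a := -1)
    (f := mon k (op .m (op .α (inp 0) (inp 1)) (inp 2)))
    (by rw [Finsupp.single_neg]; exact sub_eq_neg_add _ _) (by simp) ?_ (fun σ _ => ?_) ht
  · exact ⟨by simp [inp, op, OpTree.IsColoured, lrSig], by simp [inp, op, leaves],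
      fun x => by change Fin 3 at x; fin_cases x <;> simp [inp, op, leaves]⟩
  · exact forall_support_mon
      (qmLess_module _ _ _ (perm_ne σ).1 (perm_ne σ).2.1 (perm_ne σ).2.2)

theorem reducible_anchor (ht : IsShuffleMonomial lrShSig χ c
    (C.fill (substPlanar τ (op .d (inp 0) (op .m (inp 1) (inp 2)))))) :
    Reducible k χ (C.fill (substPlanar τ (op .d (inp 0) (op .m (inp 1) (inp 2))))) := by
  refine reducible_substPlanar (k := k) (r := ⟨3, ![.s, .s, .l], .s, anchorRel k .α .d .m⟩)
    (by simp [lrQuadratic]) (a := 1)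
    (f := -mon k (op .α (op .d (inp 0) (inp 2)) (inp 1)))
    (by simp only [anchorRel, mon, op]; abel) one_ne_zero ?_ (fun σ _ => ?_) ht
  · exact ⟨by simp [inp, op, OpTree.IsColoured, lrSig], by simp [inp, op, leaves],
      fun x => by change Fin 3 at x; fin_cases x <;> simp [inp, op, leaves]⟩
  · exact forall_support_neg (forall_support_mon
      (qmLess_anchor _ _ _ (perm_ne σ).1 (perm_ne σ).2.1 (perm_ne σ).2.2))

theorem reducible_rinehart (ht : IsShuffleMonomial lrShSig χ c
    (C.fill (substPlanar τ (op .β (inp 1) (op .m (inp 0) (inp 2)))))) :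
    Reducible k χ (C.fill (substPlanar τ (op .β (inp 1) (op .m (inp 0) (inp 2))))) := by
  refine reducible_substPlanar (k := k) (r := ⟨3, ![.s, .l, .l], .l, rinehartRel k .β .d .m⟩)
    (by simp [lrQuadratic]) (a := 1)
    (f := -mon k (op .m (inp 0) (op .β (inp 1) (inp 2)))
      - mon k (op .m (op .d (inp 0) (inp 1)) (inp 2)))
    (by simp only [rinehartRel, mon, op]; abel) one_ne_zero ?_ (fun σ _ => ?_) ht
  · exact ⟨by simp [inp, op, OpTree.IsColoured, lrSig], by simp [inp, op, leaves],
      fun x => by change Fin 3 at x; fin_cases x <;> simp [inp, op, leaves]⟩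
  · obtain ⟨h1, h2⟩ := qmLess_rinehart _ _ _ (perm_ne σ).1 (perm_ne σ).2.1 (perm_ne σ).2.2
    exact forall_support_sub (forall_support_neg (forall_support_mon h1)) (forall_support_mon h2)

theorem reducible_assoc (h02 : (τ 0).minLeaf < (τ 2).minLeaf)
    (h12 : (τ 1).minLeaf < (τ 2).minLeaf) (ht : IsShuffleMonomial lrShSig χ c
    (C.fill (substPlanar τ (op .α (inp 0) (op .α (inp 1) (inp 2)))))) :
    Reducible k χ (C.fill (substPlanar τ (op .α (inp 0) (op .α (inp 1) (inp 2))))) := by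
  refine reducible_substPlanar (k := k) (r := ⟨3, ![.s, .s, .s], .s, assocRel k .α⟩)
    (by simp [lrQuadratic]) (a := -1)
    (f := mon k (op .α (op .α (inp 0) (inp 1)) (inp 2)))
    (by rw [Finsupp.single_neg]; exact sub_eq_neg_add _ _) (by simp) ?_ (fun σ hσ => ?_) ht
  · exact ⟨by simp [inp, op, OpTree.IsColoured, lrSig], by simp [inp, op, leaves],
      fun x => by change Fin 3 at x; fin_cases x <;> simp [inp, op, leaves]⟩
  · exact forall_support_mon
      (qmLess_assoc _ _ _ (perm_ne σ).1 ((hσ _ _).1 h02) ((hσ _ _).1 h12))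

theorem reducible_jacobi (h01 : (τ 0).minLeaf < (τ 1).minLeaf)
    (h12 : (τ 1).minLeaf < (τ 2).minLeaf) (ht : IsShuffleMonomial lrShSig χ c
    (C.fill (substPlanar τ (op .β (op .β (inp 0) (inp 1)) (inp 2))))) :
    Reducible k χ (C.fill (substPlanar τ (op .β (op .β (inp 0) (inp 1)) (inp 2)))) := by
  refine reducible_substPlanar (k := k) (r := ⟨3, ![.l, .l, .l], .l, jacobiRel k .β⟩)
    (by simp [lrQuadratic]) (a := 1)
    (f := -mon k (op .β (op .β (inp 0) (inp 2)) (inp 1))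
      - mon k (op .β (inp 0) (op .β (inp 1) (inp 2))))
    (by simp only [jacobiRel, mon, op]; abel) one_ne_zero ?_ (fun σ hσ => ?_) ht
  · exact ⟨by simp [inp, op, OpTree.IsColoured, lrSig], by simp [inp, op, leaves],
      fun x => by change Fin 3 at x; fin_cases x <;> simp [inp, op, leaves]⟩
  · obtain ⟨h1, h2⟩ := qmLess_jacobi _ _ _ ((hσ _ _).1 h01) ((hσ _ _).1 h12)
    exact forall_support_sub (forall_support_neg (forall_support_mon h1)) (forall_support_mon h2)

end

/-! ### Normal shuffle trees -/

/-- The root of the tree is marked by an element of `L`. -/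
def OpTree.RootIn {G X : Type} (L : List G) : OpTree G X → Prop
  | leaf _ => False
  | node g _ _ => g ∈ L

/-- In the correctly coloured shuffle tree with branches `l` and `r` and the given mark at the root,
no leading tree of a relation occurs at the root. -/
def IsNormalAt {X : Type} [LinearOrder X] (l r : OpTree LRShGen X) : LRShGen → Prop
  | .α => ¬r.RootIn [.α] ∧ ∀ a b, l = node .α a b → b.minLeaf < r.minLeaf
  | .β => ¬l.RootIn [.m, .n] ∧ ¬r.RootIn [.m, .n] ∧ ∀ a b, l = node .β a b → r.minLeaf < b.minLeaf
  | .d => ¬l.RootIn [.α] ∧ ∃ y, r = leaf y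
  | .e => ¬r.RootIn [.α] ∧ ∃ y, l = leaf y
  | .m => ¬r.RootIn [.m, .n]
  | .n => ¬l.RootIn [.m, .n]

/-- The shuffle trees which are not divisible by the leading trees of the relations. -/
def IsNormal {X : Type} [LinearOrder X] : OpTree LRShGen X → Prop
  | .leaf _ => True
  | .node g l r => IsNormalAt l r g ∧ IsNormal l ∧ IsNormal r

theorem exists_not_isNormalAt {X : Type} [LinearOrder X] {t : OpTree LRShGen X}
    (h : ¬IsNormal t) : ∃ (C : Ctx LRShGen X) (g : LRShGen) (l r : OpTree LRShGen X),
      C.fill (node g l r) = t ∧ ¬IsNormalAt l r g := by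
  induction t with
  | leaf x => exact absurd trivial h
  | node g l r hl hr =>
    by_cases h1 : IsNormalAt l r g
    · by_cases h2 : IsNormal l
      · obtain ⟨C, g', l', r', h3, h4⟩ := hr fun h3 => h ⟨h1, h2, h3⟩
        exact ⟨.right g l C, g', l', r', congrArg (node g l) h3, h4⟩
      · obtain ⟨C, g', l', r', h3, h4⟩ := hl h2
        exact ⟨.left g C r, g', l', r', congrArg (fun l => node g l r) h3, h4⟩
    · exact ⟨.hole, g, l, r, rfl, h1⟩

section

variable {k : Type u} [Field k] {n : ℕ} {χ : Fin n → Col} {c : Col}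

theorem OpTree.exists_of_rootIn {G X : Type} {L : List G} {t : OpTree G X} (h : t.RootIn L) :
    ∃ g ∈ L, ∃ a b, t = node g a b := by
  cases t with
  | leaf x => exact h.elim
  | node g a b => exact ⟨g, h, a, b, rfl⟩

/-- Shuffle trees which are not normal are reducible: a violation of `IsNormalAt` at a vertex, up to
the order of the branches, is the leading tree of one of the relations at three subtrees. -/
theorem reducible_of_not_isNormal {t : OpTree LRShGen (Fin n)}
    (ht : IsShuffleMonomial lrShSig χ c t) (h : ¬IsNormal t) : Reducible k χ t := by
  obtain ⟨C, g, l, r, rfl, hg⟩ := exists_not_isNormalAt h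
  have hs : (node g l r).IsShuffle := Ctx.isShuffle_of_fill ht.2
  have hn : (node g l r).leaves.Nodup := Ctx.nodup_of_fill ht.1.2.1
  obtain ⟨c', hc, -⟩ := Ctx.exists_isColoured_fill (S := lrShSig) ht.1.1
  obtain ⟨h1, h2, h3⟩ := hs
  -- below, `τ` lists the three subtrees in the order of the inputs of the relation
  have key : ∀ (τ : Fin 3 → OpTree LRShGen (Fin n)) (T : OpTree LRGen (Fin 3)),
      substPlanar τ T = node g l r → (IsShuffleMonomial lrShSig χ c (C.fill (substPlanar τ T)) →
        Reducible k χ (C.fill (substPlanar τ T))) → Reducible k χ (C.fill (node g l r)) :=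
    fun τ T e h => by rw [e] at h; exact h ht
  cases g with
  | α =>
    rw [IsNormalAt, Classical.not_and_iff_not_or_not, not_not] at hg
    rcases hg with hg | hg
    · obtain ⟨g', hg', P, Q, rfl⟩ := exists_of_rootIn hg
      obtain rfl := List.mem_singleton.1 hg'
      have h4 := h3.1
      simp only [minLeaf, min_eq_left h4.le] at h1
      refine key ![l, P, Q] _ ?_ (reducible_assoc (h1.trans h4) h4)
      simp [substPlanar, op, inp, LRGen.keep, minLeaf, h4, h4.le, h1]
    · push Not at hg
      obtain ⟨a, b, rfl, hab⟩ := hg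
      have h4 := h2.1
      have hrb : r.minLeaf < b.minLeaf := lt_of_le_of_ne hab fun e => by
        have := (List.nodup_append'.1 hn).2.2
        exact this (List.mem_append_right _ (minLeaf_mem b)) (e ▸ minLeaf_mem r)
      simp only [minLeaf, min_eq_left h4.le] at h1
      refine key ![r, a, b] _ ?_ (reducible_assoc hrb h4)
      simp [substPlanar, op, inp, LRGen.keep, LRGen.swap, minLeaf, h4, h4.le, h1.not_gt]
  | β =>
    rw [IsNormalAt, Classical.not_and_iff_not_or_not, Classical.not_and_iff_not_or_not, not_not,
      not_not] at hg
    rcases hg with hg | hg | hg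
    · obtain ⟨g', hg', P, Q, rfl⟩ := exists_of_rootIn hg
      have h4 := h2.1
      simp only [minLeaf, min_eq_left h4.le] at h1
      simp only [List.mem_cons, List.not_mem_nil, or_false] at hg'
      rcases hg' with rfl | rfl
      · refine key ![P, r, Q] _ ?_ reducible_rinehart
        simp [substPlanar, op, inp, LRGen.keep, LRGen.swap, minLeaf, h4, h4.le, h1.not_gt]
      · refine key ![Q, r, P] _ ?_ reducible_rinehart
        simp [substPlanar, op, inp, LRGen.swap, minLeaf, h4.not_gt, h4.le, h1.not_gt]
    · obtain ⟨g', hg', P, Q, rfl⟩ := exists_of_rootIn hg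
      have h4 := h3.1
      simp only [minLeaf, min_eq_left h4.le] at h1
      simp only [List.mem_cons, List.not_mem_nil, or_false] at hg'
      rcases hg' with rfl | rfl
      · refine key ![P, l, Q] _ ?_ reducible_rinehart
        simp [substPlanar, op, inp, LRGen.keep, minLeaf, h4, h4.le, h1]
      · refine key ![Q, l, P] _ ?_ reducible_rinehart
        simp [substPlanar, op, inp, LRGen.keep, LRGen.swap, minLeaf, h4.not_gt, h4.le, h1]
    · push Not at hg
      obtain ⟨a, b, rfl, hab⟩ := hg
      have h4 := h2.1
      have hrb : b.minLeaf < r.minLeaf := lt_of_le_of_ne hab fun e => by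
        have := (List.nodup_append'.1 hn).2.2
        exact this (List.mem_append_right _ (minLeaf_mem b)) (e ▸ minLeaf_mem r)
      simp only [minLeaf, min_eq_left h4.le] at h1
      refine key ![a, b, r] _ ?_ (reducible_jacobi h4 hrb)
      simp [substPlanar, op, inp, LRGen.keep, minLeaf, h4, h4.le, h1]
  | d =>
    rw [IsNormalAt, Classical.not_and_iff_not_or_not, not_not] at hg
    rcases hg with hg | hg
    · obtain ⟨g', hg', P, Q, rfl⟩ := exists_of_rootIn hg
      obtain rfl := List.mem_singleton.1 hg'
      have h4 := h2.1
      simp only [minLeaf, min_eq_left h4.le] at h1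
      refine key ![P, Q, r] _ ?_ reducible_leibniz
      simp [substPlanar, op, inp, LRGen.keep, minLeaf, h4, h4.le, h1]
    · cases r with
      | leaf y => exact absurd ⟨y, rfl⟩ hg
      | node g' P Q =>
        have h4 := h3.1
        simp only [minLeaf, min_eq_left h4.le] at h1
        have hg' := hc.2.2.1
        cases g' with
        | α => cases hg'
        | d => cases hg'
        | e => cases hg'
        | β =>
          refine key ![l, P, Q] _ ?_ reducible_morphism
          simp [substPlanar, op, inp, LRGen.keep, minLeaf, h4, h4.le, h1]
        | m =>
          refine key ![l, P, Q] _ ?_ reducible_anchor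
          simp [substPlanar, op, inp, LRGen.keep, minLeaf, h4, h4.le, h1]
        | n =>
          refine key ![l, Q, P] _ ?_ reducible_anchor
          simp [substPlanar, op, inp, LRGen.keep, LRGen.swap, minLeaf, h4.not_gt, h4.le, h1]
  | e =>
    rw [IsNormalAt, Classical.not_and_iff_not_or_not, not_not] at hg
    rcases hg with hg | hg
    · obtain ⟨g', hg', P, Q, rfl⟩ := exists_of_rootIn hg
      obtain rfl := List.mem_singleton.1 hg'
      have h4 := h3.1
      simp only [minLeaf, min_eq_left h4.le] at h1
      refine key ![P, Q, l] _ ?_ reducible_leibniz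
      simp [substPlanar, op, inp, LRGen.keep, LRGen.swap, minLeaf, h4, h4.le, h1.not_gt]
    · cases l with
      | leaf y => exact absurd ⟨y, rfl⟩ hg
      | node g' P Q =>
        have h4 := h2.1
        simp only [minLeaf, min_eq_left h4.le] at h1
        have hg' := hc.2.1.1
        cases g' with
        | α => cases hg'
        | d => cases hg'
        | e => cases hg'
        | β =>
          refine key ![r, P, Q] _ ?_ reducible_morphism
          simp [substPlanar, op, inp, LRGen.keep, LRGen.swap, minLeaf, h4, h4.le, h1.not_gt]
        | m =>
          refine key ![r, P, Q] _ ?_ reducible_anchor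
          simp [substPlanar, op, inp, LRGen.keep, LRGen.swap, minLeaf, h4, h4.le, h1.not_gt]
        | n =>
          refine key ![r, Q, P] _ ?_ reducible_anchor
          simp [substPlanar, op, inp, LRGen.swap, minLeaf, h4.not_gt, h4.le, h1.not_gt]
  | m =>
    rw [IsNormalAt, not_not] at hg
    obtain ⟨g', hg', P, Q, rfl⟩ := exists_of_rootIn hg
    have h4 := h3.1
    simp only [minLeaf, min_eq_left h4.le] at h1
    simp only [List.mem_cons, List.not_mem_nil, or_false] at hg'
    rcases hg' with rfl | rfl
    · refine key ![l, P, Q] _ ?_ reducible_module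
      simp [substPlanar, op, inp, LRGen.keep, minLeaf, h4, h4.le, h1]
    · refine key ![l, Q, P] _ ?_ reducible_module
      simp [substPlanar, op, inp, LRGen.keep, LRGen.swap, minLeaf, h4.not_gt, h4.le, h1]
  | n =>
    rw [IsNormalAt, not_not] at hg
    obtain ⟨g', hg', P, Q, rfl⟩ := exists_of_rootIn hg
    have h4 := h2.1
    simp only [minLeaf, min_eq_left h4.le] at h1
    simp only [List.mem_cons, List.not_mem_nil, or_false] at hg'
    rcases hg' with rfl | rfl
    · refine key ![r, P, Q] _ ?_ reducible_module
      simp [substPlanar, op, inp, LRGen.keep, LRGen.swap, minLeaf, h4, h4.le, h1.not_gt]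
    · refine key ![r, Q, P] _ ?_ reducible_module
      simp [substPlanar, op, inp, LRGen.swap, minLeaf, h4.not_gt, h4.le, h1.not_gt]

end

open OpTree

/-! ### Normal shuffle trees are determined by chains and words -/

section Data

variable {X : Type} [LinearOrder X] {χ : X → Col}

omit [LinearOrder X] in
/-- The chains and the word of a shuffle tree: a chain `(x, w)` consists of a straight leaf `x` and
the dotted leaves `w` which act on it, from the root to the top; the word consists of the leaves of
the Lie monomial, from left to right. -/
def treeData (χ : X → Col) : OpTree LRShGen X → Multiset (X × List X) × List X
  | .leaf x => match χ x with
    | .s => ({(x, [])}, [])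
    | .l => (0, [x])
  | .node .α l r => ((treeData χ l).1 + (treeData χ r).1, [])
  | .node .β l r => (0, (treeData χ l).2 ++ (treeData χ r).2)
  | .node .d l r => ((treeData χ l).1.map fun p => (p.1, (treeData χ r).2 ++ p.2), [])
  | .node .e l r => ((treeData χ r).1.map fun p => (p.1, (treeData χ l).2 ++ p.2), [])
  | .node .m l r => ((treeData χ l).1, (treeData χ r).2)
  | .node .n l r => ((treeData χ r).1, (treeData χ l).2)

omit [LinearOrder X] in
theorem treeData_leaf_s {x : X} (h : χ x = .s) :
    treeData χ (.leaf x : OpTree LRShGen X) = ({(x, [])}, []) := by simp [treeData, h]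

omit [LinearOrder X] in
theorem treeData_leaf_l {x : X} (h : χ x = .l) :
    treeData χ (.leaf x : OpTree LRShGen X) = (0, [x]) := by simp [treeData, h]

omit [LinearOrder X] in
theorem pairLabels_singleton (p : X × List X) :
    pairLabels ({p} : Multiset (X × List X)) = ((p.1 :: p.2 : List X) : Multiset X) := by
  simp [pairLabels]

/-- Correctly coloured normal shuffle trees without repeated leaves. -/
structure IsGood (χ : X → Col) (c : Col) (t : OpTree LRShGen X) : Prop where
  coloured : t.IsColoured lrShSig χ c
  shuffle : t.IsShuffle
  nodup : t.leaves.Nodup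
  normal : IsNormal t

variable {c : Col} {g : LRShGen} {l r : OpTree LRShGen X}

theorem IsGood.left (h : IsGood χ c (.node g l r)) : IsGood χ (lrShSig.in₁ g) l :=
  ⟨h.coloured.2.1, h.shuffle.2.1, (List.nodup_append'.1 h.nodup).1, h.normal.2.1⟩

theorem IsGood.right (h : IsGood χ c (.node g l r)) : IsGood χ (lrShSig.in₂ g) r :=
  ⟨h.coloured.2.2, h.shuffle.2.2, (List.nodup_append'.1 h.nodup).2.1, h.normal.2.2⟩

theorem IsGood.out (h : IsGood χ c (.node g l r)) : lrShSig.out g = c := h.coloured.1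

/-- The data of a normal tree with straight output. -/
theorem IsGood.treeData_s {t : OpTree LRShGen X} (h : IsGood χ .s t) :
    (treeData χ t).2 = [] ∧ (treeData χ t).1 ≠ 0 ∧ PairsColoured χ (treeData χ t).1 ∧
      pairLabels (treeData χ t).1 = t.leaves ∧
      (¬t.RootIn [.α] → ∃ p, (treeData χ t).1 = {p}) := by
  induction t with
  | leaf x =>
    have hx : χ x = .s := h.coloured
    rw [treeData_leaf_s hx]
    refine ⟨rfl, by simp, fun p hp => ?_, ?_, fun _ => ⟨_, rfl⟩⟩
    · obtain rfl := Multiset.mem_singleton.1 hp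
      exact ⟨hx, by simp⟩
    · rw [pairLabels_singleton]; rfl
  | node g l r hl hr =>
    cases g with
    | α =>
      obtain ⟨-, l1, l2, l3, -⟩ := hl h.left
      obtain ⟨-, -, r2, r3, -⟩ := hr h.right
      refine ⟨rfl, ?_, ?_, ?_, fun hα => absurd (List.mem_singleton_self _) hα⟩
      · simp [treeData, l1]
      · intro p hp
        exact (Multiset.mem_add.1 hp).elim (l2 p) (r2 p)
      · rw [treeData, pairLabels_add, l3, r3, leaves, Multiset.coe_add]
    | d =>
      obtain ⟨hα, y, rfl⟩ := h.normal.1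
      have hy : χ y = .l := h.right.coloured
      obtain ⟨-, -, l2, l3, l4⟩ := hl h.left
      obtain ⟨p, hp⟩ := l4 hα
      rw [hp, pairLabels_singleton] at l3
      have e : treeData χ (.node .d l (.leaf y)) = ({(p.1, y :: p.2)}, []) := by
        simp [treeData, hp, hy]
      rw [e]
      refine ⟨rfl, by simp, fun q hq => ?_, ?_, fun _ => ⟨_, rfl⟩⟩
      · obtain rfl := Multiset.mem_singleton.1 hq
        obtain ⟨h1, h2⟩ := l2 p (by simp [hp])
        exact ⟨h1, fun z hz => (List.mem_cons.1 hz).elim (fun e => e ▸ hy) (h2 z)⟩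
      · rw [pairLabels_singleton, leaves, leaves, ← Multiset.coe_add, ← l3, Multiset.coe_add]
        exact Multiset.coe_eq_coe.2 (by
          simpa using (List.perm_append_singleton y p.2).symm.cons p.1)
    | e =>
      obtain ⟨hα, y, rfl⟩ := h.normal.1
      have hy : χ y = .l := h.left.coloured
      obtain ⟨-, -, l2, l3, l4⟩ := hr h.right
      obtain ⟨p, hp⟩ := l4 hα
      rw [hp, pairLabels_singleton] at l3
      have e : treeData χ (.node .e (.leaf y) r) = ({(p.1, y :: p.2)}, []) := by
        simp [treeData, hp, hy]
      rw [e]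
      refine ⟨rfl, by simp, fun q hq => ?_, ?_, fun _ => ⟨_, rfl⟩⟩
      · obtain rfl := Multiset.mem_singleton.1 hq
        obtain ⟨h1, h2⟩ := l2 p (by simp [hp])
        exact ⟨h1, fun z hz => (List.mem_cons.1 hz).elim (fun e => e ▸ hy) (h2 z)⟩
      · rw [pairLabels_singleton, leaves, leaves, ← Multiset.coe_add, ← l3, Multiset.coe_add]
        exact Multiset.coe_eq_coe.2 (List.Perm.swap y p.1 p.2)
    | β => cases h.out
    | m => cases h.out
    | n => cases h.out

/-- The data of a Lie monomial. -/
theorem IsGood.treeData_lie {t : OpTree LRShGen X} (h : IsGood χ .l t)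
    (hm : ¬t.RootIn [.m, .n]) : treeData χ t = (0, t.leaves) := by
  induction t with
  | leaf x => exact treeData_leaf_l h.coloured
  | node g l r hl hr =>
    cases g with
    | β =>
      obtain ⟨h1, h2, -⟩ := h.normal.1
      rw [treeData, hl h.left h1, hr h.right h2]; rfl
    | m => exact absurd (by simp [RootIn]) hm
    | n => exact absurd (by simp [RootIn]) hm
    | α => cases h.out
    | d => cases h.out
    | e => cases h.out

theorem IsGood.colour_leaves {t : OpTree LRShGen X} (h : IsGood χ .l t)
    (hm : ¬t.RootIn [.m, .n]) : ∀ y ∈ t.leaves, χ y = .l := by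
  induction t with
  | leaf x => exact fun y hy => List.mem_singleton.1 hy ▸ h.coloured
  | node g l r hl hr =>
    cases g with
    | β =>
      obtain ⟨h1, h2, -⟩ := h.normal.1
      exact fun y hy => (List.mem_append.1 hy).elim (hl h.left h1 y) (hr h.right h2 y)
    | m => exact absurd (by simp [RootIn]) hm
    | n => exact absurd (by simp [RootIn]) hm
    | α => cases h.out
    | d => cases h.out
    | e => cases h.out

theorem IsGood.minHead {t : OpTree LRShGen X} (h : IsGood χ c t) : MinHead t.leaves := by
  obtain ⟨w, hw⟩ := h.shuffle.head_leaves
  exact ⟨_, w, hw, fun y hy => minLeaf_le (by rw [hw]; exact List.mem_cons_of_mem _ hy)⟩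

/-- The data of a normal tree with dotted output. -/
theorem IsGood.treeData_l {t : OpTree LRShGen X} (h : IsGood χ .l t) :
    MinHead (treeData χ t).2 ∧ PairsColoured χ (treeData χ t).1 ∧
      (∀ y ∈ (treeData χ t).2, χ y = .l) ∧
      pairLabels (treeData χ t).1 + ((treeData χ t).2 : Multiset X) = t.leaves := by
  by_cases hm : t.RootIn [.m, .n]
  · obtain ⟨g, hg, l, r, rfl⟩ := exists_of_rootIn hm
    simp only [List.mem_cons, List.not_mem_nil, or_false] at hg
    rcases hg with rfl | rfl
    · obtain ⟨-, -, l2, l3, -⟩ := IsGood.treeData_s h.left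
      have hr := IsGood.treeData_lie h.right h.normal.1
      simp only [treeData, hr, l3, leaves, Multiset.coe_add]
      exact ⟨h.right.minHead, l2, h.right.colour_leaves h.normal.1, trivial⟩
    · obtain ⟨-, -, l2, l3, -⟩ := IsGood.treeData_s h.right
      have hr := IsGood.treeData_lie h.left h.normal.1
      simp only [treeData, hr, l3, leaves, Multiset.coe_add]
      exact ⟨h.left.minHead, l2, h.left.colour_leaves h.normal.1,
        Multiset.coe_eq_coe.2 List.perm_append_comm⟩
  · rw [h.treeData_lie hm]
    exact ⟨h.minHead, by simp [PairsColoured], h.colour_leaves hm, by simp [pairLabels]⟩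

/-- In a normal product, the minima of the factors are smaller than that of the last factor. -/
theorem IsGood.exists_lt (h : IsGood χ .s (.node .α l r)) :
    ∀ p ∈ (treeData χ l).1, ∃ y ∈ p.1 :: p.2, y < r.minLeaf := by
  induction l generalizing r with
  | leaf x =>
    have hx : χ x = .s := h.left.coloured
    intro p hp
    rw [treeData_leaf_s hx] at hp
    obtain rfl := Multiset.mem_singleton.1 hp
    exact ⟨x, by simp, h.shuffle.1⟩
  | node g a b ha hb =>
    by_cases hα : (node g a b).RootIn [.α]
    · obtain rfl := List.mem_singleton.1 hα
      have hbr := h.normal.1.2 a b rfl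
      intro p hp
      rcases Multiset.mem_add.1 hp with hp | hp
      · obtain ⟨y, hy, hyb⟩ := ha h.left p hp
        exact ⟨y, hy, hyb.trans hbr⟩
      · obtain ⟨q, hq⟩ := (IsGood.treeData_s h.left.right).2.2.2.2 h.left.normal.1.1
        have hl := (IsGood.treeData_s h.left.right).2.2.2.1
        rw [hq] at hp hl
        obtain rfl := Multiset.mem_singleton.1 hp
        rw [pairLabels_singleton] at hl
        exact ⟨b.minLeaf, (Multiset.coe_eq_coe.1 hl).mem_iff.2 (minLeaf_mem b), hbr⟩
    · obtain ⟨q, hq⟩ := (IsGood.treeData_s h.left).2.2.2.2 hα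
      have hl := (IsGood.treeData_s h.left).2.2.2.1
      intro p hp
      rw [hq] at hp hl
      obtain rfl := Multiset.mem_singleton.1 hp
      rw [pairLabels_singleton] at hl
      exact ⟨_, (Multiset.coe_eq_coe.1 hl).mem_iff.2 (minLeaf_mem _), h.shuffle.1⟩

theorem IsGood.exists_chain {t : OpTree LRShGen X} (h : IsGood χ .s t) (hα : ¬t.RootIn [.α]) :
    ∃ p, (treeData χ t).1 = {p} ∧ (p.1 :: p.2).Perm t.leaves := by
  obtain ⟨p, hp⟩ := (IsGood.treeData_s h).2.2.2.2 hα
  have hl := (IsGood.treeData_s h).2.2.2.1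
  rw [hp, pairLabels_singleton] at hl
  exact ⟨p, hp, Multiset.coe_eq_coe.1 hl⟩

/-- The data of the three kinds of normal trees with straight output. -/
theorem IsGood.cases_s {t : OpTree LRShGen X} (h : IsGood χ .s t) :
    (∃ x, t = .leaf x ∧ (treeData χ t).1 = {(x, [])}) ∨
    (∃ g a y p, IsGood χ .s a ∧ (treeData χ a).1 = {p} ∧ (treeData χ t).1 = {(p.1, y :: p.2)} ∧
      ((g = .d ∧ t = .node g a (.leaf y) ∧ a.minLeaf < y) ∨
        (g = .e ∧ t = .node g (.leaf y) a ∧ y < a.minLeaf))) ∨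
    (∃ l r p, t = .node .α l r ∧ (treeData χ l).1 ≠ 0 ∧ (treeData χ r).1 = {p} ∧
      (p.1 :: p.2).Perm r.leaves) := by
  cases t with
  | leaf x => exact Or.inl ⟨x, rfl, by rw [treeData_leaf_s h.coloured]⟩
  | node g l r =>
    cases g with
    | α =>
      obtain ⟨p, hp, hp'⟩ := IsGood.exists_chain h.right h.normal.1.1
      exact Or.inr (Or.inr ⟨l, r, p, rfl, (IsGood.treeData_s h.left).2.1, hp, hp'⟩)
    | d =>
      obtain ⟨hα, y, rfl⟩ := h.normal.1
      have hy : χ y = .l := h.right.coloured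
      obtain ⟨p, hp, -⟩ := IsGood.exists_chain h.left hα
      exact Or.inr (Or.inl ⟨.d, l, y, p, h.left, hp, by simp [treeData, hp, hy],
        Or.inl ⟨rfl, rfl, h.shuffle.1⟩⟩)
    | e =>
      obtain ⟨hα, y, rfl⟩ := h.normal.1
      have hy : χ y = .l := h.left.coloured
      obtain ⟨p, hp, -⟩ := IsGood.exists_chain h.right hα
      exact Or.inr (Or.inl ⟨.e, r, y, p, h.right, hp, by simp [treeData, hp, hy],
        Or.inr ⟨rfl, rfl, h.shuffle.1⟩⟩)
    | β => cases h.out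
    | m => cases h.out
    | n => cases h.out

/-- Normal trees with straight output are determined by their chains. -/
theorem IsGood.eq_s_of_vertices (N : ℕ) : ∀ {t t' : OpTree LRShGen X}, t.vertices < N →
    IsGood χ .s t → IsGood χ .s t' → (treeData χ t).1 = (treeData χ t').1 → t = t' := by
  induction N with
  | zero => exact fun h => absurd h (Nat.not_lt_zero _)
  | succ N ih =>
    intro t t' hN h h' he
    -- products have at least two chains
    have hcard : ∀ {l r : OpTree LRShGen X} {p q : X × List X}, (treeData χ l).1 ≠ 0 →
        (treeData χ r).1 = {p} → (treeData χ (.node .α l r)).1 ≠ {q} := by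
      intro l r p q h1 h2 h3
      have h4 := congrArg Multiset.card h3
      rw [treeData, h2, Multiset.card_add, Multiset.card_singleton, Multiset.card_singleton] at h4
      exact h1 (Multiset.card_eq_zero.1 (by omega))
    rcases h.cases_s with ⟨x, rfl, hx⟩ | ⟨g, a, y, p, ha, hp, ht, hg⟩ |
      ⟨l, r, p, rfl, hl, hr, hp⟩
    · rw [hx] at he
      rcases h'.cases_s with ⟨x', rfl, hx'⟩ | ⟨g', a', y', p', ha', hp', ht', hg'⟩ |
        ⟨l', r', p', rfl, hl', hr', hp'⟩
      · rw [hx'] at he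
        simpa using he
      · rw [ht'] at he
        simp at he
      · exact absurd he.symm (hcard hl' hr')
    · rw [ht] at he
      rcases h'.cases_s with ⟨x', rfl, hx'⟩ | ⟨g', a', y', p', ha', hp', ht', hg'⟩ |
        ⟨l', r', p', rfl, hl', hr', hp'⟩
      · rw [hx'] at he
        simp at he
      · rw [ht'] at he
        simp only [Multiset.singleton_inj, Prod.mk.injEq, List.cons.injEq] at he
        obtain ⟨h1, rfl, h2⟩ := he
        obtain rfl : p = p' := Prod.ext h1 h2
        have hv : a.vertices < N := by
          rcases hg with ⟨rfl, rfl, -⟩ | ⟨rfl, rfl, -⟩ <;> simp only [vertices] at hN <;> omega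
        obtain rfl := ih hv ha ha' (hp.trans hp'.symm)
        rcases hg with ⟨rfl, rfl, hlt⟩ | ⟨rfl, rfl, hlt⟩ <;>
          rcases hg' with ⟨rfl, rfl, hlt'⟩ | ⟨rfl, rfl, hlt'⟩
        · rfl
        · exact absurd hlt hlt'.not_gt
        · exact absurd hlt hlt'.not_gt
        · rfl
      · exact absurd he.symm (hcard hl' hr')
    · rcases h'.cases_s with ⟨x', rfl, hx'⟩ | ⟨g', a', y', p', ha', hp', ht', hg'⟩ |
        ⟨l', r', p', rfl, hl', hr', hp'⟩
      · exact absurd (he.trans hx') (hcard hl hr)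
      · exact absurd (he.trans ht') (hcard hl hr)
      · rw [treeData, treeData, hr, hr'] at he
        replace he : (treeData χ l).1 + {p} = (treeData χ l').1 + {p'} := he
        -- the last factors are those with the greatest smallest leaves
        obtain rfl : p = p' := by
          by_contra hne
          have h1 : p' ∈ (treeData χ l).1 := by
            have : p' ∈ (treeData χ l).1 + {p} := by rw [he]; simp
            exact (Multiset.mem_add.1 this).resolve_right
              fun h => hne (Multiset.mem_singleton.1 h).symm
          have h2 : p ∈ (treeData χ l').1 := by
            have : p ∈ (treeData χ l').1 + {p'} := by rw [← he]; simp
            exact (Multiset.mem_add.1 this).resolve_right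
              fun h => hne (Multiset.mem_singleton.1 h)
          obtain ⟨y, hy, hlt⟩ := h.exists_lt p' h1
          obtain ⟨y', hy', hlt'⟩ := h'.exists_lt p h2
          have h3 := minLeaf_le (hp'.mem_iff.1 hy)
          have h4 := minLeaf_le (hp.mem_iff.1 hy')
          exact absurd (h3.trans_lt (hlt.trans_le h4)) hlt'.not_gt
        simp only [vertices] at hN
        rw [ih (by omega) h.left h'.left (add_right_cancel he),
          ih (by omega) h.right h'.right (hr.trans hr'.symm)]

theorem IsGood.lt_of_mem_tail (h : IsGood χ .l (.node .β l r)) :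
    ∀ y ∈ l.leaves.tail, r.minLeaf < y := by
  induction l generalizing r with
  | leaf x => simp [leaves]
  | node g a b ha hb =>
    obtain ⟨h1, h2, h3⟩ := h.normal.1
    cases g with
    | β =>
      intro y hy
      obtain ⟨w, hw⟩ := IsShuffle.head_leaves h.left.left.shuffle
      rw [leaves, hw, List.cons_append, List.tail_cons] at hy
      have hrb := h3 a b rfl
      rcases List.mem_append.1 hy with hy | hy
      · exact hrb.trans (ha h.left y (by rw [hw]; exact hy))
      · exact hrb.trans_le (minLeaf_le hy)
    | m => exact absurd (by simp [RootIn]) h1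
    | n => exact absurd (by simp [RootIn]) h1
    | α => cases h.left.out
    | d => cases h.left.out
    | e => cases h.left.out

/-- The splitting of the word of a normal Lie monomial is determined by the word. -/
theorem IsGood.length_le {l' r' : OpTree LRShGen X} (h : IsGood χ .l (.node .β l r))
    (h' : IsGood χ .l (.node .β l' r')) (he : l.leaves ++ r.leaves = l'.leaves ++ r'.leaves) :
    l'.leaves.length ≤ l.leaves.length := by
  by_contra hlt
  rw [not_le] at hlt
  rcases List.append_eq_append_iff.1 he with ⟨w, hw, hw'⟩ | ⟨w, hw, hw'⟩
  · obtain ⟨x, v, hx⟩ := List.exists_cons_of_ne_nil (l := l.leaves) (leaves_ne_nil l)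
    obtain ⟨y, u, rfl⟩ := List.exists_cons_of_ne_nil (l := w) (by
      rintro rfl
      simp [hw] at hlt)
    obtain ⟨z, hz⟩ := IsShuffle.head_leaves h.right.shuffle
    obtain rfl : r.minLeaf = y := by
      rw [hz, List.cons_append] at hw'
      exact (List.cons.inj hw').1
    have h1 : r'.minLeaf < r.minLeaf := h'.lt_of_mem_tail _ (by rw [hw, hx]; simp)
    exact absurd (minLeaf_le (by rw [hw']; simp [minLeaf_mem])) h1.not_ge
  · have := congrArg List.length hw
    rw [List.length_append] at this
    omega

/-- A normal tree of Lie brackets is determined by its word of leaves: the cut between the two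
branches at the root is the same by `IsGood.length_le`. -/
theorem IsGood.eq_lie {t : OpTree LRShGen X} (h : IsGood χ .l t) (hm : ¬t.RootIn [.m, .n]) :
    ∀ {t' : OpTree LRShGen X}, IsGood χ .l t' → ¬t'.RootIn [.m, .n] → t.leaves = t'.leaves →
      t = t' := by
  induction t with
  | leaf x =>
    intro t' h' hm' he
    have hv := leaves_length t'
    rw [← he] at hv
    cases t' with
    | leaf x' => exact congrArg leaf (List.cons.inj he).1
    | node g' l' r' => simp [leaves, vertices] at hv
  | node g l r hl hr =>
    intro t' h' hm' he
    cases t' with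
    | leaf x' =>
      have hv := leaves_length (node g l r)
      rw [he] at hv
      simp [leaves, vertices] at hv
    | node g' l' r' =>
      have hβ : ∀ {g : LRShGen} {l r : OpTree LRShGen X}, IsGood χ .l (.node g l r) →
          ¬(node g l r).RootIn [.m, .n] → g = .β := by
        intro g l r h hm
        cases g with
        | β => rfl
        | m => exact absurd (by simp [RootIn]) hm
        | n => exact absurd (by simp [RootIn]) hm
        | α => cases h.out
        | d => cases h.out
        | e => cases h.out
      obtain rfl := hβ h hm
      obtain rfl := hβ h' hm'
      have hlen := le_antisymm (h'.length_le h he.symm) (h.length_le h' he)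
      obtain ⟨h1, h2⟩ := List.append_inj he hlen
      rw [hl h.left h.normal.1.1 h'.left h'.normal.1.1 h1,
        hr h.right h.normal.1.2.1 h'.right h'.normal.1.2.1 h2]

/-- The data of the two kinds of normal trees with dotted output. -/
theorem IsGood.cases_l {t : OpTree LRShGen X} (h : IsGood χ .l t) :
    (¬t.RootIn [.m, .n] ∧ (treeData χ t).1 = 0 ∧ (treeData χ t).2 = t.leaves) ∨
    ∃ g a b, IsGood χ .s a ∧ IsGood χ .l b ∧ ¬b.RootIn [.m, .n] ∧ (treeData χ a).1 ≠ 0 ∧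
      (treeData χ t).1 = (treeData χ a).1 ∧ (treeData χ t).2 = b.leaves ∧
      ((g = .m ∧ t = .node g a b ∧ a.minLeaf < b.minLeaf) ∨
        (g = .n ∧ t = .node g b a ∧ b.minLeaf < a.minLeaf)) := by
  by_cases hm : t.RootIn [.m, .n]
  · obtain ⟨g, hg, l, r, rfl⟩ := exists_of_rootIn hm
    simp only [List.mem_cons, List.not_mem_nil, or_false] at hg
    rcases hg with rfl | rfl
    · refine Or.inr ⟨.m, l, r, h.left, h.right, h.normal.1, (IsGood.treeData_s h.left).2.1, rfl, ?_,
        Or.inl ⟨rfl, rfl, h.shuffle.1⟩⟩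
      rw [treeData, IsGood.treeData_lie h.right h.normal.1]
    · refine Or.inr ⟨.n, r, l, h.right, h.left, h.normal.1, (IsGood.treeData_s h.right).2.1, rfl,
        ?_, Or.inr ⟨rfl, rfl, h.shuffle.1⟩⟩
      rw [treeData, IsGood.treeData_lie h.left h.normal.1]
  · exact Or.inl ⟨hm, by rw [h.treeData_lie hm], by rw [h.treeData_lie hm]⟩

/-- Normal trees are determined by their data. -/
theorem IsGood.eq_of_treeData {c : Col} {t t' : OpTree LRShGen X} (h : IsGood χ c t)
    (h' : IsGood χ c t') (he : treeData χ t = treeData χ t') : t = t' := by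
  cases c with
  | s => exact h.eq_s_of_vertices _ (Nat.lt_succ_self _) h' (congrArg Prod.fst he)
  | l =>
    obtain ⟨he1, he2⟩ := Prod.ext_iff.1 he
    rcases h.cases_l with ⟨h1, h2, h3⟩ | ⟨g, a, b, ha, hb, hm, h0, h1, h2, hg⟩ <;>
      rcases h'.cases_l with ⟨h1', h2', h3'⟩ | ⟨g', a', b', ha', hb', hm', h0', h1', h2', hg'⟩
    · exact h.eq_lie h1 h' h1' (by rw [← h3, ← h3', he2])
    · exact absurd (by rw [← h1', ← he1, h2]) h0'
    · exact absurd (by rw [← h1, he1, h2']) h0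
    · obtain rfl := IsGood.eq_s_of_vertices _ (Nat.lt_succ_self _) ha ha'
        (by rw [← h1, ← h1', he1])
      obtain rfl := hb.eq_lie hm hb' hm' (by rw [← h2, ← h2', he2])
      rcases hg with ⟨rfl, rfl, hlt⟩ | ⟨rfl, rfl, hlt⟩ <;>
        rcases hg' with ⟨rfl, rfl, hlt'⟩ | ⟨rfl, rfl, hlt'⟩
      · rfl
      · exact absurd hlt hlt'.not_gt
      · exact absurd hlt hlt'.not_gt
      · rfl

end Data

/-! ### Normal shuffle trees are linearly independent -/

section Independence

variable {n : ℕ} {χ : Fin n → Col} {c : Col}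

theorem isGood_of_isShuffleMonomial {t : OpTree LRShGen (Fin n)}
    (h : IsShuffleMonomial lrShSig χ c t) (h' : IsNormal t) : IsGood χ c t :=
  ⟨h.1.1, h.2, h.1.2.1, h'⟩

theorem isKey_treeData {t : OpTree LRShGen (Fin n)} (h : IsShuffleMonomial lrShSig χ c t)
    (h' : IsNormal t) : IsKey χ c (treeData χ t) := by
  have hg := isGood_of_isShuffleMonomial h h'
  have hu : (t.leaves : Multiset (Fin n)) = Finset.univ.val :=
    (Multiset.Nodup.ext (Multiset.coe_nodup.2 h.1.2.1) Finset.univ.nodup).2 fun x => by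
      simpa using h.1.2.2 x
  cases c with
  | s =>
    obtain ⟨h1, h2, h3, h4, -⟩ := IsGood.treeData_s hg
    exact ⟨by rw [h1, h4, ← hu]; exact add_zero _, h3, by simp [h1], ⟨h2, h1⟩⟩
  | l =>
    obtain ⟨h1, h2, h3, h4⟩ := IsGood.treeData_l hg
    exact ⟨h4.trans hu, h2, h3, h1⟩

/-- The normal shuffle tree monomials. -/
abbrev NormalTree (χ : Fin n → Col) (c : Col) : Type :=
  {t : OpTree LRShGen (Fin n) // IsShuffleMonomial lrShSig χ c t ∧ IsNormal t}

/-- There are not more normal shuffle tree monomials than normal forms in the symmetric operad. -/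
theorem exists_injective_key : ∃ F : NormalTree χ c → Key χ c, Function.Injective F :=
  ⟨fun t => ⟨treeData χ t.1, isKey_treeData t.2.1 t.2.2⟩, fun t t' h => Subtype.ext
    ((isGood_of_isShuffleMonomial t.2.1 t.2.2).eq_of_treeData
      (isGood_of_isShuffleMonomial t'.2.1 t'.2.2) (Subtype.ext_iff.1 h))⟩

end Independence

open OpTree

/-! ### Rewriting to normal shuffle trees -/

section Rewriting

variable {k : Type u} [Field k] {n : ℕ} {χ : Fin n → Col} {c : Col}

/-- The component `(n, χ, c)` of the ideal generated by the quadratic relations in the free shuffle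
operad. -/
def quadraticIdeal (k : Type u) [Field k] (χ : Fin n → Col) (c : Col) :
    Submodule k (OpTree LRShGen (Fin n) →₀ k) where
  carrier := {f | InShuffleIdeal (S := lrShSig) (lrShuffleRelations k) χ c f}
  zero_mem' := InShuffleIdeal.zero χ c
  add_mem' hf hg := InShuffleIdeal.add hf hg
  smul_mem' a _ hf := InShuffleIdeal.smul a hf

theorem mem_sup_supported_mono {α : Type*} {I : Submodule k (α →₀ k)} {s t : Set α} {f : α →₀ k}
    (h : f ∈ I ⊔ Finsupp.supported k k s) (hst : ∀ x ∈ s, x ∈ t) :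
    f ∈ I ⊔ Finsupp.supported k k t :=
  sup_le_sup (le_refl I) (Finsupp.supported_mono hst) h

theorem finite_trees (N : ℕ) : {t : OpTree LRShGen (Fin n) | t.vertices ≤ N}.Finite := by
  have hG : (Set.univ : Set LRShGen).Finite :=
    (Set.toFinite {.α, .β, .d, .e, .m, .n}).subset fun g _ => by cases g <;> simp
  induction N with
  | zero =>
    refine (Set.finite_range (leaf : Fin n → OpTree LRShGen (Fin n))).subset fun t ht => ?_
    cases t with
    | leaf x => exact ⟨x, rfl⟩
    | node g l r => exact absurd ht (by simp [vertices])
  | succ N ih =>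
    refine ((Set.finite_range (leaf : Fin n → OpTree LRShGen (Fin n))).union
      ((hG.prod (ih.prod ih)).image fun p => node p.1 p.2.1 p.2.2)).subset fun t ht => ?_
    cases t with
    | leaf x => exact Or.inl ⟨x, rfl⟩
    | node g l r =>
      have h : l.vertices + r.vertices + 1 ≤ N + 1 := ht
      exact Or.inr ⟨(g, l, r), ⟨trivial, show l.vertices ≤ N by omega,
        show r.vertices ≤ N by omega⟩, rfl⟩

theorem finite_shuffleMonomials (χ : Fin n → Col) (c : Col) :
    {t : OpTree LRShGen (Fin n) | IsShuffleMonomial lrShSig χ c t}.Finite := by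
  refine (finite_trees n).subset fun t ht => ?_
  have h1 := leaves_length t
  have h2 := (show t.leaves.Nodup from ht.1.2.1).length_le_card
  rw [Fintype.card_fin] at h2
  exact show t.vertices ≤ n by omega

/-- Every shuffle tree monomial is equal, modulo the quadratic relations, to a combination of normal
ones which are not greater. -/
theorem single_mem_sup (t : OpTree LRShGen (Fin n)) (ht : IsShuffleMonomial lrShSig χ c t) :
    Finsupp.single t 1 ∈ quadraticIdeal k χ c ⊔ Finsupp.supported k k
      {s | (IsShuffleMonomial lrShSig χ c s ∧ IsNormal s) ∧ (s = t ∨ QMLess s t)} := by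
  have hfin : Finite {t : OpTree LRShGen (Fin n) | IsShuffleMonomial lrShSig χ c t} :=
    (finite_shuffleMonomials χ c).to_subtype
  let R : {t : OpTree LRShGen (Fin n) | IsShuffleMonomial lrShSig χ c t} →
    {t : OpTree LRShGen (Fin n) | IsShuffleMonomial lrShSig χ c t} → Prop :=
    fun s t => QMLess s.1 t.1
  have h1 : IsTrans _ R := ⟨fun _ _ _ h h' => QMLess.trans h h'⟩
  have h2 : Std.Irrefl R := ⟨fun _ h => QMLess.irrefl h⟩
  have hwf := Finite.wellFounded_of_trans_of_irrefl R
  suffices H : ∀ t : {t : OpTree LRShGen (Fin n) | IsShuffleMonomial lrShSig χ c t},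
      Finsupp.single t.1 1 ∈ quadraticIdeal k χ c ⊔ Finsupp.supported k k
      {s | (IsShuffleMonomial lrShSig χ c s ∧ IsNormal s) ∧ (s = t.1 ∨ QMLess s t.1)} from H ⟨t, ht⟩
  intro t
  induction t using hwf.induction with
  | _ t ih =>
  obtain ⟨t, ht⟩ := t
  by_cases hnorm : IsNormal t
  · exact Submodule.mem_sup_right (Finsupp.single_mem_supported k 1 ⟨⟨ht, hnorm⟩, Or.inl rfl⟩)
  · obtain ⟨a, r, ha, hI, hr⟩ := (reducible_of_not_isNormal (k := k) ht hnorm).exists_rewrite ht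
    have hsm : ∀ s ∈ r.support, IsShuffleMonomial lrShSig χ c s := fun s hs => by
      refine InShuffleIdeal.isShuffleMonomial
        (fun g hg => lrShuffleRelations_isShuffleMonomial hg) hI s ?_
      refine Finsupp.mem_support_iff.2 ?_
      have hne : t ≠ s := fun e => QMLess.irrefl (e ▸ hr s hs : QMLess s s)
      refine ne_of_eq_of_ne ((Finsupp.add_apply _ _ _).trans
        (congrArg (· + r s) (Finsupp.single_eq_of_ne' hne))) ?_
      rw [zero_add]
      exact Finsupp.mem_support_iff.1 hs
    have e : Finsupp.single t 1 = a⁻¹ • (Finsupp.single t a + r) - a⁻¹ • r := by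
      rw [smul_add, add_sub_cancel_right, Finsupp.smul_single, smul_eq_mul, inv_mul_cancel₀ ha]
    change Finsupp.single t 1 ∈ _
    rw [e]
    refine sub_mem (Submodule.mem_sup_left (Submodule.smul_mem _ _ hI)) (Submodule.smul_mem _ _ ?_)
    rw [← Finsupp.sum_single r]
    refine sum_mem fun s hs => ?_
    have hs1 : Finsupp.single s (r s) = r s • Finsupp.single s (1 : k) := by simp
    change Finsupp.single s (r s) ∈ _
    rw [hs1]
    refine Submodule.smul_mem _ _ ?_
    refine mem_sup_supported_mono (ih ⟨s, hsm s hs⟩ (hr s hs)) fun v hv => ?_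
    refine ⟨hv.1, Or.inr ?_⟩
    rcases hv.2 with rfl | hv
    · exact hr _ hs
    · exact hv.trans (hr s hs)

/-- The value of a combination of shuffle trees at the generic elements of the model. -/
def shuffleEval (k : Type u) [Field k] (χ : Fin n → Col) :
    (OpTree LRShGen (Fin n) →₀ k) →ₗ[k] Model k (Fin n) :=
  evalLin (shOps (modelOps k (Fin n))) (generic k χ)

theorem sat_lrShuffleRelations {Z : Type v} [AddCommGroup Z] [Module k Z] {μ : Ops k LRGen Z}
    (hμ : IsLRAlg μ) : Sat (S := lrShSig) (lrShuffleRelations k) (shOps μ) := by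
  rintro _ ⟨r, hr, σ, rfl⟩ z
  refine (evalLin_planarize hμ z _).trans ((evalLin_map μ z σ r.elt).trans ?_)
  exact sat_lrRel.2 hμ r (Or.inr hr) _

theorem shuffleEval_eq_zero {f : OpTree LRShGen (Fin n) →₀ k} (hf : f ∈ quadraticIdeal k χ c) :
    shuffleEval k χ f = 0 :=
  InShuffleIdeal.evalLin_eq_zero (sat_lrShuffleRelations isLRAlg_modelOps) hf _

/-- The values of the normal shuffle tree monomials span all operations of the model. -/
theorem genericEval_mem_span (p : (lieR k).obj (Fin n) χ c) :
    genericEval k χ c p ∈ Submodule.span k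
      (Set.range fun t : NormalTree χ c => shuffleEval k χ (Finsupp.single t.1 1)) := by
  have hp : p ∈ Submodule.span k (Set.range (presentedMk (lrRel k) (χ := χ) (c := c))) := by
    rw [span_presentedMk]; trivial
  refine linear_mem_of_span (f := genericEval k χ c) ?_ hp
  rintro _ ⟨t, rfl⟩
  rw [genericEval_mk]
  refine (congrArg (· ∈ Submodule.span k _)
    (eval_planar isLRAlg_modelOps (generic k χ) t.1)).mp ?_
  refine Submodule.smul_mem _ _ ?_
  have h := single_mem_sup (k := k) (planar t.1) (isShuffleMonomial_planar t.2)
  obtain ⟨f, hf, g, hg, hfg⟩ := Submodule.mem_sup.1 h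
  have e : (planar t.1).eval (shOps (modelOps k (Fin n))) (generic k χ) = shuffleEval k χ g := by
    have h1 := congrArg (shuffleEval k χ) hfg
    rw [map_add, shuffleEval_eq_zero hf, zero_add] at h1
    rw [h1, shuffleEval, evalLin_single, one_smul]
  rw [e, ← Finsupp.sum_single g, Finsupp.sum, map_sum]
  refine sum_mem fun s hs => ?_
  have hs1 : Finsupp.single s (g s) = g s • Finsupp.single s (1 : k) := by simp
  rw [hs1, map_smul]
  exact Submodule.smul_mem _ _ (Submodule.subset_span ⟨⟨s, (hg hs).1⟩, rfl⟩)

/-- The values of the normal shuffle tree monomials are linearly independent: there are not more of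
them than elements of the basis `keyBasis`. -/
theorem linearIndependent_normalTree : LinearIndependent k
    fun t : NormalTree χ c => shuffleEval k χ (Finsupp.single t.1 1) := by
  classical
  obtain ⟨F, hF⟩ := exists_injective_key (χ := χ) (c := c)
  have hK := finite_key χ c
  have hN : Finite (NormalTree χ c) := Finite.of_injective F hF
  have := Fintype.ofFinite (Key χ c)
  have := Fintype.ofFinite (NormalTree χ c)
  rw [linearIndependent_iff_card_le_finrank_span]
  refine (Fintype.card_le_of_injective F hF).trans ?_
  have hli : LinearIndependent k fun q => genericEval k χ c (keyBasis k χ c q) :=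
    (keyBasis k χ c).linearIndependent.map' (genericEval k χ c)
      (LinearMap.ker_eq_bot.2 (genericEval_injective χ c))
  let W := Submodule.span k
    (Set.range fun t : NormalTree χ c => shuffleEval k χ (Finsupp.single t.1 1))
  have : FiniteDimensional k W := FiniteDimensional.span_of_finite k (Set.finite_range _)
  have hli' : LinearIndependent k fun q =>
      (⟨genericEval k χ c (keyBasis k χ c q), genericEval_mem_span _⟩ : W) :=
    LinearIndependent.of_comp W.subtype hli
  exact hli'.fintype_card_le_finrank

/-- A combination of normal shuffle tree monomials is determined by its value in the model. -/
theorem eq_zero_of_shuffleEval {f : OpTree LRShGen (Fin n) →₀ k}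
    (hf : ∀ s ∈ f.support, IsShuffleMonomial lrShSig χ c s ∧ IsNormal s)
    (h : shuffleEval k χ f = 0) : f = 0 := by
  have hli : LinearIndepOn k (fun t => shuffleEval k χ (Finsupp.single t 1))
      {t | IsShuffleMonomial lrShSig χ c t ∧ IsNormal t} := linearIndependent_normalTree
  refine linearIndepOn_iff.1 hli f hf (Eq.trans ?_ h)
  conv_rhs => rw [← Finsupp.sum_single f, Finsupp.sum, map_sum]
  refine Finset.sum_congr rfl fun s _ => ?_
  have hs1 : Finsupp.single s (f s) = f s • Finsupp.single s (1 : k) := by simp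
  rw [hs1, map_smul]
  rfl

/-! ### The Gröbner basis -/

/-- The quadratic relations generate the ideal of relations. -/
theorem mem_lrShuffleIdeal_iff {f : OpTree LRShGen (Fin n) →₀ k} :
    f ∈ lrShuffleIdeal k n χ c ↔ f ∈ quadraticIdeal k χ c := by
  refine mem_lrShuffleIdeal.trans ⟨fun ⟨h1, h2⟩ => ?_, fun h => ⟨?_, shuffleEval_eq_zero h⟩⟩
  · have hmem : f ∈ quadraticIdeal k χ c ⊔ Finsupp.supported k k
        {s | IsShuffleMonomial lrShSig χ c s ∧ IsNormal s} := by
      rw [← Finsupp.sum_single f]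
      refine sum_mem fun s hs => ?_
      have hs1 : Finsupp.single s (f s) = f s • Finsupp.single s (1 : k) := by simp
      change Finsupp.single s (f s) ∈ _
      rw [hs1]
      refine Submodule.smul_mem _ _ ?_
      exact mem_sup_supported_mono (single_mem_sup s (h1 s hs)) fun v hv => hv.1
    obtain ⟨a, ha, b, hb, rfl⟩ := Submodule.mem_sup.1 hmem
    have h3 : shuffleEval k χ (a + b) = 0 := h2
    rw [map_add, shuffleEval_eq_zero ha, zero_add] at h3
    rw [eq_zero_of_shuffleEval hb h3, add_zero]
    exact ha
  · exact InShuffleIdeal.isShuffleMonomial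
      (fun g hg => lrShuffleRelations_isShuffleMonomial hg) h

theorem exists_isLeadingTerm {I : Type} {S : Signature I}
    {lt : (Σ n, ShuffleMonomial S n) → (Σ n, ShuffleMonomial S n) → Prop} (hlt : IsAdmissible lt)
    {χ : Fin n → I} {c : I} {f : OpTree S.Gen (Fin n) →₀ k}
    (hf : ∀ s ∈ f.support, IsShuffleMonomial S χ c s) (h0 : f ≠ 0) :
    ∃ t, IsLeadingTerm lt χ c f t := by
  classical
  have htot := hlt.total
  let _ : LinearOrder (Σ n, ShuffleMonomial S n) := linearOrderOfSTO lt
  have hne : f.support.attach.Nonempty := by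
    rw [Finset.attach_nonempty_iff]; exact Finsupp.support_nonempty_iff.2 h0
  obtain ⟨t, -, ht⟩ := Finset.exists_max_image f.support.attach
    (fun s => (⟨n, ⟨χ, c, s.1, hf s.1 s.2⟩⟩ : Σ n, ShuffleMonomial S n)) hne
  refine ⟨t.1, t.2, hf t.1 t.2, fun s hs hst => ⟨hf s hs, ?_⟩⟩
  have h := ht ⟨s, hs⟩ (Finset.mem_attach _ _)
  refine lt_of_le_of_ne h fun e => hst ?_
  simpa using e

/-- If a tree is the leading term of an element of the ideal, then it is not normal: otherwise the
normal form of the element would still contain this tree. -/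
theorem not_isNormal_of_isLeadingTerm
    {lt : (Σ n, ShuffleMonomial lrShSig n) → (Σ n, ShuffleMonomial lrShSig n) → Prop}
    (hlt : IsAdmissible lt) (hQM : RefinesQM lt) {f : OpTree LRShGen (Fin n) →₀ k}
    (hf : f ∈ quadraticIdeal k χ c) {t : OpTree LRShGen (Fin n)}
    (ht : IsLeadingTerm (S := lrShSig) lt χ c f t) : ¬IsNormal t := by
  classical
  intro hn
  have htot := hlt.total
  obtain ⟨ht1, htm, ht2⟩ := ht
  have hmem : f.erase t ∈ quadraticIdeal k χ c ⊔ Finsupp.supported k k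
      {s | (IsShuffleMonomial lrShSig χ c s ∧ IsNormal s) ∧ s ≠ t} := by
    rw [← Finsupp.sum_single (f.erase t)]
    refine sum_mem fun s hs => ?_
    rw [Finsupp.support_erase, Finset.mem_erase] at hs
    obtain ⟨hsm, hst⟩ := ht2 s hs.2 hs.1
    have hs1 : Finsupp.single s (f.erase t s) = f.erase t s • Finsupp.single s (1 : k) := by simp
    change Finsupp.single s (f.erase t s) ∈ _
    rw [hs1]
    refine Submodule.smul_mem _ _ ?_
    refine mem_sup_supported_mono (single_mem_sup s hsm) fun v hv => ⟨hv.1, ?_⟩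
    rintro rfl
    rcases hv.2 with rfl | hvs
    · exact hs.1 rfl
    · have := hQM n ⟨χ, c, v, htm⟩ ⟨χ, c, s, hsm⟩ hvs
      exact (htot.toIsStrictOrder.toIrrefl).irrefl _ (htot.toIsStrictOrder.toIsTrans.trans _ _ _ this hst)
  obtain ⟨a, ha, b, hb, hab⟩ := Submodule.mem_sup.1 hmem
  have h0 : shuffleEval k χ (Finsupp.single t (f t) + b) = 0 := by
    have h1 := shuffleEval_eq_zero hf
    rw [← Finsupp.single_add_erase t f, ← hab, map_add, map_add, shuffleEval_eq_zero ha,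
      zero_add, ← map_add] at h1
    exact h1
  have hb' : ∀ s ∈ b.support, (IsShuffleMonomial lrShSig χ c s ∧ IsNormal s) ∧ s ≠ t := hb
  have h2 := eq_zero_of_shuffleEval (c := c) (fun s hs => by
    rcases Finset.mem_union.1 (Finsupp.support_add hs) with h | h
    · obtain rfl := Finset.mem_singleton.1 (Finsupp.support_single_subset h)
      exact ⟨htm, hn⟩
    · exact (hb' s h).1) h0
  have h3 := DFunLike.congr_fun h2 t
  rw [Finsupp.add_apply, Finsupp.single_eq_same,
    Finsupp.notMem_support_iff.1 fun h => (hb' t h).2 rfl, add_zero] at h3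
  exact Finsupp.mem_support_iff.1 ht1 h3

/-- The quadratic relations are a Gröbner basis. -/
theorem isGroebnerBasis_lrShuffleRelations (k : Type u) [Field k]
    {lt : (Σ n, ShuffleMonomial lrShSig n) → (Σ n, ShuffleMonomial lrShSig n) → Prop}
    (hlt : IsAdmissible lt) (hQM : RefinesQM lt) :
    IsGroebnerBasis lt (lrShuffleIdeal k) (lrShuffleRelations k) := by
  refine ⟨fun n χ c f => mem_lrShuffleIdeal_iff, fun n χ c f hf h0 => ?_⟩
  obtain ⟨t, ht⟩ := exists_isLeadingTerm hlt (mem_lrShuffleIdeal.1 hf).1 h0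
  have htm := ht.2.1
  have hn := not_isNormal_of_isLeadingTerm hlt hQM (mem_lrShuffleIdeal_iff.1 hf) ht
  obtain ⟨g, hg, s, ⟨hs1, hs2⟩, C, θ, h1, h2, h3⟩ := reducible_of_not_isNormal (k := k) htm hn
  have hgm := lrShuffleRelations_isShuffleMonomial hg
  refine ⟨g, hg, s, t, ⟨hs1, hgm s hs1, fun s' hs' hne => ⟨hgm s' hs', ?_⟩⟩, ht, s.bind θ, θ, ?_,
    rfl, fun i j hij => h2 hij, h3⟩
  · exact hQM _ ⟨g.inp, g.out, s', hgm s' hs'⟩ ⟨g.inp, g.out, s, hgm s hs1⟩ (hs2 s' hs' hne)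
  · rw [← h1]
    exact Ctx.isSubtree_fill _ C

end Rewriting

open OpTree

/-! ### Directed path words -/

section DirectedPath

variable {G X Y : Type} [DecidableEq X] [DecidableEq Y]

/-- The vertices on the path from the root to the leaf `x`, with the directions of the path. -/
def OpTree.dpath (x : X) : OpTree G X → List (G × Bool)
  | leaf _ => []
  | node g l r => if x ∈ l.leaves then (g, false) :: l.dpath x else (g, true) :: r.dpath x

theorem OpTree.map_fst_dpath (x : X) (t : OpTree G X) : (t.dpath x).map Prod.fst = t.path x := by
  induction t with
  | leaf y => rfl
  | node g l r hl hr =>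
    rw [dpath, path]
    split_ifs
    · rw [List.map_cons, hl]
    · rw [List.map_cons, hr]

theorem OpTree.dpath_bind {θ : X → OpTree G Y}
    (hd : ∀ i j, i ≠ j → List.Disjoint (θ i).leaves (θ j).leaves) {i : X} {y : Y}
    (hy : y ∈ (θ i).leaves) : ∀ {s : OpTree G X}, i ∈ s.leaves →
      (s.bind θ).dpath y = s.dpath i ++ (θ i).dpath y
  | leaf x, h => by
    obtain rfl := List.mem_singleton.1 h
    rfl
  | node g l r, h => by
    have e : y ∈ (l.bind θ).leaves ↔ i ∈ l.leaves := by
      rw [leaves_bind, List.mem_flatMap]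
      refine ⟨fun ⟨j, hj, hyj⟩ => ?_, fun hi => ⟨i, hi, hy⟩⟩
      by_contra hi
      exact hd i j (fun e => hi (e ▸ hj)) hy hyj
    simp only [OpTree.bind, dpath, e]
    split_ifs with hi
    · rw [OpTree.dpath_bind hd hy hi, List.cons_append]
    · rw [OpTree.dpath_bind hd hy ((List.mem_append.1 h).resolve_left hi), List.cons_append]

theorem OpTree.dpath_map {f : X → Y} (hf : Function.Injective f) (x : X) (t : OpTree G X) :
    (t.map f).dpath (f x) = t.dpath x := by
  induction t with
  | leaf y => rfl
  | node g l r hl hr =>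
    simp only [OpTree.map, dpath, leaves_map, List.mem_map_of_injective hf, hl, hr]

/-- A tree with distinct leaves is determined by the directed paths to its leaves. -/
theorem OpTree.eq_of_dpath {t : OpTree G X} (ht : t.leaves.Nodup) : ∀ {t' : OpTree G X},
    t'.leaves.Nodup → (∀ x, x ∈ t.leaves ↔ x ∈ t'.leaves) →
      (∀ x ∈ t.leaves, t.dpath x = t'.dpath x) → t = t' := by
  induction t with
  | leaf x =>
    intro t' _ h hp
    cases t' with
    | leaf x' => exact congrArg leaf (List.mem_singleton.1 ((h x).1 (List.mem_singleton_self x)))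
    | node g l r =>
      have := hp x (List.mem_singleton_self x)
      rw [dpath, dpath] at this
      split_ifs at this
  | node g l r hl hr =>
    intro t' ht' h hp
    cases t' with
    | leaf x' =>
      have := hp x' ((h x').2 (List.mem_singleton_self x'))
      rw [dpath, dpath] at this
      split_ifs at this
    | node g' l' r' =>
      obtain ⟨n1, n2, n3⟩ := List.nodup_append'.1 ht
      obtain ⟨n1', n2', n3'⟩ := List.nodup_append'.1 ht'
      have e1 : ∀ x ∈ l.leaves, g = g' ∧ x ∈ l'.leaves ∧ l.dpath x = l'.dpath x := by
        intro x hx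
        have := hp x (List.mem_append_left _ hx)
        rw [dpath, dpath, if_pos hx] at this
        split_ifs at this with hx'
        · simp only [List.cons.injEq, Prod.mk.injEq] at this
          exact ⟨this.1.1, hx', this.2⟩
        · simp at this
      have e2 : ∀ x ∈ r.leaves, x ∈ r'.leaves ∧ r.dpath x = r'.dpath x := by
        intro x hx
        have hxl : x ∉ l.leaves := fun h => n3 h hx
        have := hp x (List.mem_append_right _ hx)
        rw [dpath, dpath, if_neg hxl] at this
        split_ifs at this with hx'
        · simp at this
        · simp only [List.cons.injEq, Prod.mk.injEq] at this
          exact ⟨(List.mem_append.1 ((h x).1 (List.mem_append_right _ hx))).resolve_left hx',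
            this.2⟩
      obtain ⟨x, hx⟩ := List.exists_mem_of_ne_nil _ (leaves_ne_nil l)
      obtain rfl := (e1 x hx).1
      rw [hl n1 n1' (fun x => ⟨fun hx => (e1 x hx).2.1, fun hx => ?_⟩) fun x hx => (e1 x hx).2.2,
        hr n2 n2' (fun x => ⟨fun hx => (e2 x hx).1, fun hx => ?_⟩) fun x hx => (e2 x hx).2]
      · exact (List.mem_append.1 ((h x).2 (List.mem_append_right _ hx))).resolve_left
          fun hxl => n3' (e1 x hxl).2.1 hx
      · exact (List.mem_append.1 ((h x).2 (List.mem_append_left _ hx))).resolve_right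
          fun hxr => n3' hx (e2 x hxr).1

omit [DecidableEq X] in
theorem OpTree.IsColoured.inp_unique {I : Type} {S : Signature I} {χ χ' : X → I} {c : I}
    {t : OpTree S.Gen X} (h : t.IsColoured S χ c) (h' : t.IsColoured S χ' c) :
    ∀ x ∈ t.leaves, χ x = χ' x := by
  induction t generalizing c with
  | leaf x =>
    intro y hy
    obtain rfl := List.mem_singleton.1 hy
    exact Eq.trans (b := c) h (Eq.symm h')
  | node g l r hl hr =>
    exact fun x hx => (List.mem_append.1 hx).elim (hl h.2.1 h'.2.1 x) (hr h.2.2 h'.2.2 x)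

/-- The directed paths in a composition. -/
theorem dpath_graft {m n N : ℕ} {i : Fin m} {φ : Fin m → Fin N} {ψ : Fin n → Fin N}
    (h : IsGrafting i φ ψ) {t₁ : OpTree G (Fin m)} {t₂ : OpTree G (Fin n)}
    (h₁ : ∀ x, x ∈ t₁.leaves) (h₂ : ∀ x, x ∈ t₂.leaves) :
    (∀ j, j ≠ i → (graft i φ ψ t₁ t₂).dpath (φ j) = t₁.dpath j) ∧
    ∀ b, (graft i φ ψ t₁ t₂).dpath (ψ b) = t₁.dpath i ++ t₂.dpath b := by
  unfold graft
  have key : ∀ θ : Fin m → OpTree G (Fin N), θ i = t₂.map ψ → (∀ j, j ≠ i → θ j = leaf (φ j)) →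
      (∀ j, j ≠ i → (t₁.bind θ).dpath (φ j) = t₁.dpath j) ∧
      ∀ b, (t₁.bind θ).dpath (ψ b) = t₁.dpath i ++ t₂.dpath b := by
    intro θ hi hj
    have hd : ∀ i j, i ≠ j → List.Disjoint (θ i).leaves (θ j).leaves := by
      have aux : ∀ j, j ≠ i → List.Disjoint (θ j).leaves (θ i).leaves := by
        intro j hji
        rw [hj j hji, hi, leaves, leaves_map, List.singleton_disjoint]
        rintro hb
        obtain ⟨b, -, hb⟩ := List.mem_map.1 hb
        exact h.disjoint j hji b hb.symm
      intro j j' hjj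
      by_cases h1 : j = i
      · subst h1; exact (aux j' hjj.symm).symm
      · by_cases h2 : j' = i
        · subst h2; exact aux j h1
        · rw [hj j h1, hj j' h2, leaves, leaves, List.singleton_disjoint, List.mem_singleton]
          exact fun e => hjj (h.inj_left h1 h2 e)
    refine ⟨fun j hji => ?_, fun b => ?_⟩
    · rw [OpTree.dpath_bind hd (i := j) (by rw [hj j hji]; simp [leaves]) (h₁ j), hj j hji, dpath,
        List.append_nil]
    · have hb : ψ b ∈ (θ i).leaves := by
        rw [hi, leaves_map]; exact List.mem_map_of_mem (h₂ b)
      rw [OpTree.dpath_bind hd hb (h₁ i), hi, OpTree.dpath_map h.inj_right]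
  exact key _ (by simp) fun j hj => by simp [hj]

end DirectedPath

/-! ### Orderings of vectors indexed by the leaves -/

section Glue

variable {m n N : ℕ} {M : Type} {i : Fin m} {φ : Fin m → Fin N} {ψ : Fin n → Fin N}

open Classical in
/-- The vector of a composition: at the leaves of the grafted tree, its entries are composed with
the `i`-th entry of the vector `v`. -/
def glue (i : Fin m) (φ : Fin m → Fin N) (ψ : Fin n → Fin N) (op : M → M → M) (v : Fin m → M)
    (w : Fin n → M) : Fin N → M := fun p =>
  if h : ∃ b, ψ b = p then op (v i) (w h.choose)
  else if h : ∃ j, φ j = p then v h.choose else v i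

theorem glue_right (h : IsShuffling i φ ψ) (op : M → M → M) (v : Fin m → M) (w : Fin n → M)
    (b : Fin n) : glue i φ ψ op v w (ψ b) = op (v i) (w b) := by
  have hb : ∃ b', ψ b' = ψ b := ⟨b, rfl⟩
  rw [glue, dif_pos hb, h.grafting.inj_right hb.choose_spec]

theorem glue_left (h : IsShuffling i φ ψ) (op : M → M → M) (v : Fin m → M) (w : Fin n → M)
    {j : Fin m} (hj : j ≠ i) : glue i φ ψ op v w (φ j) = v j := by
  have hb : ¬∃ b, ψ b = φ j := fun ⟨b, hb⟩ => h.grafting.disjoint j hj b hb.symm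
  have hj' : ∃ j', φ j' = φ j := ⟨j, rfl⟩
  rw [glue, dif_neg hb, dif_pos hj', h.left.injective hj'.choose_spec]

theorem eq_glue (h : IsShuffling i φ ψ) {op : M → M → M} {v : Fin m → M} {w : Fin n → M}
    {u : Fin N → M} (h1 : ∀ j, j ≠ i → u (φ j) = v j) (h2 : ∀ b, u (ψ b) = op (v i) (w b)) :
    u = glue i φ ψ op v w := by
  funext p
  rcases h.grafting.cover p with ⟨j, hj, rfl⟩ | ⟨b, rfl⟩
  · rw [h1 j hj, glue_left h _ _ _ hj]
  · rw [h2 b, glue_right h]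

variable [LinearOrder M] {op : M → M → M}

theorem glue_strictMono_left (h : IsShuffling i φ ψ) (hop : ∀ y, StrictMono fun x => op x y)
    (w : Fin n → M) : StrictMono fun v : Lex (Fin m → M) => toLex (glue i φ ψ op (ofLex v) w) := by
  rintro v v' ⟨j, h1, h2⟩
  refine ⟨φ j, fun p hp => ?_, ?_⟩
  · change glue i φ ψ op (ofLex v) w p = glue i φ ψ op (ofLex v') w p
    rcases h.grafting.cover p with ⟨j', hj', rfl⟩ | ⟨b, rfl⟩
    · rw [glue_left h _ _ _ hj', glue_left h _ _ _ hj']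
      exact h1 j' (h.left.lt_iff_lt.1 hp)
    · rw [glue_right h, glue_right h]
      exact congrArg (fun x => op x (w b))
        (h1 i (h.left.lt_iff_lt.1 ((h.least.2 ⟨b, rfl⟩).trans_lt hp)))
  · change glue i φ ψ op (ofLex v) w (φ j) < glue i φ ψ op (ofLex v') w (φ j)
    by_cases hj : j = i
    · subst hj
      obtain ⟨b, hb⟩ := h.least.1
      rw [← hb, glue_right h, glue_right h]
      exact hop _ h2
    · rw [glue_left h _ _ _ hj, glue_left h _ _ _ hj]
      exact h2

theorem glue_strictMono_right (h : IsShuffling i φ ψ) (hop : ∀ x, StrictMono (op x))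
    (v : Fin m → M) : StrictMono fun w : Lex (Fin n → M) => toLex (glue i φ ψ op v (ofLex w)) := by
  rintro w w' ⟨b, h1, h2⟩
  refine ⟨ψ b, fun p hp => ?_, ?_⟩
  · change glue i φ ψ op v (ofLex w) p = glue i φ ψ op v (ofLex w') p
    rcases h.grafting.cover p with ⟨j', hj', rfl⟩ | ⟨b', rfl⟩
    · rw [glue_left h _ _ _ hj', glue_left h _ _ _ hj']
    · rw [glue_right h, glue_right h]
      exact congrArg (op (v i)) (h1 b' (h.right.lt_iff_lt.1 hp))
  · change glue i φ ψ op v (ofLex w) (ψ b) < glue i φ ψ op v (ofLex w') (ψ b)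
    rw [glue_right h, glue_right h]
    exact hop _ h2

end Glue

/-! ### Words as numbers -/

section Words

/-- The composition of words, where a word of length `a` in an alphabet with `12` letters is given
by `a` and the number with these digits. Words of the same length are compared
lexicographically. -/
def wordMul (x y : ℕ ×ₗ ℕ) : ℕ ×ₗ ℕ :=
  toLex ((ofLex x).1 + (ofLex y).1, (ofLex x).2 * 12 ^ (ofLex y).1 + (ofLex y).2)

theorem wordMul_strictMono_left (y : ℕ ×ₗ ℕ) : StrictMono fun x => wordMul x y := by
  intro x x' h
  rcases Prod.Lex.lt_iff.1 h with h | ⟨h, h'⟩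
  · exact Prod.Lex.lt_iff.2 (Or.inl (Nat.add_lt_add_right h _))
  · refine Prod.Lex.lt_iff.2 (Or.inr ⟨congrArg (· + _) h, ?_⟩)
    exact Nat.add_lt_add_right (Nat.mul_lt_mul_of_pos_right h' (by positivity)) _

theorem wordMul_strictMono_right (x : ℕ ×ₗ ℕ) : StrictMono (wordMul x) := by
  intro y y' h
  rcases Prod.Lex.lt_iff.1 h with h | ⟨h, h'⟩
  · exact Prod.Lex.lt_iff.2 (Or.inl (Nat.add_lt_add_left h _))
  · refine Prod.Lex.lt_iff.2 (Or.inr ⟨congrArg (_ + ·) h, ?_⟩)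
    simp only [wordMul, ofLex_toLex, h]
    exact Nat.add_lt_add_left h' _

/-- The digit of a generator and a direction. -/
def digit : LRShGen × Bool → ℕ
  | (.α, b) => b.toNat
  | (.β, b) => 2 + b.toNat
  | (.d, b) => 4 + b.toNat
  | (.e, b) => 6 + b.toNat
  | (.m, b) => 8 + b.toNat
  | (.n, b) => 10 + b.toNat

theorem digit_lt (a : LRShGen × Bool) : digit a < 12 := by
  obtain ⟨g, b⟩ := a
  cases g <;> cases b <;> decide

theorem digit_injective : Function.Injective digit := by
  rintro ⟨g, b⟩ ⟨g', b'⟩ h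
  cases g <;> cases b <;> cases g' <;> cases b' <;> first | rfl | exact absurd h (by decide)

/-- The number with the digits of a word. -/
def wordNum : List (LRShGen × Bool) → ℕ
  | [] => 0
  | a :: p => digit a * 12 ^ p.length + wordNum p

/-- The code of a word. -/
def wordCode (p : List (LRShGen × Bool)) : ℕ ×ₗ ℕ := toLex (p.length, wordNum p)

theorem wordNum_append (p q : List (LRShGen × Bool)) :
    wordNum (p ++ q) = wordNum p * 12 ^ q.length + wordNum q := by
  induction p with
  | nil => simp [wordNum]
  | cons a p ih => rw [List.cons_append, wordNum, wordNum, ih, List.length_append, pow_add]; ring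

theorem wordCode_append (p q : List (LRShGen × Bool)) :
    wordCode (p ++ q) = wordMul (wordCode p) (wordCode q) := by
  simp [wordCode, wordMul, wordNum_append]

theorem wordNum_lt (p : List (LRShGen × Bool)) : wordNum p < 12 ^ p.length := by
  induction p with
  | nil => simp [wordNum]
  | cons a p ih =>
    rw [wordNum, List.length_cons, pow_succ]
    nlinarith [digit_lt a, Nat.mul_le_mul_right (12 ^ p.length) (Nat.le_of_lt_succ (digit_lt a))]

/-- The first component gives the length, and the second one the word as a number in base `12`. -/
theorem wordCode_injective : Function.Injective wordCode := by
  intro p q h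
  simp only [wordCode, EmbeddingLike.apply_eq_iff_eq, Prod.mk.injEq] at h
  obtain ⟨h1, h2⟩ := h
  induction p generalizing q with
  | nil => exact (List.length_eq_zero_iff.1 h1.symm).symm
  | cons a p ih =>
    cases q with
    | nil => simp at h1
    | cons b q =>
      have hl : p.length = q.length := by simpa using h1
      have hp := wordNum_lt p
      have hq := wordNum_lt q
      rw [wordNum, wordNum, ← hl] at h2
      rw [← hl] at hq
      have hpos : 0 < 12 ^ p.length := by positivity
      have e2 := congrArg (· % 12 ^ p.length) h2
      simp only [Nat.mul_add_mod_self_right, Nat.mod_eq_of_lt hp, Nat.mod_eq_of_lt hq] at e2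
      rw [e2] at h2
      rw [digit_injective (Nat.eq_of_mul_eq_mul_right hpos (Nat.add_right_cancel h2)), ih hl e2]

end Words

open OpTree

/-! ### An admissible ordering refining the quantum monomial ordering -/

section LexMap

variable {A A' B B' C C' : Type} [LinearOrder A] [LinearOrder A'] [LinearOrder B]
  [LinearOrder B'] [LinearOrder C] [LinearOrder C']

/-- A pair of binary maps on the levels of a lexicographic product. -/
def lexMap₂ (f : A → B → C) (g : A' → B' → C') (p : A ×ₗ A') (q : B ×ₗ B') : C ×ₗ C' :=
  toLex (f (ofLex p).1 (ofLex q).1, g (ofLex p).2 (ofLex q).2)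

omit [LinearOrder B] [LinearOrder B'] in
theorem lexMap₂_monotone_left {f : A → B → C} {g : A' → B' → C'}
    (hf : ∀ y, StrictMono fun x => f x y) (hg : ∀ y, Monotone fun x => g x y) (q : B ×ₗ B') :
    Monotone fun p => lexMap₂ f g p q := by
  intro p p' h
  rcases Prod.Lex.le_iff.1 h with h | ⟨h, h'⟩
  · exact Prod.Lex.le_iff.2 (Or.inl (hf _ h))
  · exact Prod.Lex.le_iff.2 (Or.inr ⟨congrArg (fun x => f x _) h, hg _ h'⟩)

omit [LinearOrder A] [LinearOrder A'] in
theorem lexMap₂_monotone_right {f : A → B → C} {g : A' → B' → C'}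
    (hf : ∀ x, StrictMono (f x)) (hg : ∀ x, Monotone (g x)) (p : A ×ₗ A') :
    Monotone (lexMap₂ f g p) := by
  intro q q' h
  rcases Prod.Lex.le_iff.1 h with h | ⟨h, h'⟩
  · exact Prod.Lex.le_iff.2 (Or.inl (hf _ h))
  · exact Prod.Lex.le_iff.2 (Or.inr ⟨congrArg (f _) h, hg _ h'⟩)

open OrderDual

/-- A binary map on the opposite orderings. -/
def dualMap₂ (f : A → B → C) (x : Aᵒᵈ) (y : Bᵒᵈ) : Cᵒᵈ := toDual (f (ofDual x) (ofDual y))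

omit [LinearOrder B] in
theorem dualMap₂_strictMono_left {f : A → B → C} (hf : ∀ y, StrictMono fun x => f x y)
    (y : Bᵒᵈ) : StrictMono fun x => dualMap₂ f x y :=
  fun _ _ h => hf (ofDual y) h

omit [LinearOrder A] in
theorem dualMap₂_strictMono_right {f : A → B → C} (hf : ∀ x, StrictMono (f x)) (x : Aᵒᵈ) :
    StrictMono (dualMap₂ f x) :=
  fun _ _ h => hf (ofDual x) h

end LexMap

/-- The ordered set in which the keys of tree monomials of arity `n` are compared: the four degree
vectors, the codes of the directed paths, and the output colour. -/
abbrev OrdKey (n : ℕ) : Type :=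
  (Lex (Fin n → ℕ))ᵒᵈ ×ₗ (Lex (Fin n → ℕ))ᵒᵈ ×ₗ (Lex (Fin n → ℕ))ᵒᵈ ×ₗ Lex (Fin n → ℕ) ×ₗ
    Lex (Fin n → ℕ ×ₗ ℕ) ×ₗ ℕ

/-- The number of a colour. -/
def colCode : Col → ℕ
  | .s => 0
  | .l => 1

open OrderDual in
/-- The key of a tree with an output colour. -/
def ordKey {n : ℕ} (c : Col) (t : OpTree LRShGen (Fin n)) : OrdKey n :=
  toLex (toDual (toLex (degVector [.α] t)), toLex (toDual (toLex (degVector [.d, .e] t)),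
    toLex (toDual (toLex (degVector [.m, .n] t)), toLex (toLex (degVector [.β] t),
      toLex (toLex (fun i => wordCode (t.dpath i)), colCode c)))))

section Comp

variable {m n N : ℕ} {i : Fin m} {φ : Fin m → Fin N} {ψ : Fin n → Fin N}

/-- The vector of a composition as a map of lexicographically ordered sets. -/
def glueLex {M : Type} (i : Fin m) (φ : Fin m → Fin N) (ψ : Fin n → Fin N) (op : M → M → M)
    (v : Lex (Fin m → M)) (w : Lex (Fin n → M)) : Lex (Fin N → M) :=
  toLex (glue i φ ψ op (ofLex v) (ofLex w))

/-- The key of a composition as a function of the keys of its factors. -/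
def ordKeyComp (i : Fin m) (φ : Fin m → Fin N) (ψ : Fin n → Fin N) :
    OrdKey m → OrdKey n → OrdKey N :=
  lexMap₂ (dualMap₂ (glueLex i φ ψ (· + ·))) (lexMap₂ (dualMap₂ (glueLex i φ ψ (· + ·)))
    (lexMap₂ (dualMap₂ (glueLex i φ ψ (· + ·))) (lexMap₂ (glueLex i φ ψ (· + ·))
      (lexMap₂ (glueLex i φ ψ wordMul) fun c _ => c))))

theorem ordKeyComp_monotone_left (h : IsShuffling i φ ψ) (q : OrdKey n) :
    Monotone fun p => ordKeyComp i φ ψ p q := by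
  have ha : ∀ w, StrictMono fun v => glueLex (M := ℕ) i φ ψ (· + ·) v w :=
    fun w => glue_strictMono_left h (fun y => add_left_strictMono) (ofLex w)
  have hw : ∀ w, StrictMono fun v => glueLex i φ ψ wordMul v w :=
    fun w => glue_strictMono_left h wordMul_strictMono_left (ofLex w)
  have hd := dualMap₂_strictMono_left ha
  exact lexMap₂_monotone_left hd (lexMap₂_monotone_left hd (lexMap₂_monotone_left hd
    (lexMap₂_monotone_left ha (lexMap₂_monotone_left hw fun _ => monotone_id)))) q

theorem ordKeyComp_monotone_right (h : IsShuffling i φ ψ) (p : OrdKey m) :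
    Monotone (ordKeyComp (n := n) i φ ψ p) := by
  have ha : ∀ v, StrictMono (glueLex (M := ℕ) i φ ψ (· + ·) v) :=
    fun v => glue_strictMono_right h (fun y => add_right_strictMono) (ofLex v)
  have hw : ∀ v, StrictMono (glueLex i φ ψ wordMul v) :=
    fun v => glue_strictMono_right h wordMul_strictMono_right (ofLex v)
  have hd := dualMap₂_strictMono_right ha
  exact lexMap₂_monotone_right hd (lexMap₂_monotone_right hd (lexMap₂_monotone_right hd
    (lexMap₂_monotone_right ha (lexMap₂_monotone_right hw fun _ => monotone_const)))) p

theorem degVector_eq (L : List LRShGen) (t : OpTree LRShGen (Fin n)) (j : Fin n) :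
    degVector L t j = (t.dpath j).countP fun a => a.1 ∈ L := by
  rw [degVector, ← OpTree.map_fst_dpath, List.countP_map]
  rfl

theorem ordKey_graft (h : IsShuffling i φ ψ) {t₁ : OpTree LRShGen (Fin m)}
    {t₂ : OpTree LRShGen (Fin n)} (h₁ : ∀ x, x ∈ t₁.leaves) (h₂ : ∀ x, x ∈ t₂.leaves)
    (c c' : Col) :
    ordKey c (graft i φ ψ t₁ t₂) = ordKeyComp i φ ψ (ordKey c t₁) (ordKey c' t₂) := by
  obtain ⟨p1, p2⟩ := dpath_graft h.grafting h₁ h₂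
  have hd : ∀ L, degVector L (graft i φ ψ t₁ t₂) =
      glue i φ ψ (· + ·) (degVector L t₁) (degVector L t₂) := fun L =>
    eq_glue h (fun j hj => by rw [degVector_eq, degVector_eq, p1 j hj])
      fun b => by rw [degVector_eq, degVector_eq, degVector_eq, p2 b, List.countP_append]
  have hw : (fun p => wordCode ((graft i φ ψ t₁ t₂).dpath p)) =
      glue i φ ψ wordMul (fun p => wordCode (t₁.dpath p)) fun p => wordCode (t₂.dpath p) :=
    eq_glue h (fun j hj => by rw [p1 j hj]) fun b => by rw [p2 b, wordCode_append]
  simp only [ordKey, hd, hw]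
  rfl

end Comp

theorem ShuffleMonomial.mem_leaves {I : Type} {S : Signature I} {n : ℕ} (x : ShuffleMonomial S n)
    (j : Fin n) : j ∈ x.tree.leaves :=
  x.isShuffleMonomial.1.2.2 j

/-- The directed paths determine the tree, and the tree determines the input colours. The output
colour is needed only for the tree without vertices. -/
theorem ordKey_injective {n : ℕ} :
    Function.Injective fun x : ShuffleMonomial lrShSig n => ordKey x.out x.tree := by
  rintro ⟨χ, c, t, ht⟩ ⟨χ', c', t', ht'⟩ h
  simp only [ordKey, EmbeddingLike.apply_eq_iff_eq, Prod.mk.injEq] at h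
  obtain ⟨-, -, -, -, hw, hc⟩ := h
  obtain rfl : c = c' := by cases c <;> cases c' <;> first | rfl | exact absurd hc (by decide)
  obtain rfl : t = t' := OpTree.eq_of_dpath ht.1.2.1 ht'.1.2.1
    (fun x => ⟨fun _ => ht'.1.2.2 x, fun _ => ht.1.2.2 x⟩)
    fun x _ => wordCode_injective (congrFun hw x)
  obtain rfl : χ = χ' := funext fun x => ht.1.1.inp_unique ht'.1.1 x (ht.1.2.2 x)
  rfl

/-- The ordering by the arity and the key. -/
def keyLT (x y : Σ n, ShuffleMonomial lrShSig n) : Prop :=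
  Sigma.Lex (· < ·) (fun n (p q : ShuffleMonomial lrShSig n) =>
    ordKey p.out p.tree < ordKey q.out q.tree) x y

theorem keyLT_iff {n : ℕ} {x y : ShuffleMonomial lrShSig n} :
    keyLT ⟨n, x⟩ ⟨n, y⟩ ↔ ordKey x.out x.tree < ordKey y.out y.tree := by
  refine ⟨fun h => ?_, fun h => .right _ _ h⟩
  cases h with
  | left _ _ h => exact absurd h (lt_irrefl _)
  | right _ _ h => exact h

theorem eq_or_keyLT_iff {n : ℕ} {x y : ShuffleMonomial lrShSig n} :
    x = y ∨ keyLT ⟨n, x⟩ ⟨n, y⟩ ↔ ordKey x.out x.tree ≤ ordKey y.out y.tree := by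
  rw [keyLT_iff, le_iff_eq_or_lt, ordKey_injective.eq_iff (a := x) (b := y)]

/-- The key of a composition is a monotone function of the keys of both factors, and a tree monomial
is determined by its key. -/
theorem isAdmissible_keyLT : IsAdmissible keyLT where
  total :=
    { trichotomous := by
        rintro ⟨m, x⟩ ⟨n, y⟩ h1 h2
        rcases lt_trichotomy m n with h | rfl | h
        · exact absurd (Sigma.Lex.left _ _ h) h1
        · rw [keyLT_iff, not_lt] at h1 h2
          rw [ordKey_injective (le_antisymm h2 h1)]
        · exact absurd (Sigma.Lex.left _ _ h) h2
      irrefl := fun ⟨n, x⟩ h => lt_irrefl _ (keyLT_iff.1 h)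
      trans := by
        intro x y z h1 h2
        cases h1 with
        | left _ _ h =>
          cases h2 with
          | left _ _ h' => exact .left _ _ (h.trans h')
          | right _ _ h' => exact .left _ _ h
        | right _ _ h =>
          cases h2 with
          | left _ _ h' => exact .left _ _ h'
          | right _ _ h' => exact .right _ _ (h.trans h') }
  arity _ _ h := .left _ _ h
  comp i φ ψ x x' y y' z z' hz hz' hx hy := by
    rw [eq_or_keyLT_iff] at hx hy ⊢
    have e := ordKey_graft hz.shuffling x.mem_leaves y.mem_leaves x.out y.out
    have e' := ordKey_graft hz.shuffling x'.mem_leaves y'.mem_leaves x'.out y'.out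
    rw [hz.tree, hz.out, hz'.tree, hz'.out]
    exact e.le.trans (((ordKeyComp_monotone_left hz.shuffling _ hx).trans
      (ordKeyComp_monotone_right hz.shuffling _ hy)).trans e'.ge)

theorem refinesQM_keyLT : RefinesQM keyLT := by
  intro n x y h
  refine keyLT_iff.2 ?_
  simp only [QMLess, lexLT_iff, @eq_comm _ (degVector _ y.tree)] at h
  simp only [ordKey, Prod.Lex.toLex_lt_toLex, OrderDual.toDual_lt_toDual,
    EmbeddingLike.apply_eq_iff_eq]
  tauto

end ColouredOperad

end

theorem mainTheorem2 (k : Type*) [Field k] [CharZero k] :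
    ((∃ lt : (Σ n, ColouredOperad.ShuffleMonomial ColouredOperad.lrShSig n) →
          (Σ n, ColouredOperad.ShuffleMonomial ColouredOperad.lrShSig n) → Prop,
        ColouredOperad.IsAdmissible lt ∧ ColouredOperad.RefinesQM lt) ∧
      (∀ lt : (Σ n, ColouredOperad.ShuffleMonomial ColouredOperad.lrShSig n) →
          (Σ n, ColouredOperad.ShuffleMonomial ColouredOperad.lrShSig n) → Prop,
        ColouredOperad.IsAdmissible lt → ColouredOperad.RefinesQM lt →
          ColouredOperad.IsGroebnerBasis lt (ColouredOperad.lrShuffleIdeal k)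
            (ColouredOperad.lrShuffleRelations k)) ∧
      ∀ r ∈ ColouredOperad.lrShuffleRelations k, ColouredOperad.IsQuadratic r) ∧
    Nonempty (ColouredOperad.SymCollection.Iso (ColouredOperad.lieR k)
      (ColouredOperad.SymCollection.comp (ColouredOperad.nilM k) (ColouredOperad.dComLie k))) ∧
    (∀ (X : Type) [Finite X] (χ : X → ColouredOperad.Col) (c : ColouredOperad.Col),
      Module.Finite k ((ColouredOperad.lieR k).obj X χ c)) ∧
    (ColouredOperad.lieR k).genSeries ColouredOperad.Col.s =
      ColouredOperad.expSeries (ColouredOperad.t₁ * (1 - ColouredOperad.t₂)⁻¹) - 1 ∧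
    (ColouredOperad.lieR k).genSeries ColouredOperad.Col.l =
      -ColouredOperad.logOneAddSeries (-ColouredOperad.t₂) *
        ColouredOperad.expSeries (ColouredOperad.t₁ * (1 - ColouredOperad.t₂)⁻¹) := by
  exact ⟨⟨⟨ColouredOperad.keyLT, ColouredOperad.isAdmissible_keyLT, ColouredOperad.refinesQM_keyLT⟩,
      fun _ hlt hQM => ColouredOperad.isGroebnerBasis_lrShuffleRelations k hlt hQM,
      fun _ hr => ColouredOperad.lrShuffleRelations_isQuadratic hr⟩,
    ColouredOperad.nonempty_iso_comp k, fun _ _ _ _ => ColouredOperad.finite_lieR k _ _ _,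
    ColouredOperad.genSeries_s k, ColouredOperad.genSeries_l k⟩
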